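/- Let $(M,g)$ be a smooth $3$-dimensional Riemannian manifold with distance $\mathrm{dist}$ and volume $|\cdot|$, and let $0<\alpha<\frac12\,\mathrm{inj}(M)$, where $\mathrm{inj}(M)$ is the injectivity radius. For a geodesic segment $\gamma$ of length $\alpha$ put $T_\gamma^\delta=\{y:\mathrm{dist}(y,\gamma)\le\delta\}$, and for a family $\mathcal F$ of such segments put $$f^*_{\delta,\mathcal F}(x)=\sup_{x\in\gamma\in\mathcal F}|T_\gamma^\delta|^{-1}\int_{T_\gamma^\delta}|f(y)|\,dy ;$$ write $f^*_\delta$ when $\mathcal F$ consists of all geodesic segments of length $\alpha$. For a compact set $K$ we say that the Nikodym maximal operator of $\mathcal F$ is bounded from $L^p(K)$ to $L^q$ with norm $O(\delta^{-\sigma-\varepsilon})$ for all $\varepsilon>0$ if for every $\varepsilon>0$ there is $C_\varepsilon$ such that $\|f^*_{\delta,\mathcal F}\|_{L^q(M)}\le C_\varepsilon\delta^{-\sigma-\varepsilon}\|f\|_{L^p(M)}$ for all sufficiently small $\delta>0$ and all measurable $f$ vanishing outside $K$. $M$ satisfies the *chaotic curvature condition* at $x_0\in M$ in the direction $\tau_0\in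 T_{x_0}M\setminus\{0\}$ if, for every unit speed geodesic $\gamma$ through $x_0$ with velocity $\pm\tau_0/\|\tau_0\|$ there and every nonzero parallel field $X$ along $\gamma$ orthogonal to $\dot\gamma$, the field $Z=(\mathrm{Ric}\,X)_\perp$ satisfies $|Z|+|DZ/dt|\neq0$ at $x_0$; here $\mathrm{Ric}$ is the Ricci operator and $\perp$ denotes projection onto the orthogonal complement of $\mathrm{span}(X,\dot\gamma)$. ($M$ is called variably curved if this holds at all points and in all directions; below only one point and one direction are needed.) *Fermi coordinates* $(x_1,x_2,x_3)$ about a unit speed geodesic $\{(s,0,0):a<s<b\}$ are smooth coordinates on a tube $a<x_1<b$, $x_2^2+x_3^2<r^2$ whose coordinate frame is orthonormal and parallel along this geodesic and in which the rays $t\mapsto(s,tx_2,tx_3)$ are geodesics. Write $x'=(x_2,x_3)$. **1.** Suppose that the chaotic curvature condition holds at $x_0$ in some direction, and let $K$ be any compact neighbourhood of $x_0$. Then the bound $\|f^*_\delta\|_{10/3}\le C_\varepsilon\delta^{-1/5-\varepsilon}\|f\|_{5/2}$ (for all $\varepsilon>0$, all small $\delta>0$ and all $f$ vanishing outside $K$)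 fails. If $1\le q\le\infty$ and the operator $f\mapsto f^*_\delta$ is bounded from $L^{5/2}(K)$ to $L^q$ with norm $O(\delta^{-1/5-\varepsilon})$ for all $\varepsilon>0$, then $q\le 5/2$ (so $q=5/2$ if $q\ge 5/2$). If $1\le p\le\infty$ and it is bounded from $L^p(K)$ to $L^p$ with norm $O(\delta^{1-3/p-\varepsilon})$ for all $\varepsilon>0$, then $p\le5/2$. **2.** In Fermi coordinates, suppose that $\partial_2\partial_3g_{11}=0$ at a point $(s_0,0,0)$, and that the chaotic curvature condition holds there in the direction of the central geodesic. Let $f_\delta$ be the indicator function of the slab $\{|x_1-s_0|\le\delta^{1/5},\ |x_2|\le\delta^{2/5},\ |x_3|\le2\delta\}$. Then there is $c>0$ such that for all small $\delta>0$ and all $p,q\in[1,\infty]$ $$\|f_\delta^*\|_q\ \ge\ c\,\delta^{\frac15+\frac3{5q}-\frac8{5p}}\,\|f_\delta\|_p .$$ **3.** In Fermi coordinates, let $\gamma_0=\{(s,0,0):a_0\le s\le a_0+\alpha\}$, where $a<a_0\le0\le a_0+\alpha<b$, and suppose that the chaotic curvature condition holds at the origin in the direction of $\gamma_0$. For $\kappa\in\mathbb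 R$ put $$\mathcal A_\delta f(x')=\sup_{\gamma\ni(0,x'),\ \gamma\cap\gamma_0\neq\emptyset}|T^\delta_{\gamma}|^{-1}\int_{T^\delta_{\gamma}}|f(y)|\,\mathrm{dist}(y,\gamma\cap\gamma_0)^{\kappa}\,dy ,$$ the supremum being over geodesic segments $\gamma$ of length $\alpha$. Let $K$ be any compact neighbourhood of the origin. If $\kappa=\frac12$, then the bound $$\|\mathcal A_\delta f\|_{L^2(|x'|<r)}\le C(\log 1/\delta)^{3/2}\|f\|_{L^2}\qquad(\text{all small }\delta>0,\ f\text{ vanishing outside }K)$$ fails; and if it holds for the exponent $\kappa$, then $\kappa\ge\frac32$. **4.** Suppose that in Fermi coordinates whose central geodesic contains $\gamma_0=\{(s,0,0):0\le s\le\alpha\}$ (with $a<0$ and $\alpha<b$) the metric is $$dx_1^2+dx_2^2+dx_3^2+\bigl((x_2^2-x_3^2)\cos x_1+2x_2x_3\sin x_1\bigr)dx_1^2 .$$ Let $\rho>0$, and let $\mathcal F$ be the family of the geodesic segments of length $\alpha$ that lie within distance $\rho$ of $\gamma_0$. Let $f_\delta$ be the indicator function of $\{|x_1|+|x_2|\le\delta^{1/4},\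 |x_3|\le\delta\}$. Then there is $c>0$ such that $\|f^*_{\delta,\mathcal F}\|_q\ge c\,\delta^{\frac14+\frac1{4q}-\frac3{2p}}\|f_\delta\|_p$ for all small $\delta>0$ and all $p,q\in[1,\infty]$. Moreover, for every compact neighbourhood $K$ of the origin, the Nikodym maximal operator of $\mathcal F$ is not bounded from $L^{5/2}(K)$ to $L^{10/3}$ with norm $O(\delta^{-1/5-\varepsilon})$ for all $\varepsilon>0$; and if $1\le p\le\infty$ and it is bounded from $L^p(K)$ to $L^p$ with norm $O(\delta^{1-3/p-\varepsilon})$ for all $\varepsilon>0$, then $p\le7/3$. -/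

import Mathlib

open Set Filter Topology MeasureTheory Bundle
open scoped Manifold ContDiff ENNReal

/-- Three-dimensional Euclidean space, the model space. Coordinates are indexed by `0, 1, 2`. -/
abbrev E3 : Type := EuclideanSpace ℝ (Fin 3)

/-- A smooth coordinate chart of `M` is an element of the maximal `C^∞` atlas. -/
def IsSmoothChart {M : Type*} [TopologicalSpace M] [ChartedSpace E3 M]
    (e : OpenPartialHomeomorph M E3) : Prop :=
  e ∈ IsManifold.maximalAtlas (𝓡 3) ∞ M

/-- The partial derivative `∂f/∂x_i` on `ℝ³`. -/
noncomputable def pderiv (i : Fin 3) (f : E3 → ℝ) (u : E3) : ℝ :=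
  fderiv ℝ f u (EuclideanSpace.single i 1)

/-- The velocity vector of a curve in `M`. -/
noncomputable def velocity {M : Type*} [TopologicalSpace M] [ChartedSpace E3 M]
    (γ : ℝ → M) (t : ℝ) : TangentSpace (𝓡 3) (γ t) :=
  mfderiv 𝓘(ℝ, ℝ) (𝓡 3) γ t (1 : ℝ)

/-- The coefficients `g_{ij}(u) = ⟨∂_i, ∂_j⟩` of the metric in the chart `e`. -/
noncomputable def metricCoeff {M : Type*} [TopologicalSpace M] [ChartedSpace E3 M]
    [RiemannianBundle (fun x : M ↦ TangentSpace (𝓡 3) x)]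
    (e : OpenPartialHomeomorph M E3) (i j : Fin 3) (u : E3) : ℝ :=
  inner ℝ
    (mfderiv (𝓡 3) (𝓡 3) e.symm u (EuclideanSpace.single i (1 : ℝ)) :
      TangentSpace (𝓡 3) (e.symm u))
    (mfderiv (𝓡 3) (𝓡 3) e.symm u (EuclideanSpace.single j (1 : ℝ)) :
      TangentSpace (𝓡 3) (e.symm u))

/-- The inverse metric `g^{ij}` in the chart `e`. -/
noncomputable def metricInv {M : Type*} [TopologicalSpace M] [ChartedSpace E3 M]
    [RiemannianBundle (fun x : M ↦ TangentSpace (𝓡 3) x)]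
    (e : OpenPartialHomeomorph M E3) (i j : Fin 3) (u : E3) : ℝ :=
  (Matrix.of fun k l ↦ metricCoeff e k l u)⁻¹ i j

/-- The Christoffel symbols `Γ_{ij}^k` of the Levi-Civita connection in the chart `e`. -/
noncomputable def christoffel {M : Type*} [TopologicalSpace M] [ChartedSpace E3 M]
    [RiemannianBundle (fun x : M ↦ TangentSpace (𝓡 3) x)]
    (e : OpenPartialHomeomorph M E3) (i j k : Fin 3) (u : E3) : ℝ :=
  (1 / 2) * ∑ l, metricInv e k l u *
    (pderiv i (metricCoeff e j l) u + pderiv j (metricCoeff e i l) u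
      - pderiv l (metricCoeff e i j) u)

/-- The Ricci tensor `R_{jk}` in the chart `e`. -/
noncomputable def ricci {M : Type*} [TopologicalSpace M] [ChartedSpace E3 M]
    [RiemannianBundle (fun x : M ↦ TangentSpace (𝓡 3) x)]
    (e : OpenPartialHomeomorph M E3) (j k : Fin 3) (u : E3) : ℝ :=
  ∑ i, (pderiv i (christoffel e j k i) u - pderiv j (christoffel e i k i) u
    + ∑ p, (christoffel e i p i u * christoffel e j k p u
      - christoffel e j p i u * christoffel e i k p u))

/-- The inner product of two coordinate vectors at the point with coordinates `u`. -/
noncomputable def coordInner {M : Type*} [TopologicalSpace M] [ChartedSpace E3 M]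
    [RiemannianBundle (fun x : M ↦ TangentSpace (𝓡 3) x)]
    (e : OpenPartialHomeomorph M E3) (u V W : E3) : ℝ :=
  ∑ i, ∑ j, metricCoeff e i j u * V i * W j

/-- The Ricci operator `X ↦ (∑_j R^i_j X^j)_i` at the point with coordinates `u`. -/
noncomputable def ricciOp {M : Type*} [TopologicalSpace M] [ChartedSpace E3 M]
    [RiemannianBundle (fun x : M ↦ TangentSpace (𝓡 3) x)]
    (e : OpenPartialHomeomorph M E3) (u X : E3) : E3 :=
  WithLp.toLp 2 fun i ↦ ∑ l, ∑ j, metricInv e i l u * ricci e l j u * X j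

/-- The covariant derivative `DV/dt` of a vector field along a curve; the curve `u` and the field
`V` are given by their coordinates in the chart `e`. -/
noncomputable def covDeriv {M : Type*} [TopologicalSpace M] [ChartedSpace E3 M]
    [RiemannianBundle (fun x : M ↦ TangentSpace (𝓡 3) x)]
    (e : OpenPartialHomeomorph M E3) (u V : ℝ → E3) (t : ℝ) : E3 :=
  deriv V t +
    WithLp.toLp 2 fun k ↦ ∑ i, ∑ j, christoffel e i j k (u t) * deriv u t i * V t j

/-- `γ` is a geodesic on the open set `s` of times: it is smooth there and `Dγ'/dt = 0`. -/
def IsGeodesicOn {M : Type*} [TopologicalSpace M] [ChartedSpace E3 M]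
    [RiemannianBundle (fun x : M ↦ TangentSpace (𝓡 3) x)]
    (γ : ℝ → M) (s : Set ℝ) : Prop :=
  ContMDiffOn 𝓘(ℝ, ℝ) (𝓡 3) ∞ γ s ∧
    ∀ e : OpenPartialHomeomorph M E3, IsSmoothChart e → ∀ t ∈ s, γ t ∈ e.source →
      covDeriv e (fun τ ↦ e (γ τ)) (deriv fun τ ↦ e (γ τ)) t = 0

/-- `γ` is a geodesic parametrized by arclength on the open set `s` of times. -/
def IsUnitGeodesicOn {M : Type*} [TopologicalSpace M] [ChartedSpace E3 M]
    [RiemannianBundle (fun x : M ↦ TangentSpace (𝓡 3) x)]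
    (γ : ℝ → M) (s : Set ℝ) : Prop :=
  IsGeodesicOn γ s ∧ ∀ t ∈ s, ‖velocity γ t‖ = 1

/-- The set of all geodesic segments of length `α` (as subsets of `M`). A geodesic on a closed
interval always extends a little beyond it. -/
def geodesicSegments (M : Type*) [TopologicalSpace M] [ChartedSpace E3 M]
    [RiemannianBundle (fun x : M ↦ TangentSpace (𝓡 3) x)]
    (α : ℝ) : Set (Set M) :=
  {S | ∃ (γ : ℝ → M) (η : ℝ), 0 < η ∧ IsUnitGeodesicOn γ (Ioo (-η) (α + η)) ∧ S = γ '' Icc 0 α}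

/-- The Riemannian length of a tangent vector. -/
noncomputable def tangentNorm {M : Type*} [TopologicalSpace M] [ChartedSpace E3 M]
    [RiemannianBundle (fun x : M ↦ TangentSpace (𝓡 3) x)]
    (x : M) (v : TangentSpace (𝓡 3) x) : ℝ := ‖v‖

/-- The exponential map at `x` is defined on the ball of radius `r` of `T_xM` and is a
diffeomorphism of this ball onto an open subset of `M`. Here `Φ` is the exponential map: its rays
are the geodesics that start at `x`. -/
def ExpIsDiffeo {M : Type*} [TopologicalSpace M] [ChartedSpace E3 M]
    [RiemannianBundle (fun x : M ↦ TangentSpace (𝓡 3) x)]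
    (x : M) (r : ℝ) : Prop :=
  ∃ Φ : OpenPartialHomeomorph E3 M,
    Φ.source = {v : E3 | tangentNorm x v < r} ∧
    ContMDiffOn (𝓡 3) (𝓡 3) ∞ Φ Φ.source ∧
    ContMDiffOn (𝓡 3) (𝓡 3) ∞ Φ.symm Φ.target ∧
    ∀ v : E3, tangentNorm x v = 1 →
      IsUnitGeodesicOn (fun t : ℝ ↦ Φ (t • v)) (Ioo (-r) r) ∧
      (⟨Φ ((0 : ℝ) • v), velocity (fun t : ℝ ↦ Φ (t • v)) 0⟩ : TangentBundle (𝓡 3) M) = ⟨x, v⟩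

/-- The injectivity radius of `M`. -/
noncomputable def injRadius (M : Type*) [TopologicalSpace M] [ChartedSpace E3 M]
    [RiemannianBundle (fun x : M ↦ TangentSpace (𝓡 3) x)] : ℝ≥0∞ :=
  ⨅ x : M, ⨆ (r : ℝ) (_ : 0 < r ∧ ExpIsDiffeo x r), ENNReal.ofReal r

/-- The field `Z = Y_⊥`, where `Y = Ric X` and `⊥` is the orthogonal projection onto the
complement of the span of `X` and `γ'` (which are orthogonal to each other); all in the
coordinates of the chart `e`, in which the curve is `u`. -/
noncomputable def ricciOffDiag {M : Type*} [TopologicalSpace M] [ChartedSpace E3 M]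
    [RiemannianBundle (fun x : M ↦ TangentSpace (𝓡 3) x)]
    (e : OpenPartialHomeomorph M E3) (u X : ℝ → E3) (t : ℝ) : E3 :=
  let Y := ricciOp e (u t) (X t)
  let T := deriv u t
  Y - (coordInner e (u t) Y (X t) / coordInner e (u t) (X t) (X t)) • X t
    - (coordInner e (u t) Y T / coordInner e (u t) T T) • T

/-- The chaotic curvature condition at `x₀` in the direction `τ₀`: for every geodesic `γ` through
`x₀` with velocity `±τ₀/‖τ₀‖` there, and every nonzero parallel field `X` along `γ` orthogonal to
`γ'`, the field `Z = (Ric X)_⊥` satisfies `|Z| + |DZ/dt| ≠ 0` at `x₀`. The vector fields are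
written in the coordinates of an arbitrary smooth chart around `x₀`. -/
def IsChaoticAt {M : Type*} [TopologicalSpace M] [ChartedSpace E3 M]
    [RiemannianBundle (fun x : M ↦ TangentSpace (𝓡 3) x)]
    (x₀ : M) (τ₀ : TangentSpace (𝓡 3) x₀) : Prop :=
  ∀ (γ : ℝ → M) (t₀ η : ℝ), 0 < η → IsUnitGeodesicOn γ (Ioo (t₀ - η) (t₀ + η)) →
    ((⟨γ t₀, velocity γ t₀⟩ : TangentBundle (𝓡 3) M) = ⟨x₀, ‖τ₀‖⁻¹ • τ₀⟩ ∨
      (⟨γ t₀, velocity γ t₀⟩ : TangentBundle (𝓡 3) M) = ⟨x₀, -(‖τ₀‖⁻¹ • τ₀)⟩) →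
    ∀ e : OpenPartialHomeomorph M E3, IsSmoothChart e → x₀ ∈ e.source →
    ∀ X : ℝ → E3,
      (∀ᶠ t in 𝓝 t₀, DifferentiableAt ℝ X t ∧ covDeriv e (fun τ ↦ e (γ τ)) X t = 0 ∧
        coordInner e (e (γ t)) (X t) (deriv (fun τ ↦ e (γ τ)) t) = 0) →
      X t₀ ≠ 0 →
      ricciOffDiag e (fun τ ↦ e (γ τ)) X t₀ ≠ 0 ∨
        covDeriv e (fun τ ↦ e (γ τ)) (ricciOffDiag e (fun τ ↦ e (γ τ)) X) t₀ ≠ 0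

/-- The Nikodym maximal function of `f` for a family `F` of geodesic segments:
`f*_δ(x) = sup |T^δ_S|⁻¹ ∫_{T^δ_S} |f|` over the `S ∈ F` with `x ∈ S`, where `T^δ_S` is the closed
`δ`-neighbourhood of `S`. The measure `μHE[3]` is the Riemannian volume. -/
noncomputable def nikodymMax {M : Type*} [EMetricSpace M] [MeasurableSpace M] [BorelSpace M]
    (F : Set (Set M)) (δ : ℝ) (f : M → ℝ) (x : M) : ℝ≥0∞ :=
  ⨆ (S : Set M) (_ : S ∈ F ∧ x ∈ S),
    (μHE[3] (Metric.cthickening δ S))⁻¹ * ∫⁻ y in Metric.cthickening δ S, ‖f y‖ₑ ∂μHE[3]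

/-- The bound `‖f*_δ‖_q ≤ C_ε δ^(-σ-ε) ‖f‖_p` for every `ε > 0`, all small `δ > 0` and all `f`
supported in `K`. -/
def NikodymBound {M : Type*} [EMetricSpace M] [MeasurableSpace M] [BorelSpace M]
    (F : Set (Set M)) (K : Set M) (p q : ℝ≥0∞) (σ : ℝ) : Prop :=
  ∀ ε : ℝ, 0 < ε → ∃ C : ℝ, ∀ᶠ δ : ℝ in 𝓝[>] 0, ∀ f : M → ℝ, Measurable f →
    Function.support f ⊆ K →
    eLpNorm (nikodymMax F δ f) q μHE[3] ≤
      ENNReal.ofReal (C * δ ^ (-σ - ε)) * eLpNorm f p μHE[3]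

/-- `e` is a system of Fermi normal coordinates about the geodesic `s ↦ e⁻¹(s, 0, 0)`, `a < s < b`,
on a tube of radius `r`: the coordinate frame is orthonormal and parallel along this
geodesic, and the rays `t ↦ (s, t x₂, t x₃)` are geodesics. -/
structure IsFermiChart {M : Type*} [TopologicalSpace M] [ChartedSpace E3 M]
    [RiemannianBundle (fun x : M ↦ TangentSpace (𝓡 3) x)]
    (e : OpenPartialHomeomorph M E3) (a b r : ℝ) : Prop where
  smooth : IsSmoothChart e
  radius_pos : 0 < r
  target_eq : e.target = {u : E3 | u 0 ∈ Ioo a b ∧ u 1 ^ 2 + u 2 ^ 2 < r ^ 2}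
  axis : IsUnitGeodesicOn (fun s : ℝ ↦ e.symm !₂[s, 0, 0]) (Ioo a b)
  orthonormal : ∀ s ∈ Ioo a b, ∀ i j : Fin 3,
    metricCoeff e i j !₂[s, 0, 0] = if i = j then 1 else 0
  parallel : ∀ s ∈ Ioo a b, ∀ j : Fin 3,
    covDeriv e (fun τ : ℝ ↦ !₂[τ, 0, 0]) (fun _ ↦ EuclideanSpace.single j 1) s = 0
  rays : ∀ u ∈ e.target,
    IsGeodesicOn (fun t : ℝ ↦ e.symm !₂[u 0, t * u 1, t * u 2])
      {t : ℝ | (!₂[u 0, t * u 1, t * u 2] : E3) ∈ e.target}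

/-- The segment `{(s, 0, 0) : a₀ ≤ s ≤ a₁}` of the central geodesic of the coordinates `e`. -/
def axisSegment {M : Type*} [TopologicalSpace M]
    (e : OpenPartialHomeomorph M E3) (a₀ a₁ : ℝ) : Set M :=
  (fun s : ℝ ↦ e.symm !₂[s, 0, 0]) '' Icc a₀ a₁

/-- The auxiliary maximal function about the common geodesic `γ₀` in Fermi coordinates `e`:
`(A_δ f)(x') = sup |T^δ_S|⁻¹ ∫_{T^δ_S} |f(y)| dist(y, S ∩ γ₀)^κ dy` over the geodesic segments `S`
of length `α` that contain `(0, x')` and meet `γ₀`. -/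
noncomputable def auxMax {M : Type*} [EMetricSpace M] [ChartedSpace E3 M]
    [RiemannianBundle (fun x : M ↦ TangentSpace (𝓡 3) x)]
    [MeasurableSpace M] [BorelSpace M]
    (e : OpenPartialHomeomorph M E3) (γ₀ : Set M) (α κ δ : ℝ) (f : M → ℝ)
    (x' : EuclideanSpace ℝ (Fin 2)) : ℝ≥0∞ :=
  ⨆ (S : Set M) (_ : S ∈ geodesicSegments M α ∧ e.symm !₂[0, x' 0, x' 1] ∈ S ∧
      (S ∩ γ₀).Nonempty),
    (μHE[3] (Metric.cthickening δ S))⁻¹ *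
      ∫⁻ y in Metric.cthickening δ S, ‖f y‖ₑ * Metric.infEDist y (S ∩ γ₀) ^ κ ∂μHE[3]

/-- The bound `‖A_δ f‖_{L²(|x'| < r)} ≤ C (log 1/δ)^{3/2} ‖f‖_{L²}` for all small `δ > 0` and all
`f` supported in `K`. -/
def AuxBound {M : Type*} [EMetricSpace M] [ChartedSpace E3 M]
    [RiemannianBundle (fun x : M ↦ TangentSpace (𝓡 3) x)]
    [MeasurableSpace M] [BorelSpace M]
    (e : OpenPartialHomeomorph M E3) (r : ℝ) (γ₀ : Set M) (α κ : ℝ) (K : Set M) : Prop :=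
  ∃ C : ℝ, ∀ᶠ δ : ℝ in 𝓝[>] 0, ∀ f : M → ℝ, Measurable f → Function.support f ⊆ K →
    eLpNorm (auxMax e γ₀ α κ δ f) 2
        (volume.restrict (Metric.ball (0 : EuclideanSpace ℝ (Fin 2)) r)) ≤
      ENNReal.ofReal (C * Real.log (1 / δ) ^ (3 / 2 : ℝ)) * eLpNorm f 2 μHE[3]

/-- The indicator function of the set of points whose coordinates in the chart `e` lie in `B`. -/
noncomputable def slabFun {M : Type*} [TopologicalSpace M]
    (e : OpenPartialHomeomorph M E3) (B : Set E3) : M → ℝ :=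
  (e.source ∩ e ⁻¹' B).indicator fun _ ↦ 1

set_option linter.unusedSectionVars false
set_option maxSynthPendingDepth 3

section
variable {M : Type*} [EMetricSpace M] [ChartedSpace E3 M] [IsManifold (𝓡 3) ∞ M]
    [RiemannianBundle (fun x : M ↦ TangentSpace (𝓡 3) x)]
    [IsContMDiffRiemannianBundle (𝓡 3) ∞ E3 (fun x : M ↦ TangentSpace (𝓡 3) x)]

lemma IsSmoothChart.contMDiffOn {e : OpenPartialHomeomorph M E3} (he : IsSmoothChart e) :
    ContMDiffOn (𝓡 3) (𝓡 3) ∞ e e.source := contMDiffOn_of_mem_maximalAtlas he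

lemma IsSmoothChart.contMDiffOn_symm {e : OpenPartialHomeomorph M E3} (he : IsSmoothChart e) :
    ContMDiffOn (𝓡 3) (𝓡 3) ∞ e.symm e.target := contMDiffOn_symm_of_mem_maximalAtlas he

lemma IsSmoothChart.mdifferentiableAt {e : OpenPartialHomeomorph M E3} (he : IsSmoothChart e)
    {x : M} (hx : x ∈ e.source) : MDifferentiableAt (𝓡 3) (𝓡 3) e x :=
  (he.contMDiffOn.contMDiffAt (e.open_source.mem_nhds hx)).mdifferentiableAt (by simp)

lemma IsSmoothChart.mdifferentiableAt_symm {e : OpenPartialHomeomorph M E3} (he : IsSmoothChart e)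
    {u : E3} (hu : u ∈ e.target) : MDifferentiableAt (𝓡 3) (𝓡 3) e.symm u :=
  (he.contMDiffOn_symm.contMDiffAt (e.open_target.mem_nhds hu)).mdifferentiableAt (by simp)

/-- The differential of the inverse of a chart: it maps coordinate vectors to tangent vectors. -/
noncomputable def coordVec (e : OpenPartialHomeomorph M E3) (u V : E3) :
    TangentSpace (𝓡 3) (e.symm u) :=
  mfderiv (𝓡 3) (𝓡 3) e.symm u V

lemma IsSmoothChart.mfderiv_coordVec {e : OpenPartialHomeomorph M E3} (he : IsSmoothChart e)
    {u : E3} (hu : u ∈ e.target) (V : E3) :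
    mfderiv (𝓡 3) (𝓡 3) e (e.symm u) (coordVec e u V) = V := by
  have h1 := he.mdifferentiableAt (e.map_target hu)
  have h2 := he.mdifferentiableAt_symm hu
  have h3 := mfderiv_comp u h1 h2
  have h4 : (e ∘ e.symm) =ᶠ[𝓝 u] id := by
    filter_upwards [e.open_target.mem_nhds hu] with v hv using e.right_inv hv
  rw [h4.mfderiv_eq, mfderiv_id] at h3
  exact congr($h3.symm V)

lemma IsSmoothChart.coordVec_mfderiv {e : OpenPartialHomeomorph M E3} (he : IsSmoothChart e)
    {x : M} (hx : x ∈ e.source) (v : TangentSpace (𝓡 3) x) :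
    mfderiv (𝓡 3) (𝓡 3) e.symm (e x) (mfderiv (𝓡 3) (𝓡 3) e x v) = v := by
  have h1 := he.mdifferentiableAt hx
  have h2 := he.mdifferentiableAt_symm (e.map_source hx)
  have h3 := mfderiv_comp x h2 h1
  have h4 : (e.symm ∘ e) =ᶠ[𝓝 x] id := by
    filter_upwards [e.open_source.mem_nhds hx] with v hv using e.left_inv hv
  rw [h4.mfderiv_eq, mfderiv_id] at h3
  exact congr($h3.symm v)

lemma metricCoeff_eq_inner (e : OpenPartialHomeomorph M E3) (i j : Fin 3) (u : E3) :
    metricCoeff e i j u = inner ℝ (coordVec e u (EuclideanSpace.single i 1))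
      (coordVec e u (EuclideanSpace.single j 1)) := rfl

lemma coordVec_add (e : OpenPartialHomeomorph M E3) (u V W : E3) :
    coordVec e u (V + W) = coordVec e u V + coordVec e u W :=
  map_add (mfderiv (𝓡 3) (𝓡 3) e.symm u) V W

lemma coordVec_smul (e : OpenPartialHomeomorph M E3) (u V : E3) (c : ℝ) :
    coordVec e u (c • V) = c • coordVec e u V :=
  map_smul (mfderiv (𝓡 3) (𝓡 3) e.symm u) c V

lemma E3_eq_sum (V : E3) : V = ∑ i, V i • EuclideanSpace.single i (1 : ℝ) := by
  ext k
  fin_cases k <;> simp [Fin.sum_univ_three]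

lemma coordInner_eq_inner (e : OpenPartialHomeomorph M E3) (u V W : E3) :
    coordInner e u V W = inner ℝ (coordVec e u V) (coordVec e u W) := by
  have key : ∀ V : E3, coordVec e u V = ∑ i, V i • coordVec e u (EuclideanSpace.single i 1) := by
    intro V
    conv_lhs => rw [E3_eq_sum V]
    simp only [Fin.sum_univ_three, coordVec_add, coordVec_smul]
  rw [key V, key W, coordInner]
  simp only [sum_inner, inner_sum, real_inner_smul_left, real_inner_smul_right,
    metricCoeff_eq_inner]
  rw [Finset.sum_comm]
  refine Finset.sum_congr rfl fun i _ ↦ Finset.sum_congr rfl fun j _ ↦ ?_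
  rw [real_inner_comm]
  ring

lemma metricCoeff_comm (e : OpenPartialHomeomorph M E3) (i j : Fin 3) (u : E3) :
    metricCoeff e i j u = metricCoeff e j i u := by
  rw [metricCoeff_eq_inner, metricCoeff_eq_inner, real_inner_comm]

lemma IsSmoothChart.coordVec_ne_zero {e : OpenPartialHomeomorph M E3} (he : IsSmoothChart e)
    {u : E3} (hu : u ∈ e.target) {V : E3} (hV : V ≠ 0) : coordVec e u V ≠ 0 := by
  intro h
  have := he.mfderiv_coordVec hu V
  rw [h] at this
  exact hV (this.symm.trans (map_zero (mfderiv (𝓡 3) (𝓡 3) e (e.symm u))))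

lemma IsSmoothChart.coordInner_pos {e : OpenPartialHomeomorph M E3} (he : IsSmoothChart e)
    {u : E3} (hu : u ∈ e.target) {V : E3} (hV : V ≠ 0) : 0 < coordInner e u V V := by
  rw [coordInner_eq_inner]
  exact real_inner_self_pos.2 (he.coordVec_ne_zero hu hV)

lemma IsSmoothChart.contDiffOn_metricCoeff {e : OpenPartialHomeomorph M E3}
    (he : IsSmoothChart e) (i j : Fin 3) : ContDiffOn ℝ ∞ (metricCoeff e i j) e.target := by
  have key : ∀ V : E3, ContMDiffOn (𝓡 3) ((𝓡 3).prod 𝓘(ℝ, E3)) ∞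
      (fun u ↦ (⟨e.symm u, coordVec e u V⟩ : TangentBundle (𝓡 3) M)) e.target := by
    intro V
    have h := he.contMDiffOn_symm.contMDiffOn_tangentMapWithin (m := ∞) (by simp)
      e.open_target.uniqueMDiffOn
    have h2 : ContMDiffOn (𝓡 3) ((𝓡 3).prod 𝓘(ℝ, E3)) ∞
        (fun u : E3 ↦ (⟨u, V⟩ : TangentBundle (𝓡 3) E3)) e.target :=
      contMDiffOn_vectorSpace_iff_contDiffOn.2 contDiffOn_const
    refine (h.comp h2 (fun u hu ↦ hu)).congr ?_
    intro u hu
    simp only [Function.comp, tangentMapWithin]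
    rw [mfderivWithin_of_isOpen e.open_target hu]
    rfl
  rw [← contMDiffOn_iff_contDiffOn]
  exact ContMDiffOn.inner_bundle (E := fun x : M ↦ TangentSpace (𝓡 3) x) (key _) (key _)

/-- The Gram matrix of the coordinate frame. -/
noncomputable def gramMatrix (e : OpenPartialHomeomorph M E3) (u : E3) : Matrix (Fin 3) (Fin 3) ℝ :=
  Matrix.of fun k l ↦ metricCoeff e k l u

lemma IsSmoothChart.det_gramMatrix_ne_zero {e : OpenPartialHomeomorph M E3} (he : IsSmoothChart e)
    {u : E3} (hu : u ∈ e.target) : (gramMatrix e u).det ≠ 0 := by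
  intro h
  obtain ⟨v, hv, hv0⟩ := Matrix.exists_mulVec_eq_zero_iff.2 h
  have hV : (WithLp.toLp 2 v : E3) ≠ 0 := by
    intro h0
    exact hv (by simpa using congrArg WithLp.ofLp h0)
  have hpos := he.coordInner_pos hu hV
  have : coordInner e u (WithLp.toLp 2 v) (WithLp.toLp 2 v) = v ⬝ᵥ (gramMatrix e u).mulVec v := by
    simp only [coordInner, dotProduct, Matrix.mulVec, gramMatrix, Matrix.of_apply, Finset.mul_sum]
    refine Finset.sum_congr rfl fun i _ ↦ Finset.sum_congr rfl fun j _ ↦ by ring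
  rw [this, hv0, dotProduct_zero] at hpos
  exact lt_irrefl _ hpos

lemma IsSmoothChart.contDiffOn_metricInv {e : OpenPartialHomeomorph M E3}
    (he : IsSmoothChart e) (i j : Fin 3) : ContDiffOn ℝ ∞ (metricInv e i j) e.target := by
  have hg := he.contDiffOn_metricCoeff
  have hdet : ContDiffOn ℝ ∞ (fun u ↦ (gramMatrix e u).det) e.target := by
    simp only [Matrix.det_fin_three, gramMatrix, Matrix.of_apply]
    fun_prop
  have hadj : ContDiffOn ℝ ∞ (fun u ↦ (gramMatrix e u).adjugate i j) e.target := by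
    simp only [Matrix.adjugate_fin_three, gramMatrix, Matrix.of_apply]
    fin_cases i <;> fin_cases j <;> simp <;> fun_prop
  refine (ContDiffOn.mul (hdet.inv fun u hu ↦ he.det_gramMatrix_ne_zero hu) hadj).congr ?_
  intro u hu
  change (gramMatrix e u)⁻¹ i j = _
  rw [Matrix.inv_def, Ring.inverse_eq_inv']
  simp

lemma IsSmoothChart.sum_metricInv_mul {e : OpenPartialHomeomorph M E3}
    (he : IsSmoothChart e) {u : E3} (hu : u ∈ e.target) (i k : Fin 3) :
    ∑ j, metricCoeff e i j u * metricInv e j k u = if i = k then 1 else 0 := by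
  have h := Matrix.mul_nonsing_inv (gramMatrix e u)
    (isUnit_iff_ne_zero.2 (he.det_gramMatrix_ne_zero hu))
  have h2 := congrFun (congrFun h i) k
  rw [Matrix.mul_apply, Matrix.one_apply] at h2
  exact h2

lemma contDiffOn_pderiv {f : E3 → ℝ} {s : Set E3} (hs : IsOpen s) (hf : ContDiffOn ℝ ∞ f s)
    (i : Fin 3) : ContDiffOn ℝ ∞ (pderiv i f) s :=
  (hf.fderiv_of_isOpen hs (m := ∞) (by simp)).clm_apply contDiffOn_const

lemma IsSmoothChart.contDiffOn_christoffel {e : OpenPartialHomeomorph M E3}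
    (he : IsSmoothChart e) (i j k : Fin 3) : ContDiffOn ℝ ∞ (christoffel e i j k) e.target := by
  have h1 := he.contDiffOn_metricInv
  have h2 : ∀ i j k, ContDiffOn ℝ ∞ (pderiv i (metricCoeff e j k)) e.target := fun i j k ↦
    contDiffOn_pderiv e.open_target (he.contDiffOn_metricCoeff j k) i
  unfold christoffel
  fun_prop

lemma christoffel_comm (e : OpenPartialHomeomorph M E3) (i j k : Fin 3) (u : E3) :
    christoffel e i j k u = christoffel e j i k u := by
  unfold christoffel
  congr 1
  refine Finset.sum_congr rfl fun l _ ↦ ?_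
  have : metricCoeff e i j = metricCoeff e j i := funext fun u ↦ metricCoeff_comm e i j u
  rw [this]
  ring

/-- The Christoffel symbols of the first kind. -/
lemma IsSmoothChart.sum_metricCoeff_mul_christoffel {e : OpenPartialHomeomorph M E3}
    (he : IsSmoothChart e) {u : E3} (hu : u ∈ e.target) (i j m : Fin 3) :
    ∑ k, metricCoeff e m k u * christoffel e i j k u =
      (1 / 2) * (pderiv i (metricCoeff e j m) u + pderiv j (metricCoeff e i m) u
      - pderiv m (metricCoeff e i j) u) := by
  simp only [christoffel, Finset.mul_sum]
  rw [Finset.sum_comm]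
  have : ∀ l, ∑ k, metricCoeff e m k u * (1 / 2 * (metricInv e k l u *
      (pderiv i (metricCoeff e j l) u + pderiv j (metricCoeff e i l) u
      - pderiv l (metricCoeff e i j) u))) = (∑ k, metricCoeff e m k u * metricInv e k l u) *
      (1 / 2 * (pderiv i (metricCoeff e j l) u + pderiv j (metricCoeff e i l) u
      - pderiv l (metricCoeff e i j) u)) := by
    intro l
    rw [Finset.sum_mul]
    exact Finset.sum_congr rfl fun k _ ↦ by ring
  simp only [this, he.sum_metricInv_mul hu]
  simp

/-- Compatibility of the Levi-Civita connection with the metric. -/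
lemma IsSmoothChart.pderiv_metricCoeff {e : OpenPartialHomeomorph M E3}
    (he : IsSmoothChart e) {u : E3} (hu : u ∈ e.target) (i j k : Fin 3) :
    pderiv k (metricCoeff e i j) u = ∑ l, metricCoeff e j l u * christoffel e k i l u +
      ∑ l, metricCoeff e i l u * christoffel e k j l u := by
  rw [he.sum_metricCoeff_mul_christoffel hu, he.sum_metricCoeff_mul_christoffel hu]
  have h : metricCoeff e j i = metricCoeff e i j := funext fun u ↦ metricCoeff_comm e j i u
  rw [h]
  ring

/-- The bilinear map of `ℝ³` with a given coefficient array. -/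
noncomputable def bilinOf (c : Fin 3 → Fin 3 → Fin 3 → ℝ) : E3 →L[ℝ] E3 →L[ℝ] E3 :=
  ∑ i, ∑ j, ∑ k, c i j k •
    (EuclideanSpace.proj i : E3 →L[ℝ] ℝ).smulRight
      ((EuclideanSpace.proj j : E3 →L[ℝ] ℝ).smulRight (EuclideanSpace.single k (1 : ℝ)))

lemma bilinOf_apply (c : Fin 3 → Fin 3 → Fin 3 → ℝ) (V W : E3) (k : Fin 3) :
    bilinOf c V W k = ∑ i, ∑ j, c i j k * V i * W j := by
  simp only [bilinOf, _root_.sum_apply, _root_.smul_apply,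
    ContinuousLinearMap.smulRight_apply, WithLp.ofLp_sum, Finset.sum_apply, PiLp.smul_apply,
    PiLp.proj_apply, smul_eq_mul, PiLp.single_apply]
  refine Finset.sum_congr rfl fun i _ ↦ Finset.sum_congr rfl fun j _ ↦ ?_
  simp [mul_assoc]

/-- The Christoffel symbols at a point of the chart, as a bilinear map. -/
noncomputable def gam (e : OpenPartialHomeomorph M E3) (u : E3) : E3 →L[ℝ] E3 →L[ℝ] E3 :=
  bilinOf fun i j k ↦ christoffel e i j k u

lemma gam_apply (e : OpenPartialHomeomorph M E3) (u V W : E3) (k : Fin 3) :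
    gam e u V W k = ∑ i, ∑ j, christoffel e i j k u * V i * W j := bilinOf_apply _ _ _ _

lemma gam_single (e : OpenPartialHomeomorph M E3) (u : E3) (i j k : Fin 3) :
    gam e u (EuclideanSpace.single i 1) (EuclideanSpace.single j 1) k = christoffel e i j k u := by
  rw [gam_apply]
  simp

lemma gam_comm (e : OpenPartialHomeomorph M E3) (u V W : E3) : gam e u V W = gam e u W V := by
  ext k
  rw [gam_apply, gam_apply, Finset.sum_comm]
  refine Finset.sum_congr rfl fun i _ ↦ Finset.sum_congr rfl fun j _ ↦ ?_
  rw [christoffel_comm]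
  ring

lemma IsSmoothChart.contDiffOn_gam {e : OpenPartialHomeomorph M E3}
    (he : IsSmoothChart e) : ContDiffOn ℝ ∞ (gam e) e.target := by
  have := he.contDiffOn_christoffel
  unfold gam bilinOf
  refine ContDiffOn.sum fun i _ ↦ ContDiffOn.sum fun j _ ↦ ContDiffOn.sum fun k _ ↦ ?_
  exact (this i j k).smul contDiffOn_const

lemma covDeriv_eq (e : OpenPartialHomeomorph M E3) (u V : ℝ → E3) (t : ℝ) :
    covDeriv e u V t = deriv V t + gam e (u t) (deriv u t) (V t) := by
  rw [covDeriv]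
  congr 1
  ext k
  rw [gam_apply]
lemma IsSmoothChart.continuousOn_coordInner {e : OpenPartialHomeomorph M E3}
    (he : IsSmoothChart e) :
    ContinuousOn (fun p : E3 × E3 ↦ coordInner e p.1 p.2 p.2) (e.target ×ˢ univ) := by
  unfold coordInner
  refine continuousOn_finsetSum _ fun i _ ↦ continuousOn_finsetSum _ fun j _ ↦ ?_
  refine ContinuousOn.mul (ContinuousOn.mul ?_ (by fun_prop)) (by fun_prop)
  exact (he.contDiffOn_metricCoeff i j).continuousOn.comp continuousOn_fst (fun p hp ↦ hp.1)

lemma norm_coordVec_sq (e : OpenPartialHomeomorph M E3) (u V : E3) :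
    ‖coordVec e u V‖ ^ 2 = coordInner e u V V := by
  rw [coordInner_eq_inner, real_inner_self_eq_norm_sq]

/-- On compact subsets of a chart the Riemannian norm is comparable to the Euclidean one. -/
lemma IsSmoothChart.exists_norm_bounds {e : OpenPartialHomeomorph M E3}
    (he : IsSmoothChart e) {K : Set E3} (hK : IsCompact K) (hKe : K ⊆ e.target) :
    ∃ C : ℝ, 1 ≤ C ∧ ∀ u ∈ K, ∀ V : E3, ‖coordVec e u V‖ ≤ C * ‖V‖ ∧ ‖V‖ ≤ C * ‖coordVec e u V‖ := by
  have hS : IsCompact (K ×ˢ Metric.sphere (0 : E3) 1) := hK.prod (isCompact_sphere 0 1)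
  have hc : ContinuousOn (fun p : E3 × E3 ↦ coordInner e p.1 p.2 p.2)
      (K ×ˢ Metric.sphere (0 : E3) 1) :=
    he.continuousOn_coordInner.mono (prod_mono hKe (subset_univ _))
  have hpos : ∀ p ∈ K ×ˢ Metric.sphere (0 : E3) 1, 0 < coordInner e p.1 p.2 p.2 := by
    rintro ⟨u, V⟩ ⟨hu, hV⟩
    refine he.coordInner_pos (hKe hu) ?_
    rintro rfl
    simp at hV
  obtain ⟨B, hB⟩ := hS.exists_bound_of_continuousOn hc
  obtain ⟨B', hB'⟩ := hS.exists_bound_of_continuousOn (hc.inv₀ fun p hp ↦ (hpos p hp).ne')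
  set C := max 1 (max B B') with hC
  have hC1 : 1 ≤ C := le_max_left _ _
  have hsphere : ∀ u ∈ K, ∀ V : E3, ‖V‖ = 1 → ‖coordVec e u V‖ ≤ C ∧ 1 ≤ C * ‖coordVec e u V‖ := by
    intro u hu V hV
    have hm : (u, V) ∈ K ×ˢ Metric.sphere (0 : E3) 1 := ⟨hu, by simpa using hV⟩
    have h1 := hB _ hm
    have h2 := hB' _ hm
    have h3 := hpos _ hm
    simp only [Real.norm_eq_abs, abs_of_pos h3, Pi.inv_apply, abs_of_pos (inv_pos.2 h3)] at h1 h2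
    rw [← norm_coordVec_sq] at h1 h2 h3
    have hn : 0 < ‖coordVec e u V‖ := by
      rcases (norm_nonneg (coordVec e u V)).eq_or_lt with h | h
      · rw [← h] at h3; norm_num at h3
      · exact h
    have h1' : ‖coordVec e u V‖ ^ 2 ≤ C := h1.trans ((le_max_left _ _).trans (le_max_right _ _))
    have h2' : (‖coordVec e u V‖ ^ 2)⁻¹ ≤ C := h2.trans ((le_max_right _ _).trans (le_max_right _ _))
    have h2'' : 1 ≤ C * ‖coordVec e u V‖ ^ 2 := by
      rwa [inv_le_iff_one_le_mul₀ (by positivity)] at h2'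
    constructor
    · nlinarith
    · by_contra hcon
      push Not at hcon
      have : C * ‖coordVec e u V‖ * (C * ‖coordVec e u V‖) < 1 := by nlinarith [mul_pos (by linarith : 0 < C) hn]
      nlinarith
  refine ⟨C, hC1, fun u hu V ↦ ?_⟩
  rcases eq_or_ne V 0 with rfl | hV
  · have : coordVec e u 0 = 0 := map_zero (mfderiv (𝓡 3) (𝓡 3) e.symm u)
    simp [this]
  · have hn : 0 < ‖V‖ := norm_pos_iff.2 hV
    obtain ⟨h1, h2⟩ := hsphere u hu (‖V‖⁻¹ • V) (by rw [norm_smul, norm_inv, norm_norm, inv_mul_cancel₀ hn.ne'])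
    rw [coordVec_smul, norm_smul, norm_inv, norm_norm] at h1 h2
    constructor
    · rwa [inv_mul_le_iff₀ hn, mul_comm] at h1
    · have := mul_le_mul_of_nonneg_left h2 hn.le
      calc ‖V‖ = ‖V‖ * 1 := (mul_one _).symm
        _ ≤ _ := this
        _ = _ := by field_simp

variable [IsRiemannianManifold (𝓡 3) M]

lemma IsSmoothChart.edist_symm_le {e : OpenPartialHomeomorph M E3} (he : IsSmoothChart e)
    {s : Set E3} (hs : Convex ℝ s) (hse : s ⊆ e.target) {C : ℝ}
    (hC : ∀ u ∈ s, ∀ V : E3, ‖coordVec e u V‖ ≤ C * ‖V‖) {u v : E3} (hu : u ∈ s) (hv : v ∈ s) :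
    edist (e.symm u) (e.symm v) ≤ ENNReal.ofReal C * edist u v := by
  rw [IsRiemannianManifold.out (I := 𝓡 3) (e.symm u) (e.symm v)]
  let η := ContinuousAffineMap.lineMap (R := ℝ) u v
  have hη : ∀ t ∈ Icc (0 : ℝ) 1, η t ∈ s := by
    intro t ht
    have := hs.segment_subset hu hv
    rw [segment_eq_image_lineMap] at this
    exact this ⟨t, ht, rfl⟩
  have hηs : ContMDiff 𝓘(ℝ, ℝ) (𝓡 3) ∞ η := by
    rw [contMDiff_iff_contDiff]
    exact ContinuousAffineMap.contDiff _
  have hpath : Manifold.riemannianEDist (𝓡 3) (e.symm u) (e.symm v) ≤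
      Manifold.pathELength (𝓡 3) (e.symm ∘ η) 0 1 := by
    refine Manifold.riemannianEDist_le_pathELength ?_ (by simp [η, ContinuousAffineMap.coe_lineMap_eq])
      (by simp [η, ContinuousAffineMap.coe_lineMap_eq]) zero_le_one
    exact (he.contMDiffOn_symm.of_le (by simp)).comp (hηs.of_le (by simp)).contMDiffOn
      (fun t ht ↦ hse (hη t ht))
  refine hpath.trans ?_
  rw [Manifold.pathELength_eq_lintegral_mfderiv_Icc]
  have hle : ∀ t ∈ Icc (0 : ℝ) 1, ‖mfderiv 𝓘(ℝ, ℝ) (𝓡 3) (e.symm ∘ η) t (1 : ℝ)‖ₑ ≤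
      ENNReal.ofReal C * edist u v := by
    intro t ht
    have h1 := mfderiv_comp t (he.mdifferentiableAt_symm (hse (hη t ht)))
      (hηs.mdifferentiable (by simp) t)
    have hd : mfderiv 𝓘(ℝ, ℝ) (𝓡 3) η t (1 : ℝ) = v - u := by
      rw [mfderiv_eq_fderiv]
      exact (show v - u = fderiv ℝ (ContinuousAffineMap.lineMap (R := ℝ) u v) t 1 by simp).symm
    have h2 : mfderiv 𝓘(ℝ, ℝ) (𝓡 3) (e.symm ∘ η) t (1 : ℝ) = coordVec e (η t) (v - u) := by
      rw [h1]
      exact congrArg (mfderiv (𝓡 3) (𝓡 3) e.symm (η t)) hd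
    have h3 := hC (η t) (hη t ht) (v - u)
    rw [h2]
    change ‖coordVec e (η t) (v - u)‖ₑ ≤ _
    rw [← ofReal_norm, edist_comm, edist_dist, dist_eq_norm,
      ← ENNReal.ofReal_mul' (norm_nonneg _)]
    exact ENNReal.ofReal_le_ofReal h3
  calc ∫⁻ t in Icc (0 : ℝ) 1, ‖mfderiv 𝓘(ℝ, ℝ) (𝓡 3) (e.symm ∘ η) t (1 : ℝ)‖ₑ
      ≤ ∫⁻ t in Icc (0 : ℝ) 1, ENNReal.ofReal C * edist u v :=
        setLIntegral_mono' measurableSet_Icc hle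
    _ = _ := by simp

lemma IsSmoothChart.edist_le_of_edist_symm_lt {e : OpenPartialHomeomorph M E3}
    (he : IsSmoothChart e) {u : E3} {R C : ℝ} (hR : 0 < R) (hC1 : 0 < C)
    (hse : Metric.closedBall u R ⊆ e.target)
    (hC : ∀ w ∈ Metric.closedBall u R, ∀ V : E3, ‖V‖ ≤ C * ‖coordVec e w V‖) {y : M}
    (hy : edist (e.symm u) y < ENNReal.ofReal (R / C)) :
    y ∈ e.source ∧ edist u (e y) ≤ ENNReal.ofReal C * edist (e.symm u) y := by
  have hu : u ∈ e.target := hse (Metric.mem_closedBall_self hR.le)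
  have hdC : ∀ x ∈ e.symm '' Metric.closedBall u R, ∀ v : TangentSpace (𝓡 3) x,
      ‖(show E3 from mfderiv (𝓡 3) (𝓡 3) e x v)‖ₑ ≤ ENNReal.ofReal C * ‖v‖ₑ := by
    rintro x ⟨w, hw, rfl⟩ v
    have hws := e.map_target (hse hw)
    have h1 := hC w hw (show E3 from mfderiv (𝓡 3) (𝓡 3) e (e.symm w) v)
    have h2 := he.coordVec_mfderiv hws v
    have h3 : ‖coordVec e w (show E3 from mfderiv (𝓡 3) (𝓡 3) e (e.symm w) v)‖ = ‖v‖ := by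
      unfold coordVec
      rw [e.right_inv (hse hw)] at h2
      exact congrArg norm h2
    rw [h3] at h1
    rw [← ofReal_norm, ← ofReal_norm, ← ENNReal.ofReal_mul hC1.le]
    exact ENNReal.ofReal_le_ofReal h1
  have main : ∀ r : ℝ≥0∞, edist (e.symm u) y < r → r ≤ ENNReal.ofReal (R / C) →
      y ∈ e.source ∧ edist u (e y) ≤ ENNReal.ofReal C * r := by
    intro r hr hrR
    rw [IsRiemannianManifold.out (I := 𝓡 3) (e.symm u) y] at hr
    obtain ⟨γ, hγ0, hγ1, hγs, hγ, -⟩ :=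
      Manifold.exists_lt_locally_constant_of_riemannianEDist_lt hr zero_lt_one
    let K := e.symm '' Metric.closedBall u R
    have hKc : IsCompact K := (isCompact_closedBall u R).image_of_continuousOn
      (e.continuousOn_symm.mono hse)
    have hKs : K ⊆ e.source := by
      rintro x ⟨w, hw, rfl⟩
      exact e.map_target (hse hw)
    have est : ∀ t₁ ∈ Icc (0 : ℝ) 1, Icc 0 t₁ ⊆ γ ⁻¹' K →
        edist u (e (γ t₁)) ≤ ENNReal.ofReal C * Manifold.pathELength (𝓡 3) γ 0 1 := by
      intro t₁ ht₁ hA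
      rcases ht₁.1.eq_or_lt with rfl | ht0
      · rw [hγ0, e.right_inv hu]; simp
      have hes : ContMDiffOn 𝓘(ℝ, ℝ) (𝓡 3) 1 (e ∘ γ) (Icc 0 t₁) :=
        (he.contMDiffOn.of_le (by simp)).comp hγs.contMDiffOn fun t ht ↦ hKs (hA ht)
      have h0 : u = (e ∘ γ) 0 := by simp [hγ0, e.right_inv hu]
      rw [edist_comm, edist_eq_enorm_sub]
      calc ‖e (γ t₁) - u‖ₑ = ‖(e ∘ γ) t₁ - (e ∘ γ) 0‖ₑ := by rw [← h0]; rfl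
        _ ≤ ∫⁻ t in Icc 0 t₁, ‖derivWithin (e ∘ γ) (Icc 0 t₁) t‖ₑ := by
          apply enorm_sub_le_lintegral_derivWithin_Icc_of_contDiffOn_Icc _ ht₁.1
          rwa [← contMDiffOn_iff_contDiffOn]
        _ ≤ ∫⁻ t in Icc 0 t₁, ENNReal.ofReal C *
            ‖mfderivWithin 𝓘(ℝ, ℝ) (𝓡 3) γ (Icc 0 t₁) t (1 : ℝ)‖ₑ := by
          refine setLIntegral_mono' measurableSet_Icc fun t ht ↦ ?_
          have hcomp : mfderivWithin 𝓘(ℝ, ℝ) (𝓡 3) (e ∘ γ) (Icc 0 t₁) t =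
              (mfderiv (𝓡 3) (𝓡 3) e (γ t)).comp (mfderivWithin 𝓘(ℝ, ℝ) (𝓡 3) γ (Icc 0 t₁) t) := by
            apply mfderiv_comp_mfderivWithin
            · exact he.mdifferentiableAt (hKs (hA ht))
            · exact (hγs.mdifferentiable one_ne_zero).mdifferentiableOn _ ht
            · rw [uniqueMDiffWithinAt_iff_uniqueDiffWithinAt]
              exact uniqueDiffOn_Icc ht0 _ ht
          rw [mfderivWithin_eq_fderivWithin] at hcomp
          have h2 : derivWithin (e ∘ γ) (Icc 0 t₁) t = mfderiv (𝓡 3) (𝓡 3) e (γ t)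
              (mfderivWithin 𝓘(ℝ, ℝ) (𝓡 3) γ (Icc 0 t₁) t (1 : ℝ)) := by
            rw [← fderivWithin_derivWithin, hcomp]
            rfl
          rw [h2]
          exact hdC _ (hA ht) _
        _ = ENNReal.ofReal C * Manifold.pathELength (𝓡 3) γ 0 t₁ := by
          rw [lintegral_const_mul' _ _ ENNReal.ofReal_ne_top,
            Manifold.pathELength_eq_lintegral_mfderivWithin_Icc]
          rfl
        _ ≤ _ := by
          gcongr
          exact ht₁.2
    have hlt : ENNReal.ofReal C * Manifold.pathELength (𝓡 3) γ 0 1 < ENNReal.ofReal R := by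
      calc _ < ENNReal.ofReal C * ENNReal.ofReal (R / C) := by
            refine ENNReal.mul_lt_mul_right ?_ ENNReal.ofReal_ne_top (hγ.trans_le hrR)
            simpa using hC1
        _ = _ := by rw [← ENNReal.ofReal_mul hC1.le, mul_div_cancel₀ _ hC1.ne']
    have hsub : Icc (0 : ℝ) 1 ⊆ γ ⁻¹' K := by
      have hcl : IsClosed (γ ⁻¹' K ∩ Icc 0 1) :=
        (hKc.isClosed.preimage hγs.continuous).inter isClosed_Icc
      refine hcl.Icc_subset_of_forall_mem_nhdsGT_of_Icc_subset ?_ ?_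
      · exact ⟨u, Metric.mem_closedBall_self hR.le, hγ0.symm⟩
      · rintro t₁ ⟨ht0, ht1⟩ hA
        have h1 := (est t₁ ⟨ht0, ht1.le⟩ hA).trans_lt hlt
        have hs : γ t₁ ∈ e.source := hKs (hA ⟨ht0, le_rfl⟩)
        have hopen : IsOpen (e.symm '' Metric.ball u R) :=
          e.isOpen_image_symm_of_subset_target Metric.isOpen_ball
            (Metric.ball_subset_closedBall.trans hse)
        have hmem : γ t₁ ∈ e.symm '' Metric.ball u R := by
          refine ⟨e (γ t₁), ?_, e.left_inv hs⟩
          rw [Metric.mem_ball, dist_comm]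
          rwa [edist_dist, ENNReal.ofReal_lt_ofReal_iff hR] at h1
        have := hγs.continuous.continuousAt.preimage_mem_nhds (hopen.mem_nhds hmem)
        exact mem_nhdsWithin_of_mem_nhds (mem_of_superset this
          (preimage_mono (image_mono Metric.ball_subset_closedBall)))
    have hend := est 1 ⟨zero_le_one, le_rfl⟩ hsub
    have hys : y ∈ e.source := by
      have := hKs (hsub ⟨zero_le_one, le_rfl⟩)
      rwa [hγ1] at this
    rw [hγ1] at hend
    exact ⟨hys, hend.trans (by gcongr)⟩
  refine ⟨(main _ hy le_rfl).1, ?_⟩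
  have hCne : ENNReal.ofReal C ≠ 0 := by simpa using hC1
  have hdiv : edist u (e y) / ENNReal.ofReal C ≤ edist (e.symm u) y := by
    refine le_of_forall_gt_imp_ge_of_dense fun r hr ↦ ?_
    refine ENNReal.div_le_of_le_mul' ((main (min r (ENNReal.ofReal (R / C))) (lt_min hr hy)
      (min_le_right _ _)).2.trans ?_)
    gcongr
    exact min_le_left _ _
  rwa [ENNReal.div_le_iff_le_mul (Or.inl hCne) (Or.inl ENNReal.ofReal_ne_top), mul_comm] at hdiv
end

section
variable {X Y : Type*} [EMetricSpace X] [MeasurableSpace X] [BorelSpace X]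
  [EMetricSpace Y] [MeasurableSpace Y] [BorelSpace Y]

lemma euclideanHausdorffMeasure_image_le {f : X → Y} {s : Set X} {C : ℝ} (d : ℕ)
    (hf : ∀ x ∈ s, ∀ y ∈ s, edist (f x) (f y) ≤ ENNReal.ofReal C * edist x y) :
    μHE[d] (f '' s) ≤ ENNReal.ofReal C ^ d * μHE[d] s := by
  have h : LipschitzOnWith C.toNNReal f s := fun x hx y hy ↦ hf x hx y hy
  have := h.hausdorffMeasure_image_le (d := d) (by positivity)
  simp only [Measure.euclideanHausdorffMeasure_def, Measure.smul_apply, ENNReal.smul_def, smul_eq_mul]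
  rw [ENNReal.rpow_natCast] at this
  calc _ ≤ _ := mul_le_mul_right this _
    _ = _ := by
      rw [← mul_assoc, ← mul_assoc, mul_comm (ENNReal.ofReal C ^ d)]; rfl

lemma euclideanHausdorffMeasure_le_image {f : X → Y} {s : Set X} {C : ℝ} (d : ℕ)
    (hf : ∀ x ∈ s, ∀ y ∈ s, edist x y ≤ ENNReal.ofReal C * edist (f x) (f y)) :
    μHE[d] s ≤ ENNReal.ofReal C ^ d * μHE[d] (f '' s) := by
  rcases s.eq_empty_or_nonempty with rfl | ⟨x₀, hx₀⟩
  · simp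
  have : Nonempty X := ⟨x₀⟩
  have hinj : InjOn f s := by
    intro x hx y hy hxy
    have := hf x hx y hy
    rw [hxy] at this
    simpa using this
  have hleft := hinj.leftInvOn_invFunOn
  have him : Function.invFunOn f s '' (f '' s) = s := hleft.image_image
  conv_lhs => rw [← him]
  refine euclideanHausdorffMeasure_image_le d ?_
  rintro _ ⟨x, hx, rfl⟩ _ ⟨y, hy, rfl⟩
  rw [hleft hx, hleft hy]
  exact hf x hx y hy
end

lemma volume_closedBall_E3_le (u : E3) {r : ℝ} (hr : 0 ≤ r) :
    (volume (Metric.closedBall u r) : ℝ≥0∞) ≤ ENNReal.ofReal (8 * r ^ 3) := by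
  rw [EuclideanSpace.volume_closedBall_fin_three, ← ENNReal.ofReal_pow hr,
    ← ENNReal.ofReal_mul (by positivity)]
  refine ENNReal.ofReal_le_ofReal ?_
  nlinarith [Real.pi_lt_d2, pow_nonneg hr 3]

section
variable {M : Type*} [EMetricSpace M] [ChartedSpace E3 M] [IsManifold (𝓡 3) ∞ M]
    [RiemannianBundle (fun x : M ↦ TangentSpace (𝓡 3) x)]
    [IsContMDiffRiemannianBundle (𝓡 3) ∞ E3 (fun x : M ↦ TangentSpace (𝓡 3) x)]
    [IsRiemannianManifold (𝓡 3) M]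

/-- The bilipschitz property of a chart with constant `C` at scale `R` around the points of `K`. -/
structure IsBilipOn (e : OpenPartialHomeomorph M E3) (K : Set E3) (R C : ℝ) : Prop where
  radius_pos : 0 < R
  one_le : 1 ≤ C
  subset : ∀ u ∈ K, Metric.closedBall u R ⊆ e.target
  upper : ∀ u ∈ K, ∀ v ∈ Metric.closedBall u R, ∀ w ∈ Metric.closedBall u R,
    edist (e.symm v) (e.symm w) ≤ ENNReal.ofReal C * edist v w
  lower : ∀ u ∈ K, ∀ y : M, edist (e.symm u) y < ENNReal.ofReal (R / C) →
    y ∈ e.source ∧ edist u (e y) ≤ ENNReal.ofReal C * edist (e.symm u) y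

lemma IsSmoothChart.exists_isBilipOn {e : OpenPartialHomeomorph M E3} (he : IsSmoothChart e)
    {K : Set E3} (hK : IsCompact K) (hKe : K ⊆ e.target) : ∃ R C : ℝ, IsBilipOn e K R C := by
  obtain ⟨R, hR, hRe⟩ := hK.exists_cthickening_subset_open e.open_target hKe
  obtain ⟨C, hC1, hC⟩ := he.exists_norm_bounds (hK.cthickening (r := R)) hRe
  have hsub : ∀ u ∈ K, Metric.closedBall u R ⊆ Metric.cthickening R K := fun u hu ↦
    Metric.closedBall_subset_cthickening hu R
  refine ⟨R, C, hR, hC1, fun u hu ↦ (hsub u hu).trans hRe, fun u hu v hv w hw ↦ ?_,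
    fun u hu y hy ↦ ?_⟩
  · exact he.edist_symm_le (convex_closedBall u R) ((hsub u hu).trans hRe)
      (fun w hw V ↦ (hC w (hsub u hu hw) V).1) hv hw
  · exact he.edist_le_of_edist_symm_lt hR (by linarith) ((hsub u hu).trans hRe)
      (fun w hw V ↦ (hC w (hsub u hu hw) V).2) hy

variable [MeasurableSpace M] [BorelSpace M]

lemma IsBilipOn.measure_image_le {e : OpenPartialHomeomorph M E3} {K : Set E3} {R C : ℝ}
    (h : IsBilipOn e K R C) {u : E3} (hu : u ∈ K) {s : Set E3} (hs : s ⊆ Metric.closedBall u R) :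
    μHE[3] (e.symm '' s) ≤ ENNReal.ofReal (C ^ 3) * volume s := by
  have := euclideanHausdorffMeasure_image_le (f := e.symm) (s := s) (C := C) 3
    (fun x hx y hy ↦ h.upper u hu x (hs hx) y (hs hy))
  rwa [EuclideanSpace.euclideanHausdorffMeasure_eq_volume, ← ENNReal.ofReal_pow (by linarith [h.one_le])] at this

/-- Tubes of radius `δ` about Lipschitz curves of bounded length have volume `O(δ²)`. -/
lemma IsBilipOn.measure_tube_le {e : OpenPartialHomeomorph M E3} {K : Set E3} {R C : ℝ}
    (h : IsBilipOn e K R C) {L T₀ : ℝ} (hL : 0 ≤ L) (hT₀ : 0 ≤ T₀) :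
    ∃ B δ₀ : ℝ, 0 < B ∧ 0 < δ₀ ∧ ∀ δ : ℝ, 0 < δ → δ < δ₀ → ∀ (u : ℝ → E3) (T : ℝ), T ≤ T₀ →
      (∀ t ∈ Icc 0 T, u t ∈ K) →
      (∀ t ∈ Icc 0 T, ∀ t' ∈ Icc 0 T, dist (u t) (u t') ≤ L * |t - t'|) →
      μHE[3] (Metric.cthickening δ ((fun t ↦ e.symm (u t)) '' Icc 0 T)) ≤
        ENNReal.ofReal (B * δ ^ 2) := by
  have hC := h.one_le
  have hR := h.radius_pos
  set C' := 2 * C + L with hC'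
  have hC'0 : 0 < C' := by positivity
  refine ⟨(T₀ + 1) * (C ^ 3 * (8 * C' ^ 3)), min 1 (R / (2 * C')), by positivity, by positivity, ?_⟩
  intro δ hδ hδ₀ u T hT hK hLip
  have hδ1 : δ < 1 := hδ₀.trans_le (min_le_left _ _)
  have hδR : 2 * C' * δ < R := by
    have := hδ₀.trans_le (min_le_right _ _)
    rw [lt_div_iff₀ (by positivity)] at this
    linarith
  set n := ⌊T₀ / δ⌋₊ with hn
  let F : Finset ℕ := (Finset.range (n + 1)).filter fun k : ℕ ↦ (k : ℝ) * δ ≤ T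
  have hcover : Metric.cthickening δ ((fun t ↦ e.symm (u t)) '' Icc 0 T) ⊆
      ⋃ k ∈ F,
        e.symm '' Metric.closedBall (u (k * δ)) (C' * δ) := by
    intro y hy
    rw [Metric.mem_cthickening_iff] at hy
    have hlt : Metric.infEDist y ((fun t ↦ e.symm (u t)) '' Icc 0 T) < ENNReal.ofReal (2 * δ) :=
      hy.trans_lt ((ENNReal.ofReal_lt_ofReal_iff (by positivity)).2 (by linarith))
    obtain ⟨x, ⟨t, ht, rfl⟩, hxt⟩ := Metric.infEDist_lt_iff.1 hlt
    rw [edist_comm] at hxt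
    have hRC : 2 * δ < R / C := by
      rw [lt_div_iff₀ (by positivity)]
      nlinarith
    obtain ⟨hys, hyd⟩ := h.lower (u t) (hK t ht) y
      (hxt.trans ((ENNReal.ofReal_lt_ofReal_iff (by positivity)).2 hRC))
    have hd : dist (u t) (e y) ≤ C * (2 * δ) := by
      rw [← ENNReal.ofReal_le_ofReal_iff (by positivity), ← edist_dist, ENNReal.ofReal_mul (by positivity)]
      exact hyd.trans (by gcongr)
    set k := ⌊t / δ⌋₊ with hk
    have hk1 : (k : ℝ) * δ ≤ t := by
      have := Nat.floor_le (div_nonneg ht.1 hδ.le)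
      rwa [le_div_iff₀ hδ] at this
    have hk2 : t < (k + 1) * δ := by
      have := Nat.lt_floor_add_one (t / δ)
      rwa [div_lt_iff₀ hδ] at this
    have hk0 : (0 : ℝ) ≤ k * δ := by positivity
    have hkn : k ≤ n := Nat.floor_mono (by gcongr; exact ht.2.trans hT)
    simp only [F, mem_iUnion, Finset.mem_filter, Finset.mem_range]
    refine ⟨k, ⟨Nat.lt_succ_of_le hkn, hk1.trans ht.2⟩, e y, ?_, e.left_inv hys⟩
    have h3 := hLip t ht (k * δ) ⟨hk0, hk1.trans ht.2⟩
    rw [abs_of_nonneg (by linarith)] at h3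
    have h4 : L * (t - k * δ) ≤ L * δ := by gcongr; linarith
    rw [Metric.mem_closedBall]
    calc dist (e y) (u (k * δ)) ≤ dist (e y) (u t) + dist (u t) (u (k * δ)) := dist_triangle _ _ _
      _ ≤ C * (2 * δ) + L * δ := by rw [dist_comm (e y)]; linarith
      _ = C' * δ := by rw [hC']; ring
  have hball : ∀ k ∈ F,
      μHE[3] (e.symm '' Metric.closedBall (u (k * δ)) (C' * δ)) ≤
        ENNReal.ofReal (C ^ 3 * (8 * (C' * δ) ^ 3)) := by
    intro k hk
    rw [Finset.mem_filter] at hk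
    have hmem : u (k * δ) ∈ K := hK _ ⟨by positivity, hk.2⟩
    refine (h.measure_image_le hmem (Metric.closedBall_subset_closedBall (by linarith [mul_pos hC'0 hδ]))).trans ?_
    rw [ENNReal.ofReal_mul (by positivity)]
    gcongr
    exact volume_closedBall_E3_le _ (by positivity)
  calc _ ≤ _ := measure_mono hcover
    _ ≤ ∑ k ∈ F,
        μHE[3] (e.symm '' Metric.closedBall (u (k * δ)) (C' * δ)) := measure_biUnion_finset_le _ _
    _ ≤ ∑ k ∈ F,
        ENNReal.ofReal (C ^ 3 * (8 * (C' * δ) ^ 3)) := Finset.sum_le_sum hball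
    _ ≤ (n + 1 : ℕ) * ENNReal.ofReal (C ^ 3 * (8 * (C' * δ) ^ 3)) := by
        rw [Finset.sum_const, nsmul_eq_mul]
        gcongr
        exact (Finset.card_filter_le _ _).trans (by simp)
    _ = ENNReal.ofReal ((n + 1 : ℕ) * (C ^ 3 * (8 * (C' * δ) ^ 3))) := by
        rw [ENNReal.ofReal_mul (p := ((n + 1 : ℕ) : ℝ)) (by positivity), ENNReal.ofReal_natCast]
    _ ≤ _ := by
        refine ENNReal.ofReal_le_ofReal ?_
        have hn1 : (n : ℝ) * δ ≤ T₀ := by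
          have := Nat.floor_le (div_nonneg hT₀ hδ.le)
          rwa [le_div_iff₀ hδ] at this
        have h1 : ((n + 1 : ℕ) : ℝ) * δ ≤ T₀ + 1 := by push_cast; linarith
        calc ((n + 1 : ℕ) : ℝ) * (C ^ 3 * (8 * (C' * δ) ^ 3))
            = (((n + 1 : ℕ) : ℝ) * δ) * (C ^ 3 * (8 * C' ^ 3)) * δ ^ 2 := by ring
          _ ≤ _ := by gcongr
end

section
variable {M : Type*} [EMetricSpace M] [ChartedSpace E3 M] [IsManifold (𝓡 3) ∞ M]
    [RiemannianBundle (fun x : M ↦ TangentSpace (𝓡 3) x)]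
    [IsContMDiffRiemannianBundle (𝓡 3) ∞ E3 (fun x : M ↦ TangentSpace (𝓡 3) x)]

/-- `c` is an affinely parametrized geodesic near every time of `I`, as expressed by the geodesic
equation in all charts. -/
def IsGeodCurve (c : ℝ → M) (I : Set ℝ) : Prop :=
  ∀ t ∈ I, ContinuousAt c t ∧ ∀ e : OpenPartialHomeomorph M E3, IsSmoothChart e →
    c t ∈ e.source → HasDerivAt (fun τ ↦ e (c τ)) (deriv (fun τ ↦ e (c τ)) t) t ∧
      HasDerivAt (deriv fun τ ↦ e (c τ))
        (-(gam e (e (c t)) (deriv (fun τ ↦ e (c τ)) t) (deriv (fun τ ↦ e (c τ)) t))) t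

lemma IsGeodCurve.mono {c : ℝ → M} {I J : Set ℝ} (h : IsGeodCurve c I) (hJ : J ⊆ I) :
    IsGeodCurve c J := fun t ht ↦ h t (hJ ht)

lemma contDiffAt_chart_comp {γ : ℝ → M} {t : ℝ} (hγ : ContMDiffAt 𝓘(ℝ, ℝ) (𝓡 3) ∞ γ t)
    {e : OpenPartialHomeomorph M E3} (he : IsSmoothChart e) (hs : γ t ∈ e.source) :
    ContDiffAt ℝ ∞ (fun τ ↦ e (γ τ)) t := by
  rw [← contMDiffAt_iff_contDiffAt]
  exact (he.contMDiffOn.contMDiffAt (e.open_source.mem_nhds hs)).comp t hγ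

lemma ContDiffAt.hasDerivAt_deriv {f : ℝ → E3} {t : ℝ} (hf : ContDiffAt ℝ ∞ f t) :
    HasDerivAt f (deriv f t) t ∧ HasDerivAt (deriv f) (deriv (deriv f) t) t := by
  refine ⟨(hf.differentiableAt (by simp)).hasDerivAt, ?_⟩
  have h1 : ContDiffAt ℝ 1 (fderiv ℝ f) t := hf.fderiv_right (m := 1) (by norm_cast)
  have h2 : ContDiffAt ℝ 1 (deriv f) t := by
    have : deriv f = fun x ↦ fderiv ℝ f x 1 := by ext1 x; exact (fderiv_apply_one_eq_deriv).symm
    rw [this]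
    exact h1.clm_apply contDiffAt_const
  exact (h2.differentiableAt (by simp)).hasDerivAt

lemma IsGeodesicOn.isGeodCurve {γ : ℝ → M} {s : Set ℝ} (hs : IsOpen s) (h : IsGeodesicOn γ s) :
    IsGeodCurve γ s := by
  intro t ht
  have hγ : ContMDiffAt 𝓘(ℝ, ℝ) (𝓡 3) ∞ γ t := h.1.contMDiffAt (hs.mem_nhds ht)
  refine ⟨hγ.continuousAt, fun e he hsrc ↦ ?_⟩
  obtain ⟨h1, h2⟩ := (contDiffAt_chart_comp hγ he hsrc).hasDerivAt_deriv
  refine ⟨h1, ?_⟩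
  have h3 := h.2 e he t ht hsrc
  rw [covDeriv_eq] at h3
  rwa [← eq_neg_of_add_eq_zero_left h3]

lemma deriv_chart_comp {γ : ℝ → M} {t : ℝ} (hγ : MDifferentiableAt 𝓘(ℝ, ℝ) (𝓡 3) γ t)
    {e : OpenPartialHomeomorph M E3} (he : IsSmoothChart e) (hs : γ t ∈ e.source) :
    deriv (fun τ ↦ e (γ τ)) t = mfderiv (𝓡 3) (𝓡 3) e (γ t) (velocity γ t) := by
  have h := mfderiv_comp t (he.mdifferentiableAt hs) hγ
  rw [← fderiv_apply_one_eq_deriv, ← mfderiv_eq_fderiv]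
  exact congr($h (1 : ℝ))

lemma IsGeodCurve.comp_mul {c : ℝ → M} {I J : Set ℝ} (h : IsGeodCurve c I) {N : ℝ}
    (hJ : ∀ t ∈ J, N * t ∈ I) : IsGeodCurve (fun t ↦ c (N * t)) J := by
  intro t ht
  obtain ⟨hc, h⟩ := h (N * t) (hJ t ht)
  have hmul : HasDerivAt (fun τ : ℝ ↦ N * τ) N t := by
    simpa using (hasDerivAt_id t).const_mul N
  refine ⟨ContinuousAt.comp (f := fun τ : ℝ ↦ N * τ) hc hmul.continuousAt, fun e he hs ↦ ?_⟩
  obtain ⟨h1, h2⟩ := h e he hs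
  set u := fun τ ↦ e (c τ) with hu
  have hd : ∀ τ, deriv (fun τ ↦ e (c (N * τ))) τ = N • deriv u (N * τ) := by
    intro τ
    exact deriv_comp_mul_left N u τ
  have hd' : (deriv fun τ ↦ e (c (N * τ))) = fun τ ↦ N • deriv u (N * τ) := funext hd
  rw [hd']
  constructor
  · exact HasDerivAt.scomp t h1 hmul
  · have := (HasDerivAt.scomp t h2 hmul).const_smul N
    refine this.congr_deriv ?_
    simp only [map_smul, _root_.smul_apply, smul_neg, smul_smul]

/-- The geodesics through a point, given by their initial velocities in a chart, meet only at this
point as long as they are short. -/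
lemma ExpIsDiffeo.exists_geodesics {x : M} {r : ℝ} (h : ExpIsDiffeo x r) (hr : 0 < r)
    {e : OpenPartialHomeomorph M E3} (he : IsSmoothChart e) {u : E3} (hu : u ∈ e.target)
    (hx : e.symm u = x) :
    ∃ c : E3 → ℝ → M, (∀ V ≠ 0, c V 0 = e.symm u ∧ deriv (fun τ ↦ e (c V τ)) 0 = V ∧
      IsGeodCurve (c V) (Ioo (-(r / ‖coordVec e u V‖)) (r / ‖coordVec e u V‖)) ∧
      ∀ α : ℝ, 0 < α → α < r → c V '' Icc 0 (α / ‖coordVec e u V‖) ∈ geodesicSegments M α) ∧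
      ∀ (V W : E3) (s t : ℝ), V ≠ 0 → W ≠ 0 → |s| * ‖coordVec e u V‖ < r →
        |t| * ‖coordVec e u W‖ < r → c V s = c W t → s • V = t • W := by
  subst hx
  obtain ⟨Φ, hsrc, -, -, hΦ⟩ := h
  have hN : ∀ V ≠ 0, 0 < ‖coordVec e u V‖ := fun V hV ↦ norm_pos_iff.2 (he.coordVec_ne_zero hu hV)
  set v : E3 → TangentSpace (𝓡 3) (e.symm u) := fun V ↦ ‖coordVec e u V‖⁻¹ • coordVec e u V with hv
  have hunit : ∀ V ≠ 0, tangentNorm (e.symm u) (v V) = 1 := fun V hV ↦ by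
    rw [tangentNorm, hv, norm_smul, norm_inv, norm_norm, inv_mul_cancel₀ (hN V hV).ne']
  refine ⟨fun V t ↦ Φ ((‖coordVec e u V‖ * t) • v V), fun V hV ↦ ?_,
    fun V W s t hV hW hs ht heq ↦ ?_⟩
  · obtain ⟨hg, h0⟩ := hΦ _ (hunit V hV)
    have hNpos := hN V hV
    set N := ‖coordVec e u V‖
    set γ : ℝ → M := fun t ↦ Φ (t • v V) with hγ
    have hγ0 : γ 0 = e.symm u := congrArg TotalSpace.proj h0
    have hgc := hg.1.isGeodCurve isOpen_Ioo
    have hmem : (0 : ℝ) ∈ Ioo (-r) r := ⟨by linarith, hr⟩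
    have hdiff : MDifferentiableAt 𝓘(ℝ, ℝ) (𝓡 3) γ 0 :=
      (hg.1.1.contMDiffAt (isOpen_Ioo.mem_nhds hmem)).mdifferentiableAt (by simp)
    have hs : γ 0 ∈ e.source := by rw [hγ0]; exact e.map_target hu
    have hderiv : deriv (fun τ ↦ e (γ τ)) 0 = N⁻¹ • V := by
      rw [deriv_chart_comp hdiff he hs]
      have h1 : mfderiv (𝓡 3) (𝓡 3) e (γ 0) (velocity γ 0) =
          (show E3 from mfderiv (𝓡 3) (𝓡 3) e (e.symm u) (N⁻¹ • coordVec e u V)) :=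
        congrArg (fun p : TangentBundle (𝓡 3) M ↦
          (show E3 from mfderiv (𝓡 3) (𝓡 3) e p.1 p.2)) h0
      rw [h1, ← coordVec_smul]
      exact he.mfderiv_coordVec hu _
    refine ⟨(congrArg γ (mul_zero N)).trans hγ0, ?_, hgc.comp_mul ?_, fun α hα0 hα ↦ ?_⟩
    · have := deriv_comp_mul_left N (fun τ ↦ e (γ τ)) 0
      rw [mul_zero, hderiv, smul_smul, mul_inv_cancel₀ hNpos.ne', one_smul] at this
      exact this
    · intro t ht
      rw [mem_Ioo, ← neg_div, div_lt_iff₀ hNpos, lt_div_iff₀ hNpos, mul_comm t] at ht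
      exact ht
    · refine ⟨γ, r - α, by linarith, ?_, ?_⟩
      · have hsub : Ioo (-(r - α)) (α + (r - α)) ⊆ Ioo (-r) r :=
          Ioo_subset_Ioo (by linarith) (by linarith)
        exact ⟨⟨hg.1.1.mono hsub, fun e he t ht ↦ hg.1.2 e he t (hsub ht)⟩,
          fun t ht ↦ hg.2 t (hsub ht)⟩
      · have : Icc (0 : ℝ) α = (fun t ↦ N * t) '' Icc 0 (α / N) := by
          rw [image_mul_left_Icc' hNpos, mul_zero, mul_div_cancel₀ _ hNpos.ne']
        rw [this, image_image]
  · have hcv : ∀ (V : E3) (s : ℝ), V ≠ 0 → (‖coordVec e u V‖ * s) • v V = coordVec e u (s • V) := by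
      intro V s hV
      rw [coordVec_smul, hv, smul_smul, mul_right_comm, mul_inv_cancel₀ (hN V hV).ne', one_mul]
    have hmem : ∀ (V : E3) (s : ℝ), V ≠ 0 → |s| * ‖coordVec e u V‖ < r →
        (‖coordVec e u V‖ * s) • v V ∈ Φ.source := by
      intro V s hV hs
      rw [hsrc, hcv V s hV]
      change ‖coordVec e u (s • V)‖ < r
      rwa [coordVec_smul, norm_smul, Real.norm_eq_abs]
    have h1 := Φ.injOn (hmem V s hV hs) (hmem W t hW ht) heq
    rw [hcv V s hV, hcv W t hW] at h1
    have h2 := congrArg (fun w : TangentSpace (𝓡 3) (e.symm u) ↦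
      (show E3 from mfderiv (𝓡 3) (𝓡 3) e (e.symm u) w)) h1
    exact ((he.mfderiv_coordVec hu _).symm.trans h2).trans (he.mfderiv_coordVec hu _)

lemma ExpIsDiffeo.exists_geodesic {x : M} {r : ℝ} (h : ExpIsDiffeo x r) (hr : 0 < r)
    {e : OpenPartialHomeomorph M E3} (he : IsSmoothChart e) {u : E3} (hu : u ∈ e.target)
    (hx : e.symm u = x) {V : E3} (hV : V ≠ 0) :
    ∃ c : ℝ → M, c 0 = e.symm u ∧ deriv (fun τ ↦ e (c τ)) 0 = V ∧
      IsGeodCurve c (Ioo (-(r / ‖coordVec e u V‖)) (r / ‖coordVec e u V‖)) ∧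
      ∀ α : ℝ, 0 < α → α < r → c '' Icc 0 (α / ‖coordVec e u V‖) ∈ geodesicSegments M α := by
  obtain ⟨c, hc, -⟩ := h.exists_geodesics hr he hu hx
  exact ⟨c V, hc V hV⟩

/-- The first order system of the geodesic equation. -/
noncomputable def geodField (Γ : E3 → E3 →L[ℝ] E3 →L[ℝ] E3) (z : E3 × E3) : E3 × E3 :=
  (z.2, -(Γ z.1 z.2 z.2))

lemma IsSmoothChart.contDiffOn_geodField {e : OpenPartialHomeomorph M E3}
    (he : IsSmoothChart e) : ContDiffOn ℝ ∞ (geodField (gam e)) (e.target ×ˢ univ) := by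
  have h1 : ContDiffOn ℝ ∞ (fun z : E3 × E3 ↦ gam e z.1) (e.target ×ˢ univ) :=
    he.contDiffOn_gam.comp contDiffOn_fst (fun p hp ↦ hp.1)
  exact contDiffOn_snd.prodMk (((h1.clm_apply contDiffOn_snd).clm_apply contDiffOn_snd).neg)

/-- Continuous dependence on the initial data of geodesics near a coordinate line that is a
geodesic. -/
lemma IsSmoothChart.exists_forall_geodCurve_close {e : OpenPartialHomeomorph M E3}
    (he : IsSmoothChart e) {u₀ f : E3} {T : ℝ} (hT : 0 ≤ T)
    (hline : ∀ t ∈ Icc 0 T, u₀ + t • f ∈ e.target)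
    (hgeod : ∀ t ∈ Icc 0 T, gam e (u₀ + t • f) f f = 0) {ε : ℝ} (hε : 0 < ε) :
    ∃ η : ℝ, 0 < η ∧ ∀ (c : ℝ → M) (T' : ℝ), T' ≤ T → IsGeodCurve c (Icc 0 T') →
      c 0 ∈ e.source → ‖e (c 0) - u₀‖ ≤ η → ‖deriv (fun τ ↦ e (c τ)) 0 - f‖ ≤ η →
      ∀ t ∈ Icc 0 T', c t ∈ e.source ∧ ‖e (c t) - (u₀ + t • f)‖ ≤ ε ∧
        ‖deriv (fun τ ↦ e (c τ)) t - f‖ ≤ ε := by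
  set z₀ : ℝ → E3 × E3 := fun t ↦ (u₀ + t • f, f) with hz₀
  have hz₀c : Continuous z₀ := by fun_prop
  have hK₀ : IsCompact (z₀ '' Icc 0 T) := isCompact_Icc.image hz₀c
  have hopen : IsOpen (e.target ×ˢ (univ : Set E3)) := e.open_target.prod isOpen_univ
  obtain ⟨ε', hε', hthick⟩ := hK₀.exists_cthickening_subset_open hopen (by
    rintro _ ⟨t, ht, rfl⟩
    exact ⟨hline t ht, mem_univ _⟩)
  set ε₁ := min ε ε' with hε₁
  have hε₁pos : 0 < ε₁ := lt_min hε hε'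
  set K := Metric.cthickening ε₁ (z₀ '' Icc 0 T) with hK
  have hKc : IsCompact K := hK₀.cthickening
  have hKsub : K ⊆ e.target ×ˢ (univ : Set E3) :=
    (Metric.cthickening_mono (min_le_right _ _) _).trans hthick
  have hball : ∀ t ∈ Icc 0 T, Metric.closedBall (z₀ t) ε₁ ⊆ K := fun t ht ↦
    Metric.closedBall_subset_cthickening (mem_image_of_mem _ ht) ε₁
  have hF := he.contDiffOn_geodField
  have hFd : ContinuousOn (fderiv ℝ (geodField (gam e))) K :=
    (hF.continuousOn_fderiv_of_isOpen hopen (by simp)).mono hKsub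
  obtain ⟨B, hB⟩ := hKc.exists_bound_of_continuousOn hFd
  have hlip : ∀ t ∈ Icc 0 T, LipschitzOnWith B.toNNReal (geodField (gam e))
      (Metric.closedBall (z₀ t) ε₁) := by
    intro t ht
    refine (convex_closedBall _ _).lipschitzOnWith_of_nnnorm_fderiv_le (𝕜 := ℝ) ?_ ?_
    · intro x hx
      exact ((hF x (hKsub (hball t ht hx))).contDiffAt
        (hopen.mem_nhds (hKsub (hball t ht hx)))).differentiableAt (by simp)
    · intro x hx
      have := hB x (hball t ht hx)
      rw [← NNReal.coe_le_coe, coe_nnnorm]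
      exact this.trans (Real.le_coe_toNNReal B)
  set L : ℝ := NNReal.toReal B.toNNReal with hL
  refine ⟨ε₁ / 2 * Real.exp (-(L * T)), by positivity, ?_⟩
  intro c T' hT' hc hs0 hu0 hv0
  rcases lt_or_ge T' 0 with hneg | hT'0
  · intro t ht
    linarith [ht.1, ht.2]
  have hL0 : 0 ≤ L := NNReal.coe_nonneg _
  set η := ε₁ / 2 * Real.exp (-(L * T)) with hη
  have hηε : η ≤ ε₁ / 2 := by
    have : Real.exp (-(L * T)) ≤ 1 := Real.exp_le_one_iff.2 (by nlinarith)
    rw [hη]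
    nlinarith
  set z : ℝ → E3 × E3 := fun t ↦ (e (c t), deriv (fun τ ↦ e (c τ)) t) with hz
  have hzderiv : ∀ t ∈ Icc 0 T', c t ∈ e.source → HasDerivAt z (geodField (gam e) (z t)) t := by
    intro t ht hs
    obtain ⟨h1, h2⟩ := (hc t ht).2 e he hs
    exact h1.prodMk h2
  have hz₀deriv : ∀ t ∈ Icc 0 T, HasDerivAt z₀ (geodField (gam e) (z₀ t)) t := by
    intro t ht
    have h1 : HasDerivAt (fun t : ℝ ↦ u₀ + t • f) f t := by
      simpa using ((hasDerivAt_id t).smul_const f).const_add u₀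
    have h2 := h1.prodMk (hasDerivAt_const t f)
    simpa [geodField, hz₀, hgeod t ht] using h2
  set A : Set ℝ := {t | c t ∈ e.source ∧ dist (z t) (z₀ t) ≤ ε₁} with hA
  have hstrict : ∀ t ∈ Icc 0 T', Icc 0 t ⊆ A → dist (z t) (z₀ t) ≤ ε₁ / 2 := by
    intro t ht htA
    have hsub : Icc 0 t ⊆ Icc 0 T' := Icc_subset_Icc_right ht.2
    have hsub2 : Icc 0 T' ⊆ Icc 0 T := Icc_subset_Icc_right hT'
    have h0 : dist (z 0) (z₀ 0) ≤ η := by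
      rw [Prod.dist_eq, dist_eq_norm, dist_eq_norm]
      simp only [hz, hz₀, zero_smul, add_zero]
      exact max_le hu0 hv0
    have := dist_le_of_trajectories_ODE_of_mem (v := fun _ ↦ geodField (gam e)) (f := z) (g := z₀)
      (s := fun t ↦ Metric.closedBall (z₀ t) ε₁) (K := B.toNNReal) (a := 0) (b := t)
      (fun τ hτ ↦ hlip τ (hsub2 (hsub (Ico_subset_Icc_self hτ))))
      (fun τ hτ ↦ (hzderiv τ (hsub hτ) (htA hτ).1).continuousAt.continuousWithinAt)
      (fun τ hτ ↦ (hzderiv τ (hsub (Ico_subset_Icc_self hτ))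
        (htA (Ico_subset_Icc_self hτ)).1).hasDerivWithinAt)
      (fun τ hτ ↦ Metric.mem_closedBall.2 (htA (Ico_subset_Icc_self hτ)).2)
      hz₀c.continuousOn
      (fun τ hτ ↦ (hz₀deriv τ (hsub2 (hsub (Ico_subset_Icc_self hτ)))).hasDerivWithinAt)
      (fun τ hτ ↦ Metric.mem_closedBall_self hε₁pos.le) h0 t ⟨ht.1, le_rfl⟩
    refine this.trans ?_
    rw [hη, mul_assoc, ← Real.exp_add, sub_zero]
    have : Real.exp (-(L * T) + L * t) ≤ 1 := Real.exp_le_one_iff.2 (by nlinarith [ht.2])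
    change ε₁ / 2 * Real.exp (-(L * T) + L * t) ≤ ε₁ / 2
    nlinarith
  have hall : Icc 0 T' ⊆ A := by
    have hKM : IsCompact (e.symm '' (Prod.fst '' K)) :=
      (hKc.image continuous_fst).image_of_continuousOn (e.continuousOn_symm.mono (by
        rintro _ ⟨p, hp, rfl⟩
        exact (hKsub hp).1))
    have hcl : IsClosed (A ∩ Icc 0 T') := by
      refine isClosed_of_closure_subset fun t ht ↦ ?_
      obtain ⟨s, hs, hst⟩ := mem_closure_iff_seq_limit.1 ht
      have htI : t ∈ Icc 0 T' := isClosed_Icc.mem_of_tendsto hst (Eventually.of_forall fun n ↦ (hs n).2)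
      have hct : Tendsto (fun n ↦ c (s n)) atTop (𝓝 (c t)) := (hc t htI).1.tendsto.comp hst
      have hmem : c t ∈ e.symm '' (Prod.fst '' K) := by
        refine hKM.isClosed.mem_of_tendsto hct (Eventually.of_forall fun n ↦ ?_)
        refine ⟨e (c (s n)), ⟨z (s n), ?_, rfl⟩, e.left_inv (hs n).1.1⟩
        exact hball (s n) (Icc_subset_Icc_right hT' (hs n).2) (Metric.mem_closedBall.2 (hs n).1.2)
      have hsrc : c t ∈ e.source := by
        obtain ⟨_, ⟨p, hp, rfl⟩, hpc⟩ := hmem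
        rw [← hpc]
        exact e.map_target (hKsub hp).1
      refine ⟨⟨hsrc, ?_⟩, htI⟩
      have hzt := (hzderiv t htI hsrc).continuousAt.tendsto.comp hst
      have hz₀t := (hz₀c.tendsto t).comp hst
      exact le_of_tendsto (hzt.dist hz₀t) (Eventually.of_forall fun n ↦ (hs n).1.2)
    refine hcl.Icc_subset_of_forall_mem_nhdsGT_of_Icc_subset ?_ ?_
    · refine ⟨hs0, ?_⟩
      rw [Prod.dist_eq, dist_eq_norm, dist_eq_norm]
      simp only [hz, hz₀, zero_smul, add_zero]
      exact max_le (by linarith) (by linarith)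
    · intro t ht htA
      have htI := Ico_subset_Icc_self ht
      have hsrc := (htA ⟨ht.1, le_rfl⟩).1
      have hd : dist (z t) (z₀ t) < ε₁ := (hstrict t htI htA).trans_lt (by linarith)
      have h1 : ∀ᶠ τ in 𝓝 t, c τ ∈ e.source :=
        (hc t htI).1.eventually (e.open_source.mem_nhds hsrc)
      have h2 : ∀ᶠ τ in 𝓝 t, dist (z τ) (z₀ τ) < ε₁ :=
        ((hzderiv t htI hsrc).continuousAt.dist hz₀c.continuousAt).eventually (Iio_mem_nhds hd)
      refine mem_nhdsWithin_of_mem_nhds ?_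
      filter_upwards [h1, h2] with τ h1 h2 using ⟨h1, h2.le⟩
  intro t ht
  obtain ⟨h1, h2⟩ := hall ht
  rw [Prod.dist_eq, dist_eq_norm, dist_eq_norm] at h2
  exact ⟨h1, (le_max_left _ _).trans (h2.trans (min_le_left _ _)),
    (le_max_right _ _).trans (h2.trans (min_le_left _ _))⟩
lemma IsGeodesicOn.gam_line {e : OpenPartialHomeomorph M E3} (he : IsSmoothChart e) {p V : E3}
    {s : Set ℝ} (hs : IsOpen s) (h : IsGeodesicOn (fun t : ℝ ↦ e.symm (p + t • V)) s) {t : ℝ}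
    (ht : t ∈ s) (hp : p + t • V ∈ e.target) : gam e (p + t • V) V V = 0 := by
  have hcont : Continuous fun τ : ℝ ↦ p + τ • V := by fun_prop
  have hev : ∀ᶠ τ in 𝓝 t, e (e.symm (p + τ • V)) = p + τ • V := by
    filter_upwards [hcont.continuousAt.eventually (e.open_target.mem_nhds hp)] with τ hτ
    exact e.right_inv hτ
  have hline : ∀ τ : ℝ, HasDerivAt (fun τ : ℝ ↦ p + τ • V) V τ := by
    intro τ
    simpa using ((hasDerivAt_id τ).smul_const V).const_add p
  have hev' : ∀ᶠ τ in 𝓝 t, deriv (fun τ ↦ e (e.symm (p + τ • V))) τ = V := by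
    filter_upwards [hev.eventually_nhds] with τ hτ
    rw [EventuallyEq.deriv_eq hτ]
    exact (hline τ).deriv
  have h2 := ((h.isGeodCurve hs t ht).2 e he (e.map_target hp)).2
  rw [hev'.self_of_nhds, e.right_inv hp] at h2
  have h3 : HasDerivAt (deriv fun τ ↦ e (e.symm (p + τ • V))) 0 t :=
    (hasDerivAt_const t V).congr_of_eventuallyEq hev'
  exact neg_eq_zero.1 (h2.unique h3)

lemma gam_eq_zero_of_diag {e : OpenPartialHomeomorph M E3} {u : E3}
    (h : ∀ V : E3, gam e u V V = 0) : gam e u = 0 := by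
  ext1 V
  ext1 W
  have h1 := h (V + W)
  simp only [map_add, _root_.add_apply, h V, h W, gam_comm e u W V, zero_add,
    add_zero] at h1
  rw [← two_smul ℝ, smul_eq_zero] at h1
  simpa using h1

lemma gam_eq_zero_iff {e : OpenPartialHomeomorph M E3} {u : E3} :
    gam e u = 0 ↔ ∀ i j k, christoffel e i j k u = 0 := by
  constructor
  · intro h i j k
    rw [← gam_single, h]
    simp
  · intro h
    ext V W k
    rw [gam_apply]
    simp [h]

lemma IsSmoothChart.pderiv_metricCoeff_eq_zero {e : OpenPartialHomeomorph M E3}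
    (he : IsSmoothChart e) {u : E3} (hu : u ∈ e.target) (h : gam e u = 0) (i j k : Fin 3) :
    pderiv k (metricCoeff e i j) u = 0 := by
  rw [he.pderiv_metricCoeff hu]
  simp [gam_eq_zero_iff.1 h]

/-- `e` is a chart by geodesic normal coordinates on the ball of radius `r`. -/
structure IsNormalChart (e : OpenPartialHomeomorph M E3) (r : ℝ) : Prop where
  smooth : IsSmoothChart e
  target_eq : e.target = Metric.ball 0 r
  orthonormal : ∀ i j : Fin 3, metricCoeff e i j 0 = if i = j then 1 else 0
  rays : ∀ V : E3, ‖V‖ = 1 → IsUnitGeodesicOn (fun t : ℝ ↦ e.symm (t • V)) (Ioo (-r) r)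

lemma ExpIsDiffeo.exists_normalChart {x : M} {r : ℝ} (h : ExpIsDiffeo x r) (hr : 0 < r)
    {τ : TangentSpace (𝓡 3) x} (hτ : ‖τ‖ = 1) :
    ∃ e : OpenPartialHomeomorph M E3, IsNormalChart e r ∧ e.symm 0 = x ∧
      (⟨e.symm ((0 : ℝ) • EuclideanSpace.single 0 (1 : ℝ)),
        velocity (fun t : ℝ ↦ e.symm (t • EuclideanSpace.single 0 (1 : ℝ))) 0⟩ :
          TangentBundle (𝓡 3) M) = ⟨x, τ⟩ := by
  obtain ⟨Φ, hsrc, hΦs, hΦs', hΦ⟩ := h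
  have : FiniteDimensional ℝ (TangentSpace (𝓡 3) x) := inferInstanceAs (FiniteDimensional ℝ E3)
  have hfr : Module.finrank ℝ (TangentSpace (𝓡 3) x) = Fintype.card (Fin 3) := by
    change Module.finrank ℝ E3 = _
    simp
  obtain ⟨b, hb⟩ := Orthonormal.exists_orthonormalBasis_extension_of_card_eq
    (v := fun _ : Fin 3 ↦ τ) (s := {0}) hfr (by
      constructor
      · intro i; simpa using hτ
      · intro i j hij; exact absurd (Subsingleton.elim i j) hij)
  have hb0 : b 0 = τ := hb 0 rfl
  let B₀ : E3 ≃ₗ[ℝ] E3 := b.repr.symm.toLinearEquiv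
  let B : E3 ≃L[ℝ] E3 := B₀.toContinuousLinearEquiv
  have hBnorm : ∀ V : E3, tangentNorm x (B V) = ‖V‖ := fun V ↦ b.repr.symm.norm_map V
  let e : OpenPartialHomeomorph M E3 := (B.toHomeomorph.transOpenPartialHomeomorph Φ).symm
  have hesymm : ∀ V : E3, e.symm V = Φ (B V) := fun V ↦ rfl
  have hesrc : e.source = Φ.target := rfl
  have hetar : e.target = Metric.ball 0 r := by
    have : e.target = B ⁻¹' Φ.source := rfl
    rw [this, hsrc]
    ext V
    simp [hBnorm]
  have hBs : ContMDiff (𝓡 3) (𝓡 3) ∞ B := by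
    rw [contMDiff_iff_contDiff]; exact B.contDiff
  have hBs' : ContMDiff (𝓡 3) (𝓡 3) ∞ B.symm := by
    rw [contMDiff_iff_contDiff]; exact B.symm.contDiff
  have he : IsSmoothChart e := by
    refine e.mem_maximalAtlas_of_contMDiffOn ?_ ?_
    · exact hBs'.comp_contMDiffOn hΦs'
    · exact hΦs.comp hBs.contMDiffOn (fun V hV ↦ hV)
  have hray : ∀ V : E3, ‖V‖ = 1 → IsUnitGeodesicOn (fun t : ℝ ↦ e.symm (t • V)) (Ioo (-r) r) ∧
      (⟨e.symm ((0 : ℝ) • V), velocity (fun t : ℝ ↦ e.symm (t • V)) 0⟩ : TangentBundle (𝓡 3) M) =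
        ⟨x, B V⟩ := by
    intro V hV
    have h1 := hΦ (B V) (by rw [hBnorm, hV])
    have h2 : (fun t : ℝ ↦ Φ (t • B V)) = fun t : ℝ ↦ e.symm (t • V) := by
      ext1 t
      rw [hesymm, map_smul]
    refine ⟨h2 ▸ h1.1, ?_⟩
    rw [← h1.2]
    exact (congrArg (fun g : ℝ → M ↦ (⟨g 0, velocity g 0⟩ : TangentBundle (𝓡 3) M)) h2).symm
  have h0mem : (0 : E3) ∈ e.target := by rw [hetar]; exact Metric.mem_ball_self hr
  have hvel : ∀ V : E3, velocity (fun t : ℝ ↦ e.symm (t • V)) 0 =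
      coordVec e ((0 : ℝ) • V) V := by
    intro V
    have hl : HasFDerivAt (fun t : ℝ ↦ t • V) ((1 : ℝ →L[ℝ] ℝ).smulRight V) 0 :=
      (hasFDerivAt_id (0 : ℝ)).smul_const V
    have h1 := mfderiv_comp (I := 𝓘(ℝ, ℝ)) (I' := 𝓡 3) (I'' := 𝓡 3) (0 : ℝ)
      (g := e.symm) (f := fun t : ℝ ↦ t • V)
      (he.mdifferentiableAt_symm (by rwa [zero_smul]))
      hl.differentiableAt.mdifferentiableAt
    have h2 : mfderiv 𝓘(ℝ, ℝ) (𝓡 3) (fun t : ℝ ↦ t • V) 0 (1 : ℝ) = V := by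
      rw [mfderiv_eq_fderiv, hl.fderiv]
      exact one_smul ℝ V
    change mfderiv 𝓘(ℝ, ℝ) (𝓡 3) (e.symm ∘ fun t : ℝ ↦ t • V) 0 (1 : ℝ) = _
    rw [h1]
    exact congrArg (mfderiv (𝓡 3) (𝓡 3) e.symm ((0 : ℝ) • V)) h2
  have hnorm1 : ∀ V : E3, ‖V‖ = 1 → ‖coordVec e 0 V‖ = 1 := by
    intro V hV
    have h1 := congrArg (fun p : TangentBundle (𝓡 3) M ↦ tangentNorm p.1 p.2) (hray V hV).2
    simp only [hvel, hBnorm, hV] at h1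
    rwa [zero_smul] at h1
  have hnorm : ∀ V : E3, ‖coordVec e 0 V‖ = ‖V‖ := by
    intro V
    rcases eq_or_ne V 0 with rfl | hV
    · rw [norm_zero, norm_eq_zero]
      exact map_zero (mfderiv (𝓡 3) (𝓡 3) e.symm 0)
    · have hn : ‖V‖ ≠ 0 := norm_ne_zero_iff.2 hV
      have := hnorm1 (‖V‖⁻¹ • V) (by rw [norm_smul, norm_inv, norm_norm, inv_mul_cancel₀ hn])
      rw [coordVec_smul, norm_smul, norm_inv, norm_norm] at this
      field_simp at this
      exact this
  refine ⟨e, ⟨he, hetar, fun i j ↦ ?_, fun V hV ↦ (hray V hV).1⟩, ?_, ?_⟩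
  · have h1 : metricCoeff e i j 0 =
        inner ℝ (EuclideanSpace.single i (1 : ℝ) : E3) (EuclideanSpace.single j (1 : ℝ)) := by
      rw [metricCoeff_eq_inner,
        real_inner_eq_norm_add_mul_self_sub_norm_mul_self_sub_norm_mul_self_div_two,
        real_inner_eq_norm_add_mul_self_sub_norm_mul_self_sub_norm_mul_self_div_two,
        ← coordVec_add, hnorm, hnorm, hnorm]
    rw [h1]
    simp [EuclideanSpace.inner_single_left]
  · have := congrArg TotalSpace.proj (hray (EuclideanSpace.single 0 1) (by simp)).2
    rwa [zero_smul] at this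
  · rw [(hray (EuclideanSpace.single 0 1) (by simp)).2]
    have : B (EuclideanSpace.single 0 1) = (τ : E3) := by
      rw [← hb0]
      exact b.repr_symm_single 0
    rw [this]
/-- The chart `e` followed by the inverse of the rigid motion `z ↦ R z + u₀`. -/
noncomputable def affineChart (e : OpenPartialHomeomorph M E3) (u₀ : E3) (R : E3 ≃ₗᵢ[ℝ] E3) :
    OpenPartialHomeomorph M E3 :=
  e.transHomeomorph ((Homeomorph.subRight u₀).trans R.symm.toHomeomorph)

lemma affineChart_symm_apply (e : OpenPartialHomeomorph M E3) (u₀ : E3) (R : E3 ≃ₗᵢ[ℝ] E3)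
    (z : E3) : (affineChart e u₀ R).symm z = e.symm (R z + u₀) := rfl

lemma affineChart_apply (e : OpenPartialHomeomorph M E3) (u₀ : E3) (R : E3 ≃ₗᵢ[ℝ] E3)
    (x : M) : affineChart e u₀ R x = R.symm (e x - u₀) := rfl

lemma mem_affineChart_target {e : OpenPartialHomeomorph M E3} {u₀ : E3} {R : E3 ≃ₗᵢ[ℝ] E3}
    {z : E3} : z ∈ (affineChart e u₀ R).target ↔ R z + u₀ ∈ e.target := Iff.rfl

lemma IsSmoothChart.affineChart {e : OpenPartialHomeomorph M E3} (he : IsSmoothChart e)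
    (u₀ : E3) (R : E3 ≃ₗᵢ[ℝ] E3) : IsSmoothChart (affineChart e u₀ R) := by
  have h1 : ContMDiff (𝓡 3) (𝓡 3) ∞ (fun z : E3 ↦ R.symm (z - u₀)) := by
    rw [contMDiff_iff_contDiff]
    exact R.symm.contDiff.comp (contDiff_id.sub contDiff_const)
  have h2 : ContMDiff (𝓡 3) (𝓡 3) ∞ (fun z : E3 ↦ R z + u₀) := by
    rw [contMDiff_iff_contDiff]
    exact R.contDiff.add contDiff_const
  refine (_root_.affineChart e u₀ R).mem_maximalAtlas_of_contMDiffOn ?_ ?_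
  · exact h1.comp_contMDiffOn he.contMDiffOn
  · exact he.contMDiffOn_symm.comp h2.contMDiffOn (fun z hz ↦ hz)

lemma IsSmoothChart.coordVec_affineChart {e : OpenPartialHomeomorph M E3} (he : IsSmoothChart e)
    {u₀ : E3} {R : E3 ≃ₗᵢ[ℝ] E3} {z : E3} (hz : R z + u₀ ∈ e.target) (V : E3) :
    coordVec (_root_.affineChart e u₀ R) z V = coordVec e (R z + u₀) (R V) := by
  have hR : HasFDerivAt (fun z : E3 ↦ R z + u₀) (R : E3 →L[ℝ] E3) z :=
    (R : E3 ≃L[ℝ] E3).hasFDerivAt.add_const u₀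
  have h1 := mfderiv_comp (I := 𝓡 3) (I' := 𝓡 3) (I'' := 𝓡 3) z
    (g := e.symm) (f := fun z : E3 ↦ R z + u₀) (he.mdifferentiableAt_symm hz)
    hR.differentiableAt.mdifferentiableAt
  change mfderiv (𝓡 3) (𝓡 3) (e.symm ∘ fun z : E3 ↦ R z + u₀) z V = _
  rw [h1]
  refine congrArg (mfderiv (𝓡 3) (𝓡 3) e.symm (R z + u₀)) ?_
  rw [mfderiv_eq_fderiv, hR.fderiv]
  rfl

/-- The exponential map at every point is a diffeomorphism of a ball of radius `> α`. -/
def HasInjRadiusGT (M : Type*) [EMetricSpace M] [ChartedSpace E3 M]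
    [RiemannianBundle (fun x : M ↦ TangentSpace (𝓡 3) x)] (α : ℝ) : Prop :=
  ∀ x : M, ∃ r : ℝ, α < r ∧ ExpIsDiffeo x r

lemma hasInjRadiusGT_of_lt {α : ℝ} (h : ENNReal.ofReal α < injRadius M / 2) :
    HasInjRadiusGT M (2 * α) := by
  intro x
  have h1 : ENNReal.ofReal (2 * α) < injRadius M := by
    rw [ENNReal.ofReal_mul (by norm_num), mul_comm]
    have := (ENNReal.lt_div_iff_mul_lt (by simp) (by simp)).1 h
    simpa using this
  have h2 := h1.trans_le (iInf_le _ x)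
  obtain ⟨r, hr⟩ := lt_iSup_iff.1 h2
  obtain ⟨hr1, hr2⟩ := lt_iSup_iff.1 hr
  exact ⟨r, (ENNReal.ofReal_lt_ofReal_iff hr1.1).1 hr2, hr1.2⟩

lemma HasInjRadiusGT.exists_geodesic {α : ℝ} (hα : 0 < α) (h : HasInjRadiusGT M (2 * α))
    {e : OpenPartialHomeomorph M E3} (he : IsSmoothChart e) {u : E3} (hu : u ∈ e.target)
    {V : E3} (hV : V ≠ 0) :
    ∃ c : ℝ → M, c 0 = e.symm u ∧ deriv (fun τ ↦ e (c τ)) 0 = V ∧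
      IsGeodCurve c (Ioo (-(2 * α / ‖coordVec e u V‖)) (2 * α / ‖coordVec e u V‖)) ∧
      c '' Icc 0 (α / ‖coordVec e u V‖) ∈ geodesicSegments M α := by
  obtain ⟨r, hr, hx⟩ := h (e.symm u)
  obtain ⟨c, h1, h2, h3, h4⟩ := hx.exists_geodesic (by linarith) he hu rfl hV
  refine ⟨c, h1, h2, h3.mono ?_, h4 α hα (by linarith)⟩
  refine Ioo_subset_Ioo (neg_le_neg ?_) ?_ <;> gcongr

lemma HasInjRadiusGT.gam_affineChart {α : ℝ} (hα : 0 < α) (h : HasInjRadiusGT M (2 * α))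
    {e : OpenPartialHomeomorph M E3} (he : IsSmoothChart e)
    {u₀ : E3} {R : E3 ≃ₗᵢ[ℝ] E3} {z : E3} (hz : R z + u₀ ∈ e.target) (V W : E3) :
    gam (affineChart e u₀ R) z V W = R.symm (gam e (R z + u₀) (R V) (R W)) := by
  set e' := affineChart e u₀ R with he'
  have hdiag : ∀ V : E3, gam e' z V V = R.symm (gam e (R z + u₀) (R V) (R V)) := by
    intro V
    rcases eq_or_ne V 0 with rfl | hV
    · simp
    have hz' : z ∈ e'.target := hz
    obtain ⟨c, hc0, hcV, hc, -⟩ := h.exists_geodesic hα (he.affineChart u₀ R) hz' hV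
    have hN : 0 < ‖coordVec e' z V‖ :=
      norm_pos_iff.2 ((he.affineChart u₀ R).coordVec_ne_zero hz' hV)
    obtain ⟨hcont, hg⟩ := hc 0 ⟨by rw [neg_lt_zero]; positivity, by positivity⟩
    have hs' : c 0 ∈ e'.source := by rw [hc0]; exact e'.map_target hz'
    have hs : c 0 ∈ e.source := hs'
    obtain ⟨h1', h2'⟩ := hg e' (he.affineChart u₀ R) hs'
    obtain ⟨h1, h2⟩ := hg e he hs
    rw [hcV, hc0, e'.right_inv hz'] at h2'
    have hrel : ∀ᶠ t in 𝓝 (0 : ℝ), deriv (fun τ ↦ e' (c τ)) t =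
        R.symm (deriv (fun τ ↦ e (c τ)) t) := by
      have hev : ∀ᶠ t in 𝓝 (0 : ℝ), t ∈ Ioo (-(2 * α / ‖coordVec e' z V‖))
          (2 * α / ‖coordVec e' z V‖) :=
        isOpen_Ioo.mem_nhds ⟨by rw [neg_lt_zero]; positivity, by positivity⟩
      filter_upwards [hcont.eventually (e.open_source.mem_nhds hs), hev] with t ht hti
      have := ((hc t hti).2 e he ht).1
      exact ((R.symm : E3 ≃L[ℝ] E3).hasFDerivAt.comp_hasDerivAt t (this.sub_const u₀)).deriv
    have h3 := ((R.symm : E3 ≃L[ℝ] E3).hasFDerivAt.comp_hasDerivAt (0 : ℝ) h2)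
    have h4 := h2'.unique (h3.congr_of_eventuallyEq hrel)
    have hV0 : deriv (fun τ ↦ e (c τ)) 0 = R V := by
      have := hrel.self_of_nhds
      rw [hcV] at this
      rw [this, R.apply_symm_apply]
    have hc0' : e (c 0) = R z + u₀ := by
      rw [hc0, affineChart_symm_apply, e.right_inv hz]
    rw [hV0, hc0'] at h4
    have h5 : R.symm (-(gam e (R z + u₀) (R V) (R V))) = -(gam e' z V V) := h4.symm
    rw [map_neg, neg_inj] at h5
    exact h5.symm
  have h1 := hdiag (V + W)
  simp only [map_add, _root_.add_apply, hdiag V, hdiag W, gam_comm _ _ W V,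
    gam_comm _ _ (R W) (R V)] at h1
  have h2 : (2 : ℝ) • gam e' z V W = (2 : ℝ) • R.symm (gam e (R z + u₀) (R V) (R W)) := by
    generalize gam e' z V W = p at h1 ⊢
    generalize R.symm (gam e (R z + u₀) (R V) (R W)) = q at h1 ⊢
    generalize R.symm (gam e (R z + u₀) (R V) (R V)) = a at h1
    generalize R.symm (gam e (R z + u₀) (R W) (R W)) = d at h1
    have h2 : (2 : ℝ) • p = (a + p + (p + d)) - (a + d) := by module
    rw [h2, h1]
    module
  exact smul_right_injective E3 (two_ne_zero) h2

/-- A geodesic whose initial data are those of a coordinate line that is a geodesic is this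
line. -/
lemma IsSmoothChart.geodCurve_eq_line {e : OpenPartialHomeomorph M E3}
    (he : IsSmoothChart e) {u₀ f : E3} {T : ℝ} (hT : 0 ≤ T)
    (hline : ∀ t ∈ Icc 0 T, u₀ + t • f ∈ e.target)
    (hgeod : ∀ t ∈ Icc 0 T, gam e (u₀ + t • f) f f = 0) {c : ℝ → M}
    (hc : IsGeodCurve c (Icc 0 T)) (hc0 : c 0 = e.symm u₀)
    (hcd : deriv (fun τ ↦ e (c τ)) 0 = f) {t : ℝ} (ht : t ∈ Icc 0 T) :
    c t = e.symm (u₀ + t • f) := by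
  have hu₀ : u₀ ∈ e.target := by simpa using hline 0 ⟨le_rfl, hT⟩
  have h : ∀ ε : ℝ, 0 < ε → c t ∈ e.source ∧ ‖e (c t) - (u₀ + t • f)‖ ≤ ε := by
    intro ε hε
    obtain ⟨η, hη, h⟩ := he.exists_forall_geodCurve_close hT hline hgeod hε
    have := h c T le_rfl hc (by rw [hc0]; exact e.map_target hu₀)
      (by rw [hc0, e.right_inv hu₀]; simpa using hη.le) (by rw [hcd]; simpa using hη.le) t ht
    exact ⟨this.1, this.2.1⟩
  have h0 : ‖e (c t) - (u₀ + t • f)‖ ≤ 0 :=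
    le_of_forall_pos_le_add fun ε hε ↦ by simpa using (h ε hε).2
  rw [← sub_eq_zero.1 (norm_le_zero_iff.1 h0), e.left_inv (h 1 one_pos).1]
end

/-- The standard basis vectors of the model space. -/
noncomputable abbrev bvec (i : Fin 3) : E3 := EuclideanSpace.single i (1 : ℝ)

lemma E3_abs_apply_le (v : E3) (i : Fin 3) : |v i| ≤ ‖v‖ := by
  simpa using PiLp.norm_apply_le v i

lemma norm_sub_le_of_hasDerivAt {E : Type*} [NormedAddCommGroup E] [NormedSpace ℝ E]
    {f f' : ℝ → E} {a b C : ℝ} (hf : ∀ t ∈ Icc a b, HasDerivAt f (f' t) t)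
    (hC : ∀ t ∈ Icc a b, ‖f' t‖ ≤ C) {t : ℝ} (ht : t ∈ Icc a b) :
    ‖f t - f a‖ ≤ C * (t - a) :=
  norm_image_sub_le_of_norm_deriv_le_segment' (fun t ht ↦ (hf t ht).hasDerivWithinAt)
    (fun t ht ↦ hC t (Ico_subset_Icc_self ht)) t ht

lemma norm_le_of_hasDerivAt {E : Type*} [NormedAddCommGroup E] [NormedSpace ℝ E]
    {f f' : ℝ → E} {a s C D : ℝ} (ha : 0 ≤ a) (hf : ∀ t ∈ Icc a s, HasDerivAt f (f' t) t)
    (hC : ∀ t ∈ Icc a s, ‖f' t‖ ≤ C) (hD : ‖f a‖ ≤ D) {t : ℝ} (ht : t ∈ Icc a s) :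
    ‖f t‖ ≤ D + C * s := by
  have h1 := norm_sub_le_of_hasDerivAt hf hC ht
  have h2 : ‖f t‖ ≤ ‖f t - f a‖ + ‖f a‖ := by
    simpa using norm_add_le (f t - f a) (f a)
  have hC0 : 0 ≤ C := (norm_nonneg _).trans (hC t ht)
  have h3 : C * (t - a) ≤ C * s := mul_le_mul_of_nonneg_left (by linarith [ht.2]) hC0
  linarith

lemma E3_hasDerivAt_apply {f : ℝ → E3} {f' : E3} {t : ℝ} (h : HasDerivAt f f' t) (i : Fin 3) :
    HasDerivAt (fun t ↦ f t i) (f' i) t :=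
  ((EuclideanSpace.proj i : E3 →L[ℝ] ℝ).hasFDerivAt.comp_hasDerivAt t h)

set_option maxHeartbeats 3000000 in
/-- Solutions of a second order system that is nearly the linearized geodesic equation along an
axis separate as `x + s y` in one transversal direction, and as
`-(a / 6) s³ x - ((a + 2 b) / 12) s⁴ y` in the other. -/
lemma exists_forall_spread {M κ : ℝ} (hM : 0 ≤ M) (hκ : 0 < κ) :
    ∃ S c : ℝ, 0 < S ∧ S ≤ 1 ∧ 0 < c ∧ ∀ a b s t₀ x y : ℝ, |a| ≤ M → |b| ≤ M →
      κ ≤ |a - 2 * b| → 0 < s → s ≤ S → 0 ≤ t₀ → t₀ ≤ s ^ 5 →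
      ∀ w v A : ℝ → E3,
      (∀ t ∈ Icc t₀ s, HasDerivAt w (v t) t) → (∀ t ∈ Icc t₀ s, HasDerivAt v (A t) t) →
      (∀ t ∈ Icc t₀ s, ‖A t‖ ≤ M * ‖w t‖ + M * t * ‖v t‖ + s ^ 5 * (‖w t‖ + ‖v t‖)) →
      (∀ t ∈ Icc t₀ s, |A t 2 + a * t * w t 1 + 2 * b * t ^ 2 * v t 1| ≤
        M * t ^ 2 * ‖w t‖ + M * |w t 2| + M * t ^ 3 * ‖v t‖ + M * t * |v t 2| +
          s ^ 5 * (‖w t‖ + ‖v t‖)) →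
      ‖w t₀ - x • bvec 1‖ ≤ s ^ 5 * (|x| + |y|) → ‖v t₀ - y • bvec 1‖ ≤ s ^ 5 * (|x| + |y|) →
      c * s ^ 4 * (|x| + |y|) ≤ |w s 1| + |w s 2| ∧ ‖w s‖ ≤ 6 * (|x| + |y|) := by
  set K := 12 * M + 12 with hK
  set K₂ := 12 * M + M * (K + 3) + M * (K + 1) + 12 + M * (K + 3) + 2 * M * (K + 1) with hK₂
  set K₃ := 2 * (1 + 3 * M) + K₂ with hK₃
  set C₃ := 1 + 24 * (1 + M) / κ with hC₃
  have hK0 : 0 ≤ K := by positivity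
  have hK₂0 : 0 ≤ K₂ := by positivity
  have hK₃0 : 0 ≤ K₃ := by positivity
  have hC₃1 : 1 ≤ C₃ := by rw [hC₃]; have : 0 ≤ 24 * (1 + M) / κ := by positivity
                           linarith
  set D := 2 * M + 2 + 2 * C₃ * (K + 3 + K₃) with hD
  have hD2 : 2 * M + 2 ≤ D := by
    have : 0 ≤ 2 * C₃ * (K + 3 + K₃) := by positivity
    linarith
  have hD1 : 1 ≤ D := by linarith
  refine ⟨1 / D, 1 / (2 * C₃), by positivity, ?_, by positivity, ?_⟩
  · rw [div_le_one (by linarith)]; exact hD1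
  intro a b s t₀ x y ha hb hab hs0 hsS ht₀ ht₀s w v A hw hv hA hA2 hw0 hv0
  have hsD : s * D ≤ 1 := by rwa [le_div_iff₀ (by linarith)] at hsS
  have hs1 : s ≤ 1 := (le_mul_of_one_le_right hs0.le hD1).trans hsD
  have hpow : ∀ k : ℕ, s ^ k ≤ 1 := fun k ↦ pow_le_one₀ hs0.le hs1
  have ht₀s' : t₀ ≤ s := ht₀s.trans (by simpa using pow_le_pow_of_le_one hs0.le hs1 (show 1 ≤ 5 by norm_num))
  have hmemt₀ : t₀ ∈ Icc t₀ s := ⟨le_rfl, ht₀s'⟩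
  have hmems : s ∈ Icc t₀ s := ⟨ht₀s', le_rfl⟩
  set m := |x| + |y| with hm
  set n := |x| + s * |y| with hn
  have hm0 : 0 ≤ m := by positivity
  have hn0 : 0 ≤ n := by positivity
  have hsm : s * m ≤ n := by
    have := mul_le_of_le_one_left (abs_nonneg x) hs1
    rw [hm, hn, mul_add]; linarith only [this]
  have hnm : n ≤ m := by
    have := mul_le_of_le_one_left (abs_nonneg y) hs1
    rw [hm, hn]; linarith only [this]
  have hsy : s * |y| ≤ n := by rw [hn]; linarith [abs_nonneg x]
  have hxn : |x| ≤ n := by rw [hn]; linarith [mul_nonneg hs0.le (abs_nonneg y)]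
  have hs5m : s ^ 5 * m ≤ s ^ 4 * n := by
    have := mul_le_mul_of_nonneg_left hsm (pow_nonneg hs0.le 4)
    linarith only [this, (by ring : s ^ 5 * m = s ^ 4 * (s * m))]
  have hb1 : ∀ z : ℝ, ‖z • bvec 1‖ = |z| := by intro z; simp [norm_smul]
  -- first bounds
  have hZ : ∀ t ∈ Icc t₀ s, ‖w t‖ ≤ 6 * n ∧ s * ‖v t‖ ≤ 6 * n := by
    set Z : ℝ → E3 × E3 := fun t ↦ (w t, s • v t) with hZdef
    have hZd : ∀ t ∈ Icc t₀ s, HasDerivAt Z (v t, s • A t) t := fun t ht ↦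
      (hw t ht).prodMk ((hv t ht).const_smul s)
    have hZn : ∀ t, ‖w t‖ ≤ ‖Z t‖ ∧ s * ‖v t‖ ≤ ‖Z t‖ := by
      intro t
      refine ⟨norm_fst_le (Z t), ?_⟩
      have := norm_snd_le (Z t)
      rwa [show (Z t).2 = s • v t from rfl, norm_smul, Real.norm_of_nonneg hs0.le] at this
    have h0 : ‖Z t₀‖ ≤ 2 * n := by
      rw [Prod.norm_def]
      have h1 : ‖w t₀‖ ≤ ‖w t₀ - x • bvec 1‖ + ‖x • bvec 1‖ := by
        simpa using norm_add_le (w t₀ - x • bvec 1) (x • bvec 1)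
      have h2 : ‖v t₀‖ ≤ ‖v t₀ - y • bvec 1‖ + ‖y • bvec 1‖ := by
        simpa using norm_add_le (v t₀ - y • bvec 1) (y • bvec 1)
      rw [hb1] at h1 h2
      have h4 : s ^ 4 * n ≤ n := mul_le_of_le_one_left hn0 (hpow 4)
      refine max_le ?_ ?_
      · change ‖w t₀‖ ≤ _; linarith only [h1, hw0, hs5m, h4, hxn]
      · change ‖s • v t₀‖ ≤ _
        rw [norm_smul, Real.norm_of_nonneg hs0.le]
        have h5 : s * ‖v t₀‖ ≤ s * (n + |y|) := mul_le_mul_of_nonneg_left (by linarith only [h2, hv0, hs5m, h4]) hs0.le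
        have h6 : s * n ≤ n := mul_le_of_le_one_left hn0 hs1
        rw [mul_add] at h5
        linarith only [h5, h6, hsy]
    have hbd : ∀ t ∈ Ico t₀ s, ‖(v t, s • A t)‖ ≤ s⁻¹ * ‖Z t‖ + 0 := by
      intro t ht
      have htI := Ico_subset_Icc_self ht
      obtain ⟨h1, h2⟩ := hZn t
      have hinv : s⁻¹ * s = 1 := inv_mul_cancel₀ hs0.ne'
      rw [Prod.norm_def, add_zero]
      refine max_le ?_ ?_
      · have := mul_le_mul_of_nonneg_left h2 (inv_nonneg.2 hs0.le)
        rwa [← mul_assoc, hinv, one_mul] at this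
      · change ‖s • A t‖ ≤ _
        rw [norm_smul, Real.norm_of_nonneg hs0.le, ← div_eq_inv_mul, le_div_iff₀ hs0]
        have h3 := hA t htI
        have h4 : M * t * ‖v t‖ ≤ M * ‖Z t‖ := by
          rw [mul_assoc]
          refine mul_le_mul_of_nonneg_left (le_trans ?_ h2) hM
          exact mul_le_mul_of_nonneg_right ht.2.le (norm_nonneg _)
        have h5 : s ^ 5 * (‖w t‖ + ‖v t‖) ≤ 2 * ‖Z t‖ := by
          have e1 : s ^ 5 * ‖w t‖ ≤ ‖Z t‖ :=
            (mul_le_of_le_one_left (norm_nonneg _) (hpow 5)).trans h1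
          have e2 : s ^ 5 * ‖v t‖ ≤ ‖Z t‖ := by
            have : s ^ 5 * ‖v t‖ = s ^ 4 * (s * ‖v t‖) := by ring
            rw [this]
            exact (mul_le_of_le_one_left (by positivity) (hpow 4)).trans h2
          rw [mul_add]
          linarith only [e1, e2]
        have h6 : ‖A t‖ ≤ (2 * M + 2) * ‖Z t‖ := by
          have := mul_le_mul_of_nonneg_left h1 hM
          linarith only [this, h3, h4, h5]
        have h7 : s * s * (2 * M + 2) ≤ 1 := by
          have e1 : s * (2 * M + 2) ≤ 1 := (mul_le_mul_of_nonneg_left hD2 hs0.le).trans hsD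
          calc s * s * (2 * M + 2) = s * (s * (2 * M + 2)) := by ring
            _ ≤ 1 * 1 := by gcongr
            _ = 1 := one_mul 1
        calc s * ‖A t‖ * s ≤ s * ((2 * M + 2) * ‖Z t‖) * s := by gcongr
          _ = s * s * (2 * M + 2) * ‖Z t‖ := by ring
          _ ≤ ‖Z t‖ := mul_le_of_le_one_left (norm_nonneg _) h7
    intro t ht
    have h2 := norm_le_gronwallBound_of_norm_deriv_right_le (f := Z)
      (fun t ht ↦ (hZd t ht).continuousAt.continuousWithinAt)
      (fun t ht ↦ (hZd t (Ico_subset_Icc_self ht)).hasDerivWithinAt) h0 hbd t ht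
    rw [gronwallBound_ε0] at h2
    have h3 : Real.exp (s⁻¹ * (t - t₀)) ≤ 3 := by
      have : s⁻¹ * (t - t₀) ≤ 1 := by
        rw [← div_eq_inv_mul, div_le_one hs0]; linarith [ht.2]
      exact (Real.exp_le_exp.2 this).trans (Real.exp_one_lt_d9.le.trans (by norm_num))
    have h4 : ‖Z t‖ ≤ 6 * n := by
      have := mul_le_mul_of_nonneg_left h3 (by positivity : 0 ≤ 2 * n)
      linarith only [this, h2]
    exact ⟨(hZn t).1.trans h4, (hZn t).2.trans h4⟩
  have hlow : ∀ t ∈ Icc t₀ s, s ^ 5 * (‖w t‖ + ‖v t‖) ≤ 12 * (s ^ 4 * n) := by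
    intro t ht
    obtain ⟨h1, h2⟩ := hZ t ht
    have e0 : s ^ 5 * ‖w t‖ ≤ s ^ 4 * (6 * n) := by
      have e1 : s ^ 5 * ‖w t‖ = s ^ 4 * (s * ‖w t‖) := by ring
      rw [e1]
      exact mul_le_mul_of_nonneg_left
        ((mul_le_of_le_one_left (norm_nonneg _) hs1).trans h1) (pow_nonneg hs0.le 4)
    have e2 : s ^ 5 * ‖v t‖ = s ^ 4 * (s * ‖v t‖) := by ring
    have e3 := mul_le_mul_of_nonneg_left h2 (pow_nonneg hs0.le 4)
    linarith only [e0, e2, e3]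
  have hp4 : ∀ k : ℕ, k ≤ 4 → s ^ 4 * n ≤ s ^ k * n := fun k hk ↦
    mul_le_mul_of_nonneg_right (pow_le_pow_of_le_one hs0.le hs1 hk) hn0
  have hAK : ∀ t ∈ Icc t₀ s, ‖A t‖ ≤ K * n := by
    intro t ht
    obtain ⟨h1, h2⟩ := hZ t ht
    have h3 := hA t ht
    have h4 : M * t * ‖v t‖ ≤ M * (6 * n) := by
      rw [mul_assoc]
      exact mul_le_mul_of_nonneg_left
        ((mul_le_mul_of_nonneg_right ht.2 (norm_nonneg _)).trans h2) hM
    have h5 := hlow t ht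
    have h6 := hp4 0 (by norm_num)
    have h7 := mul_le_mul_of_nonneg_left h1 hM
    rw [hK]
    linarith only [h3, h4, h5, h6, h7]
  have hvK : ∀ t ∈ Icc t₀ s, ‖v t - y • bvec 1‖ ≤ (K + 1) * (s * n) := by
    intro t ht
    have h1 := norm_le_of_hasDerivAt ht₀ (f := fun t ↦ v t - y • bvec 1)
      (fun t ht ↦ (hv t ht).sub_const _) hAK hv0 ht
    have := hp4 1 (by norm_num)
    rw [pow_one] at this
    linarith only [this, hs5m, h1]
  have hwK : ∀ t ∈ Icc t₀ s, ‖w t - (x + t * y) • bvec 1‖ ≤ (K + 3) * (s ^ 2 * n) := by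
    intro t ht
    have hd : ∀ t ∈ Icc t₀ s, HasDerivAt (fun t ↦ w t - (x + t * y) • bvec 1)
        (v t - y • bvec 1) t := by
      intro t ht
      refine (hw t ht).sub ?_
      have := (((hasDerivAt_id t).mul_const y).const_add x).smul_const (bvec 1)
      simpa using this
    have hy0 : t₀ * |y| ≤ s ^ 4 * n := by
      calc t₀ * |y| ≤ s ^ 5 * |y| := mul_le_mul_of_nonneg_right ht₀s (abs_nonneg y)
        _ = s ^ 4 * (s * |y|) := by ring
        _ ≤ _ := mul_le_mul_of_nonneg_left hsy (pow_nonneg hs0.le 4)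
    have h0 : ‖w t₀ - (x + t₀ * y) • bvec 1‖ ≤ 2 * (s ^ 4 * n) := by
      have e1 : w t₀ - (x + t₀ * y) • bvec 1 = (w t₀ - x • bvec 1) - (t₀ * y) • bvec 1 := by
        module
      rw [e1]
      refine (norm_sub_le _ _).trans ?_
      rw [hb1, abs_mul, abs_of_nonneg ht₀]
      linarith only [hw0, hs5m, hy0]
    have h1 := norm_le_of_hasDerivAt ht₀ hd hvK h0 ht
    have := hp4 2 (by norm_num)
    linarith only [this, h1]
  have hv2 : ∀ t ∈ Icc t₀ s, |v t 2| ≤ (K + 1) * (s * n) := by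
    intro t ht
    have := (E3_abs_apply_le (v t - y • bvec 1) 2).trans (hvK t ht)
    simpa using this
  have hw2 : ∀ t ∈ Icc t₀ s, |w t 2| ≤ (K + 3) * (s ^ 2 * n) := by
    intro t ht
    have := (E3_abs_apply_le (w t - (x + t * y) • bvec 1) 2).trans (hwK t ht)
    simpa using this
  have hv1 : ∀ t ∈ Icc t₀ s, |v t 1 - y| ≤ (K + 1) * (s * n) := by
    intro t ht
    have := (E3_abs_apply_le (v t - y • bvec 1) 1).trans (hvK t ht)
    simpa using this
  have hw1 : ∀ t ∈ Icc t₀ s, |w t 1 - (x + t * y)| ≤ (K + 3) * (s ^ 2 * n) := by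
    intro t ht
    have := (E3_abs_apply_le (w t - (x + t * y) • bvec 1) 1).trans (hwK t ht)
    simpa using this
  have hsn : 0 ≤ s ^ 2 * n := by positivity
  have hA2' : ∀ t ∈ Icc t₀ s, ‖A t 2 + (a * t * (x + t * y) + 2 * b * t ^ 2 * y)‖ ≤
      K₂ * (s ^ 2 * n) := by
    intro t ht
    have ht0 : 0 ≤ t := ht₀.trans ht.1
    obtain ⟨h1, h2⟩ := hZ t ht
    have hts := ht.2
    have e1 : M * t ^ 2 * ‖w t‖ ≤ 6 * M * (s ^ 2 * n) := by
      calc M * t ^ 2 * ‖w t‖ ≤ M * s ^ 2 * (6 * n) := by gcongr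
        _ = _ := by ring
    have e2 : M * |w t 2| ≤ M * ((K + 3) * (s ^ 2 * n)) := by gcongr; exact hw2 t ht
    have e3 : M * t ^ 3 * ‖v t‖ ≤ 6 * M * (s ^ 2 * n) := by
      calc M * t ^ 3 * ‖v t‖ ≤ M * s ^ 3 * ‖v t‖ := by gcongr
        _ = M * s ^ 2 * (s * ‖v t‖) := by ring
        _ ≤ M * s ^ 2 * (6 * n) := by gcongr
        _ = _ := by ring
    have e4 : M * t * |v t 2| ≤ M * (K + 1) * (s ^ 2 * n) := by
      calc M * t * |v t 2| ≤ M * s * ((K + 1) * (s * n)) := by gcongr; exact hv2 t ht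
        _ = _ := by ring
    have e5 := (hlow t ht).trans (mul_le_mul_of_nonneg_left (hp4 2 (by norm_num)) (by norm_num))
    have e6 : |a * t * (w t 1 - (x + t * y))| ≤ M * (K + 3) * (s ^ 2 * n) := by
      rw [abs_mul, abs_mul, abs_of_nonneg ht0]
      calc |a| * t * |w t 1 - (x + t * y)| ≤ M * 1 * ((K + 3) * (s ^ 2 * n)) := by
            gcongr
            · exact hts.trans hs1
            · exact hw1 t ht
        _ = _ := by ring
    have e7 : |2 * b * t ^ 2 * (v t 1 - y)| ≤ 2 * M * (K + 1) * (s ^ 2 * n) := by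
      rw [abs_mul, abs_mul, abs_mul, abs_of_nonneg (sq_nonneg t), abs_two]
      calc 2 * |b| * t ^ 2 * |v t 1 - y| ≤ 2 * M * s ^ 2 * ((K + 1) * (s * n)) := by
            gcongr; exact hv1 t ht
        _ = 2 * M * (K + 1) * (s ^ 2 * n) * s := by ring
        _ ≤ _ := mul_le_of_le_one_right (by positivity) hs1
    have e8 := hA2 t ht
    rw [Real.norm_eq_abs]
    have e9 : A t 2 + (a * t * (x + t * y) + 2 * b * t ^ 2 * y) =
        (A t 2 + a * t * w t 1 + 2 * b * t ^ 2 * v t 1) - a * t * (w t 1 - (x + t * y)) -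
          2 * b * t ^ 2 * (v t 1 - y) := by ring
    rw [e9]
    refine (abs_sub _ _).trans ((add_le_add_left (abs_sub _ _) _).trans ?_)
    rw [hK₂]
    linarith only [e1, e2, e3, e4, e5, e6, e7, e8]
  have ht₀1 : t₀ ≤ 1 := ht₀s'.trans hs1
  have hcube : t₀ ^ 3 / 6 ≤ t₀ := by
    have := mul_le_of_le_one_right ht₀ (pow_le_one₀ ht₀ ht₀1 (n := 2))
    linarith only [this, ht₀, (by ring : t₀ ^ 3 = t₀ * t₀ ^ 2), (by positivity : 0 ≤ t₀ ^ 3)]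
  have hty : t₀ * |y| ≤ n := (mul_le_mul_of_nonneg_right ht₀s' (abs_nonneg y)).trans hsy
  have hsmall : ∀ k : ℕ, k ≤ 4 → t₀ * n ≤ s ^ k * n := fun k hk ↦ by
    have : t₀ ≤ s ^ k := ht₀s.trans (pow_le_pow_of_le_one hs0.le hs1 (by omega))
    gcongr
  have hv3 : ∀ t ∈ Icc t₀ s,
      ‖v t 2 + (a * (t ^ 2 / 2 * x + t ^ 3 / 3 * y) + 2 * b * (t ^ 3 / 3) * y)‖ ≤
      (1 + 3 * M + K₂) * (s ^ 3 * n) := by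
    intro t ht
    have hd : ∀ t ∈ Icc t₀ s, HasDerivAt
        (fun t ↦ v t 2 + (a * (t ^ 2 / 2 * x + t ^ 3 / 3 * y) + 2 * b * (t ^ 3 / 3) * y))
        (A t 2 + (a * t * (x + t * y) + 2 * b * t ^ 2 * y)) t := by
      intro t ht
      refine (E3_hasDerivAt_apply (hv t ht) 2).add ?_
      have h2 : HasDerivAt (fun t : ℝ ↦ t ^ 2 / 2) t t := by
        simpa using (hasDerivAt_pow 2 t).div_const 2
      have h3 : HasDerivAt (fun t : ℝ ↦ t ^ 3 / 3) (t ^ 2) t := by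
        simpa using (hasDerivAt_pow 3 t).div_const 3
      exact ((((h2.mul_const x).add (h3.mul_const y)).const_mul a).add
        ((h3.const_mul (2 * b)).mul_const y)).congr_deriv (by ring)
    have h0 : ‖v t₀ 2 + (a * (t₀ ^ 2 / 2 * x + t₀ ^ 3 / 3 * y) + 2 * b * (t₀ ^ 3 / 3) * y)‖ ≤
        (1 + 3 * M) * (s ^ 3 * n) := by
      have e1 : |v t₀ 2| ≤ s ^ 3 * n := by
        have := (E3_abs_apply_le (v t₀ - y • bvec 1) 2).trans (hv0.trans (hs5m.trans (hp4 3 (by norm_num))))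
        simpa using this
      have e2 : |a * (t₀ ^ 2 / 2 * x)| ≤ M * (s ^ 3 * n) := by
        rw [abs_mul, abs_mul, abs_of_nonneg (by positivity : (0 : ℝ) ≤ t₀ ^ 2 / 2)]
        have : t₀ ^ 2 / 2 * |x| ≤ t₀ * n := by
          have : t₀ ^ 2 / 2 ≤ t₀ := by nlinarith only [ht₀, ht₀1]
          gcongr
        have := this.trans (hsmall 3 (by norm_num))
        gcongr
      have h33 : t₀ ^ 3 / 3 * |y| ≤ s ^ 3 * n := by
        have h5 : t₀ ^ 3 / 3 * |y| = t₀ ^ 2 / 3 * (t₀ * |y|) := by ring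
        rw [h5]
        have h6 : t₀ ^ 2 / 3 ≤ t₀ := by nlinarith only [ht₀, ht₀1]
        exact le_trans (by gcongr) (hsmall 3 (by norm_num))
      have e3 : |a * (t₀ ^ 3 / 3 * y)| ≤ M * (s ^ 3 * n) := by
        rw [abs_mul, abs_mul, abs_of_nonneg (by positivity : (0 : ℝ) ≤ t₀ ^ 3 / 3)]
        gcongr
      have e4' : |b * (t₀ ^ 3 / 3 * y)| ≤ M * (s ^ 3 * n) / 2 := by
        rw [abs_mul, abs_mul, abs_of_nonneg (by positivity : (0 : ℝ) ≤ t₀ ^ 3 / 3)]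
        have h5 : t₀ ^ 3 / 3 * |y| = t₀ ^ 2 / 3 * (t₀ * |y|) := by ring
        have h6 : t₀ ^ 2 / 3 ≤ t₀ / 3 := by nlinarith only [ht₀, ht₀1]
        have h7 : t₀ ^ 2 / 3 * (t₀ * |y|) ≤ t₀ / 3 * n := by gcongr
        have h8 := hsmall 3 (by norm_num)
        rw [h5]
        calc |b| * (t₀ ^ 2 / 3 * (t₀ * |y|)) ≤ M * (s ^ 3 * n / 2) := by
              have : t₀ ^ 2 / 3 * (t₀ * |y|) ≤ s ^ 3 * n / 2 := by
                have : 0 ≤ s ^ 3 * n := by positivity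
                linarith only [this, h7, h8]
              gcongr
          _ = _ := by ring
      rw [Real.norm_eq_abs, abs_le]
      rw [abs_le] at e1 e2 e3 e4'
      constructor <;> linarith only [e1.1, e1.2, e2.1, e2.2, e3.1, e3.2, e4'.1, e4'.2]
    have h1 := norm_le_of_hasDerivAt ht₀ hd hA2' h0 ht
    linarith only [h1]
  have hw3 : ‖w s 2 + (a * (s ^ 3 / 6 * x + s ^ 4 / 12 * y) + b * (s ^ 4 / 6) * y)‖ ≤
      K₃ * (s ^ 4 * n) := by
    have hd : ∀ t ∈ Icc t₀ s, HasDerivAt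
        (fun t ↦ w t 2 + (a * (t ^ 3 / 6 * x + t ^ 4 / 12 * y) + b * (t ^ 4 / 6) * y))
        (v t 2 + (a * (t ^ 2 / 2 * x + t ^ 3 / 3 * y) + 2 * b * (t ^ 3 / 3) * y)) t := by
      intro t ht
      refine (E3_hasDerivAt_apply (hw t ht) 2).add ?_
      have h2 : HasDerivAt (fun t : ℝ ↦ t ^ 3 / 6) (t ^ 2 / 2) t :=
        ((hasDerivAt_pow 3 t).div_const 6).congr_deriv (by norm_num; ring)
      have h3 : HasDerivAt (fun t : ℝ ↦ t ^ 4 / 12) (t ^ 3 / 3) t :=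
        ((hasDerivAt_pow 4 t).div_const 12).congr_deriv (by norm_num; ring)
      have h4 : HasDerivAt (fun t : ℝ ↦ t ^ 4 / 6) (2 * t ^ 3 / 3) t :=
        ((hasDerivAt_pow 4 t).div_const 6).congr_deriv (by norm_num; ring)
      exact ((((h2.mul_const x).add (h3.mul_const y)).const_mul a).add
        ((h4.const_mul b).mul_const y)).congr_deriv (by ring)
    have h0 : ‖w t₀ 2 + (a * (t₀ ^ 3 / 6 * x + t₀ ^ 4 / 12 * y) + b * (t₀ ^ 4 / 6) * y)‖ ≤
        (1 + 3 * M) * (s ^ 4 * n) := by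
      have e1 : |w t₀ 2| ≤ s ^ 4 * n := by
        have := (E3_abs_apply_le (w t₀ - x • bvec 1) 2).trans (hw0.trans hs5m)
        simpa using this
      have h8 := hsmall 4 le_rfl
      have e2 : |a * (t₀ ^ 3 / 6 * x)| ≤ M * (s ^ 4 * n) := by
        rw [abs_mul, abs_mul, abs_of_nonneg (by positivity : (0 : ℝ) ≤ t₀ ^ 3 / 6)]
        have : t₀ ^ 3 / 6 * |x| ≤ t₀ * n := by
          have : t₀ ^ 3 / 6 ≤ t₀ := hcube
          gcongr
        have := this.trans h8
        gcongr
      have h9 : t₀ ^ 4 / 6 * |y| ≤ s ^ 4 * n := by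
        have h5 : t₀ ^ 4 / 6 * |y| = t₀ ^ 3 / 6 * (t₀ * |y|) := by ring
        have h6 : t₀ ^ 3 / 6 ≤ t₀ := hcube
        rw [h5]
        exact le_trans (by gcongr) h8
      have e3 : |a * (t₀ ^ 4 / 12 * y)| ≤ M * (s ^ 4 * n) := by
        rw [abs_mul, abs_mul, abs_of_nonneg (by positivity : (0 : ℝ) ≤ t₀ ^ 4 / 12)]
        have : t₀ ^ 4 / 12 * |y| ≤ s ^ 4 * n := by
          refine le_trans ?_ h9
          gcongr
          norm_num
        gcongr
      have e4 : |b * (t₀ ^ 4 / 6) * y| ≤ M * (s ^ 4 * n) := by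
        rw [mul_assoc, abs_mul, abs_mul, abs_of_nonneg (by positivity : (0 : ℝ) ≤ t₀ ^ 4 / 6)]
        gcongr
      rw [Real.norm_eq_abs, abs_le]
      rw [abs_le] at e1 e2 e3 e4
      constructor <;> linarith only [e1.1, e1.2, e2.1, e2.2, e3.1, e3.2, e4.1, e4.2]
    have h1 := norm_le_of_hasDerivAt ht₀ hd hv3 h0 hmems
    rw [hK₃]
    linarith only [h1]
  refine ⟨?_, (hZ s hmems).1.trans (by linarith)⟩
  have hw1s := hw1 s hmems
  set P := x + s * y with hP
  set Q := a * (x / 6 + s * y / 12) + b * (s * y / 6) with hQ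
  have hw3' : |w s 2 + s ^ 3 * Q| ≤ K₃ * (s ^ 4 * n) := by
    rw [Real.norm_eq_abs] at hw3
    convert hw3 using 2
    rw [hQ]; ring
  have hrel : s * y * (a - 2 * b) = 2 * (a * P) - 12 * Q := by rw [hP, hQ]; ring
  have hY : s * |y| * κ ≤ 2 * (M * |P|) + 12 * |Q| := by
    have h1 : s * |y| * κ ≤ |s * y * (a - 2 * b)| := by
      rw [abs_mul, abs_mul, abs_of_pos hs0]; gcongr
    rw [hrel] at h1
    refine h1.trans ((abs_sub _ _).trans ?_)
    rw [abs_mul, abs_mul, abs_mul, abs_two, abs_of_nonneg (by norm_num : (0 : ℝ) ≤ 12)]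
    gcongr
  have hX : |x| ≤ |P| + s * |y| := by
    have : x = P - s * y := by rw [hP]; ring
    rw [this]
    refine (abs_sub _ _).trans ?_
    rw [abs_mul, abs_of_pos hs0]
  have hnC : n ≤ C₃ * (|P| + |Q|) := by
    have h1 : s * |y| ≤ 12 * (1 + M) / κ * (|P| + |Q|) := by
      rw [div_mul_eq_mul_div, le_div_iff₀ hκ]
      linarith only [hY, abs_nonneg P, abs_nonneg Q, mul_nonneg hM (abs_nonneg P),
        mul_nonneg hM (abs_nonneg Q)]
    have h2 : C₃ * (|P| + |Q|) = (|P| + |Q|) + 2 * (12 * (1 + M) / κ * (|P| + |Q|)) := by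
      rw [hC₃]; ring
    rw [h2, hn]
    linarith only [hX, h1, abs_nonneg Q]
  have hPw : |P| ≤ |w s 1| + (K + 3) * (s ^ 2 * n) := by
    have h1 : |P| ≤ |w s 1| + |w s 1 - P| := by
      have := abs_sub (w s 1) (w s 1 - P)
      simpa using this
    linarith
  have hQw : s ^ 3 * |Q| ≤ |w s 2| + K₃ * (s ^ 4 * n) := by
    have h1 : |s ^ 3 * Q| ≤ |w s 2 + s ^ 3 * Q| + |w s 2| := by
      have := abs_sub (w s 2 + s ^ 3 * Q) (w s 2)
      simpa using this
    rw [abs_mul, abs_of_pos (by positivity)] at h1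
    linarith
  have hfin : s ^ 3 * n ≤ C₃ * (|w s 1| + |w s 2|) + s ^ 3 * n / 2 := by
    have h1 : s ^ 3 * |P| ≤ |w s 1| + (K + 3) * (s ^ 4 * n) := by
      have h2 : s ^ 3 * |P| ≤ s ^ 3 * |w s 1| + s ^ 3 * ((K + 3) * (s ^ 2 * n)) := by
        rw [← mul_add]; gcongr
      have h3 : s ^ 3 * |w s 1| ≤ |w s 1| := mul_le_of_le_one_left (abs_nonneg _) (hpow 3)
      have h4 : s ^ 3 * ((K + 3) * (s ^ 2 * n)) = (K + 3) * (s ^ 4 * n) * s := by ring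
      have h5 : (K + 3) * (s ^ 4 * n) * s ≤ (K + 3) * (s ^ 4 * n) :=
        mul_le_of_le_one_right (by positivity) hs1
      linarith
    have h2 : s ^ 3 * n ≤ s ^ 3 * (C₃ * (|P| + |Q|)) := by gcongr
    have h3 : s ^ 3 * (C₃ * (|P| + |Q|)) = C₃ * (s ^ 3 * |P| + s ^ 3 * |Q|) := by ring
    have h4 : C₃ * (s ^ 3 * |P| + s ^ 3 * |Q|) ≤ C₃ * (|w s 1| + |w s 2| + (K + 3 + K₃) * (s ^ 4 * n)) := by
      refine mul_le_mul_of_nonneg_left ?_ (by linarith only [hC₃1])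
      linarith only [h1, hQw]
    have h5 : C₃ * ((K + 3 + K₃) * (s ^ 4 * n)) ≤ s ^ 3 * n / 2 := by
      have h6 : 2 * C₃ * (K + 3 + K₃) * s ≤ 1 := by
        have : 2 * C₃ * (K + 3 + K₃) ≤ D := by rw [hD]; linarith only [hM]
        exact (mul_le_mul_of_nonneg_right this hs0.le).trans (by rwa [mul_comm])
      have h7 : C₃ * ((K + 3 + K₃) * (s ^ 4 * n)) = (2 * C₃ * (K + 3 + K₃) * s) * (s ^ 3 * n / 2) := by
        ring
      rw [h7]
      exact mul_le_of_le_one_left (by positivity) h6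
    linarith
  have h8 : s ^ 4 * m ≤ s ^ 3 * n := by
    have : s ^ 4 * m = s ^ 3 * (s * m) := by ring
    rw [this]; gcongr
  have h9 : 1 / (2 * C₃) * s ^ 4 * m = (s ^ 4 * m) / (2 * C₃) := by ring
  rw [h9, div_le_iff₀ (by positivity)]
  linarith

section
variable {E F : Type*} [NormedAddCommGroup E] [NormedSpace ℝ E] [NormedAddCommGroup F]
  [NormedSpace ℝ F]

/-- Uniform differentiability of a `C¹` function along a compact set. -/
lemma ContDiffOn.exists_forall_norm_sub_sub_le [ProperSpace E] {f : E → F} {U K : Set E}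
    (hf : ContDiffOn ℝ ∞ f U)
    (hU : IsOpen U) (hK : IsCompact K) (hKU : K ⊆ U) {ε : ℝ} (hε : 0 < ε) :
    ∃ η : ℝ, 0 < η ∧ ∀ z ∈ K, ∀ x ∈ Metric.closedBall z η, ∀ y ∈ Metric.closedBall z η,
      ‖f x - f y - fderiv ℝ f z (x - y)‖ ≤ ε * ‖x - y‖ := by
  obtain ⟨η₁, hη₁, hsub⟩ := hK.exists_cthickening_subset_open hU hKU
  have hK' := hK.cthickening (r := η₁)
  have hc : ContinuousOn (fderiv ℝ f) (Metric.cthickening η₁ K) :=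
    (hf.continuousOn_fderiv_of_isOpen hU (by simp)).mono hsub
  obtain ⟨η₂, hη₂, hu⟩ := Metric.uniformContinuousOn_iff.1
    (hK'.uniformContinuousOn_of_continuous hc) ε hε
  refine ⟨min η₁ (η₂ / 2), by positivity, fun z hz x hx y hy ↦ ?_⟩
  have hball : Metric.closedBall z (min η₁ (η₂ / 2)) ⊆ Metric.cthickening η₁ K :=
    (Metric.closedBall_subset_closedBall (min_le_left _ _)).trans
      (Metric.closedBall_subset_cthickening hz η₁)
  refine (convex_closedBall z _).norm_image_sub_le_of_norm_hasFDerivWithin_le'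
    (f := f) (f' := fderiv ℝ f) (fun p hp ↦ ?_) (fun p hp ↦ ?_) hy hx
  · have hpU := hsub (hball hp)
    exact (((hf p hpU).contDiffAt (hU.mem_nhds hpU)).differentiableAt
      (by simp)).hasFDerivAt.hasFDerivWithinAt
  · have := hu p (hball hp) z (hball (Metric.mem_closedBall_self (by positivity))) ?_
    · rw [dist_eq_norm] at this
      exact this.le
    · refine lt_of_le_of_lt (Metric.mem_closedBall.1 hp) ((min_le_right _ _).trans_lt (by linarith))

/-- Uniform second order Taylor estimate along a compact set. -/
lemma ContDiffOn.exists_forall_norm_sub_sub_le_sq [ProperSpace E] {f : E → F} {U K : Set E}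
    (hf : ContDiffOn ℝ ∞ f U)
    (hU : IsOpen U) (hK : IsCompact K) (hKU : K ⊆ U) :
    ∃ C η : ℝ, 0 ≤ C ∧ 0 < η ∧ ∀ z ∈ K, ∀ x ∈ Metric.closedBall z η,
      ‖f x - f z - fderiv ℝ f z (x - z)‖ ≤ C * ‖x - z‖ ^ 2 := by
  obtain ⟨η, hη, hsub⟩ := hK.exists_cthickening_subset_open hU hKU
  have hK' := hK.cthickening (r := η)
  have hf' : ContDiffOn ℝ ∞ (fderiv ℝ f) U := hf.fderiv_of_isOpen hU (by simp)
  have hc : ContinuousOn (fderiv ℝ (fderiv ℝ f)) (Metric.cthickening η K) :=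
    (hf'.continuousOn_fderiv_of_isOpen hU (by simp)).mono hsub
  obtain ⟨C, hC⟩ := hK'.exists_bound_of_continuousOn hc
  refine ⟨max C 0, η, le_max_right _ _, hη, fun z hz x hx ↦ ?_⟩
  have hball : Metric.closedBall z η ⊆ Metric.cthickening η K :=
    Metric.closedBall_subset_cthickening hz η
  have hsmall : Metric.closedBall z ‖x - z‖ ⊆ Metric.closedBall z η :=
    Metric.closedBall_subset_closedBall (by rw [← dist_eq_norm]; exact hx)
  have hzz : z ∈ Metric.closedBall z ‖x - z‖ := Metric.mem_closedBall_self (norm_nonneg _)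
  have key := (convex_closedBall z ‖x - z‖).norm_image_sub_le_of_norm_hasFDerivWithin_le'
    (f := f) (f' := fderiv ℝ f) (φ := fderiv ℝ f z) (C := max C 0 * ‖x - z‖)
    (fun p hp ↦ ?_) (fun p hp ↦ ?_) hzz (by rw [Metric.mem_closedBall, dist_eq_norm])
  · rw [sq, ← mul_assoc]
    exact key
  · have hpU := hsub (hball (hsmall hp))
    exact (((hf p hpU).contDiffAt (hU.mem_nhds hpU)).differentiableAt
      (by simp)).hasFDerivAt.hasFDerivWithinAt
  · have h1 := (convex_closedBall z ‖x - z‖).norm_image_sub_le_of_norm_hasFDerivWithin_le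
      (f := fderiv ℝ f) (f' := fderiv ℝ (fderiv ℝ f)) (C := max C 0)
      (fun q hq ↦ ?_) (fun q hq ↦ ?_) hzz hp
    · refine h1.trans (mul_le_mul_of_nonneg_left ?_ (le_max_right _ _))
      rw [← dist_eq_norm]; exact hp
    · have hqU := hsub (hball (hsmall hq))
      exact (((hf' q hqU).contDiffAt (hU.mem_nhds hqU)).differentiableAt
        (by simp)).hasFDerivAt.hasFDerivWithinAt
    · exact (hC q (hball (hsmall hq))).trans (le_max_left _ _)
end

/-- Solutions of the geodesic equation `u'' = -Γ(u)(u', u')`, with velocity `v`. -/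
def IsGeodSol (Γ : E3 → E3 →L[ℝ] E3 →L[ℝ] E3) (u v : ℝ → E3) (I : Set ℝ) : Prop :=
  ∀ t ∈ I, HasDerivAt u (v t) t ∧ HasDerivAt v (-(Γ (u t) (v t) (v t))) t

/-- The first coordinate axis is a geodesic of `Γ`, and along it `Γ` and its derivatives have the
Taylor expansions that force geodesics close to the axis to stay in a thin slab. -/
structure AxisJet (Γ : E3 → E3 →L[ℝ] E3 →L[ℝ] E3) (U : Set E3) (T M a b : ℝ) : Prop where
  isOpen : IsOpen U
  smooth : ContDiffOn ℝ ∞ Γ U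
  symm : ∀ u V W, Γ u V W = Γ u W V
  pos : 0 < T
  nonneg : 0 ≤ M
  mem : ∀ t ∈ Icc 0 T, t • bvec 0 ∈ U
  geod : ∀ t ∈ Icc 0 T, Γ (t • bvec 0) (bvec 0) (bvec 0) = 0
  norm_le : ∀ t ∈ Icc 0 T, ‖Γ (t • bvec 0)‖ ≤ M * t
  fderiv_le : ∀ t ∈ Icc 0 T, ‖fderiv ℝ Γ (t • bvec 0)‖ ≤ M
  fderiv_axis : ∀ t ∈ Icc 0 T, fderiv ℝ Γ (t • bvec 0) (bvec 0) (bvec 0) (bvec 0) = 0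
  fderiv_cross : ∀ t ∈ Icc 0 T,
    |fderiv ℝ Γ (t • bvec 0) (bvec 1) (bvec 0) (bvec 0) 2 - a * t| ≤ M * t ^ 2
  cross : ∀ t ∈ Icc 0 T, |Γ (t • bvec 0) (bvec 0) (bvec 1) 2 - b * t ^ 2| ≤ M * t ^ 3

variable {Γ : E3 → E3 →L[ℝ] E3 →L[ℝ] E3} {U : Set E3} {T M a b : ℝ}

lemma norm_bvec (i : Fin 3) : ‖bvec i‖ = 1 := by simp

lemma E3_eq_sum_three (v : E3) : v = v 0 • bvec 0 + v 1 • bvec 1 + v 2 • bvec 2 := by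
  conv_lhs => rw [E3_eq_sum v, Fin.sum_univ_three]

lemma AxisJet.isCompact_axis (T : ℝ) : IsCompact ((fun t : ℝ ↦ t • bvec 0) '' Icc 0 T) :=
  isCompact_Icc.image (by fun_prop)

lemma AxisJet.hasFDerivAt_quad (h : AxisJet Γ U T M a b) {t : ℝ} (ht : t ∈ Icc 0 T) (y w : E3) :
    fderiv ℝ (fun z : E3 × E3 ↦ Γ z.1 z.2 z.2) (t • bvec 0, bvec 0) (y, w) =
      fderiv ℝ Γ (t • bvec 0) y (bvec 0) (bvec 0) + (2 : ℝ) • Γ (t • bvec 0) (bvec 0) w := by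
  have hΓ : HasFDerivAt Γ (fderiv ℝ Γ (t • bvec 0)) (t • bvec 0) :=
    (((h.smooth _ (h.mem t ht)).contDiffAt (h.isOpen.mem_nhds (h.mem t ht))).differentiableAt
      (by simp)).hasFDerivAt
  have h1 : HasFDerivAt (fun z : E3 × E3 ↦ Γ z.1)
      ((fderiv ℝ Γ (t • bvec 0)).comp (ContinuousLinearMap.fst ℝ E3 E3)) (t • bvec 0, bvec 0) :=
    HasFDerivAt.comp (t • bvec 0, bvec 0) (f := Prod.fst) hΓ hasFDerivAt_fst
  have h2 := (h1.clm_apply (hasFDerivAt_snd (𝕜 := ℝ))).clm_apply (hasFDerivAt_snd (𝕜 := ℝ))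
  rw [h2.fderiv]
  simp only [_root_.add_apply, ContinuousLinearMap.comp_apply, ContinuousLinearMap.flip_apply,
    ContinuousLinearMap.coe_fst', ContinuousLinearMap.coe_snd']
  rw [h.symm _ w, two_smul]
  abel

lemma AxisJet.exists_forall_linearization (h : AxisJet Γ U T M a b) {ε : ℝ} (hε : 0 < ε) :
    ∃ η : ℝ, 0 < η ∧ ∀ t ∈ Icc 0 T, ∀ u u' v v' : E3, ‖u - t • bvec 0‖ ≤ η →
      ‖u' - t • bvec 0‖ ≤ η → ‖v - bvec 0‖ ≤ η → ‖v' - bvec 0‖ ≤ η →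
      ‖Γ u v v - Γ u' v' v' - (fderiv ℝ Γ (t • bvec 0) (u - u') (bvec 0) (bvec 0) +
        (2 : ℝ) • Γ (t • bvec 0) (bvec 0) (v - v'))‖ ≤ ε * (‖u - u'‖ + ‖v - v'‖) := by
  have hs : ContDiffOn ℝ ∞ (fun z : E3 × E3 ↦ Γ z.1 z.2 z.2) (U ×ˢ univ) :=
    ((h.smooth.comp contDiffOn_fst (fun p hp ↦ hp.1)).clm_apply contDiffOn_snd).clm_apply
      contDiffOn_snd
  have hK : IsCompact ((fun t : ℝ ↦ (t • bvec 0, bvec 0)) '' Icc 0 T) :=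
    isCompact_Icc.image (by fun_prop)
  obtain ⟨η, hη, hlin⟩ := hs.exists_forall_norm_sub_sub_le (h.isOpen.prod isOpen_univ) hK
    (by rintro _ ⟨t, ht, rfl⟩; exact ⟨h.mem t ht, mem_univ _⟩) hε
  refine ⟨η, hη, fun t ht u u' v v' h1 h2 h3 h4 ↦ ?_⟩
  have hmem : ∀ p q : E3, ‖p - t • bvec 0‖ ≤ η → ‖q - bvec 0‖ ≤ η →
      (p, q) ∈ Metric.closedBall (t • bvec 0, bvec 0) η := by
    intro p q hp hq
    rw [Metric.mem_closedBall, Prod.dist_eq, dist_eq_norm, dist_eq_norm]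
    exact max_le hp hq
  have := hlin _ ⟨t, ht, rfl⟩ (u, v) (hmem u v h1 h3) (u', v') (hmem u' v' h2 h4)
  rw [Prod.mk_sub_mk, h.hasFDerivAt_quad ht] at this
  refine this.trans (mul_le_mul_of_nonneg_left ?_ hε.le)
  rw [Prod.norm_def]
  exact max_le (by simp) (by simp)

lemma AxisJet.fderiv_apply_two_le (h : AxisJet Γ U T M a b) {t : ℝ} (ht : t ∈ Icc 0 T) (w : E3) :
    |fderiv ℝ Γ (t • bvec 0) w (bvec 0) (bvec 0) 2 - a * t * w 1| ≤
      M * t ^ 2 * ‖w‖ + M * |w 2| := by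
  have h1 : fderiv ℝ Γ (t • bvec 0) w (bvec 0) (bvec 0) 2 =
      w 1 * fderiv ℝ Γ (t • bvec 0) (bvec 1) (bvec 0) (bvec 0) 2 +
        w 2 * fderiv ℝ Γ (t • bvec 0) (bvec 2) (bvec 0) (bvec 0) 2 := by
    conv_lhs => rw [E3_eq_sum_three w]
    simp only [map_add, map_smul, _root_.add_apply, _root_.smul_apply, h.fderiv_axis t ht,
      smul_zero, zero_add, PiLp.add_apply, PiLp.smul_apply, smul_eq_mul]
  have h2 : |fderiv ℝ Γ (t • bvec 0) (bvec 2) (bvec 0) (bvec 0) 2| ≤ M := by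
    refine (E3_abs_apply_le _ 2).trans ?_
    have := (fderiv ℝ Γ (t • bvec 0) (bvec 2)).le_opNorm₂ (bvec 0) (bvec 0)
    rw [norm_bvec, mul_one, mul_one] at this
    have h3 := (fderiv ℝ Γ (t • bvec 0)).le_opNorm (bvec 2)
    rw [norm_bvec, mul_one] at h3
    exact this.trans (h3.trans (h.fderiv_le t ht))
  have h3 : fderiv ℝ Γ (t • bvec 0) w (bvec 0) (bvec 0) 2 - a * t * w 1 =
      w 1 * (fderiv ℝ Γ (t • bvec 0) (bvec 1) (bvec 0) (bvec 0) 2 - a * t) +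
      w 2 * fderiv ℝ Γ (t • bvec 0) (bvec 2) (bvec 0) (bvec 0) 2 := by rw [h1]; ring
  rw [h3]
  refine (abs_add_le _ _).trans ?_
  rw [abs_mul, abs_mul]
  have h4 : |w 1| * |fderiv ℝ Γ (t • bvec 0) (bvec 1) (bvec 0) (bvec 0) 2 - a * t| ≤
      ‖w‖ * (M * t ^ 2) :=
    mul_le_mul (E3_abs_apply_le w 1) (h.fderiv_cross t ht) (abs_nonneg _) (norm_nonneg _)
  have h5 := mul_le_mul_of_nonneg_left h2 (abs_nonneg (w 2))
  linarith

lemma AxisJet.apply_two_le (h : AxisJet Γ U T M a b) {t : ℝ} (ht : t ∈ Icc 0 T) (w : E3) :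
    |Γ (t • bvec 0) (bvec 0) w 2 - b * t ^ 2 * w 1| ≤
      M * t ^ 3 * ‖w‖ + M * t * |w 2| := by
  have h1 : Γ (t • bvec 0) (bvec 0) w 2 = w 1 * Γ (t • bvec 0) (bvec 0) (bvec 1) 2 +
        w 2 * Γ (t • bvec 0) (bvec 0) (bvec 2) 2 := by
    conv_lhs => rw [E3_eq_sum_three w]
    simp only [map_add, map_smul, h.geod t ht,
      smul_zero, zero_add, PiLp.add_apply, PiLp.smul_apply, smul_eq_mul]
  have h2 : |Γ (t • bvec 0) (bvec 0) (bvec 2) 2| ≤ M * t := by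
    refine (E3_abs_apply_le _ 2).trans ?_
    have := (Γ (t • bvec 0)).le_opNorm₂ (bvec 0) (bvec 2)
    rw [norm_bvec, norm_bvec, mul_one, mul_one] at this
    exact this.trans (h.norm_le t ht)
  have h3 : Γ (t • bvec 0) (bvec 0) w 2 - b * t ^ 2 * w 1 =
      w 1 * (Γ (t • bvec 0) (bvec 0) (bvec 1) 2 - b * t ^ 2) +
      w 2 * Γ (t • bvec 0) (bvec 0) (bvec 2) 2 := by rw [h1]; ring
  rw [h3]
  refine (abs_add_le _ _).trans ?_
  rw [abs_mul, abs_mul]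
  have h4 : |w 1| * |Γ (t • bvec 0) (bvec 0) (bvec 1) 2 - b * t ^ 2| ≤ ‖w‖ * (M * t ^ 3) :=
    mul_le_mul (E3_abs_apply_le w 1) (h.cross t ht) (abs_nonneg _) (norm_nonneg _)
  have h5 := mul_le_mul_of_nonneg_left h2 (abs_nonneg (w 2))
  linarith

/-- Two geodesics close to the axis separate, transversally to the axis, at least as their
initial data do. -/
lemma exists_forall_axisJet_spread {M κ : ℝ} (hM : 0 ≤ M) (hκ : 0 < κ) :
    ∃ S c : ℝ, 0 < S ∧ S ≤ 1 ∧ 0 < c ∧ ∀ (Γ : E3 → E3 →L[ℝ] E3 →L[ℝ] E3) (U : Set E3)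
      (T a b s₁ : ℝ), AxisJet Γ U T M a b → |a| ≤ M → |b| ≤ M → κ ≤ |a - 2 * b| → 0 < s₁ →
      2 * s₁ ≤ S → 2 * s₁ ≤ T → ∃ η : ℝ, 0 < η ∧ ∀ s t₀ x y : ℝ, s ∈ Icc s₁ (2 * s₁) → 0 ≤ t₀ →
      t₀ ≤ s₁ ^ 5 → ∀ u v u' v' : ℝ → E3, IsGeodSol Γ u v (Icc t₀ s) →
      IsGeodSol Γ u' v' (Icc t₀ s) →
      (∀ t ∈ Icc t₀ s, ‖u t - t • bvec 0‖ ≤ η ∧ ‖u' t - t • bvec 0‖ ≤ η ∧ ‖v t - bvec 0‖ ≤ η ∧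
        ‖v' t - bvec 0‖ ≤ η) →
      ‖u t₀ - u' t₀ - x • bvec 1‖ ≤ s₁ ^ 5 * (|x| + |y|) →
      ‖v t₀ - v' t₀ - y • bvec 1‖ ≤ s₁ ^ 5 * (|x| + |y|) →
      c * s₁ ^ 4 * (|x| + |y|) ≤ |(u s - u' s) 1| + |(u s - u' s) 2| ∧
        ‖u s - u' s‖ ≤ 6 * (|x| + |y|) := by
  obtain ⟨S, c, hS, hS1, hc, hspread⟩ :=
    exists_forall_spread (M := 2 * M) (κ := κ) (by positivity) hκ
  refine ⟨S, c, hS, hS1, hc, fun Γ U T a b s₁ h ha hb hab hs₁ hs₁S hs₁T ↦ ?_⟩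
  obtain ⟨η, hη, hlin⟩ := h.exists_forall_linearization (ε := s₁ ^ 5) (by positivity)
  refine ⟨η, hη, fun s t₀ x y hs ht₀ ht₀s u v u' v' hu hu' hclose hx hy ↦ ?_⟩
  have hs0 : 0 < s := hs₁.trans_le hs.1
  have hpow : s₁ ^ 5 ≤ s ^ 5 := pow_le_pow_left₀ hs₁.le hs.1 5
  have hlin' : ∀ t ∈ Icc t₀ s, t ∈ Icc 0 T ∧ ‖(-(Γ (u t) (v t) (v t)) - -(Γ (u' t) (v' t) (v' t))) +
      (fderiv ℝ Γ (t • bvec 0) (u t - u' t) (bvec 0) (bvec 0) +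
        (2 : ℝ) • Γ (t • bvec 0) (bvec 0) (v t - v' t))‖ ≤
        s ^ 5 * (‖u t - u' t‖ + ‖v t - v' t‖) := by
    intro t ht
    have htT : t ∈ Icc 0 T := ⟨ht₀.trans ht.1, ht.2.trans (hs.2.trans hs₁T)⟩
    obtain ⟨h1, h2, h3, h4⟩ := hclose t ht
    have := hlin t htT (u t) (u' t) (v t) (v' t) h1 h2 h3 h4
    refine ⟨htT, ?_⟩
    rw [← norm_neg]
    refine le_trans (le_of_eq ?_) (this.trans (mul_le_mul_of_nonneg_right hpow (by positivity)))
    congr 1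
    abel
  have key := hspread a b s t₀ x y (by linarith) (by linarith) hab hs0
    (hs.2.trans hs₁S) ht₀ (ht₀s.trans hpow) (fun t ↦ u t - u' t) (fun t ↦ v t - v' t)
    (fun t ↦ -(Γ (u t) (v t) (v t)) - -(Γ (u' t) (v' t) (v' t)))
    (fun t ht ↦ (hu t ht).1.sub (hu' t ht).1) (fun t ht ↦ (hu t ht).2.sub (hu' t ht).2)
    (fun t ht ↦ ?_) (fun t ht ↦ ?_)
    (hx.trans (mul_le_mul_of_nonneg_right hpow (by positivity)))
    (hy.trans (mul_le_mul_of_nonneg_right hpow (by positivity)))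
  · refine ⟨le_trans ?_ key.1, key.2⟩
    have : s₁ ^ 4 ≤ s ^ 4 := pow_le_pow_left₀ hs₁.le hs.1 4
    gcongr
  · obtain ⟨htT, h1⟩ := hlin' t ht
    have ht0 := htT.1
    set A := -(Γ (u t) (v t) (v t)) - -(Γ (u' t) (v' t) (v' t))
    set w := u t - u' t
    set z := v t - v' t
    have h2 : ‖fderiv ℝ Γ (t • bvec 0) w (bvec 0) (bvec 0)‖ ≤ M * ‖w‖ := by
      have := (fderiv ℝ Γ (t • bvec 0) w).le_opNorm₂ (bvec 0) (bvec 0)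
      rw [norm_bvec, mul_one, mul_one] at this
      exact this.trans ((fderiv ℝ Γ (t • bvec 0)).le_of_opNorm_le (h.fderiv_le t htT) w)
    have h3 : ‖(2 : ℝ) • Γ (t • bvec 0) (bvec 0) z‖ ≤ 2 * M * t * ‖z‖ := by
      rw [norm_smul, Real.norm_ofNat]
      have := (Γ (t • bvec 0)).le_opNorm₂ (bvec 0) z
      rw [norm_bvec, mul_one] at this
      have h4 := mul_le_mul_of_nonneg_right (h.norm_le t htT) (norm_nonneg z)
      linarith
    have h5 := norm_sub_le (A + (fderiv ℝ Γ (t • bvec 0) w (bvec 0) (bvec 0) +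
      (2 : ℝ) • Γ (t • bvec 0) (bvec 0) z)) (fderiv ℝ Γ (t • bvec 0) w (bvec 0) (bvec 0) +
      (2 : ℝ) • Γ (t • bvec 0) (bvec 0) z)
    rw [add_sub_cancel_right] at h5
    have h6 := norm_add_le (fderiv ℝ Γ (t • bvec 0) w (bvec 0) (bvec 0))
      ((2 : ℝ) • Γ (t • bvec 0) (bvec 0) z)
    have h7 : 0 ≤ M * ‖w‖ := mul_nonneg hM (norm_nonneg _)
    linarith
  · obtain ⟨htT, h1⟩ := hlin' t ht
    have ht0 := htT.1
    set A := -(Γ (u t) (v t) (v t)) - -(Γ (u' t) (v' t) (v' t))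
    set w := u t - u' t
    set z := v t - v' t
    have h2 := h.fderiv_apply_two_le htT w
    have h3 := h.apply_two_le htT z
    have h4 := (E3_abs_apply_le _ 2).trans h1
    simp only [PiLp.add_apply, PiLp.smul_apply, smul_eq_mul] at h4
    have h5 : A 2 + a * t * w 1 + 2 * b * t ^ 2 * z 1 =
        (A 2 + (fderiv ℝ Γ (t • bvec 0) w (bvec 0) (bvec 0) 2 +
          2 * Γ (t • bvec 0) (bvec 0) z 2)) -
        (fderiv ℝ Γ (t • bvec 0) w (bvec 0) (bvec 0) 2 - a * t * w 1) -
        2 * (Γ (t • bvec 0) (bvec 0) z 2 - b * t ^ 2 * z 1) := by ring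
    rw [h5]
    refine (abs_sub _ _).trans ((add_le_add_left (abs_sub _ _) _).trans ?_)
    rw [abs_mul, abs_two]
    have h6 : 0 ≤ M * t ^ 2 * ‖w‖ := by positivity
    have h7 : 0 ≤ M * |w 2| := by positivity
    linarith

section
variable {Γ : E3 → E3 →L[ℝ] E3 →L[ℝ] E3} {U : Set E3} {T M a b : ℝ}

/-- Linear growth of the distance to the axis. -/
lemma AxisJet.exists_forall_growth (h : AxisJet Γ U T M a b) :
    ∃ η C : ℝ, 0 < η ∧ 1 ≤ C ∧ ∀ t₀ t₁ δ : ℝ, 0 ≤ t₀ → t₁ ≤ T → t₁ ≤ 1 → ∀ u v : ℝ → E3,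
      IsGeodSol Γ u v (Icc t₀ t₁) →
      (∀ t ∈ Icc t₀ t₁, ‖u t - t • bvec 0‖ ≤ η ∧ ‖v t - bvec 0‖ ≤ η) →
      ‖u t₀ - t₀ • bvec 0‖ ≤ δ → ‖v t₀ - bvec 0‖ ≤ δ → ∀ t ∈ Icc t₀ t₁,
      ‖u t - t • bvec 0‖ ≤ C * δ ∧ ‖v t - bvec 0‖ ≤ C * δ ∧
        ‖Γ (u t) (v t) (v t)‖ ≤ C * δ := by
  obtain ⟨η, hη, hlin⟩ := h.exists_forall_linearization one_pos
  have hM := h.nonneg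
  set L := 3 * M + 3 with hL
  have hL0 : 0 < L := by positivity
  refine ⟨η, L * Real.exp L, hη, ?_, fun t₀ t₁ δ ht₀ ht₁ ht₁1 u v hu hclose hu0 hv0 t ht ↦ ?_⟩
  · nlinarith [Real.add_one_le_exp L]
  set Z : ℝ → E3 × E3 := fun t ↦ (u t - t • bvec 0, v t - bvec 0) with hZ
  have hZd : ∀ t ∈ Icc t₀ t₁, HasDerivAt Z (v t - bvec 0, -(Γ (u t) (v t) (v t))) t := by
    intro t ht
    refine HasDerivAt.prodMk ((hu t ht).1.sub ?_) ((hu t ht).2.sub_const _)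
    simpa using (hasDerivAt_id t).smul_const (bvec 0)
  have h0 : ‖Z t₀‖ ≤ δ := max_le hu0 hv0
  have hacc : ∀ t ∈ Icc t₀ t₁, ‖Γ (u t) (v t) (v t)‖ ≤ L * ‖Z t‖ := by
    intro t ht
    have htT : t ∈ Icc 0 T := ⟨ht₀.trans ht.1, ht.2.trans ht₁⟩
    have h1 := hlin t htT (u t) (t • bvec 0) (v t) (bvec 0) (hclose t ht).1 (by simpa using hη.le)
      (hclose t ht).2 (by simpa using hη.le)
    rw [h.geod t htT, sub_zero, one_mul] at h1
    set y := u t - t • bvec 0 with hy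
    set w := v t - bvec 0 with hw
    have hyZ : ‖y‖ ≤ ‖Z t‖ := norm_fst_le (Z t)
    have hwZ : ‖w‖ ≤ ‖Z t‖ := norm_snd_le (Z t)
    have h2 : ‖fderiv ℝ Γ (t • bvec 0) y (bvec 0) (bvec 0)‖ ≤ M * ‖y‖ := by
      have := (fderiv ℝ Γ (t • bvec 0) y).le_opNorm₂ (bvec 0) (bvec 0)
      rw [norm_bvec, mul_one, mul_one] at this
      exact this.trans ((fderiv ℝ Γ (t • bvec 0)).le_of_opNorm_le (h.fderiv_le t htT) y)
    have h3 : ‖(2 : ℝ) • Γ (t • bvec 0) (bvec 0) w‖ ≤ 2 * M * ‖w‖ := by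
      rw [norm_smul, Real.norm_ofNat]
      have := (Γ (t • bvec 0)).le_opNorm₂ (bvec 0) w
      rw [norm_bvec, mul_one] at this
      have h4 : ‖Γ (t • bvec 0)‖ ≤ M := (h.norm_le t htT).trans
        (mul_le_of_le_one_right hM (ht.2.trans ht₁1))
      have h5 := mul_le_mul_of_nonneg_right h4 (norm_nonneg w)
      linarith
    have h5 := norm_add_le (Γ (u t) (v t) (v t) - (fderiv ℝ Γ (t • bvec 0) y (bvec 0) (bvec 0) +
      (2 : ℝ) • Γ (t • bvec 0) (bvec 0) w)) (fderiv ℝ Γ (t • bvec 0) y (bvec 0) (bvec 0) +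
      (2 : ℝ) • Γ (t • bvec 0) (bvec 0) w)
    rw [sub_add_cancel] at h5
    have h6 := norm_add_le (fderiv ℝ Γ (t • bvec 0) y (bvec 0) (bvec 0))
      ((2 : ℝ) • Γ (t • bvec 0) (bvec 0) w)
    have h7 := mul_le_mul_of_nonneg_left hyZ hM
    have h8 := mul_le_mul_of_nonneg_left hwZ hM
    have h9 := norm_nonneg (Z t)
    rw [hL]
    linarith
  have hgr := norm_le_gronwallBound_of_norm_deriv_right_le (f := Z) (K := L) (ε := 0)
    (fun t ht ↦ (hZd t ht).continuousAt.continuousWithinAt)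
    (fun t ht ↦ (hZd t (Ico_subset_Icc_self ht)).hasDerivWithinAt) h0 (fun t ht ↦ ?_) t ht
  · rw [gronwallBound_ε0] at hgr
    have hδ : 0 ≤ δ := (norm_nonneg _).trans h0
    have h1 : Real.exp (L * (t - t₀)) ≤ Real.exp L := by
      rw [Real.exp_le_exp]
      exact mul_le_of_le_one_right hL0.le (by linarith [ht.2])
    have h2 : ‖Z t‖ ≤ Real.exp L * δ := by
      rw [mul_comm]; exact hgr.trans (mul_le_mul_of_nonneg_left h1 hδ)
    have h3 : Real.exp L * δ ≤ L * Real.exp L * δ := by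
      rw [mul_assoc]
      exact le_mul_of_one_le_left (by positivity) (by linarith)
    refine ⟨(norm_fst_le (Z t)).trans (h2.trans h3), (norm_snd_le (Z t)).trans (h2.trans h3),
      (hacc t ht).trans ?_⟩
    rw [mul_assoc]
    exact mul_le_mul_of_nonneg_left h2 hL0.le
  · rw [add_zero]
    refine max_le ?_ ?_
    · exact (norm_snd_le (Z t)).trans (le_mul_of_one_le_left (norm_nonneg _) (by linarith))
    · simpa using hacc t (Ico_subset_Icc_self ht)

/-- The third component of the geodesic equation near the axis. -/
lemma AxisJet.abs_quad_two_le (h : AxisJet Γ U T M a b) {t k C C₁ C₂ : ℝ} {u v y w : E3}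
    (htT : t ∈ Icc 0 T) (hk : 0 < k) (hk1 : k ≤ 1) (htk : t ≤ k) (hC : 0 ≤ C) (hC₁ : 1 ≤ C₁)
    (hC₂0 : 0 < C₂) (hvw : v = bvec 0 + w) (hw' : ‖w‖ ≤ C₁ * k) (hy' : ‖y‖ ≤ C₂ * k ^ 2)
    (hw2 : |w 2| ≤ C₁ * k ^ 2) (hy2 : |y 2| ≤ C₁ * k ^ 3)
    (hR : ‖Γ u - Γ (t • bvec 0) - fderiv ℝ Γ (t • bvec 0) y‖ ≤ C * ‖y‖ ^ 2) :
    |Γ u v v 2| ≤ (2 * (|b| * C₁ + M * C₁ + M * C₁) + M * C₁ ^ 2 + |a| * C₂ + M * C₂ + M * C₁ +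
      2 * M * C₂ * C₁ + M * C₂ * C₁ ^ 2 + C * C₂ ^ 2 * (1 + C₁) ^ 2) * k ^ 3 := by
  have hM := h.nonneg
  have ht0 := htT.1
  have hDn := h.fderiv_le t htT
  have hΓn := h.norm_le t htT
  have hD2 := h.fderiv_apply_two_le htT y
  have hΓ2 := h.apply_two_le htT w
  have hgeod := h.geod t htT
  have hsymm := h.symm (t • bvec 0)
  set D := fderiv ℝ Γ (t • bvec 0) y with hD
  set R := Γ u - Γ (t • bvec 0) - D with hRdef
  have hDy : ‖D‖ ≤ M * (C₂ * k ^ 2) :=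
    ((fderiv ℝ Γ (t • bvec 0)).le_of_opNorm_le hDn y).trans (by gcongr)
  have hdec : Γ u v v = (2 : ℝ) • Γ (t • bvec 0) (bvec 0) w +
      Γ (t • bvec 0) w w + D (bvec 0) (bvec 0) + D (bvec 0) w + D w (bvec 0) + D w w +
      R v v := by
    have h1 : Γ u = Γ (t • bvec 0) + D + R := by rw [hRdef]; abel
    rw [h1]
    simp only [_root_.add_apply]
    have h2 : ∀ B : E3 →L[ℝ] E3 →L[ℝ] E3, B v v =
        B (bvec 0) (bvec 0) + B (bvec 0) w + B w (bvec 0) + B w w := by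
      intro B
      rw [hvw]
      simp only [map_add, _root_.add_apply]
      abel
    rw [h2 (Γ (t • bvec 0)), h2 D, hgeod, hsymm w (bvec 0), two_smul]
    abel
  have hvn : ‖v‖ ≤ 1 + C₁ := by
    rw [hvw]
    refine (norm_add_le _ _).trans ?_
    rw [norm_bvec]
    have : C₁ * k ≤ C₁ := mul_le_of_le_one_right (by linarith) hk1
    linarith
  have hk30 : 0 ≤ k ^ 3 := by positivity
  have hk43 : k ^ 4 ≤ k ^ 3 := pow_le_pow_of_le_one hk.le hk1 (by norm_num)
  have b1 : |Γ (t • bvec 0) (bvec 0) w 2| ≤ (|b| * C₁ + M * C₁ + M * C₁) * k ^ 3 := by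
    have e1 : |b * t ^ 2 * w 1| ≤ |b| * C₁ * k ^ 3 := by
      rw [abs_mul, abs_mul, abs_of_nonneg (sq_nonneg t)]
      calc |b| * t ^ 2 * |w 1| ≤ |b| * k ^ 2 * (C₁ * k) := by
            gcongr
            exact (E3_abs_apply_le w 1).trans hw'
        _ = _ := by ring
    have e2 : M * t ^ 3 * ‖w‖ ≤ M * C₁ * k ^ 3 := by
      calc M * t ^ 3 * ‖w‖ ≤ M * k ^ 3 * (C₁ * k) := by gcongr
        _ = M * C₁ * k ^ 4 := by ring
        _ ≤ _ := by gcongr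
    have e3 : M * t * |w 2| ≤ M * C₁ * k ^ 3 := by
      calc M * t * |w 2| ≤ M * k * (C₁ * k ^ 2) := by gcongr
        _ = _ := by ring
    have e4 : |Γ (t • bvec 0) (bvec 0) w 2| ≤
        |Γ (t • bvec 0) (bvec 0) w 2 - b * t ^ 2 * w 1| + |b * t ^ 2 * w 1| := by
      have := abs_add_le (Γ (t • bvec 0) (bvec 0) w 2 - b * t ^ 2 * w 1) (b * t ^ 2 * w 1)
      rwa [sub_add_cancel] at this
    linarith only [e1, e2, e3, e4, hΓ2]
  have b2 : |Γ (t • bvec 0) w w 2| ≤ M * C₁ ^ 2 * k ^ 3 := by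
    refine (E3_abs_apply_le _ 2).trans (((Γ (t • bvec 0)).le_opNorm₂ w w).trans ?_)
    calc ‖Γ (t • bvec 0)‖ * ‖w‖ * ‖w‖ ≤ (M * k) * (C₁ * k) * (C₁ * k) := by
          gcongr
          exact hΓn.trans (by gcongr)
      _ = _ := by ring
  have b3 : |D (bvec 0) (bvec 0) 2| ≤ (|a| * C₂ + M * C₂ + M * C₁) * k ^ 3 := by
    have e1 : |a * t * y 1| ≤ |a| * C₂ * k ^ 3 := by
      rw [abs_mul, abs_mul, abs_of_nonneg ht0]
      calc |a| * t * |y 1| ≤ |a| * k * (C₂ * k ^ 2) := by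
            gcongr
            exact (E3_abs_apply_le y 1).trans hy'
        _ = _ := by ring
    have e2 : M * t ^ 2 * ‖y‖ ≤ M * C₂ * k ^ 3 := by
      calc M * t ^ 2 * ‖y‖ ≤ M * k ^ 2 * (C₂ * k ^ 2) := by gcongr
        _ = M * C₂ * k ^ 4 := by ring
        _ ≤ _ := by gcongr
    have e3 : M * |y 2| ≤ M * C₁ * k ^ 3 := by
      calc M * |y 2| ≤ M * (C₁ * k ^ 3) := by gcongr
        _ = _ := by ring
    have e4 : |D (bvec 0) (bvec 0) 2| ≤
        |D (bvec 0) (bvec 0) 2 - a * t * y 1| + |a * t * y 1| := by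
      simpa using abs_add_le (D (bvec 0) (bvec 0) 2 - a * t * y 1) (a * t * y 1)
    linarith only [e1, e2, e3, e4, hD2]
  have b4 : |D (bvec 0) w 2| ≤ M * C₂ * C₁ * k ^ 3 := by
    refine (E3_abs_apply_le _ 2).trans ((D.le_opNorm₂ (bvec 0) w).trans ?_)
    rw [norm_bvec, mul_one]
    calc ‖D‖ * ‖w‖ ≤ (M * (C₂ * k ^ 2)) * (C₁ * k) := by gcongr
      _ = _ := by ring
  have b5 : |D w (bvec 0) 2| ≤ M * C₂ * C₁ * k ^ 3 := by
    refine (E3_abs_apply_le _ 2).trans ((D.le_opNorm₂ w (bvec 0)).trans ?_)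
    rw [norm_bvec, mul_one]
    calc ‖D‖ * ‖w‖ ≤ (M * (C₂ * k ^ 2)) * (C₁ * k) := by gcongr
      _ = _ := by ring
  have b6 : |D w w 2| ≤ M * C₂ * C₁ ^ 2 * k ^ 3 := by
    refine (E3_abs_apply_le _ 2).trans ((D.le_opNorm₂ w w).trans ?_)
    calc ‖D‖ * ‖w‖ * ‖w‖ ≤ (M * (C₂ * k ^ 2)) * (C₁ * k) * (C₁ * k) := by gcongr
      _ = M * C₂ * C₁ ^ 2 * k ^ 4 := by ring
      _ ≤ _ := by gcongr
  have b7 : |R v v 2| ≤ C * C₂ ^ 2 * (1 + C₁) ^ 2 * k ^ 3 := by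
    refine (E3_abs_apply_le _ 2).trans ((R.le_opNorm₂ v v).trans ?_)
    calc ‖R‖ * ‖v‖ * ‖v‖ ≤ (C * (C₂ * k ^ 2) ^ 2) * (1 + C₁) * (1 + C₁) := by
          gcongr
          exact hR.trans (by gcongr)
      _ = C * C₂ ^ 2 * (1 + C₁) ^ 2 * k ^ 4 := by ring
      _ ≤ _ := by gcongr
  rw [hdec]
  simp only [PiLp.add_apply, PiLp.smul_apply, smul_eq_mul]
  have t1 := abs_add_le (2 * Γ (t • bvec 0) (bvec 0) w 2 + Γ (t • bvec 0) w w 2 +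
    D (bvec 0) (bvec 0) 2 + D (bvec 0) w 2 + D w (bvec 0) 2 + D w w 2) (R v v 2)
  have t2 := abs_add_le (2 * Γ (t • bvec 0) (bvec 0) w 2 + Γ (t • bvec 0) w w 2 +
    D (bvec 0) (bvec 0) 2 + D (bvec 0) w 2 + D w (bvec 0) 2) (D w w 2)
  have t3 := abs_add_le (2 * Γ (t • bvec 0) (bvec 0) w 2 + Γ (t • bvec 0) w w 2 +
    D (bvec 0) (bvec 0) 2 + D (bvec 0) w 2) (D w (bvec 0) 2)
  have t4 := abs_add_le (2 * Γ (t • bvec 0) (bvec 0) w 2 + Γ (t • bvec 0) w w 2 +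
    D (bvec 0) (bvec 0) 2) (D (bvec 0) w 2)
  have t5 := abs_add_le (2 * Γ (t • bvec 0) (bvec 0) w 2 + Γ (t • bvec 0) w w 2)
    (D (bvec 0) (bvec 0) 2)
  have t6 := abs_add_le (2 * Γ (t • bvec 0) (bvec 0) w 2) (Γ (t • bvec 0) w w 2)
  have t7 : |2 * Γ (t • bvec 0) (bvec 0) w 2| = 2 * |Γ (t • bvec 0) (bvec 0) w 2| := by
    rw [abs_mul, abs_two]
  linarith only [t1, t2, t3, t4, t5, t6, t7, b1, b2, b3, b4, b5, b6, b7]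

/-- Geodesics that start close to the axis, and nearly parallel to it, stay in a slab whose third
dimension is much smaller than the second one. -/
lemma AxisJet.exists_forall_slab (h : AxisJet Γ U T M a b) :
    ∃ η c₀ : ℝ, 0 < η ∧ 0 < c₀ ∧ c₀ ≤ 1 / 2 ∧ c₀ ≤ T ∧ ∀ k t₀ x τ : ℝ, 0 < k → k ≤ 1 → 0 ≤ t₀ →
      t₀ ≤ c₀ * k → |x| ≤ c₀ * k ^ 2 → |τ| ≤ c₀ * k → ∀ u v : ℝ → E3,
      IsGeodSol Γ u v (Icc t₀ (c₀ * k)) →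
      (∀ t ∈ Icc t₀ (c₀ * k), ‖u t - t • bvec 0‖ ≤ η ∧ ‖v t - bvec 0‖ ≤ η) →
      u t₀ = t₀ • bvec 0 + x • bvec 1 → v t₀ = bvec 0 + τ • bvec 1 → ∀ t ∈ Icc t₀ (c₀ * k),
      ‖u t - t • bvec 0‖ ≤ k ^ 2 / 2 ∧ |u t 2| ≤ k ^ 5 / 2 := by
  obtain ⟨η₁, C₁, hη₁, hC₁, hgrow⟩ := h.exists_forall_growth
  obtain ⟨C, η₂, hC, hη₂, htaylor⟩ := h.smooth.exists_forall_norm_sub_sub_le_sq h.isOpen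
    (AxisJet.isCompact_axis T) (by rintro _ ⟨t, ht, rfl⟩; exact h.mem t ht)
  have hM := h.nonneg
  set C₂ := 1 + C₁ with hC₂
  set C₅ := 2 * (|b| * C₁ + M * C₁ + M * C₁) + M * C₁ ^ 2 + |a| * C₂ + M * C₂ + M * C₁ +
    2 * M * C₂ * C₁ + M * C₂ * C₁ ^ 2 + C * C₂ ^ 2 * (1 + C₁) ^ 2 with hC₅
  have hC₂0 : 0 < C₂ := by linarith
  have hC₅0 : 0 ≤ C₅ := by positivity
  set c₀ := min (min 1 T) (1 / (2 * C₂ + 2 * C₅)) with hc₀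
  have hc₀0 : 0 < c₀ := lt_min (lt_min one_pos h.pos) (by positivity)
  have hc₀1 : c₀ ≤ 1 := (min_le_left _ _).trans (min_le_left _ _)
  have hc₀T : c₀ ≤ T := (min_le_left _ _).trans (min_le_right _ _)
  have hc₀C : c₀ * (2 * C₂ + 2 * C₅) ≤ 1 := by
    rw [← le_div_iff₀ (by positivity)]; exact min_le_right _ _
  have hc₀C₂ : c₀ * C₂ ≤ 1 / 2 := by linarith [mul_nonneg hc₀0.le hC₅0]
  have hc₀C₅ : c₀ * C₅ ≤ 1 / 2 := by linarith [mul_pos hc₀0 hC₂0]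
  refine ⟨min η₁ η₂, c₀, by positivity, hc₀0,
    (le_mul_of_one_le_right hc₀0.le (by linarith)).trans hc₀C₂, hc₀T, ?_⟩
  intro k t₀ x τ hk hk1 ht₀ ht₀k hx hτ u v hu hclose hu0 hv0
  have hckk : c₀ * k ≤ k := mul_le_of_le_one_left hk.le hc₀1
  have hck1 : c₀ * k ≤ 1 := hckk.trans hk1
  have hckT : c₀ * k ≤ T := (mul_le_of_le_one_right hc₀0.le hk1).trans hc₀T
  have hmem : t₀ ∈ Icc t₀ (c₀ * k) := ⟨le_rfl, ht₀k⟩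
  have hk2 : k ^ 2 ≤ k := pow_le_of_le_one hk.le hk1 two_ne_zero
  have hu0' : u t₀ - t₀ • bvec 0 = x • bvec 1 := by rw [hu0]; abel
  have hv0' : v t₀ - bvec 0 = τ • bvec 1 := by rw [hv0]; abel
  have hgr := hgrow t₀ (c₀ * k) (c₀ * k) ht₀ hckT hck1 u v hu
    (fun t ht ↦ ⟨(hclose t ht).1.trans (min_le_left _ _), (hclose t ht).2.trans (min_le_left _ _)⟩)
    (by rw [hu0', norm_smul, norm_bvec, mul_one]
        exact hx.trans (mul_le_mul_of_nonneg_left hk2 hc₀0.le))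
    (by rw [hv0', norm_smul, norm_bvec, mul_one]; exact hτ)
  have hw : ∀ t ∈ Icc t₀ (c₀ * k), ‖v t - bvec 0‖ ≤ C₁ * k := fun t ht ↦
    (hgr t ht).2.1.trans (mul_le_mul_of_nonneg_left hckk (by linarith))
  have hyc : ∀ t ∈ Icc t₀ (c₀ * k), ‖u t - t • bvec 0‖ ≤ c₀ * (C₂ * k ^ 2) := by
    intro t ht
    have hd : ∀ t ∈ Icc t₀ (c₀ * k), HasDerivAt (fun t ↦ u t - t • bvec 0) (v t - bvec 0) t := by
      intro t ht
      refine (hu t ht).1.sub ?_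
      simpa using (hasDerivAt_id t).smul_const (bvec 0)
    have h1 := norm_le_of_hasDerivAt (D := c₀ * k ^ 2) ht₀ hd hw
      (by rw [hu0', norm_smul, norm_bvec, mul_one]; exact hx) ht
    rw [hC₂]
    linarith
  have hy : ∀ t ∈ Icc t₀ (c₀ * k), ‖u t - t • bvec 0‖ ≤ C₂ * k ^ 2 := fun t ht ↦
    (hyc t ht).trans (mul_le_of_le_one_left (by positivity) hc₀1)
  have hd2 : ∀ t ∈ Icc t₀ (c₀ * k), HasDerivAt (fun t ↦ v t 2) ((-(Γ (u t) (v t) (v t))) 2) t :=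
    fun t ht ↦ E3_hasDerivAt_apply (hu t ht).2 2
  have hdu2 : ∀ t ∈ Icc t₀ (c₀ * k), HasDerivAt (fun t ↦ u t 2) (v t 2) t :=
    fun t ht ↦ E3_hasDerivAt_apply (hu t ht).1 2
  have hv20 : ‖v t₀ 2‖ ≤ 0 := by rw [hv0]; simp
  have hu20 : ‖u t₀ 2‖ ≤ 0 := by rw [hu0]; simp
  have hv2 : ∀ t ∈ Icc t₀ (c₀ * k), |v t 2| ≤ C₁ * k ^ 2 := by
    intro t ht
    have h1 := norm_le_of_hasDerivAt (C := C₁ * k) ht₀ hd2 (fun t ht ↦ ?_) hv20 ht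
    · rw [Real.norm_eq_abs] at h1
      have h2 : C₁ * k * (c₀ * k) ≤ C₁ * k * k := by gcongr
      linarith
    · refine (E3_abs_apply_le _ 2).trans ?_
      rw [norm_neg]
      exact (hgr t ht).2.2.trans (mul_le_mul_of_nonneg_left hckk (by linarith))
  have hu2 : ∀ t ∈ Icc t₀ (c₀ * k), |u t 2| ≤ C₁ * k ^ 3 := by
    intro t ht
    have h1 := norm_le_of_hasDerivAt ht₀ hdu2 hv2 hu20 ht
    rw [Real.norm_eq_abs] at h1
    have h2 : C₁ * k ^ 2 * (c₀ * k) ≤ C₁ * k ^ 2 * k := by gcongr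
    linarith
  have hacc : ∀ t ∈ Icc t₀ (c₀ * k), ‖(-(Γ (u t) (v t) (v t))) 2‖ ≤ C₅ * k ^ 3 := by
    intro t ht
    have htT : t ∈ Icc 0 T := ⟨ht₀.trans ht.1, ht.2.trans hckT⟩
    have := h.abs_quad_two_le (u := u t) (v := v t) (y := u t - t • bvec 0) (w := v t - bvec 0)
      htT hk hk1 (ht.2.trans hckk) hC hC₁ hC₂0 (by abel) (hw t ht) (hy t ht)
      (by simpa using hv2 t ht) (by simpa using hu2 t ht)
      (htaylor (t • bvec 0) ⟨t, htT, rfl⟩ (u t) (by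
        rw [Metric.mem_closedBall, dist_eq_norm]
        exact (hclose t ht).1.trans (min_le_right _ _)))
    rwa [PiLp.neg_apply, norm_neg, Real.norm_eq_abs]
  have hv2f : ∀ t ∈ Icc t₀ (c₀ * k), ‖v t 2‖ ≤ C₅ * k ^ 3 * (c₀ * k) := by
    intro t ht
    simpa using norm_le_of_hasDerivAt ht₀ hd2 hacc hv20 ht
  intro t ht
  constructor
  · refine (hyc t ht).trans ?_
    rw [← mul_assoc]
    have := mul_le_mul_of_nonneg_right hc₀C₂ (sq_nonneg k)
    linarith
  · have h1 := norm_le_of_hasDerivAt ht₀ hdu2 hv2f hu20 ht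
    rw [Real.norm_eq_abs] at h1
    have h2 : C₅ * k ^ 3 * (c₀ * k) * (c₀ * k) = (c₀ * C₅) * (c₀ * k ^ 5) := by ring
    have h3 : (c₀ * C₅) * (c₀ * k ^ 5) ≤ 1 / 2 * (1 * k ^ 5) := by gcongr
    linarith

/-- The slab estimate when the third component of the geodesic equation has the form
`u₂'' = O(|u₀ u₁| + |u₂|)`. -/
lemma AxisJet.exists_forall_slab_of_quad_le (h : AxisJet Γ U T M a b) {B : ℝ} (hB : 0 ≤ B)
    (hq : ∀ u ∈ U, ∀ v : E3, |Γ u v v 2| ≤ B * (|u 0| * |u 1| + |u 2|) * ‖v‖ ^ 2) :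
    ∃ η c₀ : ℝ, 0 < η ∧ 0 < c₀ ∧ c₀ ≤ 1 ∧ c₀ ≤ T ∧ ∀ k x τ : ℝ, 0 < k → k ≤ 1 →
      |x| ≤ c₀ * k → |τ| ≤ c₀ → ∀ u v : ℝ → E3,
      IsGeodSol Γ u v (Icc 0 (c₀ * k)) →
      (∀ t ∈ Icc 0 (c₀ * k), u t ∈ U ∧ ‖u t - t • bvec 0‖ ≤ η ∧ ‖v t - bvec 0‖ ≤ η) →
      u 0 = x • bvec 1 → v 0 = bvec 0 + τ • bvec 1 → ∀ t ∈ Icc 0 (c₀ * k),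
      |u t 0| + |u t 1| ≤ k / 2 ∧ |u t 2| ≤ k ^ 4 / 2 := by
  obtain ⟨η₁, C₁, hη₁, hC₁, hgrow⟩ := h.exists_forall_growth
  set K := 1 + 4 * B with hK
  set C := 4 * B * 6 / K * Real.exp K with hC
  set C' := 4 * B * (6 + C) with hC'
  have hC0 : 0 ≤ C := by positivity
  have hC'0 : 0 ≤ C' := by positivity
  have hK0 : 0 < K := by positivity
  set c₀ := min (min 1 T) (1 / (C₁ + 10 + 2 * C')) with hc₀
  have hc₀0 : 0 < c₀ := lt_min (lt_min one_pos h.pos) (by positivity)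
  have hc₀1 : c₀ ≤ 1 := (min_le_left _ _).trans (min_le_left _ _)
  have hc₀T : c₀ ≤ T := (min_le_left _ _).trans (min_le_right _ _)
  have hc₀C : c₀ * (C₁ + 10 + 2 * C') ≤ 1 := by
    rw [← le_div_iff₀ (by positivity)]; exact min_le_right _ _
  have hc₁ : 0 ≤ c₀ * C₁ := by positivity
  have hc₂ := mul_nonneg hc₀0.le hC'0
  have hc1 : C₁ * c₀ ≤ 1 := by linarith
  have hc2 : c₀ * 10 ≤ 1 := by linarith
  have hc3 : c₀ * C' ≤ 1 / 2 := by linarith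
  refine ⟨η₁, c₀, hη₁, hc₀0, hc₀1, hc₀T, ?_⟩
  intro k x τ hk hk1 hx hτ u v hu hclose hu0 hv0
  have hckk : c₀ * k ≤ k := mul_le_of_le_one_left hk.le hc₀1
  have hckc : c₀ * k ≤ c₀ := mul_le_of_le_one_right hc₀0.le hk1
  have hck0 : 0 < c₀ * k := by positivity
  have hu0' : u 0 - (0 : ℝ) • bvec 0 = x • bvec 1 := by rw [hu0]; module
  have hv0' : v 0 - bvec 0 = τ • bvec 1 := by rw [hv0]; abel
  have hgr := hgrow 0 (c₀ * k) c₀ le_rfl (hckc.trans hc₀T) (hckk.trans hk1) u v hu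
    (fun t ht ↦ (hclose t ht).2)
    (by rw [hu0', norm_smul, norm_bvec, mul_one]; exact hx.trans hckc)
    (by rw [hv0', norm_smul, norm_bvec, mul_one]; exact hτ)
  have hw : ∀ t ∈ Icc 0 (c₀ * k), ‖v t - bvec 0‖ ≤ 1 := fun t ht ↦ (hgr t ht).2.1.trans hc1
  have hy : ∀ t ∈ Icc 0 (c₀ * k), ‖u t - t • bvec 0‖ ≤ 2 * (c₀ * k) := by
    intro t ht
    have hd : ∀ t ∈ Icc 0 (c₀ * k), HasDerivAt (fun t ↦ u t - t • bvec 0) (v t - bvec 0) t := by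
      intro t ht
      refine (hu t ht).1.sub ?_
      simpa using (hasDerivAt_id t).smul_const (bvec 0)
    have h1 := norm_le_of_hasDerivAt (D := c₀ * k) le_rfl hd hw
      (by rw [hu0', norm_smul, norm_bvec, mul_one]; exact hx) ht
    linarith
  have h0 : ∀ t ∈ Icc 0 (c₀ * k), |u t 0| ≤ 3 * (c₀ * k) := by
    intro t ht
    have h1 := (E3_abs_apply_le (u t - t • bvec 0) 0).trans (hy t ht)
    simp only [PiLp.sub_apply, PiLp.smul_apply, PiLp.single_apply, smul_eq_mul, if_true,
      mul_one] at h1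
    rw [abs_le] at h1 ⊢
    constructor <;> linarith [h1.1, h1.2, ht.1, ht.2]
  have h1 : ∀ t ∈ Icc 0 (c₀ * k), |u t 1| ≤ 2 * (c₀ * k) := by
    intro t ht
    simpa using (E3_abs_apply_le (u t - t • bvec 0) 1).trans (hy t ht)
  have hvn : ∀ t ∈ Icc 0 (c₀ * k), ‖v t‖ ≤ 2 := by
    intro t ht
    have h2 : ‖v t‖ ≤ ‖v t - bvec 0‖ + ‖bvec 0‖ := by
      simpa using norm_add_le (v t - bvec 0) (bvec 0)
    rw [norm_bvec] at h2
    linarith [hw t ht]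
  have hacc : ∀ t ∈ Icc 0 (c₀ * k), ‖(-(Γ (u t) (v t) (v t))) 2‖ ≤
      4 * B * (6 * k ^ 2 + |u t 2|) := by
    intro t ht
    rw [PiLp.neg_apply, norm_neg, Real.norm_eq_abs]
    refine (hq (u t) (hclose t ht).1 (v t)).trans ?_
    have h3 : |u t 0| * |u t 1| ≤ 6 * k ^ 2 := by
      calc |u t 0| * |u t 1| ≤ (3 * k) * (2 * k) := by
            gcongr
            · exact (h0 t ht).trans (by linarith)
            · exact (h1 t ht).trans (by linarith)
        _ = _ := by ring
    calc B * (|u t 0| * |u t 1| + |u t 2|) * ‖v t‖ ^ 2 ≤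
          B * (6 * k ^ 2 + |u t 2|) * 2 ^ 2 := by
          gcongr
          exact hvn t ht
      _ = _ := by ring
  have hd2 : ∀ t ∈ Icc 0 (c₀ * k), HasDerivAt (fun t ↦ v t 2) ((-(Γ (u t) (v t) (v t))) 2) t :=
    fun t ht ↦ E3_hasDerivAt_apply (hu t ht).2 2
  have hdu2 : ∀ t ∈ Icc 0 (c₀ * k), HasDerivAt (fun t ↦ u t 2) (v t 2) t :=
    fun t ht ↦ E3_hasDerivAt_apply (hu t ht).1 2
  have hv20 : v 0 2 = 0 := by rw [hv0]; simp
  have hu20 : u 0 2 = 0 := by rw [hu0]; simp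
  have hu2 : ∀ t ∈ Icc 0 (c₀ * k), |u t 2| ≤ C * k ^ 2 := by
    intro t ht
    have hgr2 := norm_le_gronwallBound_of_norm_deriv_right_le (f := fun t ↦ (u t 2, v t 2)) (K := K)
      (δ := 0) (ε := 4 * B * 6 * k ^ 2)
      (f' := fun t ↦ (v t 2, (-(Γ (u t) (v t) (v t))) 2))
      (fun t ht ↦ ((hdu2 t ht).prodMk (hd2 t ht)).continuousAt.continuousWithinAt)
      (fun t ht ↦ ((hdu2 t (Ico_subset_Icc_self ht)).prodMk
        (hd2 t (Ico_subset_Icc_self ht))).hasDerivWithinAt)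
      (by rw [hu20, hv20]; simp) (fun t ht ↦ ?_) t ht
    · simp only [gronwallBound_of_K_ne_0 hK0.ne', zero_mul, zero_add, sub_zero] at hgr2
      refine (norm_fst_le (u t 2, v t 2)).trans (hgr2.trans ?_)
      have h3 : Real.exp (K * t) - 1 ≤ Real.exp K := by
        have : Real.exp (K * t) ≤ Real.exp K := by
          rw [Real.exp_le_exp]
          exact mul_le_of_le_one_right hK0.le (ht.2.trans (hckk.trans hk1))
        linarith
      calc 4 * B * 6 * k ^ 2 / K * (Real.exp (K * t) - 1) ≤
            4 * B * 6 * k ^ 2 / K * Real.exp K := by gcongr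
        _ = C * k ^ 2 := by rw [hC]; ring
    · have htI := Ico_subset_Icc_self ht
      have e1 : |u t 2| ≤ ‖(u t 2, v t 2)‖ := norm_fst_le (u t 2, v t 2)
      have e2 : |v t 2| ≤ ‖(u t 2, v t 2)‖ := norm_snd_le (u t 2, v t 2)
      have e3 := hacc t htI
      have e4 : 0 ≤ B * ‖(u t 2, v t 2)‖ := by positivity
      have e5 : 0 ≤ B * k ^ 2 := by positivity
      have e6 := mul_le_mul_of_nonneg_left e1 hB
      refine max_le ?_ ?_
      · change |v t 2| ≤ _
        rw [hK]; linarith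
      · rw [hK]; change ‖(-(Γ (u t) (v t) (v t))) 2‖ ≤ _
        linarith [norm_nonneg (u t 2, v t 2)]
  have hacc' : ∀ t ∈ Icc 0 (c₀ * k), ‖(-(Γ (u t) (v t) (v t))) 2‖ ≤ C' * k ^ 2 := by
    intro t ht
    refine (hacc t ht).trans ?_
    have := mul_le_mul_of_nonneg_left (hu2 t ht) hB
    rw [hC']
    linarith
  intro t ht
  constructor
  · have e1 := h0 t ht
    have e2 := h1 t ht
    have e3 := mul_le_mul_of_nonneg_right hc2 hk.le
    linarith
  · have hv2f : ∀ t ∈ Icc 0 (c₀ * k), ‖v t 2‖ ≤ C' * k ^ 2 * (c₀ * k) := by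
      intro t ht
      have := norm_le_of_hasDerivAt (D := 0) le_rfl hd2 hacc' (by rw [hv20, norm_zero]) ht
      rwa [zero_add] at this
    have e1 := norm_le_of_hasDerivAt (D := 0) le_rfl hdu2 hv2f (by rw [hu20, norm_zero]) ht
    rw [Real.norm_eq_abs] at e1
    have e2 : C' * k ^ 2 * (c₀ * k) * (c₀ * k) = (c₀ * C') * (c₀ * k ^ 4) := by ring
    have e3 : (c₀ * C') * (c₀ * k ^ 4) ≤ 1 / 2 * (1 * k ^ 4) := by gcongr
    linarith
end

section
variable {M : Type*} [EMetricSpace M] [ChartedSpace E3 M] [IsManifold (𝓡 3) ∞ M]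
    [RiemannianBundle (fun x : M ↦ TangentSpace (𝓡 3) x)]
    [IsContMDiffRiemannianBundle (𝓡 3) ∞ E3 (fun x : M ↦ TangentSpace (𝓡 3) x)]

/-- `c` is an affinely parametrized geodesic that starts at `u` with velocity `V`, and its initial
segment of length `α` is a geodesic segment. -/
structure IsGeodFrom (e : OpenPartialHomeomorph M E3) (α : ℝ) (c : ℝ → M) (u V : E3) : Prop where
  zero : c 0 = e.symm u
  deriv_zero : deriv (fun τ ↦ e (c τ)) 0 = V
  geod : IsGeodCurve c (Icc 0 (α / ‖coordVec e u V‖))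
  mem : c '' Icc 0 (α / ‖coordVec e u V‖) ∈ geodesicSegments M α

/-- The initial part of the first coordinate axis is a geodesic with unit initial velocity. -/
structure IsUnitAxis (e : OpenPartialHomeomorph M E3) (T : ℝ) : Prop where
  smooth : IsSmoothChart e
  pos : 0 < T
  mem : ∀ t ∈ Icc 0 T, t • bvec 0 ∈ e.target
  geod : ∀ t ∈ Icc 0 T, gam e (t • bvec 0) (bvec 0) (bvec 0) = 0
  unit : coordInner e 0 (bvec 0) (bvec 0) = 1

lemma IsUnitAxis.zero_mem {e : OpenPartialHomeomorph M E3} {T : ℝ} (h : IsUnitAxis e T) :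
    (0 : E3) ∈ e.target := by
  simpa using h.mem 0 ⟨le_rfl, h.pos.le⟩

lemma HasInjRadiusGT.exists_isGeodFrom {α : ℝ} (hα : 0 < α) (h : HasInjRadiusGT M (2 * α))
    {e : OpenPartialHomeomorph M E3} (he : IsSmoothChart e) {u : E3} (hu : u ∈ e.target)
    {V : E3} (hV : V ≠ 0) : ∃ c : ℝ → M, IsGeodFrom e α c u V := by
  obtain ⟨c, h0, h1, h2, h3⟩ := h.exists_geodesic hα he hu hV
  have hN : 0 < ‖coordVec e u V‖ := norm_pos_iff.2 (he.coordVec_ne_zero hu hV)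
  refine ⟨c, h0, h1, h2.mono fun t ht ↦ ⟨?_, ht.2.trans_lt ?_⟩, h3⟩
  · have : 0 < 2 * α / ‖coordVec e u V‖ := by positivity
    linarith [ht.1]
  · gcongr
    linarith

/-- Vectors close to the initial velocity of the axis have norm close to `1`. -/
lemma IsUnitAxis.exists_forall_norm {e : OpenPartialHomeomorph M E3} {T : ℝ} (h : IsUnitAxis e T) :
    ∃ η : ℝ, 0 < η ∧ ∀ u V : E3, ‖u‖ ≤ η → ‖V - bvec 0‖ ≤ η →
      u ∈ e.target ∧ V ≠ 0 ∧ 2 / 3 ≤ ‖coordVec e u V‖ ∧ ‖coordVec e u V‖ ≤ 2 := by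
  have hc := (h.smooth.continuousOn_coordInner (0, bvec 0) ⟨h.zero_mem, mem_univ _⟩).continuousAt
    ((e.open_target.prod isOpen_univ).mem_nhds ⟨h.zero_mem, mem_univ _⟩)
  have h1 : ∀ᶠ p : E3 × E3 in 𝓝 (0, bvec 0), coordInner e p.1 p.2 p.2 ∈ Ioo (4 / 9 : ℝ) 4 := by
    refine hc.eventually (isOpen_Ioo.mem_nhds ?_)
    change coordInner e 0 (bvec 0) (bvec 0) ∈ _
    rw [h.unit]; norm_num
  have h2 : ∀ᶠ p : E3 × E3 in 𝓝 (0, bvec 0), p.1 ∈ e.target :=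
    continuous_fst.continuousAt.eventually (e.open_target.mem_nhds h.zero_mem)
  obtain ⟨η, hη, hb⟩ := Metric.eventually_nhds_iff.1 (h1.and h2)
  refine ⟨η / 2, by positivity, fun u V hu hV ↦ ?_⟩
  obtain ⟨h3, h4⟩ := hb (y := (u, V)) (by
    rw [Prod.dist_eq, dist_zero_right, dist_eq_norm]
    exact max_lt (by simp only; linarith) (by simp only; linarith))
  simp only at h3 h4
  rw [← norm_coordVec_sq] at h3
  have hn := norm_nonneg (coordVec e u V)
  refine ⟨h4, ?_, by nlinarith [h3.1], by nlinarith [h3.2]⟩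
  rintro rfl
  have h5 : coordVec e u 0 = 0 := map_zero (mfderiv (𝓡 3) (𝓡 3) e.symm u)
  rw [h5, norm_zero] at h3
  norm_num at h3

/-- Geodesics with initial data close to those of the axis stay close to the axis. The geodesic
is considered to start at time `σ`. -/
lemma IsUnitAxis.exists_forall_isGeodSol {e : OpenPartialHomeomorph M E3} {T α : ℝ}
    (h : IsUnitAxis e T) {T' : ℝ} (hT' : T' ≤ T) (hTα : T' ≤ α / 2) {ε : ℝ}
    (hε : 0 < ε) :
    ∃ η : ℝ, 0 < η ∧ ∀ (c : ℝ → M) (u V : E3) (σ : ℝ), IsGeodFrom e α c u V → ‖u‖ ≤ η →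
      ‖V - bvec 0‖ ≤ η → 0 ≤ σ → σ ≤ η →
      IsGeodSol (gam e) (fun t ↦ e (c (t - σ))) (fun t ↦ deriv (fun τ ↦ e (c τ)) (t - σ))
        (Icc σ T') ∧ e (c (σ - σ)) = u ∧ deriv (fun τ ↦ e (c τ)) (σ - σ) = V ∧
      ∀ t ∈ Icc σ T', c (t - σ) ∈ e.source ∧ c (t - σ) ∈ c '' Icc 0 (α / ‖coordVec e u V‖) ∧
        ‖e (c (t - σ)) - t • bvec 0‖ ≤ ε ∧
        ‖deriv (fun τ ↦ e (c τ)) (t - σ) - bvec 0‖ ≤ ε := by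
  obtain ⟨η₁, hη₁, hnorm⟩ := h.exists_forall_norm
  obtain ⟨η₂, hη₂, hclose⟩ := h.smooth.exists_forall_geodCurve_close (u₀ := 0) (f := bvec 0)
    h.pos.le (by simpa using h.mem) (by simpa using h.geod) (half_pos hε)
  refine ⟨min (min η₁ η₂) (ε / 2), by positivity, fun c u V σ hc hu hV hσ0 hσ ↦ ?_⟩
  have hm1 : min (min η₁ η₂) (ε / 2) ≤ η₁ := (min_le_left _ _).trans (min_le_left _ _)
  have hm2 : min (min η₁ η₂) (ε / 2) ≤ η₂ := (min_le_left _ _).trans (min_le_right _ _)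
  obtain ⟨hue, hV0, hN1, hN2⟩ := hnorm u V (hu.trans hm1) (hV.trans hm1)
  have hNpos : 0 < ‖coordVec e u V‖ := by linarith
  have hs : c 0 ∈ e.source := by rw [hc.zero]; exact e.map_target hue
  have hu0 : e (c 0) = u := by rw [hc.zero, e.right_inv hue]
  have hsub : ∀ t ∈ Icc σ T', t - σ ∈ Icc 0 (min (T - σ) (α / ‖coordVec e u V‖)) := by
    intro t ht
    refine ⟨sub_nonneg.2 ht.1, le_min (by linarith [ht.2]) ?_⟩
    rw [le_div_iff₀ hNpos]
    have h1 : 0 ≤ t - σ := sub_nonneg.2 ht.1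
    have h2 : t - σ ≤ α / 2 := by linarith [ht.2]
    nlinarith
  have hcl := hclose c (min (T - σ) (α / ‖coordVec e u V‖)) ((min_le_left _ _).trans (by linarith))
    (hc.geod.mono (Icc_subset_Icc_right (min_le_right _ _))) hs
    (by rw [hu0, sub_zero]; exact hu.trans hm2)
    (by rw [hc.deriv_zero]; exact hV.trans hm2)
  refine ⟨fun t ht ↦ ?_, by rw [sub_self, hu0], by rw [sub_self, hc.deriv_zero], fun t ht ↦ ?_⟩
  · have ht' := hsub t ht
    obtain ⟨h1, h2⟩ := (hc.geod (t - σ) (Icc_subset_Icc_right (min_le_right _ _) ht')).2 e h.smooth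
      (hcl _ ht').1
    exact ⟨HasDerivAt.comp_sub_const t σ h1, HasDerivAt.comp_sub_const t σ h2⟩
  · have ht' := hsub t ht
    obtain ⟨h1, h2, h3⟩ := hcl _ ht'
    refine ⟨h1, ⟨t - σ, Icc_subset_Icc_right (min_le_right _ _) ht', rfl⟩, ?_, by linarith⟩
    have h4 : e (c (t - σ)) - t • bvec 0 =
        (e (c (t - σ)) - (0 + (t - σ) • bvec 0)) - σ • bvec 0 := by module
    rw [h4]
    refine (norm_sub_le _ _).trans ?_
    rw [norm_smul, norm_bvec, mul_one, Real.norm_of_nonneg hσ0]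
    linarith [hσ.trans (min_le_right _ _)]

lemma IsSmoothChart.contDiffOn_transition {e e' : OpenPartialHomeomorph M E3}
    (he : IsSmoothChart e) (he' : IsSmoothChart e') :
    ContDiffOn ℝ ∞ (fun u ↦ e' (e.symm u)) (e.target ∩ e.symm ⁻¹' e'.source) := by
  rw [← contMDiffOn_iff_contDiffOn]
  exact he'.contMDiffOn.comp (he.contMDiffOn_symm.mono inter_subset_left) fun u hu ↦ hu.2

/-- The tubes about geodesic segments with initial data close to those of the axis have volume
`O(δ²)`. -/
lemma IsUnitAxis.exists_forall_measure_tube_le [IsRiemannianManifold (𝓡 3) M] [MeasurableSpace M]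
    [BorelSpace M] {e : OpenPartialHomeomorph M E3} {T α : ℝ} (h : IsUnitAxis e T) (hα : 0 < α)
    (hinj : HasInjRadiusGT M (2 * α)) :
    ∃ η B δ₀ : ℝ, 0 < η ∧ 0 < B ∧ 0 < δ₀ ∧ ∀ (c : ℝ → M) (u V : E3), IsGeodFrom e α c u V →
      ‖u‖ ≤ η → ‖V - bvec 0‖ ≤ η → ∀ δ : ℝ, 0 < δ → δ < δ₀ →
      μHE[3] (Metric.cthickening δ (c '' Icc 0 (α / ‖coordVec e u V‖))) ≤
        ENNReal.ofReal (B * δ ^ 2) := by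
  have h0 := h.zero_mem
  obtain ⟨r, hr, hx⟩ := hinj (e.symm 0)
  have hr0 : 0 < r := by linarith
  have hτ : ‖coordVec e 0 (bvec 0)‖ = 1 := by
    have h1 := norm_coordVec_sq e 0 (bvec 0)
    rw [h.unit] at h1
    nlinarith [norm_nonneg (coordVec e 0 (bvec 0))]
  obtain ⟨e', hn, hx0, hpair⟩ := hx.exists_normalChart hr0 hτ
  have he' := hn.smooth
  have hmem' : ∀ v : E3, ‖v‖ < r → v ∈ e'.target := by
    intro v hv; rw [hn.target_eq]; simpa using hv
  have h0' : (0 : E3) ∈ e'.target := hmem' 0 (by simpa using hr0)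
  have hline : ∀ t ∈ Icc 0 (3 / 2 * α), (0 : E3) + t • bvec 0 ∈ e'.target := by
    intro t ht
    refine hmem' _ ?_
    rw [zero_add, norm_smul, norm_bvec, mul_one, Real.norm_of_nonneg ht.1]
    linarith [ht.2]
  have hgeod : ∀ t ∈ Icc 0 (3 / 2 * α), gam e' (0 + t • bvec 0) (bvec 0) (bvec 0) = 0 := by
    intro t ht
    refine IsGeodesicOn.gam_line he' isOpen_Ioo (s := Ioo (-r) r) ?_
      ⟨by linarith [ht.1], by linarith [ht.2]⟩ (hline t ht)
    simpa using (hn.rays (bvec 0) (norm_bvec 0)).1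
  obtain ⟨η₁, hη₁, hclose⟩ := he'.exists_forall_geodCurve_close (u₀ := 0) (f := bvec 0)
    (T := 3 / 2 * α) (by positivity) hline hgeod (ε := min (α / 4) 1) (by positivity)
  obtain ⟨η₂, hη₂, hnorm⟩ := h.exists_forall_norm
  -- the transition map
  set φ : E3 → E3 := fun u ↦ e' (e.symm u) with hφ
  set O := e.target ∩ e.symm ⁻¹' e'.source with hO
  have hOo : IsOpen O := e.isOpen_inter_preimage_symm e'.open_source
  have hφs : ContDiffOn ℝ ∞ φ O := h.smooth.contDiffOn_transition he'
  have h0O : (0 : E3) ∈ O := ⟨h0, by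
    change e.symm 0 ∈ e'.source
    rw [← hx0]; exact e'.map_target h0'⟩
  have hφ0 : φ 0 = 0 := by
    change e' (e.symm 0) = 0
    rw [← hx0, e'.right_inv h0']
  have hφd : fderiv ℝ φ 0 (bvec 0) = bvec 0 := by
    have h1 := mfderiv_comp (I := 𝓡 3) (I' := 𝓡 3) (I'' := 𝓡 3) (0 : E3)
      (g := e') (f := e.symm) (he'.mdifferentiableAt h0O.2) (h.smooth.mdifferentiableAt_symm h0)
    have h2 : fderiv ℝ φ 0 (bvec 0) =
        mfderiv (𝓡 3) (𝓡 3) e' (e.symm 0) (coordVec e 0 (bvec 0)) := by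
      rw [← mfderiv_eq_fderiv]
      exact congr($h1 (bvec 0))
    rw [h2]
    set γ : ℝ → M := fun t ↦ e'.symm (t • bvec 0) with hγ
    have h3 : mfderiv (𝓡 3) (𝓡 3) e' (γ 0) (velocity γ 0) =
        (show E3 from mfderiv (𝓡 3) (𝓡 3) e' (e.symm 0) (coordVec e 0 (bvec 0))) :=
      congrArg (fun p : TangentBundle (𝓡 3) M ↦ (show E3 from mfderiv (𝓡 3) (𝓡 3) e' p.1 p.2)) hpair
    have hγ0 : γ 0 ∈ e'.source := by
      change e'.symm ((0 : ℝ) • bvec 0) ∈ _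
      rw [zero_smul]; exact e'.map_target h0'
    have h4 := deriv_chart_comp (((hn.rays (bvec 0) (norm_bvec 0)).1.1.contMDiffAt
      (isOpen_Ioo.mem_nhds ⟨by linarith, hr0⟩)).mdifferentiableAt (by simp) :
        MDifferentiableAt 𝓘(ℝ, ℝ) (𝓡 3) γ 0) he' hγ0
    refine h3.symm.trans (h4.symm.trans ?_)
    have hev : (fun t : ℝ ↦ e' (γ t)) =ᶠ[𝓝 0] fun t ↦ t • bvec 0 := by
      have : ∀ᶠ t : ℝ in 𝓝 0, t • bvec 0 ∈ e'.target := by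
        have hc : ContinuousAt (fun t : ℝ ↦ t • bvec 0) 0 := by fun_prop
        refine hc.eventually (e'.open_target.mem_nhds ?_)
        simpa using h0'
      filter_upwards [this] with t ht using e'.right_inv ht
    rw [hev.deriv_eq]
    simpa using ((hasDerivAt_id (0 : ℝ)).smul_const (bvec 0)).deriv
  have hcont : ContinuousAt (fun p : E3 × E3 ↦ (φ p.1, fderiv ℝ φ p.1 p.2)) (0, bvec 0) := by
    have h1 : ContinuousAt φ 0 := (hφs.continuousOn 0 h0O).continuousAt (hOo.mem_nhds h0O)
    have h2 : ContinuousAt (fderiv ℝ φ) 0 :=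
      ((hφs.continuousOn_fderiv_of_isOpen hOo (by simp)) 0 h0O).continuousAt (hOo.mem_nhds h0O)
    refine ContinuousAt.prodMk ?_ ?_
    · exact ContinuousAt.comp (x := ((0 : E3), bvec 0)) (f := Prod.fst) h1 continuousAt_fst
    · exact (ContinuousAt.comp (x := ((0 : E3), bvec 0)) (f := Prod.fst) h2 continuousAt_fst).clm_apply continuousAt_snd
  have hev : ∀ᶠ p : E3 × E3 in 𝓝 (0, bvec 0), dist (φ p.1, fderiv ℝ φ p.1 p.2) (0, bvec 0) < η₁ := by
    have := hcont.eventually (Metric.ball_mem_nhds _ hη₁)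
    simpa only [hφ0, hφd, Metric.mem_ball] using this
  have hev2 : ∀ᶠ p : E3 × E3 in 𝓝 (0, bvec 0), p.1 ∈ O :=
    continuous_fst.continuousAt.eventually (hOo.mem_nhds h0O)
  obtain ⟨η₃, hη₃, hb⟩ := Metric.eventually_nhds_iff.1 (hev.and hev2)
  have hKt : Metric.closedBall (0 : E3) (7 / 4 * α) ⊆ e'.target := by
    intro v hv
    refine hmem' v ?_
    rw [mem_closedBall_zero_iff] at hv
    linarith
  obtain ⟨R, C, hbil⟩ := he'.exists_isBilipOn (isCompact_closedBall 0 (7 / 4 * α)) hKt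
  obtain ⟨B, δ₀, hB, hδ₀, htube⟩ := hbil.measure_tube_le (L := 2) (T₀ := 3 / 2 * α) (by norm_num)
    (by positivity)
  refine ⟨min η₂ (η₃ / 2), B, δ₀, by positivity, hB, hδ₀, fun c u V hc hu hV δ hδ hδ' ↦ ?_⟩
  obtain ⟨hue, hV0, hN1, hN2⟩ := hnorm u V (hu.trans (min_le_left _ _)) (hV.trans (min_le_left _ _))
  set N := ‖coordVec e u V‖ with hN
  have hNpos : 0 < N := by linarith
  obtain ⟨hd1, hd2⟩ := hb (y := (u, V)) (by
    rw [Prod.dist_eq, dist_zero_right, dist_eq_norm]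
    exact max_lt (by simp only; linarith [hu.trans (min_le_right _ _)])
      (by simp only; linarith [hV.trans (min_le_right _ _)]))
  simp only at hd1 hd2
  rw [Prod.dist_eq, dist_zero_right, dist_eq_norm] at hd1
  have hs : c 0 ∈ e.source := by rw [hc.zero]; exact e.map_target hue
  have hs' : c 0 ∈ e'.source := by rw [hc.zero]; exact hd2.2
  have hαN0 : 0 ≤ α / N := by positivity
  have h0I : (0 : ℝ) ∈ Icc 0 (α / N) := ⟨le_rfl, hαN0⟩
  have hαN : α / N ≤ 3 / 2 * α := by
    rw [div_le_iff₀ hNpos]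
    nlinarith
  have hder : deriv (fun τ ↦ e' (c τ)) 0 = fderiv ℝ φ u V := by
    have h1 := ((hc.geod 0 h0I).2 e h.smooth hs).1
    rw [hc.deriv_zero] at h1
    have hec : e (c 0) = u := by rw [hc.zero, e.right_inv hue]
    have h2 : HasFDerivAt φ (fderiv ℝ φ u) (e (c 0)) := by
      rw [hec]
      exact (((hφs u hd2).contDiffAt (hOo.mem_nhds hd2)).differentiableAt (by simp)).hasFDerivAt
    have h3 := h2.comp_hasDerivAt (0 : ℝ) h1
    refine (h3.congr_of_eventuallyEq ?_).deriv
    filter_upwards [(hc.geod 0 h0I).1.eventually (e.open_source.mem_nhds hs)] with t ht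
    change e' (c t) = e' (e.symm (e (c t)))
    rw [e.left_inv ht]
  have hcl := hclose c (α / N) hαN hc.geod hs'
    (by rw [sub_zero, hc.zero]; exact (lt_of_le_of_lt (le_max_left _ _) hd1).le)
    (by rw [hder]; exact (lt_of_le_of_lt (le_max_right _ _) hd1).le)
  have him : c '' Icc 0 (α / N) = (fun t ↦ e'.symm (e' (c t))) '' Icc 0 (α / N) :=
    image_congr fun t ht ↦ (e'.left_inv (hcl t ht).1).symm
  rw [him]
  refine htube δ hδ hδ' (fun t ↦ e' (c t)) (α / N) hαN (fun t ht ↦ ?_) (fun t ht t' ht' ↦ ?_)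
  · have h1 := (hcl t ht).2.1
    rw [mem_closedBall_zero_iff]
    have h2 : ‖e' (c t)‖ ≤ ‖e' (c t) - (0 + t • bvec 0)‖ + ‖(0 : E3) + t • bvec 0‖ := by
      simpa using norm_add_le (e' (c t) - (0 + t • bvec 0)) (0 + t • bvec 0)
    rw [zero_add, norm_smul, norm_bvec, mul_one, Real.norm_of_nonneg ht.1] at h2
    rw [zero_add] at h1
    linarith [ht.2, h1.trans (min_le_left _ _)]
  · have hbd : ∀ t ∈ Icc 0 (α / N), ‖deriv (fun τ ↦ e' (c τ)) t‖ ≤ 2 := by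
      intro t ht
      have h1 := (hcl t ht).2.2.trans (min_le_right _ _)
      have h2 : ‖deriv (fun τ ↦ e' (c τ)) t‖ ≤
          ‖deriv (fun τ ↦ e' (c τ)) t - bvec 0‖ + ‖bvec 0‖ := by
        simpa using norm_add_le (deriv (fun τ ↦ e' (c τ)) t - bvec 0) (bvec 0)
      rw [norm_bvec] at h2
      linarith
    have := (convex_Icc 0 (α / N)).norm_image_sub_le_of_norm_hasDerivWithin_le
      (f := fun τ ↦ e' (c τ)) (f' := deriv (fun τ ↦ e' (c τ)))
      (fun t ht ↦ ((hc.geod t ht).2 e' he' (hcl t ht).1).1.hasDerivWithinAt) hbd ht' ht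
    rw [dist_eq_norm]
    simpa using this
end

/-- Coordinate boxes. -/
def euclideanBox {n : ℕ} (lo hi : Fin n → ℝ) : Set (EuclideanSpace ℝ (Fin n)) :=
  WithLp.ofLp ⁻¹' Icc lo hi

lemma mem_euclideanBox {n : ℕ} {lo hi : Fin n → ℝ} {p : EuclideanSpace ℝ (Fin n)} :
    p ∈ euclideanBox lo hi ↔ ∀ i, p i ∈ Icc (lo i) (hi i) := by
  simp only [euclideanBox, mem_preimage, mem_Icc, Pi.le_def]
  exact ⟨fun h i ↦ ⟨h.1 i, h.2 i⟩, fun h ↦ ⟨fun i ↦ (h i).1, fun i ↦ (h i).2⟩⟩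

lemma isCompact_euclideanBox {n : ℕ} (lo hi : Fin n → ℝ) : IsCompact (euclideanBox lo hi) :=
  (PiLp.homeomorph 2 fun _ : Fin n ↦ ℝ).isCompact_preimage.2 isCompact_Icc

lemma volume_euclideanBox {n : ℕ} (lo hi : Fin n → ℝ) :
    (volume (euclideanBox lo hi) : ℝ≥0∞) = ∏ i, ENNReal.ofReal (hi i - lo i) := by
  rw [euclideanBox, (PiLp.volume_preserving_ofLp (Fin n)).measure_preimage
    measurableSet_Icc.nullMeasurableSet, Real.volume_Icc_pi]

section
variable {X : Type*} [MeasurableSpace X] {μ : Measure X}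

lemma ofReal_le_eLpNorm_of_forall_le {g : X → ℝ≥0∞} {E : Set X} (hE : MeasurableSet E)
    {l m : ℝ} (hl : 0 ≤ l) (hm : 0 < m) (hEm : ENNReal.ofReal m ≤ μ E)
    (hg : ∀ x ∈ E, ENNReal.ofReal l ≤ g x) {q : ℝ≥0∞} (hq : 1 ≤ q) :
    ENNReal.ofReal (l * m ^ (1 / q.toReal)) ≤ eLpNorm g q μ := by
  have h1 : eLpNorm (E.indicator fun _ ↦ l) q μ ≤ eLpNorm g q μ := by
    refine eLpNorm_mono_enorm fun x ↦ ?_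
    by_cases hx : x ∈ E
    · rw [indicator_of_mem hx, Real.enorm_eq_ofReal hl]
      exact hg x hx
    · rw [indicator_of_notMem hx]
      simp
  refine le_trans ?_ h1
  have hq0 : q ≠ 0 := (zero_lt_one.trans_le hq).ne'
  have hμE : μ E ≠ 0 := ((ENNReal.ofReal_pos.2 hm).trans_le hEm).ne'
  rw [eLpNorm_indicator_const' hE hμE hq0, Real.enorm_eq_ofReal hl, ENNReal.ofReal_mul hl,
    ← ENNReal.ofReal_rpow_of_pos hm]
  gcongr
end

section
variable {M : Type*} [EMetricSpace M] [ChartedSpace E3 M] [IsManifold (𝓡 3) ∞ M]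
    [RiemannianBundle (fun x : M ↦ TangentSpace (𝓡 3) x)]
    [IsContMDiffRiemannianBundle (𝓡 3) ∞ E3 (fun x : M ↦ TangentSpace (𝓡 3) x)]

/-- The inverse of the chart `e` is bi-Lipschitz on the ball of radius `R` about `0`. -/
structure IsBilipBall (e : OpenPartialHomeomorph M E3) (R C : ℝ) : Prop where
  pos : 0 < R
  one_le : 1 ≤ C
  subset : Metric.closedBall 0 R ⊆ e.target
  upper : ∀ v ∈ Metric.closedBall (0 : E3) R, ∀ w ∈ Metric.closedBall (0 : E3) R,
    edist (e.symm v) (e.symm w) ≤ ENNReal.ofReal C * edist v w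
  lower : ∀ v ∈ Metric.closedBall (0 : E3) R, ∀ w ∈ Metric.closedBall (0 : E3) R,
    edist v w ≤ ENNReal.ofReal C * edist (e.symm v) (e.symm w)

lemma IsSmoothChart.exists_isBilipBall [IsRiemannianManifold (𝓡 3) M]
    {e : OpenPartialHomeomorph M E3} (he : IsSmoothChart e)
    (h0 : (0 : E3) ∈ e.target) : ∃ R C : ℝ, IsBilipBall e R C := by
  obtain ⟨R₁, hR₁, hsub⟩ := Metric.nhds_basis_closedBall.mem_iff.1 (e.open_target.mem_nhds h0)
  obtain ⟨R, C, h⟩ := he.exists_isBilipOn (isCompact_closedBall 0 R₁) hsub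
  have hC := h.one_le
  have hR := h.radius_pos
  have h0m : (0 : E3) ∈ Metric.closedBall (0 : E3) R₁ := Metric.mem_closedBall_self hR₁.le
  set R' := min (min R₁ R) (R / (C * C * 3)) with hR'
  have hR'0 : 0 < R' := by positivity
  have hR'1 : R' ≤ R₁ := (min_le_left _ _).trans (min_le_left _ _)
  have hR'2 : R' ≤ R := (min_le_left _ _).trans (min_le_right _ _)
  have hs1 := Metric.closedBall_subset_closedBall (x := (0 : E3)) hR'1
  have hs2 := Metric.closedBall_subset_closedBall (x := (0 : E3)) hR'2
  refine ⟨R', C, hR'0, hC, hs1.trans hsub, fun v hv w hw ↦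
    h.upper 0 h0m v (hs2 hv) w (hs2 hw), fun v hv w hw ↦ ?_⟩
  have h1 := h.upper 0 h0m v (hs2 hv) w (hs2 hw)
  have h2 : edist v w ≤ ENNReal.ofReal (2 * R') := by
    rw [edist_dist]
    refine ENNReal.ofReal_le_ofReal ?_
    have := dist_triangle_right v w 0
    rw [Metric.mem_closedBall] at hv hw
    linarith
  have h3 : edist (e.symm v) (e.symm w) < ENNReal.ofReal (R / C) := by
    refine (h1.trans (mul_le_mul_right h2 _)).trans_lt ?_
    rw [← ENNReal.ofReal_mul (by positivity), ENNReal.ofReal_lt_ofReal_iff (by positivity),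
      lt_div_iff₀ (by positivity)]
    have h4 : R' * (C * C * 3) ≤ R := by
      rw [← le_div_iff₀ (by positivity)]; exact min_le_right _ _
    nlinarith [mul_pos hR'0 (mul_pos (zero_lt_one.trans_le hC) (zero_lt_one.trans_le hC))]
  have h5 := (h.lower v (hs1 hv) (e.symm w) h3).2
  rwa [e.right_inv (hsub (hs1 hw))] at h5

lemma IsBilipBall.image_compact {e : OpenPartialHomeomorph M E3} {R C : ℝ}
    (h : IsBilipBall e R C) {K : Set E3} (hK : IsCompact K) {G : E3 → E3} (hG : ContinuousOn G K)
    (hGR : ∀ p ∈ K, ‖G p‖ ≤ R) : IsCompact ((fun p ↦ e.symm (G p)) '' K) := by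
  refine hK.image_of_continuousOn ?_
  exact (e.continuousOn_symm.mono h.subset).comp hG fun p hp ↦ by
    rw [mem_closedBall_zero_iff]; exact hGR p hp

lemma IsBilipBall.volume_le_image [MeasurableSpace M] [BorelSpace M]
    {e : OpenPartialHomeomorph M E3} {R C : ℝ}
    (h : IsBilipBall e R C) {K : Set E3} {G : E3 → E3} (hGR : ∀ p ∈ K, ‖G p‖ ≤ R) {A : ℝ}
    (hA0 : 0 ≤ A) (hA : ∀ p ∈ K, ∀ q ∈ K, ‖p - q‖ ≤ A * ‖G p - G q‖) :
    volume K ≤ ENNReal.ofReal ((A * C) ^ 3) * μHE[3] ((fun p ↦ e.symm (G p)) '' K) := by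
  have hC := h.one_le
  have := euclideanHausdorffMeasure_le_image (f := fun p ↦ e.symm (G p)) (s := K) (C := A * C) 3 ?_
  · rwa [EuclideanSpace.euclideanHausdorffMeasure_eq_volume,
      ← ENNReal.ofReal_pow (by positivity)] at this
  · intro p hp q hq
    have h1 : edist p q ≤ ENNReal.ofReal A * edist (G p) (G q) := by
      rw [edist_dist, edist_dist, ← ENNReal.ofReal_mul hA0, dist_eq_norm, dist_eq_norm]
      exact ENNReal.ofReal_le_ofReal (hA p hp q hq)
    have h2 := h.lower (G p) (by rw [mem_closedBall_zero_iff]; exact hGR p hp) (G q)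
      (by rw [mem_closedBall_zero_iff]; exact hGR q hq)
    refine h1.trans ?_
    rw [ENNReal.ofReal_mul hA0, mul_assoc]
    gcongr

/-- The thickening of a curve that is nearly parallel to the first coordinate axis: it lies in the
tube about the curve, and its volume is comparable to that of the tube. -/
lemma IsBilipBall.thick_curve [MeasurableSpace M] [BorelSpace M]
    {e : OpenPartialHomeomorph M E3} {R C : ℝ}
    (h : IsBilipBall e R C) {u : ℝ → E3} {t₁ t₂ δ : ℝ} (ht : t₁ ≤ t₂) (hδ : 0 < δ)
    (hδR : δ ≤ R / 2)
    (hu : ∀ t ∈ Icc t₁ t₂, ‖u t‖ ≤ R / 2)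
    (hul : ∀ t ∈ Icc t₁ t₂, ∀ t' ∈ Icc t₁ t₂, ‖u t - u t' - (t - t') • bvec 0‖ ≤ |t - t'| / 2)
    {S : Set M} (hS : ∀ t ∈ Icc t₁ t₂, e.symm (u t) ∈ S) :
    ∃ W : Set M, MeasurableSet W ∧ W ⊆ Metric.cthickening δ S ∧
      (∀ y ∈ W, ∃ t ∈ Icc t₁ t₂, ∃ z : E3, ‖z‖ ≤ δ ∧ ‖u t + z‖ ≤ R ∧ y = e.symm (u t + z)) ∧
      ENNReal.ofReal ((t₂ - t₁) * δ ^ 2 / (2 * C) ^ 5) ≤ μHE[3] W := by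
  have hC := h.one_le
  have hR := h.pos
  set d := δ / (2 * C) with hd
  have hd0 : 0 < d := by positivity
  have hdC : 2 * d * C = δ := by rw [hd]; field_simp
  have hdδ : 2 * d ≤ δ := by
    rw [← hdC]; exact le_mul_of_one_le_right (by positivity) hC
  set K := euclideanBox ![t₁, -d, -d] ![t₂, d, d] with hK
  have hKm : ∀ p ∈ K, p 0 ∈ Icc t₁ t₂ ∧ |p 1| ≤ d ∧ |p 2| ≤ d := by
    intro p hp
    rw [hK, mem_euclideanBox] at hp
    exact ⟨hp 0, abs_le.2 (hp 1), abs_le.2 (hp 2)⟩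
  set G : E3 → E3 := fun p ↦ u (p 0) + (p 1 • bvec 1 + p 2 • bvec 2) with hG
  have hz : ∀ p ∈ K, ‖p 1 • bvec 1 + p 2 • bvec 2‖ ≤ 2 * d := by
    intro p hp
    obtain ⟨-, h1, h2⟩ := hKm p hp
    refine (norm_add_le _ _).trans ?_
    rw [norm_smul, norm_smul, norm_bvec, norm_bvec, mul_one, mul_one, Real.norm_eq_abs,
      Real.norm_eq_abs]
    linarith
  have hGR : ∀ p ∈ K, ‖G p‖ ≤ R := by
    intro p hp
    refine (norm_add_le _ _).trans ?_
    linarith [hu _ (hKm p hp).1, hz p hp]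
  have hdiff : ∀ p ∈ K, ∀ q ∈ K, ‖G p - G q - (p - q)‖ ≤ ‖p - q‖ / 2 := by
    intro p hp q hq
    have h1 : G p - G q - (p - q) = u (p 0) - u (q 0) - (p 0 - q 0) • bvec 0 := by
      conv_lhs => rw [hG, E3_eq_sum_three p, E3_eq_sum_three q]
      simp
      module
    rw [h1]
    refine (hul _ (hKm p hp).1 _ (hKm q hq).1).trans ?_
    have := E3_abs_apply_le (p - q) 0
    simp only [PiLp.sub_apply] at this
    linarith
  have hanti : ∀ p ∈ K, ∀ q ∈ K, ‖p - q‖ ≤ 2 * ‖G p - G q‖ := by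
    intro p hp q hq
    have h1 := hdiff p hp q hq
    have h2 := norm_sub_norm_le (p - q) (G p - G q)
    rw [norm_sub_rev (p - q)] at h2
    linarith
  have hcont : ContinuousOn G K := by
    have : LipschitzOnWith 2 G K := by
      refine LipschitzOnWith.of_dist_le_mul fun p hp q hq ↦ ?_
      have h1 := hdiff p hp q hq
      have h2 := norm_sub_norm_le (G p - G q) (p - q)
      rw [dist_eq_norm, dist_eq_norm]
      have h3 := norm_nonneg (p - q)
      push_cast
      linarith
    exact this.continuousOn
  have hKc : IsCompact K := isCompact_euclideanBox _ _
  refine ⟨(fun p ↦ e.symm (G p)) '' K, (h.image_compact hKc hcont hGR).isClosed.measurableSet,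
    ?_, ?_, ?_⟩
  · rintro _ ⟨p, hp, rfl⟩
    rw [Metric.mem_cthickening_iff]
    refine (Metric.infEDist_le_edist_of_mem (hS _ (hKm p hp).1)).trans ?_
    refine (h.upper _ ?_ _ ?_).trans ?_
    · rw [mem_closedBall_zero_iff]; exact hGR p hp
    · rw [mem_closedBall_zero_iff]; linarith [hu _ (hKm p hp).1]
    · rw [edist_dist, ← ENNReal.ofReal_mul (by positivity)]
      refine ENNReal.ofReal_le_ofReal ?_
      rw [dist_eq_norm, hG, add_sub_cancel_left]
      have := mul_le_mul_of_nonneg_left (hz p hp) (by positivity : 0 ≤ C)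
      linarith
  · rintro _ ⟨p, hp, rfl⟩
    exact ⟨p 0, (hKm p hp).1, _, (hz p hp).trans hdδ, hGR p hp, rfl⟩
  · have h1 := h.volume_le_image hGR (by norm_num) hanti
    rw [hK, volume_euclideanBox, Fin.prod_univ_three] at h1
    simp only [Matrix.cons_val_zero, Matrix.cons_val_one, Matrix.cons_val_two, Matrix.head_cons,
      Matrix.tail_cons, sub_neg_eq_add] at h1
    rw [← ENNReal.ofReal_mul (by linarith), ← ENNReal.ofReal_mul (by positivity)] at h1
    have h2 : ENNReal.ofReal ((t₂ - t₁) * δ ^ 2 / (2 * C) ^ 5) * ENNReal.ofReal ((2 * C) ^ 3) ≤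
        ENNReal.ofReal ((2 * C) ^ 3) * μHE[3] ((fun p ↦ e.symm (G p)) '' K) := by
      refine le_trans ?_ h1
      rw [← ENNReal.ofReal_mul (div_nonneg (mul_nonneg (by linarith) (by positivity)) (by positivity))]
      refine ENNReal.ofReal_le_ofReal ?_
      have h3 : (t₂ - t₁) * δ ^ 2 / (2 * C) ^ 5 * (2 * C) ^ 3 = (t₂ - t₁) * (d * d) := by
        rw [hd]; field_simp
      rw [h3]
      have h4 : 0 ≤ (t₂ - t₁) * (d * d) := mul_nonneg (by linarith) (by positivity)
      linarith
    rw [mul_comm] at h2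
    exact (ENNReal.mul_le_mul_iff_right (ENNReal.ofReal_pos.2 (by positivity)).ne'
      ENNReal.ofReal_ne_top).1 h2

lemma ofReal_le_average [MeasurableSpace M] [BorelSpace M] {S W : Set M} {δ B w l : ℝ}
    (hB : 0 < B) (hl : 0 ≤ l) {f : M → ℝ≥0∞}
    (hT : μHE[3] (Metric.cthickening δ S) ≤ ENNReal.ofReal B) (hW : MeasurableSet W)
    (hWS : W ⊆ Metric.cthickening δ S) (hw : ENNReal.ofReal w ≤ μHE[3] W)
    (hf : ∀ y ∈ W, ENNReal.ofReal l ≤ f y) :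
    ENNReal.ofReal (l * w / B) ≤ (μHE[3] (Metric.cthickening δ S))⁻¹ *
      ∫⁻ y in Metric.cthickening δ S, f y ∂μHE[3] := by
  have h1 : ENNReal.ofReal (l * w) ≤ ∫⁻ y in Metric.cthickening δ S, f y ∂μHE[3] := by
    calc ENNReal.ofReal (l * w) = ENNReal.ofReal l * ENNReal.ofReal w := ENNReal.ofReal_mul hl
      _ ≤ ENNReal.ofReal l * μHE[3] W := by gcongr
      _ = ∫⁻ _ in W, ENNReal.ofReal l ∂μHE[3] := by rw [setLIntegral_const]
      _ ≤ ∫⁻ y in W, f y ∂μHE[3] := setLIntegral_mono' hW hf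
      _ ≤ _ := lintegral_mono_set hWS
  rw [div_eq_inv_mul, ENNReal.ofReal_mul (by positivity), ENNReal.ofReal_inv_of_pos hB]
  exact mul_le_mul' (ENNReal.inv_le_inv.2 hT) h1
end

lemma AxisJet.mono {Γ : E3 → E3 →L[ℝ] E3 →L[ℝ] E3} {U : Set E3} {T M M' a b : ℝ}
    (h : AxisJet Γ U T M a b) (hM : M ≤ M') : AxisJet Γ U T M' a b where
  isOpen := h.isOpen
  smooth := h.smooth
  symm := h.symm
  pos := h.pos
  nonneg := h.nonneg.trans hM
  mem := h.mem
  geod := h.geod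
  norm_le t ht := (h.norm_le t ht).trans (mul_le_mul_of_nonneg_right hM ht.1)
  fderiv_le t ht := (h.fderiv_le t ht).trans hM
  fderiv_axis := h.fderiv_axis
  fderiv_cross t ht := (h.fderiv_cross t ht).trans (mul_le_mul_of_nonneg_right hM (sq_nonneg t))
  cross t ht := (h.cross t ht).trans (mul_le_mul_of_nonneg_right hM (pow_nonneg ht.1 3))

lemma IsGeodSol.mono {Γ : E3 → E3 →L[ℝ] E3 →L[ℝ] E3} {u v : ℝ → E3} {I J : Set ℝ}
    (h : IsGeodSol Γ u v I) (hJ : J ⊆ I) : IsGeodSol Γ u v J := fun t ht ↦ h t (hJ ht)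

/-- A vector that is the sum of a transversal part and a nearly axial part controls both. -/
lemma abs_add_le_of_transversal {w r D : E3} {m d ε c : ℝ} (hD : D = w + d • bvec 0 + r)
    (hw : c * m ≤ |w 1| + |w 2|) (hw' : ‖w‖ ≤ 6 * m) (hr : ‖r‖ ≤ ε * |d|) (hc : 0 < c)
    (hc1 : c ≤ 1) (hε : 50 * ε ≤ c) : |d| + m ≤ 54 / c * ‖D‖ := by
  have h0 : |d| ≤ ‖D‖ + 6 * m + ε * |d| := by
    have h1 : d • bvec 0 = D - w - r := by rw [hD]; abel
    have h2 : ‖d • bvec 0‖ = |d| := by rw [norm_smul, norm_bvec, mul_one, Real.norm_eq_abs]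
    have h3 := norm_sub_le (D - w) r
    have h4 := norm_sub_le D w
    rw [← h1, h2] at h3
    linarith
  have h1 : ∀ i : Fin 3, i ≠ 0 → |w i| ≤ ‖D‖ + ε * |d| := by
    intro i hi
    have h2 : w i = (D - r) i := by rw [hD]; simp [hi]
    rw [h2]
    exact (E3_abs_apply_le _ i).trans ((norm_sub_le _ _).trans (by linarith))
  have h2 := h1 1 (by decide)
  have h3 := h1 2 (by decide)
  have hd := abs_nonneg d
  have h4 : c * m ≤ 2 * ‖D‖ + 2 * (ε * |d|) := by linarith
  have h5 : 50 * (ε * |d|) ≤ c * |d| := by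
    linarith [mul_le_mul_of_nonneg_right hε hd]
  have h6 : c * |d| ≤ |d| := mul_le_of_le_one_left hd hc1
  rw [div_mul_eq_mul_div, le_div_iff₀ hc]
  have h7 : c * ‖D‖ ≤ ‖D‖ := mul_le_of_le_one_left (norm_nonneg _) hc1
  have h8 := mul_le_mul_of_nonneg_left h0 hc.le
  have h9 : c * (ε * |d|) ≤ c * |d| / 50 := by
    have := mul_le_mul_of_nonneg_left (show ε * |d| ≤ |d| / 50 by linarith) hc.le
    linarith
  linarith [norm_nonneg D]

lemma norm_sub_sub_smul_le {u v : ℝ → E3} {a b ε : ℝ} (hu : ∀ t ∈ Icc a b, HasDerivAt u (v t) t)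
    (hv : ∀ t ∈ Icc a b, ‖v t - bvec 0‖ ≤ ε) {t t' : ℝ} (ht : t ∈ Icc a b) (ht' : t' ∈ Icc a b) :
    ‖u t - u t' - (t - t') • bvec 0‖ ≤ ε * |t - t'| := by
  have hd : ∀ t ∈ Icc a b, HasDerivWithinAt (fun t ↦ u t - t • bvec 0) (v t - bvec 0) (Icc a b) t := by
    intro t ht
    refine ((hu t ht).sub ?_).hasDerivWithinAt
    simpa using (hasDerivAt_id t).smul_const (bvec 0)
  have := (convex_Icc a b).norm_image_sub_le_of_norm_hasDerivWithin_le hd hv ht' ht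
  rw [Real.norm_eq_abs] at this
  have h : u t - u t' - (t - t') • bvec 0 = (u t - t • bvec 0) - (u t' - t' • bvec 0) := by module
  rwa [h]

section
variable {M : Type*} [EMetricSpace M] [ChartedSpace E3 M] [IsManifold (𝓡 3) ∞ M]
    [RiemannianBundle (fun x : M ↦ TangentSpace (𝓡 3) x)]
    [IsContMDiffRiemannianBundle (𝓡 3) ∞ E3 (fun x : M ↦ TangentSpace (𝓡 3) x)]

lemma slabFun_symm {e : OpenPartialHomeomorph M E3} {B : Set E3} {z : E3} (hz : z ∈ e.target)
    (hB : z ∈ B) : slabFun e B (e.symm z) = 1 := by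
  rw [slabFun, indicator_of_mem]
  exact ⟨e.map_target hz, by rwa [mem_preimage, e.right_inv hz]⟩

variable [IsRiemannianManifold (𝓡 3) M] [MeasurableSpace M] [BorelSpace M]

/-- If the geodesics with initial data in a box (of dimensions `k ^ (j + 1)` and `k ^ j`) stay in
the slab `B k` for a time comparable to `k`, and spread later, then the Nikodym maximal function
of the slab is large on a set of measure comparable to `k ^ (2 j + 1)`. -/
theorem exists_forall_le_nikodymMax {e : OpenPartialHomeomorph M E3} {T M₀ a b α : ℝ} (hα : 0 < α)
    (hinj : HasInjRadiusGT M (2 * α)) (hax : IsUnitAxis e T)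
    (hj : AxisJet (gam e) e.target T M₀ a b) (hab : a ≠ 2 * b) {F : Set (Set M)}
    (hF : ∃ η : ℝ, 0 < η ∧ ∀ (c : ℝ → M) (u V : E3), IsGeodFrom e α c u V → ‖u‖ ≤ η →
      ‖V - bvec 0‖ ≤ η → c '' Icc 0 (α / ‖coordVec e u V‖) ∈ F)
    {n j : ℕ} (hn : n ≠ 0) {B : ℝ → Set E3}
    (hslab : ∃ η c₀ k₀ : ℝ, 0 < η ∧ 0 < c₀ ∧ 0 < k₀ ∧ ∀ k x τ : ℝ, 0 < k → k ≤ k₀ →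
      |x| ≤ c₀ * k ^ (j + 1) → |τ| ≤ c₀ * k ^ j → ∀ u v : ℝ → E3,
      IsGeodSol (gam e) u v (Icc 0 (c₀ * k)) →
      (∀ t ∈ Icc 0 (c₀ * k), u t ∈ e.target ∧ ‖u t - t • bvec 0‖ ≤ η ∧ ‖v t - bvec 0‖ ≤ η) →
      u 0 = x • bvec 1 → v 0 = bvec 0 + τ • bvec 1 → ∀ t ∈ Icc 0 (c₀ * k), ∀ z : E3,
      ‖z‖ ≤ k ^ n / 2 → u t + z ∈ B k) :
    ∃ cE cA : ℝ, 0 < cE ∧ 0 < cA ∧ ∀ᶠ k : ℝ in 𝓝[>] 0, ∃ E : Set M, MeasurableSet E ∧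
      ENNReal.ofReal (cE * k ^ (2 * j + 1)) ≤ μHE[3] E ∧
      ∀ y ∈ E, ENNReal.ofReal (cA * k) ≤ nikodymMax F (k ^ n) (slabFun e (B k)) y := by
  obtain ⟨ηF, hηF, hF⟩ := hF
  obtain ⟨ηs, c₀, k₀, hηs, hc₀, hk₀, hslab⟩ := hslab
  obtain ⟨ηn, hηn, hnorm⟩ := hax.exists_forall_norm
  obtain ⟨ηt, Bt, δt, hηt, hBt, hδt, htube⟩ := hax.exists_forall_measure_tube_le hα hinj
  obtain ⟨R, C, hbil⟩ := hax.smooth.exists_isBilipBall hax.zero_mem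
  have hR := hbil.pos
  have hC := hbil.one_le
  set M₁ := max M₀ (max |a| |b|) with hM₁
  have hj' := hj.mono (le_max_left M₀ (max |a| |b|))
  have haM : |a| ≤ M₁ := (le_max_left _ _).trans (le_max_right _ _)
  have hbM : |b| ≤ M₁ := (le_max_right _ _).trans (le_max_right _ _)
  have hκ : 0 < |a - 2 * b| := abs_pos.2 (sub_ne_zero.2 hab)
  obtain ⟨S, c, hS, hS1, hc, hspread⟩ := exists_forall_axisJet_spread hj'.nonneg hκ
  have hTpos := hax.pos
  set T' := min T (α / 2) with hT'
  have hT'0 : 0 < T' := by positivity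
  obtain ⟨s₁, hs₁⟩ : ∃ s₁, s₁ = min (min (S / 2) (T' / 2)) (R / 8) := ⟨_, rfl⟩
  have hs₁0 : 0 < s₁ := by rw [hs₁]; positivity
  have hs₁S : 2 * s₁ ≤ S := by
    have : s₁ ≤ S / 2 := hs₁ ▸ (min_le_left _ _).trans (min_le_left _ _)
    linarith
  have hs₁T' : 2 * s₁ ≤ T' := by
    have : s₁ ≤ T' / 2 := hs₁ ▸ (min_le_left _ _).trans (min_le_right _ _)
    linarith
  have hs₁R : 2 * s₁ ≤ R / 4 := by
    have : s₁ ≤ R / 8 := hs₁ ▸ min_le_right _ _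
    linarith
  obtain ⟨ηp, hηp, hspread⟩ := hspread (gam e) e.target T a b s₁ hj' haM hbM le_rfl hs₁0 hs₁S
    (hs₁T'.trans (min_le_left _ _))
  set c' := min (c * s₁ ^ 4) 1 with hc'
  have hc'0 : 0 < c' := by positivity
  have hc'1 : c' ≤ 1 := min_le_right _ _
  set ε := min (min ηp ηs) (min (R / 4) (c' / 50)) with hε
  have hε0 : 0 < ε := by positivity
  have hεp : ε ≤ ηp := (min_le_left _ _).trans (min_le_left _ _)
  have hεs : ε ≤ ηs := (min_le_left _ _).trans (min_le_right _ _)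
  have hεR : ε ≤ R / 4 := (min_le_right _ _).trans (min_le_left _ _)
  have hεc : 50 * ε ≤ c' := by
    have : ε ≤ c' / 50 := (min_le_right _ _).trans (min_le_right _ _)
    linarith
  obtain ⟨ηl, hηl, hlocal⟩ := hax.exists_forall_isGeodSol (α := α) (min_le_left T (α / 2))
    (min_le_right T (α / 2)) hε0
  set c₁ := min (min (min c₀ ηF) (min ηn ηt)) ηl with hc₁
  have hc₁0 : 0 < c₁ := by positivity
  have hc₁c₀ : c₁ ≤ c₀ := (min_le_left _ _).trans ((min_le_left _ _).trans (min_le_left _ _))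
  have hc₁F : c₁ ≤ ηF := (min_le_left _ _).trans ((min_le_left _ _).trans (min_le_right _ _))
  have hc₁n : c₁ ≤ ηn := (min_le_left _ _).trans ((min_le_right _ _).trans (min_le_left _ _))
  have hc₁t : c₁ ≤ ηt := (min_le_left _ _).trans ((min_le_right _ _).trans (min_le_right _ _))
  have hc₁l : c₁ ≤ ηl := min_le_right _ _
  have hux : ∀ x : ℝ, ‖x • bvec 1‖ = |x| := fun x ↦ by simp [norm_smul]
  have hVτ : ∀ τ : ℝ, ‖bvec 0 + τ • bvec 1 - bvec 0‖ = |τ| := fun τ ↦ by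
    rw [add_sub_cancel_left, hux]
  have hex : ∀ x τ : ℝ, ∃ cv : ℝ → M, |x| ≤ c₁ → |τ| ≤ c₁ →
      IsGeodFrom e α cv (x • bvec 1) (bvec 0 + τ • bvec 1) := by
    intro x τ
    by_cases h : |x| ≤ c₁ ∧ |τ| ≤ c₁
    · obtain ⟨h1, h2, -, -⟩ := hnorm (x • bvec 1) (bvec 0 + τ • bvec 1)
        (by rw [hux]; exact h.1.trans hc₁n) (by rw [hVτ]; exact h.2.trans hc₁n)
      obtain ⟨cv, hcv⟩ := hinj.exists_isGeodFrom hα hax.smooth h1 h2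
      exact ⟨cv, fun _ _ ↦ hcv⟩
    · exact ⟨fun _ ↦ e.symm 0, fun h1 h2 ↦ (h ⟨h1, h2⟩).elim⟩
  choose cv hcv using hex
  set U : ℝ → ℝ → ℝ → E3 := fun x τ t ↦ e (cv x τ (t - 0)) with hU
  set Vl : ℝ → ℝ → ℝ → E3 := fun x τ t ↦ deriv (fun s ↦ e (cv x τ s)) (t - 0) with hVl
  have hloc : ∀ x τ : ℝ, |x| ≤ c₁ → |τ| ≤ c₁ → IsGeodSol (gam e) (U x τ) (Vl x τ) (Icc 0 T') ∧
      U x τ 0 = x • bvec 1 ∧ Vl x τ 0 = bvec 0 + τ • bvec 1 ∧ ∀ t ∈ Icc 0 T',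
        cv x τ t ∈ e.source ∧
        cv x τ t ∈ cv x τ '' Icc 0 (α / ‖coordVec e (x • bvec 1) (bvec 0 + τ • bvec 1)‖) ∧
        ‖U x τ t - t • bvec 0‖ ≤ ε ∧ ‖Vl x τ t - bvec 0‖ ≤ ε := by
    intro x τ hx hτ
    have := hlocal (cv x τ) _ _ 0 (hcv x τ hx hτ) (by rw [hux]; exact hx.trans hc₁l)
      (by rw [hVτ]; exact hτ.trans hc₁l) le_rfl hηl.le
    refine ⟨this.1, this.2.1, this.2.2.1, fun t ht ↦ ?_⟩
    have h2 := this.2.2.2 t ht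
    rw [sub_zero] at h2
    simpa only [hU, hVl, sub_zero] using h2
  have hUR : ∀ x τ : ℝ, |x| ≤ c₁ → |τ| ≤ c₁ → ∀ t ∈ Icc 0 (2 * s₁), ‖U x τ t‖ ≤ R / 2 := by
    intro x τ hx hτ t ht
    have h1 := ((hloc x τ hx hτ).2.2.2 t ⟨ht.1, ht.2.trans hs₁T'⟩).2.2.1
    have h2 : ‖U x τ t‖ ≤ ‖U x τ t - t • bvec 0‖ + ‖t • bvec 0‖ := by
      simpa using norm_add_le (U x τ t - t • bvec 0) (t • bvec 0)
    rw [norm_smul, norm_bvec, mul_one, Real.norm_of_nonneg ht.1] at h2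
    linarith [ht.2]
  -- the spreading of the geodesics
  have hdiff : ∀ x τ x' τ' s s' : ℝ, |x| ≤ c₁ → |τ| ≤ c₁ → |x'| ≤ c₁ → |τ'| ≤ c₁ →
      s ∈ Icc s₁ (2 * s₁) → s' ∈ Icc s₁ (2 * s₁) →
      |s - s'| + (|x - x'| + |τ - τ'|) ≤ 54 / c' * ‖U x τ s - U x' τ' s'‖ ∧
        ‖U x τ s - U x' τ' s'‖ ≤ 6 * (|x - x'| + |τ - τ'|) + 2 * |s - s'| := by
    intro x τ x' τ' s s' hx hτ hx' hτ' hs hs'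
    obtain ⟨g1, g2, g3, g4⟩ := hloc x τ hx hτ
    obtain ⟨g1', g2', g3', g4'⟩ := hloc x' τ' hx' hτ'
    have hsub : Icc 0 s ⊆ Icc 0 T' := Icc_subset_Icc_right (hs.2.trans hs₁T')
    have hsp := hspread s 0 (x - x') (τ - τ') hs le_rfl (by positivity) (U x τ) (Vl x τ) (U x' τ')
      (Vl x' τ') (g1.mono hsub) (g1'.mono hsub)
      (fun t ht ↦ ⟨(g4 t (hsub ht)).2.2.1.trans hεp, (g4' t (hsub ht)).2.2.1.trans hεp,
        (g4 t (hsub ht)).2.2.2.trans hεp, (g4' t (hsub ht)).2.2.2.trans hεp⟩)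
      (by rw [g2, g2', ← sub_smul, sub_self, norm_zero]; positivity)
      (by rw [g3, g3', add_sub_add_left_eq_sub, ← sub_smul, sub_self, norm_zero]; positivity)
    have hs0 : s ∈ Icc 0 T' := ⟨hs₁0.le.trans hs.1, hs.2.trans hs₁T'⟩
    have hs0' : s' ∈ Icc 0 T' := ⟨hs₁0.le.trans hs'.1, hs'.2.trans hs₁T'⟩
    have hr := norm_sub_sub_smul_le (fun t ht ↦ (g1' t ht).1) (fun t ht ↦ (g4' t ht).2.2.2) hs0 hs0'
    have hD : U x τ s - U x' τ' s' = (U x τ s - U x' τ' s) + (s - s') • bvec 0 +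
        (U x' τ' s - U x' τ' s' - (s - s') • bvec 0) := by abel
    constructor
    · refine abs_add_le_of_transversal hD (le_trans ?_ hsp.1) hsp.2 hr hc'0 hc'1 hεc
      exact mul_le_mul_of_nonneg_right (min_le_left _ _) (by positivity)
    · rw [hD]
      refine (norm_add_le _ _).trans ((add_le_add_left (norm_add_le _ _) _).trans ?_)
      rw [norm_smul, norm_bvec, mul_one, Real.norm_eq_abs]
      have h1 : ε * |s - s'| ≤ 1 * |s - s'| := by
        refine mul_le_mul_of_nonneg_right ?_ (abs_nonneg _)
        linarith
      linarith [hsp.2]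
  set G : E3 → E3 := fun p ↦ U (p 1) (p 2) (p 0) with hG
  refine ⟨4 * s₁ * c₁ ^ 2 / (54 / c' * C) ^ 3, c₀ / (4 * (2 * C) ^ 5) / Bt, by positivity,
    by positivity, ?_⟩
  set k₁ := min (min (min k₀ 1) (min δt R)) (2 * s₁ / c₀) with hk₁
  have hk₁0 : 0 < k₁ := by positivity
  filter_upwards [Ioo_mem_nhdsGT hk₁0] with k hk
  have hk0 : 0 < k := hk.1
  have hkk₀ : k ≤ k₀ :=
    hk.2.le.trans ((min_le_left _ _).trans ((min_le_left _ _).trans (min_le_left _ _)))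
  have hk1 : k ≤ 1 :=
    hk.2.le.trans ((min_le_left _ _).trans ((min_le_left _ _).trans (min_le_right _ _)))
  have hkδ : k < δt :=
    hk.2.trans_le ((min_le_left _ _).trans ((min_le_right _ _).trans (min_le_left _ _)))
  have hkR : k ≤ R :=
    hk.2.le.trans ((min_le_left _ _).trans ((min_le_right _ _).trans (min_le_right _ _)))
  have hks : c₀ * k ≤ 2 * s₁ := by
    have := hk.2.le.trans (min_le_right _ _)
    rwa [le_div_iff₀ hc₀, mul_comm] at this
  have hkpow : ∀ i : ℕ, k ^ i ≤ 1 := fun i ↦ pow_le_one₀ hk0.le hk1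
  have hkn : k ^ n ≤ k := pow_le_of_le_one hk0.le hk1 hn
  set X := c₁ * k ^ (j + 1) with hX
  set Θ := c₁ * k ^ j with hΘ
  have hX1 : X ≤ c₁ := mul_le_of_le_one_right hc₁0.le (hkpow _)
  have hΘ1 : Θ ≤ c₁ := mul_le_of_le_one_right hc₁0.le (hkpow _)
  set K := euclideanBox ![s₁, -X, -Θ] ![2 * s₁, X, Θ] with hK
  have hKm : ∀ p ∈ K, p 0 ∈ Icc s₁ (2 * s₁) ∧ |p 1| ≤ X ∧ |p 2| ≤ Θ := by
    intro p hp
    rw [hK, mem_euclideanBox] at hp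
    exact ⟨hp 0, abs_le.2 (hp 1), abs_le.2 (hp 2)⟩
  have hGR : ∀ p ∈ K, ‖G p‖ ≤ R := by
    intro p hp
    obtain ⟨h0, h1, h2⟩ := hKm p hp
    have := hUR (p 1) (p 2) (h1.trans hX1) (h2.trans hΘ1) (p 0) ⟨hs₁0.le.trans h0.1, h0.2⟩
    linarith
  have hanti : ∀ p ∈ K, ∀ q ∈ K, ‖p - q‖ ≤ 54 / c' * ‖G p - G q‖ := by
    intro p hp q hq
    obtain ⟨h0, h1, h2⟩ := hKm p hp
    obtain ⟨h0', h1', h2'⟩ := hKm q hq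
    refine le_trans ?_ (hdiff _ _ _ _ _ _ (h1.trans hX1) (h2.trans hΘ1) (h1'.trans hX1)
      (h2'.trans hΘ1) h0 h0').1
    rw [E3_eq_sum_three (p - q)]
    refine (norm_add_le _ _).trans ((add_le_add_left (norm_add_le _ _) _).trans ?_)
    simp only [norm_smul, norm_bvec, mul_one, Real.norm_eq_abs, PiLp.sub_apply]
    rw [add_assoc]
  have hcont : ContinuousOn G K := by
    have : LipschitzOnWith 14 G K := by
      refine LipschitzOnWith.of_dist_le_mul fun p hp q hq ↦ ?_
      obtain ⟨h0, h1, h2⟩ := hKm p hp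
      obtain ⟨h0', h1', h2'⟩ := hKm q hq
      have := (hdiff _ _ _ _ _ _ (h1.trans hX1) (h2.trans hΘ1) (h1'.trans hX1)
        (h2'.trans hΘ1) h0 h0').2
      rw [dist_eq_norm, dist_eq_norm]
      have e0 := E3_abs_apply_le (p - q) 0
      have e1 := E3_abs_apply_le (p - q) 1
      have e2 := E3_abs_apply_le (p - q) 2
      simp only [PiLp.sub_apply] at e0 e1 e2
      push_cast
      refine this.trans ?_
      linarith
    exact this.continuousOn
  have hKc : IsCompact K := isCompact_euclideanBox _ _
  refine ⟨(fun p ↦ e.symm (G p)) '' K, (hbil.image_compact hKc hcont hGR).isClosed.measurableSet,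
    ?_, ?_⟩
  · have h1 := hbil.volume_le_image hGR (by positivity) hanti
    rw [hK, volume_euclideanBox, Fin.prod_univ_three] at h1
    simp only [Matrix.cons_val_zero, Matrix.cons_val_one, Matrix.cons_val_two, Matrix.head_cons,
      Matrix.tail_cons, sub_neg_eq_add] at h1
    rw [← ENNReal.ofReal_mul (by linarith), ← ENNReal.ofReal_mul (by
      have : 0 < X := by positivity
      exact mul_nonneg (by linarith) (by positivity))] at h1
    rw [div_mul_eq_mul_div, ENNReal.ofReal_div_of_pos (by positivity)]
    refine ENNReal.div_le_of_le_mul' (le_trans (ENNReal.ofReal_le_ofReal (le_of_eq ?_)) h1)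
    rw [hX, hΘ]
    ring
  · rintro _ ⟨p, hp, rfl⟩
    obtain ⟨h0, h1, h2⟩ := hKm p hp
    have hx := h1.trans hX1
    have hτ := h2.trans hΘ1
    obtain ⟨g1, g2, g3, g4⟩ := hloc (p 1) (p 2) hx hτ
    have hg := hcv (p 1) (p 2) hx hτ
    set Sg := cv (p 1) (p 2) ''
      Icc 0 (α / ‖coordVec e (p 1 • bvec 1) (bvec 0 + p 2 • bvec 1)‖) with hSg
    have hux1 : ‖p 1 • bvec 1‖ ≤ c₁ := by rw [hux]; exact hx
    have hvt1 : ‖bvec 0 + p 2 • bvec 1 - bvec 0‖ ≤ c₁ := by rw [hVτ]; exact hτ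
    have hSF : Sg ∈ F := hF _ _ _ hg (hux1.trans hc₁F) (hvt1.trans hc₁F)
    have hsymm : ∀ t ∈ Icc 0 T', e.symm (U (p 1) (p 2) t) = cv (p 1) (p 2) t := by
      intro t ht
      simp only [hU, sub_zero]
      exact e.left_inv (g4 t ht).1
    have hp0T : p 0 ∈ Icc 0 T' := ⟨hs₁0.le.trans h0.1, h0.2.trans hs₁T'⟩
    have hyS : e.symm (G p) ∈ Sg := by
      rw [hG]
      simp only
      rw [hsymm _ hp0T]
      exact (g4 _ hp0T).2.1
    have hkT : Icc 0 (c₀ * k) ⊆ Icc 0 T' := Icc_subset_Icc_right (hks.trans hs₁T')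
    obtain ⟨W, hWm, hWS, hWe, hWμ⟩ := hbil.thick_curve (u := U (p 1) (p 2)) (t₁ := 0)
      (t₂ := c₀ * k) (δ := k ^ n / 2) (by positivity) (by positivity) (by linarith)
      (fun t ht ↦ hUR _ _ hx hτ t ⟨ht.1, ht.2.trans hks⟩)
      (fun t ht t' ht' ↦ by
        have := norm_sub_sub_smul_le (fun t ht ↦ (g1 t ht).1) (fun t ht ↦ (g4 t ht).2.2.2)
          (hkT ht) (hkT ht')
        refine this.trans ?_
        have h5 : ε * |t - t'| ≤ 1 / 2 * |t - t'| := by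
          refine mul_le_mul_of_nonneg_right ?_ (abs_nonneg _)
          linarith
        linarith)
      (S := Sg) (fun t ht ↦ by rw [hsymm t (hkT ht)]; exact (g4 t (hkT ht)).2.1)
    have hWS' : W ⊆ Metric.cthickening (k ^ n) Sg :=
      hWS.trans (Metric.cthickening_mono (by linarith [pow_pos hk0 n]) _)
    have hin := hslab k (p 1) (p 2) hk0 hkk₀
      (h1.trans (mul_le_mul_of_nonneg_right hc₁c₀ (by positivity)))
      (h2.trans (mul_le_mul_of_nonneg_right hc₁c₀ (by positivity)))
      (U (p 1) (p 2)) (Vl (p 1) (p 2)) (g1.mono hkT) (fun t ht ↦ ⟨by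
        have := e.map_source (g4 t (hkT ht)).1
        simpa only [hU, sub_zero] using this, (g4 t (hkT ht)).2.2.1.trans hεs,
        (g4 t (hkT ht)).2.2.2.trans hεs⟩) g2 g3
    have htb := htube _ _ _ hg (hux1.trans hc₁t) (hvt1.trans hc₁t) (k ^ n) (by positivity)
      (hkn.trans_lt hkδ)
    have hav := ofReal_le_average (l := 1) (f := fun y ↦ ‖slabFun e (B k) y‖ₑ) (by positivity)
      zero_le_one htb hWm hWS' hWμ (fun y hy ↦ by
        obtain ⟨t, ht, z, hz, hzR, rfl⟩ := hWe y hy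
        rw [slabFun_symm (hbil.subset (by rwa [mem_closedBall_zero_iff])) (hin t ht z hz)]
        simp)
    refine (le_trans (ENNReal.ofReal_le_ofReal (le_of_eq ?_)) hav).trans
      (le_iSup₂_of_le Sg ⟨hSF, hyS⟩ le_rfl)
    rw [sub_zero]
    field_simp
    ring
end

section
variable {X : Type*} [MeasurableSpace X] {μ : Measure X}

lemma ofReal_mul_eLpNorm_indicator_le {g : X → ℝ≥0∞} {S E : Set X} (hE : MeasurableSet E)
    {cE cA C k : ℝ} (hcE : 0 < cE) (hcA : 0 < cA) (hk : 0 < k) {m n : ℕ}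
    (hEm : ENNReal.ofReal (cE * k ^ m) ≤ μ E) (hg : ∀ x ∈ E, ENNReal.ofReal (cA * k) ≤ g x)
    (hS : μ S ≤ ENNReal.ofReal (C * k ^ n)) {p q : ℝ≥0∞} (hp : 1 ≤ p) (hq : 1 ≤ q) :
    ENNReal.ofReal (cA * min 1 cE / max 1 C * k ^ (1 + m / q.toReal - n / p.toReal : ℝ)) *
      eLpNorm (S.indicator fun _ ↦ (1 : ℝ)) p μ ≤ eLpNorm g q μ := by
  have hinv : ∀ {p : ℝ≥0∞}, 1 ≤ p → 0 ≤ 1 / p.toReal ∧ 1 / p.toReal ≤ 1 := by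
    intro p hp
    refine ⟨by positivity, ?_⟩
    rcases eq_or_ne p ⊤ with rfl | h
    · simp
    · have : 1 ≤ p.toReal := by simpa using ENNReal.toReal_mono h hp
      exact (div_le_one (by linarith)).2 this
  have hC1 : 1 ≤ max 1 C := le_max_left _ _
  have hC0 : 0 < max 1 C := by linarith
  have h1 : eLpNorm (S.indicator fun _ ↦ (1 : ℝ)) p μ ≤
      ENNReal.ofReal (max 1 C * k ^ (n / p.toReal : ℝ)) := by
    refine (eLpNorm_indicator_const_le _ _).trans ?_
    rw [enorm_one, one_mul]
    have h2 : μ S ≤ ENNReal.ofReal (max 1 C * k ^ n) :=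
      hS.trans (ENNReal.ofReal_le_ofReal (by gcongr; exact le_max_right _ _))
    refine (ENNReal.rpow_le_rpow h2 (hinv hp).1).trans ?_
    rw [ENNReal.ofReal_rpow_of_pos (by positivity), Real.mul_rpow hC0.le (by positivity),
      ← Real.rpow_natCast, ← Real.rpow_mul hk.le, mul_one_div]
    gcongr
    calc max 1 C ^ (1 / p.toReal) ≤ max 1 C ^ (1 : ℝ) :=
          Real.rpow_le_rpow_of_exponent_le hC1 (hinv hp).2
      _ = max 1 C := Real.rpow_one _
  have h3 := ofReal_le_eLpNorm_of_forall_le hE (by positivity) (by positivity) hEm hg hq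
  refine le_trans ?_ h3
  refine (mul_le_mul_right h1 _).trans ?_
  rw [← ENNReal.ofReal_mul (by positivity)]
  refine ENNReal.ofReal_le_ofReal ?_
  have h4 : min 1 cE ≤ cE ^ (1 / q.toReal) := by
    have h5 : 0 < min 1 cE := by positivity
    calc min 1 cE = min 1 cE ^ (1 : ℝ) := (Real.rpow_one _).symm
      _ ≤ min 1 cE ^ (1 / q.toReal) :=
        Real.rpow_le_rpow_of_exponent_ge h5 (min_le_left _ _) (hinv hq).2
      _ ≤ _ := Real.rpow_le_rpow h5.le (min_le_right _ _) (hinv hq).1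
  have h6 : (cE * k ^ m) ^ (1 / q.toReal) = cE ^ (1 / q.toReal) * k ^ (m / q.toReal : ℝ) := by
    rw [Real.mul_rpow hcE.le (by positivity), ← Real.rpow_natCast, ← Real.rpow_mul hk.le,
      mul_one_div]
  have h7 : k ^ (1 + m / q.toReal - n / p.toReal : ℝ) * k ^ (n / p.toReal : ℝ) =
      k * k ^ (m / q.toReal : ℝ) := by
    rw [← Real.rpow_add hk, sub_add_cancel, Real.rpow_add hk, Real.rpow_one]
  calc _ = cA * min 1 cE * (k ^ (1 + m / q.toReal - n / p.toReal : ℝ) * k ^ (n / p.toReal : ℝ)) := by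
        field_simp
    _ = cA * k * (min 1 cE * k ^ (m / q.toReal : ℝ)) := by rw [h7]; ring
    _ ≤ _ := by rw [h6]; gcongr
end

section
variable {M : Type*} [EMetricSpace M] [MeasurableSpace M] [BorelSpace M]

lemma NikodymBound.exponent_nonneg {F : Set (Set M)} {K : Set M} {p q : ℝ≥0∞} {σ : ℝ}
    (h : NikodymBound F K p q σ) {n : ℕ} (hn : n ≠ 0) {c s : ℝ} (hc : 0 < c) {f : ℝ → M → ℝ}
    (hf : ∀ᶠ k : ℝ in 𝓝[>] 0, Measurable (f k) ∧ Function.support (f k) ⊆ K ∧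
      eLpNorm (f k) p μHE[3] ≠ 0 ∧ eLpNorm (f k) p μHE[3] ≠ ⊤ ∧
      ENNReal.ofReal (c * k ^ s) * eLpNorm (f k) p μHE[3] ≤
        eLpNorm (nikodymMax F (k ^ n) (f k)) q μHE[3]) :
    0 ≤ s + n * σ := by
  by_contra! hlt
  have hn0 : (0 : ℝ) < n := by positivity
  set ε := -(s + n * σ) / (2 * n) with hε
  have hε0 : 0 < ε := div_pos (by linarith) (by positivity)
  obtain ⟨C, hC⟩ := h ε hε0
  have hpow : Tendsto (fun k : ℝ ↦ k ^ n) (𝓝[>] 0) (𝓝[>] 0) := by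
    refine tendsto_nhdsWithin_iff.2 ⟨?_, eventually_mem_nhdsWithin.mono fun k hk ↦ pow_pos (mem_Ioi.1 hk) n⟩
    have : Tendsto (fun k : ℝ ↦ k ^ n) (𝓝 0) (𝓝 (0 ^ n)) := (continuous_pow n).tendsto 0
    rw [zero_pow hn] at this
    exact this.mono_left nhdsWithin_le_nhds
  have hneg : s + n * σ + n * ε < 0 := by
    rw [hε]
    field_simp
    linarith
  have hlim := (tendsto_rpow_neg_nhdsGT_zero hneg).eventually_gt_atTop (C / c)
  obtain ⟨k, ⟨hfm, hfK, hf0, hft, hfl⟩, hCk, hk, hk0⟩ :=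
    (hf.and ((hpow.eventually hC).and (hlim.and eventually_mem_nhdsWithin))).exists
  have hk0 : 0 < k := hk0
  have h1 := hfl.trans (hCk (f k) hfm hfK)
  rw [ENNReal.mul_le_mul_iff_left hf0 hft] at h1
  have h2 : 0 < c * k ^ s := by positivity
  have h3 := (ENNReal.ofReal_le_ofReal_iff' .. ).1 h1
  rcases h3 with h3 | h3
  · have h4 : k ^ s = k ^ (s + n * σ + n * ε) * (k ^ n) ^ (-σ - ε) := by
      rw [← Real.rpow_natCast, ← Real.rpow_mul hk0.le, ← Real.rpow_add hk0]
      congr 1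
      ring
    rw [h4, ← mul_assoc] at h3
    have h5 := le_of_mul_le_mul_right h3 (by positivity)
    rw [div_lt_iff₀ hc] at hk
    linarith
  · linarith

lemma eventually_nhdsGT_zero_of_pow {P : ℝ → ℝ → Prop} {n : ℕ} (hn : n ≠ 0)
    (h : ∀ᶠ k : ℝ in 𝓝[>] 0, P k (k ^ n)) :
    ∀ᶠ δ : ℝ in 𝓝[>] 0, P (δ ^ (1 / n : ℝ)) δ := by
  have hn0 : (0 : ℝ) < 1 / n := by positivity
  have hlim : Tendsto (fun δ : ℝ ↦ δ ^ (1 / n : ℝ)) (𝓝[>] 0) (𝓝[>] 0) := by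
    refine tendsto_nhdsWithin_iff.2
      ⟨?_, eventually_mem_nhdsWithin.mono fun δ hδ ↦ Real.rpow_pos_of_pos hδ _⟩
    have := (Real.continuousAt_rpow_const 0 (1 / n : ℝ) (Or.inr hn0.le)).tendsto
    rw [Real.zero_rpow hn0.ne'] at this
    exact this.mono_left nhdsWithin_le_nhds
  filter_upwards [hlim.eventually h, eventually_mem_nhdsWithin] with δ hδ hδ0
  rwa [← Real.rpow_natCast, ← Real.rpow_mul (le_of_lt hδ0), one_div_mul_cancel (by positivity),
    Real.rpow_one] at hδ
end

section
variable {M : Type*} [EMetricSpace M] [ChartedSpace E3 M] [IsManifold (𝓡 3) ∞ M]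
    [RiemannianBundle (fun x : M ↦ TangentSpace (𝓡 3) x)]
    [IsContMDiffRiemannianBundle (𝓡 3) ∞ E3 (fun x : M ↦ TangentSpace (𝓡 3) x)]
    [IsRiemannianManifold (𝓡 3) M] [MeasurableSpace M] [BorelSpace M]

lemma measurableSet_source_inter_preimage (e : OpenPartialHomeomorph M E3) {B : Set E3}
    (hB : MeasurableSet B) : MeasurableSet (e.source ∩ e ⁻¹' B) := by
  have h1 := (continuousOn_iff_continuous_domRestrict.1 e.continuousOn).measurable hB
  have h2 := e.open_source.measurableSet.subtype_image h1
  convert h2 using 1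
  ext x
  simp only [mem_inter_iff, mem_preimage, mem_image, domRestrict_apply, Subtype.exists,
    exists_and_left, exists_prop, exists_eq_right_right]
  exact and_comm

lemma measurable_slabFun (e : OpenPartialHomeomorph M E3) {B : Set E3} (hB : MeasurableSet B) :
    Measurable (slabFun e B) :=
  measurable_const.indicator (measurableSet_source_inter_preimage e hB)

lemma IsBilipBall.source_inter_preimage {e : OpenPartialHomeomorph M E3} {R C : ℝ}
    (h : IsBilipBall e R C) {B : Set E3} (hB : B ⊆ Metric.closedBall 0 R) :
    e.source ∩ e ⁻¹' B = e.symm '' B := by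
  rw [e.symm.image_eq_target_inter_inv_preimage (hB.trans h.subset)]
  simp

lemma IsBilipBall.measure_slab_le {e : OpenPartialHomeomorph M E3} {R C : ℝ}
    (h : IsBilipBall e R C) {B : Set E3} (hB : B ⊆ Metric.closedBall 0 R) :
    μHE[3] (e.source ∩ e ⁻¹' B) ≤ ENNReal.ofReal (C ^ 3) * volume B := by
  have hC := h.one_le
  rw [h.source_inter_preimage hB, ENNReal.ofReal_pow (by linarith),
    ← EuclideanSpace.euclideanHausdorffMeasure_eq_volume]
  exact euclideanHausdorffMeasure_image_le 3 fun v hv w hw ↦ h.upper v (hB hv) w (hB hw)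

lemma IsBilipBall.measure_slab_ne_zero {e : OpenPartialHomeomorph M E3} {R C : ℝ}
    (h : IsBilipBall e R C) {B : Set E3} (hB : B ⊆ Metric.closedBall 0 R) (hB0 : B ∈ 𝓝 0) :
    μHE[3] (e.source ∩ e ⁻¹' B) ≠ 0 := by
  have h1 := h.volume_le_image (K := B) (G := id) (A := 1)
    (fun p hp ↦ mem_closedBall_zero_iff.1 (hB hp)) zero_le_one (by simp)
  rw [h.source_inter_preimage hB]
  intro h0
  simp only [id, h0, mul_zero, nonpos_iff_eq_zero] at h1
  exact (Measure.measure_pos_of_mem_nhds volume hB0).ne' h1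

/-- Lower bounds for the norms of the Nikodym maximal functions of slabs, and the resulting
necessary condition for the boundedness of the maximal operator. -/
theorem nikodymMax_slab {e : OpenPartialHomeomorph M E3} (he : IsSmoothChart e)
    (h0 : (0 : E3) ∈ e.target) {F : Set (Set M)} {n m l : ℕ} (hn : n ≠ 0) {B : ℝ → Set E3} {D V : ℝ}
    (hB : ∀ᶠ k : ℝ in 𝓝[>] 0, MeasurableSet (B k) ∧ B k ∈ 𝓝 0 ∧
      B k ⊆ Metric.closedBall 0 (D * k) ∧ volume (B k) ≤ ENNReal.ofReal (V * k ^ l))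
    (hE : ∃ cE cA : ℝ, 0 < cE ∧ 0 < cA ∧ ∀ᶠ k : ℝ in 𝓝[>] 0, ∃ E : Set M, MeasurableSet E ∧
      ENNReal.ofReal (cE * k ^ m) ≤ μHE[3] E ∧
      ∀ y ∈ E, ENNReal.ofReal (cA * k) ≤ nikodymMax F (k ^ n) (slabFun e (B k)) y) :
    (∃ c : ℝ, 0 < c ∧ ∀ᶠ k : ℝ in 𝓝[>] 0, ∀ p q : ℝ≥0∞, 1 ≤ p → 1 ≤ q →
      ENNReal.ofReal (c * k ^ (1 + m / q.toReal - l / p.toReal : ℝ)) *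
        eLpNorm (slabFun e (B k)) p μHE[3] ≤
          eLpNorm (nikodymMax F (k ^ n) (slabFun e (B k))) q μHE[3]) ∧
    ∀ K : Set M, K ∈ 𝓝 (e.symm 0) → ∀ (p q : ℝ≥0∞) (σ : ℝ), 1 ≤ p → 1 ≤ q →
      NikodymBound F K p q σ → 0 ≤ 1 + m / q.toReal - l / p.toReal + n * σ := by
  obtain ⟨cE, cA, hcE, hcA, hE⟩ := hE
  obtain ⟨R, C, hbil⟩ := he.exists_isBilipBall h0
  have hsmall : ∀ {r : ℝ}, 0 < r → ∀ᶠ k : ℝ in 𝓝[>] 0, D * k < r := by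
    intro r hr
    have : Tendsto (fun k : ℝ ↦ D * k) (𝓝[>] 0) (𝓝 (D * 0)) :=
      (tendsto_id.const_mul D).mono_left nhdsWithin_le_nhds
    rw [mul_zero] at this
    exact this.eventually_lt_const hr
  have hslab : ∀ᶠ k : ℝ in 𝓝[>] 0,
      μHE[3] (e.source ∩ e ⁻¹' B k) ≤ ENNReal.ofReal (C ^ 3 * V * k ^ l) ∧
      μHE[3] (e.source ∩ e ⁻¹' B k) ≠ 0 := by
    filter_upwards [hB, hsmall hbil.pos] with k hk hkR
    have hsub := hk.2.2.1.trans (Metric.closedBall_subset_closedBall hkR.le)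
    refine ⟨(hbil.measure_slab_le hsub).trans ?_, hbil.measure_slab_ne_zero hsub hk.2.1⟩
    have hC := hbil.one_le
    rw [mul_assoc, ENNReal.ofReal_mul (by positivity)]
    exact mul_le_mul_right hk.2.2.2 _
  have hmain : ∀ᶠ k : ℝ in 𝓝[>] 0, ∀ p q : ℝ≥0∞, 1 ≤ p → 1 ≤ q →
      ENNReal.ofReal (cA * min 1 cE / max 1 (C ^ 3 * V) *
        k ^ (1 + m / q.toReal - l / p.toReal : ℝ)) * eLpNorm (slabFun e (B k)) p μHE[3] ≤
          eLpNorm (nikodymMax F (k ^ n) (slabFun e (B k))) q μHE[3] := by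
    filter_upwards [hE, hslab, eventually_mem_nhdsWithin] with k hk hkS hk0 p q hp hq
    obtain ⟨E, hEm, hEk, hEy⟩ := hk
    exact ofReal_mul_eLpNorm_indicator_le hEm hcE hcA hk0 hEk hEy hkS.1 hp hq
  have hc : 0 < cA * min 1 cE / max 1 (C ^ 3 * V) :=
    div_pos (by positivity) (zero_lt_one.trans_le (le_max_left _ _))
  refine ⟨⟨_, hc, hmain⟩, fun K hK p q σ hp hq hbound ↦
    hbound.exponent_nonneg hn hc (f := fun k ↦ slabFun e (B k)) ?_⟩
  have hK' : e.symm ⁻¹' K ∈ 𝓝 (0 : E3) := (e.symm.continuousAt h0).preimage_mem_nhds hK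
  obtain ⟨r, hr, hrK⟩ := Metric.mem_nhds_iff.1 hK'
  have hp0 : p ≠ 0 := (zero_lt_one.trans_le hp).ne'
  filter_upwards [hB, hslab, hmain, hsmall hr] with k hk hkS hkm hkr
  refine ⟨measurable_slabFun e hk.1, ?_, ?_, ?_, hkm p q hp hq⟩
  · intro x hx
    have hx' : x ∈ e.source ∩ e ⁻¹' B k := by
      by_contra h
      exact hx (indicator_of_notMem h _)
    have h1 : e x ∈ Metric.ball 0 r :=
      Metric.closedBall_subset_ball hkr (hk.2.2.1 hx'.2)
    have h2 : e.symm (e x) ∈ K := hrK h1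
    rwa [e.left_inv hx'.1] at h2
  · rw [slabFun, eLpNorm_indicator_const' (measurableSet_source_inter_preimage e hk.1) hkS.2 hp0,
      enorm_one, one_mul]
    exact (ENNReal.rpow_pos (pos_iff_ne_zero.2 hkS.2)
      (hkS.1.trans_lt ENNReal.ofReal_lt_top).ne).ne'
  · refine ((eLpNorm_indicator_const_le _ _).trans_lt ?_).ne
    rw [enorm_one, one_mul]
    exact ENNReal.rpow_lt_top_of_nonneg (by positivity) (hkS.1.trans_lt ENNReal.ofReal_lt_top).ne
end

lemma ContDiffOn.hasFDerivAt_of_isOpen {F : Type*} [NormedAddCommGroup F] [NormedSpace ℝ F]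
    {f : E3 → F} {U : Set E3} (hf : ContDiffOn ℝ ∞ f U) (hU : IsOpen U) {u : E3}
    (hu : u ∈ U) : HasFDerivAt f (fderiv ℝ f u) u :=
  (((hf u hu).contDiffAt (hU.mem_nhds hu)).differentiableAt (by simp)).hasFDerivAt

lemma pderiv_congr {f g : E3 → ℝ} {u : E3} (h : f =ᶠ[𝓝 u] g) (i : Fin 3) :
    pderiv i f u = pderiv i g u := by
  rw [pderiv, pderiv, h.fderiv_eq]

lemma pderiv_eventuallyEq {f g : E3 → ℝ} {u : E3} (h : f =ᶠ[𝓝 u] g) (i : Fin 3) :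
    pderiv i f =ᶠ[𝓝 u] pderiv i g :=
  h.eventually_nhds.mono fun _ hv ↦ pderiv_congr hv i

lemma pderiv_mul {f g : E3 → ℝ} {u : E3} (hf : DifferentiableAt ℝ f u)
    (hg : DifferentiableAt ℝ g u) (i : Fin 3) :
    pderiv i (fun v ↦ f v * g v) u = f u * pderiv i g u + pderiv i f u * g u := by
  simp only [pderiv]
  rw [fderiv_fun_mul hf hg]
  simp [mul_comm]

lemma pderiv_add {f g : E3 → ℝ} {u : E3} (hf : DifferentiableAt ℝ f u)
    (hg : DifferentiableAt ℝ g u) (i : Fin 3) :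
    pderiv i (fun v ↦ f v + g v) u = pderiv i f u + pderiv i g u := by
  simp only [pderiv]
  rw [fderiv_fun_add hf hg]
  rfl

lemma pderiv_sub {f g : E3 → ℝ} {u : E3} (hf : DifferentiableAt ℝ f u)
    (hg : DifferentiableAt ℝ g u) (i : Fin 3) :
    pderiv i (fun v ↦ f v - g v) u = pderiv i f u - pderiv i g u := by
  simp only [pderiv]
  rw [fderiv_fun_sub hf hg]
  rfl

lemma pderiv_const_mul {f : E3 → ℝ} {u : E3} (hf : DifferentiableAt ℝ f u) (c : ℝ) (i : Fin 3) :
    pderiv i (fun v ↦ c * f v) u = c * pderiv i f u := by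
  simp only [pderiv]
  rw [fderiv_const_mul hf]
  rfl

lemma pderiv_sum {ι : Type*} (s : Finset ι) {f : ι → E3 → ℝ} {u : E3}
    (hf : ∀ j ∈ s, DifferentiableAt ℝ (f j) u) (i : Fin 3) :
    pderiv i (fun v ↦ ∑ j ∈ s, f j v) u = ∑ j ∈ s, pderiv i (f j) u := by
  simp only [pderiv]
  rw [fderiv_fun_sum hf]
  simp

section
variable {U : Set E3} {f g : E3 → ℝ}

lemma ContDiffOn.differentiableAt_of_isOpen (hf : ContDiffOn ℝ ∞ f U) (hU : IsOpen U) {u : E3}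
    (hu : u ∈ U) : DifferentiableAt ℝ f u :=
  ((hf u hu).contDiffAt (hU.mem_nhds hu)).differentiableAt (by simp)

lemma pderiv_comm (hf : ContDiffOn ℝ ∞ f U) (hU : IsOpen U) {u : E3} (hu : u ∈ U)
    (i j : Fin 3) : pderiv i (pderiv j f) u = pderiv j (pderiv i f) u := by
  have h := ((hf u hu).contDiffAt (hU.mem_nhds hu)).isSymmSndFDerivAt
    (by rw [minSmoothness_of_isRCLikeNormedField]; exact ENat.LEInfty.out)
  have hd : DifferentiableAt ℝ (fderiv ℝ f) u :=
    (((hf.fderiv_of_isOpen hU (m := ∞) (by simp)) u hu).contDiffAt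
      (hU.mem_nhds hu)).differentiableAt (by simp)
  have h1 : ∀ i j : Fin 3, pderiv i (pderiv j f) u = fderiv ℝ (fderiv ℝ f) u (bvec i) (bvec j) := by
    intro i j
    change fderiv ℝ (fun v ↦ fderiv ℝ f v (bvec j)) u (bvec i) = _
    rw [fderiv_clm_apply hd (differentiableAt_const _)]
    simp
  rw [h1, h1, h.eq]

/-- The derivatives up to second order of `∑ g_l f_l` at a point where all `f_l` vanish and the
`g_l` are constant to first order. -/
lemma pderiv_pderiv_sum_mul (hU : IsOpen U) {u : E3} (hu : u ∈ U) {f g : Fin 3 → E3 → ℝ}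
    (hf : ∀ l, ContDiffOn ℝ ∞ (f l) U) (hg : ∀ l, ContDiffOn ℝ ∞ (g l) U) {k : Fin 3}
    (hf0 : ∀ l, f l u = 0) (hg0 : ∀ l, g l u = if k = l then 1 else 0)
    (hg1 : ∀ l i, pderiv i (g l) u = 0) (i j : Fin 3) :
    pderiv i (fun v ↦ ∑ l, g l v * f l v) u = pderiv i (f k) u ∧
      pderiv i (pderiv j fun v ↦ ∑ l, g l v * f l v) u = pderiv i (pderiv j (f k)) u := by
  have hd : ∀ {h : E3 → ℝ}, ContDiffOn ℝ ∞ h U → ∀ v ∈ U, DifferentiableAt ℝ h v :=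
    fun hh v hv ↦ hh.differentiableAt_of_isOpen hU hv
  have hfp : ∀ l j, ContDiffOn ℝ ∞ (pderiv j (f l)) U := fun l j ↦ contDiffOn_pderiv hU (hf l) j
  have hgp : ∀ l j, ContDiffOn ℝ ∞ (pderiv j (g l)) U := fun l j ↦ contDiffOn_pderiv hU (hg l) j
  have h1 : ∀ i, ∀ v ∈ U, pderiv i (fun v ↦ ∑ l, g l v * f l v) v =
      ∑ l, (g l v * pderiv i (f l) v + pderiv i (g l) v * f l v) := by
    intro i v hv
    rw [pderiv_sum _ fun l _ ↦ (hd (hg l) v hv).fun_mul (hd (hf l) v hv)]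
    exact Finset.sum_congr rfl fun l _ ↦ pderiv_mul (hd (hg l) v hv) (hd (hf l) v hv) i
  constructor
  · rw [h1 i u hu]
    simp [hf0, hg0]
  · have h2 : (pderiv j fun v ↦ ∑ l, g l v * f l v) =ᶠ[𝓝 u]
        fun v ↦ ∑ l, (g l v * pderiv j (f l) v + pderiv j (g l) v * f l v) :=
      Filter.eventually_of_mem (hU.mem_nhds hu) fun v hv ↦ h1 j v hv
    rw [pderiv_congr h2, pderiv_sum _ fun l _ ↦ ((hd (hg l) u hu).fun_mul (hd (hfp l j) u hu)).fun_add
      ((hd (hgp l j) u hu).fun_mul (hd (hf l) u hu))]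
    have h3 : ∀ l, pderiv i (fun v ↦ g l v * pderiv j (f l) v + pderiv j (g l) v * f l v) u =
        if k = l then pderiv i (pderiv j (f l)) u else 0 := by
      intro l
      rw [pderiv_add ((hd (hg l) u hu).fun_mul (hd (hfp l j) u hu))
        ((hd (hgp l j) u hu).fun_mul (hd (hf l) u hu)), pderiv_mul (hd (hg l) u hu) (hd (hfp l j) u hu),
        pderiv_mul (hd (hgp l j) u hu) (hd (hf l) u hu)]
      simp [hf0, hg0, hg1]
    simp [h3]
end

section
variable {M : Type*} [EMetricSpace M] [ChartedSpace E3 M] [IsManifold (𝓡 3) ∞ M]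
    [RiemannianBundle (fun x : M ↦ TangentSpace (𝓡 3) x)]
    [IsContMDiffRiemannianBundle (𝓡 3) ∞ E3 (fun x : M ↦ TangentSpace (𝓡 3) x)]

/-- At the point `u₀`, the chart is orthonormal and the metric is constant to first order. -/
structure IsFlatAt (e : OpenPartialHomeomorph M E3) (u₀ : E3) : Prop where
  smooth : IsSmoothChart e
  mem : u₀ ∈ e.target
  orthonormal : ∀ i j : Fin 3, metricCoeff e i j u₀ = if i = j then 1 else 0
  gam_zero : gam e u₀ = 0

/-- At the origin, the chart is orthonormal and the metric is constant to first order. -/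
abbrev IsFlatAtZero (e : OpenPartialHomeomorph M E3) : Prop := IsFlatAt e 0

namespace IsFlatAt
variable {e : OpenPartialHomeomorph M E3} {u₀ : E3}

lemma pderiv_metric (h : IsFlatAt e u₀) (i j k : Fin 3) : pderiv k (metricCoeff e i j) u₀ = 0 :=
  h.smooth.pderiv_metricCoeff_eq_zero h.mem h.gam_zero i j k

lemma christoffel_zero (h : IsFlatAt e u₀) (i j k : Fin 3) : christoffel e i j k u₀ = 0 :=
  gam_eq_zero_iff.1 h.gam_zero i j k

lemma metricInv_zero (h : IsFlatAt e u₀) (i j : Fin 3) :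
    metricInv e i j u₀ = if i = j then 1 else 0 := by
  have := h.smooth.sum_metricInv_mul h.mem i j
  simpa [h.orthonormal] using this

lemma pderiv_metricInv (h : IsFlatAt e u₀) (i j k : Fin 3) : pderiv k (metricInv e i j) u₀ = 0 := by
  have hU := e.open_target
  have hg := h.smooth.contDiffOn_metricCoeff
  have hh := h.smooth.contDiffOn_metricInv
  have h1 : (fun u ↦ ∑ l, metricCoeff e i l u * metricInv e l j u) =ᶠ[𝓝 u₀]
      fun _ ↦ if i = j then 1 else 0 :=
    Filter.eventually_of_mem (hU.mem_nhds h.mem) fun u hu ↦ h.smooth.sum_metricInv_mul hu i j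
  have h2 := pderiv_congr h1 k
  have hd : ∀ {f : E3 → ℝ}, ContDiffOn ℝ ∞ f e.target → DifferentiableAt ℝ f u₀ :=
    fun hf ↦ hf.differentiableAt_of_isOpen hU h.mem
  rw [pderiv_sum _ fun l _ ↦ (hd (hg i l)).fun_mul (hd (hh l j))] at h2
  have h3 : ∀ l, pderiv k (fun v ↦ metricCoeff e i l v * metricInv e l j v) u₀ =
      if i = l then pderiv k (metricInv e l j) u₀ else 0 := by
    intro l
    rw [pderiv_mul (hd (hg i l)) (hd (hh l j))]
    simp [h.orthonormal, h.pderiv_metric]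
  simp only [h3, Finset.sum_ite_eq, Finset.mem_univ, if_true] at h2
  rw [h2]
  simp [pderiv]

/-- The first and second derivatives of the Christoffel symbols in terms of the metric. -/
lemma pderiv_christoffel (h : IsFlatAt e u₀) (i j k : Fin 3) (a b : Fin 3) :
    pderiv a (christoffel e i j k) u₀ = (1 / 2) * (pderiv a (pderiv i (metricCoeff e j k)) u₀ +
      pderiv a (pderiv j (metricCoeff e i k)) u₀ - pderiv a (pderiv k (metricCoeff e i j)) u₀) ∧
    pderiv a (pderiv b (christoffel e i j k)) u₀ = (1 / 2) *
      (pderiv a (pderiv b (pderiv i (metricCoeff e j k))) u₀ +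
      pderiv a (pderiv b (pderiv j (metricCoeff e i k))) u₀ -
      pderiv a (pderiv b (pderiv k (metricCoeff e i j))) u₀) := by
  have hU := e.open_target
  have hg := h.smooth.contDiffOn_metricCoeff
  have hg1 : ∀ i j k, ContDiffOn ℝ ∞ (pderiv i (metricCoeff e j k)) e.target := fun i j k ↦
    contDiffOn_pderiv hU (hg j k) i
  have hg2 : ∀ b i j k, ContDiffOn ℝ ∞ (pderiv b (pderiv i (metricCoeff e j k))) e.target :=
    fun b i j k ↦ contDiffOn_pderiv hU (hg1 i j k) b
  have hd : ∀ {f : E3 → ℝ}, ContDiffOn ℝ ∞ f e.target → ∀ {v}, v ∈ e.target →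
      DifferentiableAt ℝ f v :=
    fun hf v hv ↦ hf.differentiableAt_of_isOpen hU hv
  have h1 := pderiv_pderiv_sum_mul hU h.mem (f := fun l ↦ christoffel e i j l)
    (g := fun l ↦ metricCoeff e k l) (k := k) (fun l ↦ h.smooth.contDiffOn_christoffel i j l)
    (fun l ↦ hg k l) (fun l ↦ h.christoffel_zero i j l) (fun l ↦ h.orthonormal k l)
    (fun l i ↦ h.pderiv_metric k l i) a b
  have h2 : (fun v ↦ ∑ l, metricCoeff e k l v * christoffel e i j l v) =ᶠ[𝓝 u₀] fun u ↦
      (1 / 2) * (pderiv i (metricCoeff e j k) u + pderiv j (metricCoeff e i k) u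
      - pderiv k (metricCoeff e i j) u) :=
    Filter.eventually_of_mem (hU.mem_nhds h.mem) fun u hu ↦ h.smooth.sum_metricCoeff_mul_christoffel hu i j k
  have h3 : ∀ c, ∀ v ∈ e.target, pderiv c (fun u ↦
      (1 / 2) * (pderiv i (metricCoeff e j k) u + pderiv j (metricCoeff e i k) u
      - pderiv k (metricCoeff e i j) u)) v = (1 / 2) * (pderiv c (pderiv i (metricCoeff e j k)) v +
      pderiv c (pderiv j (metricCoeff e i k)) v - pderiv c (pderiv k (metricCoeff e i j)) v) := by
    intro c v hv
    rw [pderiv_const_mul (((hd (hg1 i j k) hv).fun_add (hd (hg1 j i k) hv)).fun_sub (hd (hg1 k i j) hv)),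
      pderiv_sub ((hd (hg1 i j k) hv).fun_add (hd (hg1 j i k) hv)) (hd (hg1 k i j) hv),
      pderiv_add (hd (hg1 i j k) hv) (hd (hg1 j i k) hv)]
  constructor
  · rw [← h1.1, pderiv_congr h2, h3 a u₀ h.mem]
  · rw [← h1.2, pderiv_congr ((pderiv_eventuallyEq h2 b).trans
      (Filter.eventually_of_mem (hU.mem_nhds h.mem) (h3 b))),
      pderiv_const_mul (((hd (hg2 b i j k) h.mem).fun_add (hd (hg2 b j i k) h.mem)).fun_sub
        (hd (hg2 b k i j) h.mem)),
      pderiv_sub ((hd (hg2 b i j k) h.mem).fun_add (hd (hg2 b j i k) h.mem)) (hd (hg2 b k i j) h.mem),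
      pderiv_add (hd (hg2 b i j k) h.mem) (hd (hg2 b j i k) h.mem)]

lemma pderiv_christoffel_symm (h : IsFlatAt e u₀) (j k : Fin 3) :
    pderiv 0 (christoffel e 0 j k) u₀ - pderiv j (christoffel e 0 0 k) u₀ =
      pderiv 0 (christoffel e 0 k j) u₀ - pderiv k (christoffel e 0 0 j) u₀ := by
  have hc : ∀ i j k l : Fin 3, pderiv i (pderiv j (metricCoeff e k l)) u₀ =
      pderiv j (pderiv i (metricCoeff e k l)) u₀ := fun i j k l ↦
    pderiv_comm (h.smooth.contDiffOn_metricCoeff k l) e.open_target h.mem i j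
  have hs : ∀ k l, metricCoeff e k l = metricCoeff e l k := fun k l ↦
    funext fun u ↦ metricCoeff_comm e k l u
  simp only [(h.pderiv_christoffel _ _ _ _ 0).1]
  rw [hs k j, hc j k 0 0, hc j 0 0 k, hc k 0 0 j]
  ring

lemma ricci_two_one (h : IsFlatAt e u₀) : ricci e 2 1 u₀ =
    -(pderiv 0 (christoffel e 0 1 2) u₀ - pderiv 1 (christoffel e 0 0 2) u₀) := by
  have hc : ∀ i j k l : Fin 3, pderiv i (pderiv j (metricCoeff e k l)) u₀ =
      pderiv j (pderiv i (metricCoeff e k l)) u₀ := fun i j k l ↦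
    pderiv_comm (h.smooth.contDiffOn_metricCoeff k l) e.open_target h.mem i j
  have hs : ∀ k l, metricCoeff e k l = metricCoeff e l k := fun k l ↦
    funext fun u ↦ metricCoeff_comm e k l u
  simp only [ricci, h.christoffel_zero, mul_zero, sub_zero, Finset.sum_const_zero, add_zero]
  rw [Fin.sum_univ_three]
  simp only [(h.pderiv_christoffel _ _ _ _ 0).1]
  rw [hs 2 1, hs 2 0, hs 1 0, hc 2 1, hc 2 1, hc 2 0, hc 1 0]
  ring

lemma contDiffOn_ricci (h : IsFlatAt e u₀) (j k : Fin 3) :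
    ContDiffOn ℝ ∞ (ricci e j k) e.target := by
  have h1 := h.smooth.contDiffOn_christoffel
  have h2 : ∀ a i j k, ContDiffOn ℝ ∞ (pderiv a (christoffel e i j k)) e.target := fun a i j k ↦
    contDiffOn_pderiv e.open_target (h1 i j k) a
  unfold ricci
  fun_prop

lemma pderiv_ricci_two_one (h : IsFlatAt e u₀) : pderiv 0 (ricci e 2 1) u₀ =
    -(pderiv 0 (pderiv 0 (christoffel e 0 1 2)) u₀ - pderiv 0 (pderiv 1 (christoffel e 0 0 2)) u₀) := by
  have hU := e.open_target
  have hd : ∀ {f : E3 → ℝ}, ContDiffOn ℝ ∞ f e.target → DifferentiableAt ℝ f u₀ :=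
    fun hf ↦ hf.differentiableAt_of_isOpen hU h.mem
  have h1 := h.smooth.contDiffOn_christoffel
  have h2 : ∀ a i j k, ContDiffOn ℝ ∞ (pderiv a (christoffel e i j k)) e.target := fun a i j k ↦
    contDiffOn_pderiv hU (h1 i j k) a
  have hm : ∀ i j k i' j' k', DifferentiableAt ℝ
      (fun u ↦ christoffel e i j k u * christoffel e i' j' k' u) u₀ := fun i j k i' j' k' ↦
    (hd (h1 i j k)).fun_mul (hd (h1 i' j' k'))
  have h4 : ∀ i, pderiv 0 (fun u ↦ pderiv i (christoffel e 2 1 i) u - pderiv 2 (christoffel e i 1 i) u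
      + ∑ p, (christoffel e i p i u * christoffel e 2 1 p u
      - christoffel e 2 p i u * christoffel e i 1 p u)) u₀ =
      pderiv 0 (pderiv i (christoffel e 2 1 i)) u₀ - pderiv 0 (pderiv 2 (christoffel e i 1 i)) u₀ := by
    intro i
    have hsum : ∀ p ∈ Finset.univ, DifferentiableAt ℝ (fun u ↦ (christoffel e i p i u *
      christoffel e 2 1 p u - christoffel e 2 p i u * christoffel e i 1 p u)) u₀ := fun p _ ↦
      (hm _ _ _ _ _ _).fun_sub (hm _ _ _ _ _ _)
    rw [pderiv_add ((hd (h2 i 2 1 i)).fun_sub (hd (h2 2 i 1 i))) (DifferentiableAt.fun_sum hsum),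
      pderiv_sub (hd (h2 i 2 1 i)) (hd (h2 2 i 1 i)), pderiv_sum _ hsum]
    rw [add_eq_left]
    refine Finset.sum_eq_zero fun p _ ↦ ?_
    rw [pderiv_sub (hm _ _ _ _ _ _) (hm _ _ _ _ _ _), pderiv_mul (hd (h1 _ _ _)) (hd (h1 _ _ _)),
      pderiv_mul (hd (h1 _ _ _)) (hd (h1 _ _ _))]
    simp [h.christoffel_zero]
  have h5 : ∀ i, DifferentiableAt ℝ (fun u ↦ pderiv i (christoffel e 2 1 i) u -
      pderiv 2 (christoffel e i 1 i) u + ∑ p, (christoffel e i p i u * christoffel e 2 1 p u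
      - christoffel e 2 p i u * christoffel e i 1 p u)) u₀ := fun i ↦
    ((hd (h2 i 2 1 i)).fun_sub (hd (h2 2 i 1 i))).fun_add
      (DifferentiableAt.fun_sum fun p _ ↦ (hm _ _ _ _ _ _).fun_sub (hm _ _ _ _ _ _))
  change pderiv 0 (fun u ↦ ∑ i, (pderiv i (christoffel e 2 1 i) u -
      pderiv 2 (christoffel e i 1 i) u + ∑ p, (christoffel e i p i u * christoffel e 2 1 p u
      - christoffel e 2 p i u * christoffel e i 1 p u))) u₀ = _
  rw [pderiv_sum _ fun i _ ↦ h5 i, Fin.sum_univ_three, h4, h4, h4]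
  have hc : ∀ i j k l : Fin 3, pderiv i (pderiv j (metricCoeff e k l)) =ᶠ[𝓝 u₀]
      pderiv j (pderiv i (metricCoeff e k l)) := fun i j k l ↦
    Filter.eventually_of_mem (hU.mem_nhds h.mem) fun u hu ↦
      pderiv_comm (h.smooth.contDiffOn_metricCoeff k l) hU hu i j
  have hc' : ∀ i j k l : Fin 3, pderiv 0 (pderiv i (pderiv j (metricCoeff e k l))) u₀ =
      pderiv 0 (pderiv j (pderiv i (metricCoeff e k l))) u₀ := fun i j k l ↦
    pderiv_congr (hc i j k l) 0
  have hs : ∀ k l, metricCoeff e k l = metricCoeff e l k := fun k l ↦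
    funext fun u ↦ metricCoeff_comm e k l u
  simp only [(h.pderiv_christoffel _ _ _ _ _).2]
  rw [hs 2 1, hs 2 0, hs 1 0, hc' 2 1, hc' 2 1, hc' 2 0, hc' 1 0]
  ring
end IsFlatAt
end

lemma E3_hasDerivAt_of_apply {f : ℝ → E3} {f' : E3} {t : ℝ}
    (h : ∀ i, HasDerivAt (fun τ ↦ f τ i) (f' i) t) : HasDerivAt f f' t :=
  HasFDerivAt.comp_hasDerivAt (f := fun τ ↦ (f τ).ofLp) (f' := f'.ofLp) t
    (PiLp.continuousLinearEquiv 2 ℝ (fun _ : Fin 3 ↦ ℝ)).symm.hasFDerivAt (hasDerivAt_pi.2 h)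

/-- Parallel transport along a coordinate line. -/
lemma exists_parallel {Γ : E3 → E3 →L[ℝ] E3 →L[ℝ] E3} {U : Set E3} (hU : IsOpen U)
    (hΓ : ContDiffOn ℝ ∞ Γ U) (h0 : (0 : E3) ∈ U) (f x : E3) :
    ∃ (X : ℝ → E3) (ε : ℝ), 0 < ε ∧ X 0 = x ∧
      ∀ t ∈ Ioo (-ε) ε, HasDerivAt X (-(Γ (t • f) f (X t))) t := by
  have hF : ContDiffAt ℝ 1 (fun p : E3 × E3 ↦ (f, -(Γ p.1 f p.2))) (0, x) := by
    have h1 : ContDiffAt ℝ 1 (fun p : E3 × E3 ↦ Γ p.1) (0, x) :=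
      (((hΓ 0 h0).contDiffAt (hU.mem_nhds h0)).of_le (by simp)).comp (0, x) contDiffAt_fst
    exact contDiffAt_const.prodMk ((h1.clm_apply contDiffAt_const).clm_apply contDiffAt_snd).neg
  obtain ⟨Y, hY0, ε, hε, hY⟩ :=
    hF.exists_forall_mem_closedBall_exists_eq_forall_mem_Ioo_hasDerivAt₀ 0
  rw [zero_sub, zero_add] at hY
  have h1 : ∀ t ∈ Ioo (-ε) ε, (Y t).1 = t • f := by
    intro t ht
    have hd : ∀ t ∈ Ioo (-ε) ε, HasDerivAt (fun t ↦ (Y t).1 - t • f) 0 t := by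
      intro t ht
      have h2 : HasDerivAt (fun t ↦ (Y t).1) f t := (hY t ht).fst
      simpa using h2.fun_sub ((hasDerivAt_id t).smul_const f)
    have h3 := isOpen_Ioo.is_const_of_deriv_eq_zero isPreconnected_Ioo
      (fun t ht ↦ (hd t ht).differentiableAt.differentiableWithinAt)
      (fun t ht ↦ (hd t ht).deriv) ht (show (0 : ℝ) ∈ Ioo (-ε) ε from ⟨by linarith, hε⟩)
    simp only [hY0, zero_smul, sub_zero] at h3
    exact sub_eq_zero.1 h3
  refine ⟨fun t ↦ (Y t).2, ε, hε, by simp only [hY0], fun t ht ↦ ?_⟩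
  have h4 := (hY t ht).snd
  rwa [h1 t ht] at h4

section
variable {M : Type*} [EMetricSpace M] [ChartedSpace E3 M] [IsManifold (𝓡 3) ∞ M]
    [RiemannianBundle (fun x : M ↦ TangentSpace (𝓡 3) x)]
    [IsContMDiffRiemannianBundle (𝓡 3) ∞ E3 (fun x : M ↦ TangentSpace (𝓡 3) x)]

lemma hasDerivAt_comp_axis {f : E3 → ℝ} {t : ℝ} (hf : DifferentiableAt ℝ f (t • bvec 0)) :
    HasDerivAt (fun τ : ℝ ↦ f (τ • bvec 0)) (pderiv 0 f (t • bvec 0)) t := by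
  have h1 : HasDerivAt (fun τ : ℝ ↦ τ • bvec 0) (bvec 0) t := by
    simpa using (hasDerivAt_id t).smul_const (bvec 0)
  exact hf.hasFDerivAt.comp_hasDerivAt t h1

lemma gam_bvec_zero_apply (e : OpenPartialHomeomorph M E3) (u V : E3) (k : Fin 3) :
    gam e u (bvec 0) V k = ∑ j, christoffel e 0 j k u * V j := by
  rw [gam_apply, Fin.sum_univ_three]
  simp [Fin.sum_univ_three]

lemma IsSmoothChart.hasDerivAt_coordInner {e : OpenPartialHomeomorph M E3} (he : IsSmoothChart e)
    {t : ℝ} (ht : t • bvec 0 ∈ e.target) {V W : ℝ → E3} {V' W' : E3} (hV : HasDerivAt V V' t)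
    (hW : HasDerivAt W W' t) :
    HasDerivAt (fun τ : ℝ ↦ coordInner e (τ • bvec 0) (V τ) (W τ))
      (coordInner e (t • bvec 0) (V' + gam e (t • bvec 0) (bvec 0) (V t)) (W t) +
        coordInner e (t • bvec 0) (V t) (W' + gam e (t • bvec 0) (bvec 0) (W t))) t := by
  have hg : ∀ i j, HasDerivAt (fun τ : ℝ ↦ metricCoeff e i j (τ • bvec 0))
      (pderiv 0 (metricCoeff e i j) (t • bvec 0)) t := fun i j ↦
    hasDerivAt_comp_axis ((he.contDiffOn_metricCoeff i j).differentiableAt_of_isOpen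
      e.open_target ht)
  have h1 : HasDerivAt (fun τ : ℝ ↦ coordInner e (τ • bvec 0) (V τ) (W τ))
      (∑ i, ∑ j, ((pderiv 0 (metricCoeff e i j) (t • bvec 0) * V t i +
        metricCoeff e i j (t • bvec 0) * V' i) * W t j +
        metricCoeff e i j (t • bvec 0) * V t i * W' j)) t :=
    HasDerivAt.fun_sum fun i _ ↦ HasDerivAt.fun_sum fun j _ ↦
      ((hg i j).fun_mul (E3_hasDerivAt_apply hV i)).fun_mul (E3_hasDerivAt_apply hW j)
  refine h1.congr_deriv ?_
  simp only [coordInner, he.pderiv_metricCoeff ht, PiLp.add_apply, gam_bvec_zero_apply,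
    Fin.sum_univ_three]
  rw [metricCoeff_comm e 1 0, metricCoeff_comm e 2 0, metricCoeff_comm e 2 1]
  ring

namespace IsFlatAtZero
variable {e : OpenPartialHomeomorph M E3}

lemma coordInner_zero (h : IsFlatAtZero e) (V W : E3) : coordInner e 0 V W = ∑ i, V i * W i := by
  simp [coordInner, h.orthonormal]

lemma hasDerivAt_coordInner (h : IsFlatAtZero e) {V W : ℝ → E3} {V' W' : E3}
    (hV : HasDerivAt V V' 0) (hW : HasDerivAt W W' 0) :
    HasDerivAt (fun τ : ℝ ↦ coordInner e (τ • bvec 0) (V τ) (W τ))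
      (∑ i, V' i * W 0 i + ∑ i, V 0 i * W' i) 0 := by
  have := h.smooth.hasDerivAt_coordInner (by simpa using h.mem) hV hW
  simpa only [zero_smul, h.gam_zero, _root_.zero_apply, add_zero, h.coordInner_zero] using this

lemma ricciOp_zero (h : IsFlatAtZero e) (i : Fin 3) :
    ricciOp e 0 (bvec 1) i = ricci e i 1 0 := by
  simp [ricciOp, h.metricInv_zero]

lemma hasDerivAt_ricciOp (h : IsFlatAtZero e) {X : ℝ → E3} (hX : HasDerivAt X 0 0)
    (hX0 : X 0 = bvec 1) : HasDerivAt (fun τ : ℝ ↦ ricciOp e (τ • bvec 0) (X τ))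
      (WithLp.toLp 2 fun i ↦ pderiv 0 (ricci e i 1) 0) 0 := by
  have hd : ∀ {f : E3 → ℝ}, ContDiffOn ℝ ∞ f e.target →
      HasDerivAt (fun τ : ℝ ↦ f (τ • bvec 0)) (pderiv 0 f ((0 : ℝ) • bvec 0)) 0 := fun hf ↦
    hasDerivAt_comp_axis (hf.differentiableAt_of_isOpen e.open_target (by simpa using h.mem))
  refine E3_hasDerivAt_of_apply fun i ↦ ?_
  have h1 : HasDerivAt (fun τ : ℝ ↦ ricciOp e (τ • bvec 0) (X τ) i) (∑ l, ∑ j,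
      ((pderiv 0 (metricInv e i l) ((0 : ℝ) • bvec 0) * ricci e l j ((0 : ℝ) • bvec 0) +
      metricInv e i l ((0 : ℝ) • bvec 0) * pderiv 0 (ricci e l j) ((0 : ℝ) • bvec 0)) * X 0 j +
      metricInv e i l ((0 : ℝ) • bvec 0) * ricci e l j ((0 : ℝ) • bvec 0) * (0 : E3) j)) 0 :=
    HasDerivAt.fun_sum (u := Finset.univ) fun l _ ↦ HasDerivAt.fun_sum (u := Finset.univ) fun j _ ↦
      ((hd (h.smooth.contDiffOn_metricInv i l)).fun_mul (hd (h.contDiffOn_ricci l j))).fun_mul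
        (E3_hasDerivAt_apply hX j)
  refine h1.congr_deriv ?_
  simp [h.pderiv_metricInv, h.metricInv_zero, hX0]

/-- The chaotic curvature condition in terms of the Christoffel symbols. -/
lemma christoffel_of_isChaoticAt (h : IsFlatAtZero e) {η : ℝ} (hη : 0 < η)
    (hmem : ∀ t ∈ Ioo (-η) η, t • bvec 0 ∈ e.target)
    (hgeod : IsUnitGeodesicOn (fun t : ℝ ↦ e.symm (t • bvec 0)) (Ioo (-η) η)) {x₀ : M}
    {τ₀ : TangentSpace (𝓡 3) x₀}
    (hpair : (⟨e.symm ((0 : ℝ) • bvec 0), velocity (fun t : ℝ ↦ e.symm (t • bvec 0)) 0⟩ :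
      TangentBundle (𝓡 3) M) = ⟨x₀, ‖τ₀‖⁻¹ • τ₀⟩) (hch : IsChaoticAt x₀ τ₀) :
    pderiv 0 (christoffel e 0 1 2) 0 ≠ pderiv 1 (christoffel e 0 0 2) 0 ∨
      pderiv 0 (pderiv 0 (christoffel e 0 1 2)) 0 ≠ pderiv 0 (pderiv 1 (christoffel e 0 0 2)) 0 := by
  by_contra! hcon
  have hr0 : ricci e 2 1 0 = 0 := by rw [h.ricci_two_one, hcon.1, sub_self, neg_zero]
  have hr1 : pderiv 0 (ricci e 2 1) 0 = 0 := by
    rw [h.pderiv_ricci_two_one, hcon.2, sub_self, neg_zero]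
  obtain ⟨X, ε, hε, hX0, hX⟩ := exists_parallel e.open_target h.smooth.contDiffOn_gam h.mem
    (bvec 0) (bvec 1)
  set γ : ℝ → M := fun t ↦ e.symm (t • bvec 0) with hγ
  have hu : ∀ t ∈ Ioo (-η) η, (fun τ ↦ e (γ τ)) =ᶠ[𝓝 t] fun τ ↦ τ • bvec 0 := by
    intro t ht
    filter_upwards [isOpen_Ioo.mem_nhds ht] with τ hτ
    exact e.right_inv (hmem τ hτ)
  have hline : ∀ t : ℝ, HasDerivAt (fun τ : ℝ ↦ τ • bvec 0) (bvec 0) t := fun t ↦ by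
    simpa using (hasDerivAt_id t).smul_const (bvec 0)
  have hdu : ∀ t ∈ Ioo (-η) η, deriv (fun τ ↦ e (γ τ)) t = bvec 0 := fun t ht ↦ by
    rw [(hu t ht).deriv_eq]
    exact (hline t).deriv
  have h00 : (0 : ℝ) ∈ Ioo (-η) η := ⟨by linarith, hη⟩
  have h00' : (0 : ℝ) ∈ Ioo (-ε) ε := ⟨by linarith, hε⟩
  have hx₀ : e.symm ((0 : ℝ) • bvec 0) = x₀ := congrArg (fun p ↦ p.proj) hpair
  have hgam : ∀ t ∈ Ioo (-η) η, gam e (t • bvec 0) (bvec 0) (bvec 0) = 0 := by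
    intro t ht
    have := IsGeodesicOn.gam_line h.smooth (p := 0) (V := bvec 0) isOpen_Ioo
      (by simpa only [zero_add] using hgeod.1) ht (by simpa using hmem t ht)
    simpa only [zero_add] using this
  set r := min η ε with hr
  have hr0' : 0 < r := lt_min hη hε
  have hrη : Ioo (-r) r ⊆ Ioo (-η) η :=
    Ioo_subset_Ioo (neg_le_neg (min_le_left _ _)) (min_le_left _ _)
  have hrε : Ioo (-r) r ⊆ Ioo (-ε) ε :=
    Ioo_subset_Ioo (neg_le_neg (min_le_right _ _)) (min_le_right _ _)
  have h0r : (0 : ℝ) ∈ Ioo (-r) r := ⟨by linarith, hr0'⟩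
  have hortho : ∀ t ∈ Ioo (-r) r, coordInner e (t • bvec 0) (X t) (bvec 0) = 0 := by
    intro t ht
    have hd : ∀ t ∈ Ioo (-r) r,
        HasDerivAt (fun τ ↦ coordInner e (τ • bvec 0) (X τ) (bvec 0)) 0 t := by
      intro t ht
      refine (h.smooth.hasDerivAt_coordInner (hmem t (hrη ht)) (hX t (hrε ht))
        (hasDerivAt_const t (bvec 0))).congr_deriv ?_
      rw [hgam t (hrη ht), neg_add_cancel, add_zero]
      simp [coordInner]
    have h3 := isOpen_Ioo.is_const_of_deriv_eq_zero isPreconnected_Ioo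
      (fun t ht ↦ (hd t ht).differentiableAt.differentiableWithinAt)
      (fun t ht ↦ (hd t ht).deriv) ht h0r
    refine h3.trans ?_
    rw [zero_smul, h.coordInner_zero, hX0]
    simp
  have hkey := hch γ 0 η hη (by simpa using hgeod) (Or.inl hpair) e h.smooth
    (by rw [← hx₀, zero_smul]; exact e.map_target h.mem) X (by
      filter_upwards [isOpen_Ioo.mem_nhds h0r] with t ht
      refine ⟨(hX t (hrε ht)).differentiableAt, ?_, ?_⟩
      · rw [covDeriv_eq, (hX t (hrε ht)).deriv, hdu t (hrη ht), show e (γ t) = t • bvec 0 from (hu t (hrη ht)).self_of_nhds,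
          neg_add_cancel]
      · rw [hdu t (hrη ht), show e (γ t) = t • bvec 0 from (hu t (hrη ht)).self_of_nhds]
        exact hortho t ht) (by rw [hX0]; simp)
  set Y : ℝ → E3 := fun τ ↦ ricciOp e (τ • bvec 0) (X τ) with hY
  set T : ℝ → E3 := fun _ ↦ bvec 0 with hT
  set q : (ℝ → E3) → (ℝ → E3) → ℝ → ℝ := fun V W τ ↦ coordInner e (τ • bvec 0) (V τ) (W τ) with hq
  have hZ : ricciOffDiag e (fun τ ↦ e (γ τ)) X =ᶠ[𝓝 0] fun t ↦
      Y t - (q Y X t / q X X t) • X t - (q Y T t / q T T t) • T t := by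
    filter_upwards [isOpen_Ioo.mem_nhds h00] with t ht
    simp only [ricciOffDiag, hdu t ht, show e (γ t) = t • bvec 0 from (hu t ht).self_of_nhds, hq,
      hY, hT]
  have hX' : HasDerivAt X 0 0 := by
    have := hX 0 h00'
    simpa [h.gam_zero] using this
  have hT' : HasDerivAt T 0 0 := hasDerivAt_const _ _
  have hY' := h.hasDerivAt_ricciOp hX' hX0
  have hY0 : ∀ i, Y 0 i = ricci e i 1 0 := fun i ↦ by
    simp only [hY, zero_smul, hX0, h.ricciOp_zero]
  have q1 : HasDerivAt (q Y X) (pderiv 0 (ricci e 1 1) 0) 0 :=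
    (h.hasDerivAt_coordInner hY' hX').congr_deriv (by simp [hX0])
  have q2 : HasDerivAt (q X X) 0 0 := (h.hasDerivAt_coordInner hX' hX').congr_deriv (by simp)
  have q3 : HasDerivAt (q Y T) (pderiv 0 (ricci e 0 1) 0) 0 :=
    (h.hasDerivAt_coordInner hY' hT').congr_deriv (by simp [hT])
  have q4 : HasDerivAt (q T T) 0 0 := (h.hasDerivAt_coordInner hT' hT').congr_deriv (by simp)
  have q1' : q Y X 0 = ricci e 1 1 0 := by
    simp only [hq, zero_smul, h.coordInner_zero, hX0, Fin.sum_univ_three, hY0]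
    simp
  have q2' : q X X 0 = 1 := by
    simp only [hq, zero_smul, h.coordInner_zero, hX0, Fin.sum_univ_three]
    simp
  have q3' : q Y T 0 = ricci e 0 1 0 := by
    simp only [hq, zero_smul, h.coordInner_zero, hT, Fin.sum_univ_three, hY0]
    simp
  have q4' : q T T 0 = 1 := by
    simp only [hq, zero_smul, h.coordInner_zero, hT, Fin.sum_univ_three]
    simp
  have hZ' := (hY'.fun_sub ((q1.fun_div q2 (by rw [q2']; norm_num)).fun_smul hX')).fun_sub
    ((q3.fun_div q4 (by rw [q4']; norm_num)).fun_smul hT')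
  rcases hkey with hkey | hkey
  · refine hkey ?_
    rw [hZ.self_of_nhds]
    simp only
    rw [q1', q2', q3', q4', hX0]
    ext i
    fin_cases i <;> simp [hY0, hT, hr0]
  · refine hkey ?_
    rw [covDeriv_eq, hZ.deriv_eq, hZ'.deriv, show e (γ 0) = (0 : ℝ) • bvec 0 from
      (hu 0 h00).self_of_nhds, zero_smul, h.gam_zero, q1', q2', q3', q4', hX0]
    ext i
    fin_cases i <;> simp [hT, hr1]
end IsFlatAtZero
end

/-- The rotation by the angle `θ` about the first coordinate axis. -/
noncomputable def rot (θ : ℝ) : E3 ≃ₗᵢ[ℝ] E3 where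
  toFun V := !₂[V 0, Real.cos θ * V 1 - Real.sin θ * V 2, Real.sin θ * V 1 + Real.cos θ * V 2]
  invFun V := !₂[V 0, Real.cos θ * V 1 + Real.sin θ * V 2, -Real.sin θ * V 1 + Real.cos θ * V 2]
  map_add' V W := by
    ext i
    fin_cases i <;> simp <;> ring
  map_smul' c V := by
    ext i
    fin_cases i <;> simp <;> ring
  left_inv V := by
    ext i
    fin_cases i
    · simp
    · simp
      linear_combination V 1 * Real.sin_sq_add_cos_sq θ
    · simp
      linear_combination V 2 * Real.sin_sq_add_cos_sq θ
  right_inv V := by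
    ext i
    fin_cases i
    · simp
    · simp
      linear_combination V 1 * Real.sin_sq_add_cos_sq θ
    · simp
      linear_combination V 2 * Real.sin_sq_add_cos_sq θ
  norm_map' V := by
    rw [EuclideanSpace.norm_eq, EuclideanSpace.norm_eq]
    congr 1
    simp [Fin.sum_univ_three]
    linear_combination (V 1 ^ 2 + V 2 ^ 2) * Real.sin_sq_add_cos_sq θ

lemma rot_bvec_zero (θ : ℝ) : rot θ (bvec 0) = bvec 0 := by
  ext i
  fin_cases i <;> simp [rot]

lemma rot_bvec_one (θ : ℝ) : rot θ (bvec 1) = Real.cos θ • bvec 1 + Real.sin θ • bvec 2 := by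
  ext i
  fin_cases i <;> simp [rot]

lemma rot_symm_apply_two (θ : ℝ) (V : E3) :
    (rot θ).symm V 2 = -Real.sin θ * V 1 + Real.cos θ * V 2 := by
  change (!₂[V 0, Real.cos θ * V 1 + Real.sin θ * V 2, -Real.sin θ * V 1 + Real.cos θ * V 2] : E3) 2
    = _
  simp

/-- The off-diagonal entry of the bilinear form `p` in the basis rotated by `θ`. -/
noncomputable def rotForm (θ : ℝ) (p : Fin 3 → Fin 3 → ℝ) : ℝ :=
  -Real.sin θ * (Real.cos θ * p 1 1 + Real.sin θ * p 2 1) +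
    Real.cos θ * (Real.cos θ * p 1 2 + Real.sin θ * p 2 2)

lemma exists_rotForm_eq_zero {p : Fin 3 → Fin 3 → ℝ} (hp : p 1 2 = p 2 1) :
    ∃ θ ∈ Icc 0 (Real.pi / 2), rotForm θ p = 0 := by
  have hc : Continuous fun θ ↦ rotForm θ p := by
    unfold rotForm
    fun_prop
  have h0 : rotForm 0 p = p 1 2 := by simp [rotForm]
  have h1 : rotForm (Real.pi / 2) p = -p 1 2 := by simp [rotForm, hp]
  have h2 := intermediate_value_uIcc (f := fun θ ↦ rotForm θ p) (a := 0) (b := Real.pi / 2)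
    hc.continuousOn
  simp only [h0, h1] at h2
  rw [uIcc_of_le Real.pi_div_two_pos.le] at h2
  refine (mem_image _ _ _).1 (h2 ?_)
  rw [mem_uIcc]
  rcases le_total (p 1 2) 0 with h | h
  · exact Or.inl ⟨h, by linarith⟩
  · exact Or.inr ⟨by linarith, h⟩

section
variable {f f' f'' f''' : ℝ → ℝ} {T M : ℝ}

lemma abs_sub_le_mul_of_hasDerivAt (hf : ∀ t ∈ Icc 0 T, HasDerivAt f (f' t) t)
    (hM : ∀ t ∈ Icc 0 T, |f' t| ≤ M) {t : ℝ} (ht : t ∈ Icc 0 T) : |f t - f 0| ≤ M * t := by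
  have h := (convex_Icc (0 : ℝ) T).norm_image_sub_le_of_norm_hasDerivWithin_le
    (fun t ht ↦ (hf t ht).hasDerivWithinAt) hM ⟨le_rfl, ht.1.trans ht.2⟩ ht
  rwa [sub_zero, Real.norm_eq_abs, Real.norm_of_nonneg ht.1] at h

lemma abs_sub_sub_le_mul_of_hasDerivAt (hf : ∀ t ∈ Icc 0 T, HasDerivAt f (f' t) t)
    (hf' : ∀ t ∈ Icc 0 T, HasDerivAt f' (f'' t) t) (hM : ∀ t ∈ Icc 0 T, |f'' t| ≤ M) {t : ℝ}
    (ht : t ∈ Icc 0 T) : |f t - f 0 - f' 0 * t| ≤ M * t ^ 2 := by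
  have hM0 : 0 ≤ M := (abs_nonneg _).trans (hM t ht)
  have hsub : ∀ s ∈ Icc 0 t, s ∈ Icc 0 T := fun s hs ↦ ⟨hs.1, hs.2.trans ht.2⟩
  have h := abs_sub_le_mul_of_hasDerivAt (f := fun t ↦ f t - f' 0 * t) (f' := fun s ↦ f' s - f' 0)
    (T := t) (M := M * t) (fun s hs ↦ ?_) (fun s hs ↦ ?_) ⟨ht.1, le_rfl⟩
  · convert h using 1
    · congr 1
      ring
    · ring
  · simpa using (hf s (hsub s hs)).fun_sub ((hasDerivAt_id s).const_mul (f' 0))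
  · exact (abs_sub_le_mul_of_hasDerivAt hf' hM (hsub s hs)).trans
      (mul_le_mul_of_nonneg_left hs.2 hM0)

lemma abs_sub_sub_sub_le_mul_of_hasDerivAt (hf : ∀ t ∈ Icc 0 T, HasDerivAt f (f' t) t)
    (hf' : ∀ t ∈ Icc 0 T, HasDerivAt f' (f'' t) t)
    (hf'' : ∀ t ∈ Icc 0 T, HasDerivAt f'' (f''' t) t) (hM : ∀ t ∈ Icc 0 T, |f''' t| ≤ M) {t : ℝ}
    (ht : t ∈ Icc 0 T) : |f t - f 0 - f' 0 * t - f'' 0 / 2 * t ^ 2| ≤ M * t ^ 3 := by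
  have hM0 : 0 ≤ M := (abs_nonneg _).trans (hM t ht)
  have hsub : ∀ s ∈ Icc 0 t, s ∈ Icc 0 T := fun s hs ↦ ⟨hs.1, hs.2.trans ht.2⟩
  have h := abs_sub_le_mul_of_hasDerivAt (f := fun t ↦ f t - f' 0 * t - f'' 0 / 2 * t ^ 2)
    (f' := fun s ↦ f' s - f' 0 - f'' 0 * s) (T := t) (M := M * t ^ 2) (fun s hs ↦ ?_)
    (fun s hs ↦ ?_) ⟨ht.1, le_rfl⟩
  · convert h using 1
    · congr 1
      ring
    · ring
  · refine (((hf s (hsub s hs)).fun_sub ((hasDerivAt_id s).const_mul (f' 0))).fun_sub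
      ((hasDerivAt_pow 2 s).const_mul (f'' 0 / 2))).congr_deriv ?_
    simp
    ring
  · exact (abs_sub_sub_le_mul_of_hasDerivAt hf' hf'' hM (hsub s hs)).trans
      (mul_le_mul_of_nonneg_left (pow_le_pow_left₀ hs.1 hs.2 2) hM0)
end

section
variable {M : Type*} [EMetricSpace M] [ChartedSpace E3 M] [IsManifold (𝓡 3) ∞ M]
    [RiemannianBundle (fun x : M ↦ TangentSpace (𝓡 3) x)]
    [IsContMDiffRiemannianBundle (𝓡 3) ∞ E3 (fun x : M ↦ TangentSpace (𝓡 3) x)]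
    {e : OpenPartialHomeomorph M E3}

lemma IsSmoothChart.hasFDerivAt_gam_apply (he : IsSmoothChart e) {u : E3} (hu : u ∈ e.target)
    (V W : E3) : HasFDerivAt (fun z ↦ gam e z V W)
      (((fderiv ℝ (gam e) u).flip V).flip W) u := by
  have h1 := he.contDiffOn_gam.hasFDerivAt_of_isOpen e.open_target hu
  have h2 := (h1.clm_apply (hasFDerivAt_const V u)).clm_apply (hasFDerivAt_const W u)
  refine h2.congr_fderiv ?_
  ext w
  simp

lemma IsSmoothChart.fderiv_gam_apply (he : IsSmoothChart e) {u : E3} (hu : u ∈ e.target)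
    (a i j k : Fin 3) :
    fderiv ℝ (gam e) u (bvec a) (bvec i) (bvec j) k = pderiv a (christoffel e i j k) u := by
  have h1 := he.hasFDerivAt_gam_apply hu (bvec i) (bvec j)
  have h2 := (EuclideanSpace.proj k : E3 →L[ℝ] ℝ).hasFDerivAt.comp u h1
  have h3 : (⇑(EuclideanSpace.proj k : E3 →L[ℝ] ℝ) ∘ fun z ↦ gam e z (bvec i) (bvec j)) =
      christoffel e i j k := funext fun z ↦ gam_single e z i j k
  rw [h3] at h2
  rw [pderiv, h2.fderiv]
  simp

lemma IsSmoothChart.fderiv_gam_comm (he : IsSmoothChart e) {u : E3} (hu : u ∈ e.target)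
    (Y V W : E3) : fderiv ℝ (gam e) u Y V W = fderiv ℝ (gam e) u Y W V := by
  have h1 := he.hasFDerivAt_gam_apply hu V W
  have h2 := he.hasFDerivAt_gam_apply hu W V
  have h3 : (fun z ↦ gam e z W V) = fun z ↦ gam e z V W := funext fun z ↦ gam_comm e z W V
  rw [h3] at h2
  exact congrArg (fun L : E3 →L[ℝ] E3 ↦ L Y) (h1.unique h2)

lemma IsSmoothChart.fderiv_gam_axis (he : IsSmoothChart e) {T : ℝ} (hT : 0 < T)
    (hmem : ∀ t ∈ Icc 0 T, t • bvec 0 ∈ e.target)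
    (hgeod : ∀ t ∈ Icc 0 T, gam e (t • bvec 0) (bvec 0) (bvec 0) = 0) {t : ℝ} (ht : t ∈ Icc 0 T) :
    fderiv ℝ (gam e) (t • bvec 0) (bvec 0) (bvec 0) (bvec 0) = 0 := by
  have h1 : HasDerivAt (fun τ : ℝ ↦ τ • bvec 0) (bvec 0) t := by
    simpa using (hasDerivAt_id t).smul_const (bvec 0)
  have h2 := ((he.hasFDerivAt_gam_apply (hmem t ht) (bvec 0) (bvec 0)).comp_hasDerivAt t
    h1).hasDerivWithinAt (s := Icc 0 T)
  have h3 : HasDerivWithinAt (fun _ : ℝ ↦ (0 : E3)) 0 (Icc 0 T) t := hasDerivWithinAt_const ..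
  have h4 := h3.congr (f₁ := (fun z ↦ gam e z (bvec 0) (bvec 0)) ∘ fun τ : ℝ ↦ τ • bvec 0)
    (fun s hs ↦ hgeod s hs) (hgeod t ht)
  exact (uniqueDiffOn_Icc hT t ht).eq_deriv _ h2 h4

/-- The Taylor expansions along the first coordinate axis. -/
lemma IsFlatAtZero.exists_axisJet (h : IsFlatAtZero e) {T : ℝ} (hT : 0 < T)
    (hmem : ∀ t ∈ Icc 0 T, t • bvec 0 ∈ e.target)
    (hgeod : ∀ t ∈ Icc 0 T, gam e (t • bvec 0) (bvec 0) (bvec 0) = 0)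
    (hA : pderiv 1 (christoffel e 0 0 2) 0 = 0) (hB : pderiv 0 (christoffel e 0 1 2) 0 = 0) :
    ∃ C, AxisJet (gam e) e.target T C (pderiv 0 (pderiv 1 (christoffel e 0 0 2)) 0)
      (pderiv 0 (pderiv 0 (christoffel e 0 1 2)) 0 / 2) := by
  have hU := e.open_target
  have he := h.smooth
  have hΓ := he.contDiffOn_gam
  have hax : Continuous fun t : ℝ ↦ t • bvec 0 := by fun_prop
  have hbound : ∀ {F : Type} [NormedAddCommGroup F] {f : E3 → F}, ContinuousOn f e.target →
      ∃ C, ∀ t ∈ Icc 0 T, ‖f (t • bvec 0)‖ ≤ C := fun hf ↦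
    isCompact_Icc.exists_bound_of_continuousOn (hf.comp hax.continuousOn fun t ht ↦ hmem t ht)
  have hd : ∀ {f : E3 → ℝ}, ContDiffOn ℝ ∞ f e.target → ∀ t ∈ Icc 0 T,
      HasDerivAt (fun τ : ℝ ↦ f (τ • bvec 0)) (pderiv 0 f (t • bvec 0)) t := fun hf t ht ↦
    hasDerivAt_comp_axis (hf.differentiableAt_of_isOpen hU (hmem t ht))
  have hp : ∀ {f : E3 → ℝ}, ContDiffOn ℝ ∞ f e.target → ∀ i, ContDiffOn ℝ ∞ (pderiv i f) e.target :=
    fun hf i ↦ contDiffOn_pderiv hU hf i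
  have hfd : ContinuousOn (fderiv ℝ (gam e)) e.target :=
    (hΓ.fderiv_of_isOpen hU (m := ∞) (by simp)).continuousOn
  have hc1 := hp (he.contDiffOn_christoffel 0 0 2) 1
  have hc2 := he.contDiffOn_christoffel 0 1 2
  obtain ⟨C₁, hC₁⟩ := hbound hfd
  obtain ⟨C₂, hC₂⟩ := hbound (hp (hp hc1 0) 0).continuousOn
  obtain ⟨C₃, hC₃⟩ := hbound (hp (hp (hp hc2 0) 0) 0).continuousOn
  have h0T : (0 : ℝ) ∈ Icc 0 T := ⟨le_rfl, hT.le⟩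
  have hC₁0 : 0 ≤ C₁ := (norm_nonneg _).trans (hC₁ 0 h0T)
  refine ⟨max C₁ (max C₂ C₃), hU, hΓ, gam_comm e, hT, hC₁0.trans (le_max_left _ _), hmem, hgeod,
    fun t ht ↦ ?_, fun t ht ↦ (hC₁ t ht).trans (le_max_left _ _),
    fun t ht ↦ he.fderiv_gam_axis hT hmem hgeod ht, fun t ht ↦ ?_, fun t ht ↦ ?_⟩
  · have h1 : ∀ s ∈ Icc 0 T, HasDerivWithinAt (fun τ : ℝ ↦ gam e (τ • bvec 0))
        (fderiv ℝ (gam e) (s • bvec 0) (bvec 0)) (Icc 0 T) s := by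
      intro s hs
      have h2 : HasDerivAt (fun τ : ℝ ↦ τ • bvec 0) (bvec 0) s := by
        simpa using (hasDerivAt_id s).smul_const (bvec 0)
      exact ((hΓ.hasFDerivAt_of_isOpen hU (hmem s hs)).comp_hasDerivAt s h2).hasDerivWithinAt
    have h3 := (convex_Icc (0 : ℝ) T).norm_image_sub_le_of_norm_hasDerivWithin_le (C := C₁) h1
      (fun s hs ↦ ?_) h0T ht
    · simp only [zero_smul, h.gam_zero, sub_zero, Real.norm_of_nonneg ht.1] at h3
      exact h3.trans (mul_le_mul_of_nonneg_right (le_max_left _ _) ht.1)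
    · refine (ContinuousLinearMap.le_opNorm _ _).trans ?_
      rw [norm_bvec, mul_one]
      exact hC₁ s hs
  · rw [he.fderiv_gam_apply (hmem t ht)]
    have h1 := abs_sub_sub_le_mul_of_hasDerivAt (hd hc1) (hd (hp hc1 0)) hC₂ ht
    simp only [zero_smul, hA, sub_zero] at h1
    exact h1.trans (mul_le_mul_of_nonneg_right ((le_max_left _ _).trans (le_max_right _ _))
      (sq_nonneg _))
  · rw [gam_single]
    have h1 := abs_sub_sub_sub_le_mul_of_hasDerivAt (hd hc2) (hd (hp hc2 0)) (hd (hp (hp hc2 0) 0))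
      hC₃ ht
    simp only [zero_smul, h.christoffel_zero, hB, sub_zero, zero_mul] at h1
    exact h1.trans (mul_le_mul_of_nonneg_right ((le_max_right _ _).trans (le_max_right _ _))
      (pow_nonneg ht.1 3))
end

section
variable {θ : ℝ} {u₀ z : E3}

lemma hasFDerivAt_comp_rot {F : E3 → ℝ} (hF : DifferentiableAt ℝ F (rot θ z + u₀)) :
    HasFDerivAt (fun z ↦ F (rot θ z + u₀))
      ((fderiv ℝ F (rot θ z + u₀)).comp (rot θ : E3 →L[ℝ] E3)) z :=
  hF.hasFDerivAt.comp z ((rot θ : E3 ≃L[ℝ] E3).hasFDerivAt.add_const u₀)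

lemma pderiv_zero_comp_rot {F : E3 → ℝ} (hF : DifferentiableAt ℝ F (rot θ z + u₀)) :
    pderiv 0 (fun z ↦ F (rot θ z + u₀)) z = pderiv 0 F (rot θ z + u₀) := by
  rw [pderiv, (hasFDerivAt_comp_rot hF).fderiv]
  change fderiv ℝ F (rot θ z + u₀) (rot θ (bvec 0)) = _
  rw [rot_bvec_zero, pderiv]

lemma pderiv_one_comp_rot {F : E3 → ℝ} (hF : DifferentiableAt ℝ F (rot θ z + u₀)) :
    pderiv 1 (fun z ↦ F (rot θ z + u₀)) z =
      Real.cos θ * pderiv 1 F (rot θ z + u₀) + Real.sin θ * pderiv 2 F (rot θ z + u₀) := by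
  rw [pderiv, (hasFDerivAt_comp_rot hF).fderiv]
  change fderiv ℝ F (rot θ z + u₀) (rot θ (bvec 1)) = _
  rw [rot_bvec_one, map_add, map_smul, map_smul]
  rfl

lemma pderiv_rotForm {P : Fin 3 → Fin 3 → E3 → ℝ}
    (hP : ∀ j k, DifferentiableAt ℝ (P j k) (rot θ z + u₀)) :
    pderiv 0 (fun z ↦ rotForm θ fun j k ↦ P j k (rot θ z + u₀)) z =
      rotForm θ fun j k ↦ pderiv 0 (P j k) (rot θ z + u₀) := by
  have hd : ∀ j k, DifferentiableAt ℝ (fun z ↦ P j k (rot θ z + u₀)) z := fun j k ↦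
    (hasFDerivAt_comp_rot (hP j k)).differentiableAt
  unfold rotForm
  rw [pderiv_add ((((hd 1 1).const_mul _).fun_add ((hd 2 1).const_mul _)).const_mul _)
    ((((hd 1 2).const_mul _).fun_add ((hd 2 2).const_mul _)).const_mul _),
    pderiv_const_mul (((hd 1 1).const_mul _).fun_add ((hd 2 1).const_mul _)),
    pderiv_const_mul (((hd 1 2).const_mul _).fun_add ((hd 2 2).const_mul _)),
    pderiv_add ((hd 1 1).const_mul _) ((hd 2 1).const_mul _),
    pderiv_add ((hd 1 2).const_mul _) ((hd 2 2).const_mul _), pderiv_const_mul (hd 1 1),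
    pderiv_const_mul (hd 2 1), pderiv_const_mul (hd 1 2), pderiv_const_mul (hd 2 2),
    pderiv_zero_comp_rot (hP 1 1), pderiv_zero_comp_rot (hP 2 1), pderiv_zero_comp_rot (hP 1 2),
    pderiv_zero_comp_rot (hP 2 2)]
end

section
variable {M : Type*} [EMetricSpace M] [ChartedSpace E3 M] [IsManifold (𝓡 3) ∞ M]
    [RiemannianBundle (fun x : M ↦ TangentSpace (𝓡 3) x)]
    [IsContMDiffRiemannianBundle (𝓡 3) ∞ E3 (fun x : M ↦ TangentSpace (𝓡 3) x)]
    {e : OpenPartialHomeomorph M E3} {α θ : ℝ} {u₀ : E3}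

lemma affineChart_target_mem_nhds {z : E3} (hz : rot θ z + u₀ ∈ e.target) :
    ∀ᶠ w in 𝓝 z, rot θ w + u₀ ∈ e.target :=
  (affineChart e u₀ (rot θ)).open_target.mem_nhds (x := z) hz

lemma HasInjRadiusGT.christoffel_rot (hα : 0 < α) (h : HasInjRadiusGT M (2 * α))
    (he : IsSmoothChart e) {z : E3} (hz : rot θ z + u₀ ∈ e.target) :
    christoffel (affineChart e u₀ (rot θ)) 0 1 2 z =
        rotForm θ (fun j k ↦ christoffel e 0 j k (rot θ z + u₀)) ∧
      christoffel (affineChart e u₀ (rot θ)) 0 0 2 z =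
        -Real.sin θ * christoffel e 0 0 1 (rot θ z + u₀) +
          Real.cos θ * christoffel e 0 0 2 (rot θ z + u₀) := by
  constructor
  · rw [← gam_single, h.gam_affineChart hα he hz, rot_symm_apply_two, rot_bvec_zero, rot_bvec_one,
      map_add, map_smul, map_smul]
    simp only [PiLp.add_apply, PiLp.smul_apply, gam_single, smul_eq_mul, rotForm]
  · rw [← gam_single, h.gam_affineChart hα he hz, rot_symm_apply_two, rot_bvec_zero]
    simp only [gam_single]

lemma HasInjRadiusGT.pderiv_christoffel_rot (hα : 0 < α) (h : HasInjRadiusGT M (2 * α))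
    (he : IsSmoothChart e) {z : E3} (hz : rot θ z + u₀ ∈ e.target) :
    pderiv 0 (christoffel (affineChart e u₀ (rot θ)) 0 1 2) z =
        rotForm θ (fun j k ↦ pderiv 0 (christoffel e 0 j k) (rot θ z + u₀)) ∧
      pderiv 1 (christoffel (affineChart e u₀ (rot θ)) 0 0 2) z =
        rotForm θ (fun j k ↦ pderiv j (christoffel e 0 0 k) (rot θ z + u₀)) := by
  have hd : ∀ i j k, DifferentiableAt ℝ (christoffel e i j k) (rot θ z + u₀) := fun i j k ↦
    (he.contDiffOn_christoffel i j k).differentiableAt_of_isOpen e.open_target hz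
  have hd' : ∀ i j k, DifferentiableAt ℝ (fun z ↦ christoffel e i j k (rot θ z + u₀)) z :=
    fun i j k ↦ (hasFDerivAt_comp_rot (hd i j k)).differentiableAt
  have hev := affineChart_target_mem_nhds hz
  constructor
  · rw [pderiv_congr (hev.mono fun w hw ↦ (h.christoffel_rot hα he hw).1),
      pderiv_rotForm (P := fun j k ↦ christoffel e 0 j k) fun j k ↦ hd 0 j k]
  · rw [pderiv_congr (hev.mono fun w hw ↦ (h.christoffel_rot hα he hw).2),
      pderiv_add ((hd' 0 0 1).const_mul _) ((hd' 0 0 2).const_mul _), pderiv_const_mul (hd' 0 0 1),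
      pderiv_const_mul (hd' 0 0 2), pderiv_one_comp_rot (hd 0 0 1), pderiv_one_comp_rot (hd 0 0 2),
      rotForm]

lemma HasInjRadiusGT.pderiv_pderiv_christoffel_rot (hα : 0 < α) (h : HasInjRadiusGT M (2 * α))
    (he : IsSmoothChart e) {z : E3} (hz : rot θ z + u₀ ∈ e.target) :
    pderiv 0 (pderiv 1 (christoffel (affineChart e u₀ (rot θ)) 0 0 2)) z =
      rotForm θ (fun j k ↦ pderiv 0 (pderiv j (christoffel e 0 0 k)) (rot θ z + u₀)) := by
  have hev := affineChart_target_mem_nhds hz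
  rw [pderiv_congr (hev.mono fun w hw ↦ (h.pderiv_christoffel_rot hα he hw).2),
    pderiv_rotForm (P := fun j k ↦ pderiv j (christoffel e 0 0 k)) fun j k ↦
      (contDiffOn_pderiv e.open_target (he.contDiffOn_christoffel 0 0 k)
        j).differentiableAt_of_isOpen e.open_target hz]

namespace IsNormalChart
variable {r : ℝ}

lemma gam_line (h : IsNormalChart e r) {V : E3} {t : ℝ} (ht : ‖t • V‖ < r) :
    gam e (t • V) V V = 0 := by
  rcases eq_or_ne V 0 with rfl | hV
  · simp
  have hN : 0 < ‖V‖ := norm_pos_iff.2 hV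
  have h1 := IsGeodesicOn.gam_line h.smooth (p := 0) (V := ‖V‖⁻¹ • V) (t := t * ‖V‖) isOpen_Ioo
    (by simpa only [zero_add] using (h.rays (‖V‖⁻¹ • V) (by rw [norm_smul]; simp [hN.ne'])).1)
    (by
      rw [norm_smul, Real.norm_eq_abs] at ht
      exact abs_lt.1 (by rwa [abs_mul, abs_of_pos hN])) (by
      rw [zero_add, smul_smul, mul_assoc, mul_inv_cancel₀ hN.ne', mul_one, h.target_eq]
      simpa using ht)
  rw [zero_add, smul_smul, mul_assoc, mul_inv_cancel₀ hN.ne', mul_one] at h1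
  simp only [map_smul, _root_.smul_apply, smul_smul, smul_eq_zero] at h1
  exact h1.resolve_left (by positivity)

lemma isFlatAtZero (h : IsNormalChart e r) (hr : 0 < r) : IsFlatAtZero e where
  smooth := h.smooth
  mem := by rw [h.target_eq]; simpa using hr
  orthonormal := h.orthonormal
  gam_zero := gam_eq_zero_of_diag fun V ↦ by
    simpa using h.gam_line (V := V) (t := 0) (by simpa using hr)

lemma fderiv_gam_diag (h : IsNormalChart e r) (hr : 0 < r) (V : E3) :
    fderiv ℝ (gam e) 0 V V V = 0 := by
  have h0 : (0 : E3) ∈ e.target := (h.isFlatAtZero hr).mem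
  have h1 : HasDerivAt (fun τ : ℝ ↦ τ • V) V 0 := by
    simpa using (hasDerivAt_id (0 : ℝ)).smul_const V
  have h2 : HasFDerivAt (fun z ↦ gam e z V V) (((fderiv ℝ (gam e) 0).flip V).flip V)
      ((0 : ℝ) • V) := by
    rw [zero_smul]
    exact h.smooth.hasFDerivAt_gam_apply h0 V V
  have h3 := h2.comp_hasDerivAt 0 h1
  have hc : Continuous fun τ : ℝ ↦ ‖τ • V‖ := by fun_prop
  have h4 : ((fun z ↦ gam e z V V) ∘ fun τ : ℝ ↦ τ • V) =ᶠ[𝓝 0] fun _ ↦ (0 : E3) := by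
    filter_upwards [hc.continuousAt.eventually_lt_const (show ‖(0 : ℝ) • V‖ < r by simpa using hr)]
      with τ hτ
    exact h.gam_line hτ
  exact h3.unique ((hasDerivAt_const (0 : ℝ) (0 : E3)).congr_of_eventuallyEq h4)

lemma pderiv_christoffel_add (h : IsNormalChart e r) (hr : 0 < r) (j k : Fin 3) :
    pderiv j (christoffel e 0 0 k) 0 + 2 * pderiv 0 (christoffel e 0 j k) 0 = 0 := by
  have h0 : (0 : E3) ∈ e.target := (h.isFlatAtZero hr).mem
  rw [← h.smooth.fderiv_gam_apply h0, ← h.smooth.fderiv_gam_apply h0]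
  set D := fderiv ℝ (gam e) 0 with hD
  have hs : ∀ Y V W, D Y V W = D Y W V := h.smooth.fderiv_gam_comm h0
  have h1 := h.fderiv_gam_diag hr (bvec 0 + bvec j)
  have h2 := h.fderiv_gam_diag hr (bvec 0 - bvec j)
  have h3 := h.fderiv_gam_diag hr (bvec 0)
  have h3' := h.fderiv_gam_diag hr (bvec j)
  rw [← hD] at h1 h2 h3 h3'
  simp only [map_add, map_sub, _root_.add_apply, _root_.sub_apply, hs _ (bvec j) (bvec 0), h3, h3']
    at h1 h2
  have h4 : D (bvec j) (bvec 0) (bvec 0) + (2 : ℝ) • D (bvec 0) (bvec 0) (bvec j) = 0 := by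
    have h5 := congrArg₂ (fun x y : E3 ↦ (1 / 2 : ℝ) • (x - y)) h1 h2
    simp only [sub_zero, smul_zero] at h5
    rw [← h5]
    module
  have h6 := congrArg (fun x : E3 ↦ x k) h4
  simpa using h6

lemma rot (h : IsNormalChart e r) (hr : 0 < r) (θ : ℝ) :
    IsNormalChart (affineChart e 0 (rot θ)) r where
  smooth := h.smooth.affineChart 0 (_root_.rot θ)
  target_eq := by
    ext z
    rw [mem_affineChart_target, h.target_eq, add_zero, mem_ball_zero_iff, mem_ball_zero_iff,
      LinearIsometryEquiv.norm_map]
  orthonormal i j := by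
    have h0 := (h.isFlatAtZero hr).mem
    have h0' : _root_.rot θ 0 + 0 ∈ e.target := by simpa using h0
    have h1 := (h.isFlatAtZero hr).coordInner_zero (_root_.rot θ (bvec i)) (_root_.rot θ (bvec j))
    have h2 : ∑ k, _root_.rot θ (bvec i) k * _root_.rot θ (bvec j) k =
        inner ℝ (_root_.rot θ (bvec i)) (_root_.rot θ (bvec j)) := by
      rw [PiLp.inner_apply]
      exact Finset.sum_congr rfl fun k _ ↦ mul_comm _ _
    rw [h2, LinearIsometryEquiv.inner_map_map] at h1
    have h3 : metricCoeff (affineChart e 0 (_root_.rot θ)) i j 0 =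
        coordInner e 0 (_root_.rot θ (bvec i)) (_root_.rot θ (bvec j)) := by
      have h4 := coordInner_eq_inner (affineChart e 0 (_root_.rot θ)) 0 (bvec i) (bvec j)
      have h5 := coordInner_eq_inner e (_root_.rot θ 0 + 0) (_root_.rot θ (bvec i))
        (_root_.rot θ (bvec j))
      rw [h.smooth.coordVec_affineChart h0', h.smooth.coordVec_affineChart h0'] at h4
      have h6 := h4.trans h5.symm
      rw [map_zero, add_zero] at h6
      rw [← h6]
      simp [coordInner]
    rw [h3, h1]
    simp [PiLp.inner_apply]
  rays V hV := by
    have := h.rays (_root_.rot θ V) (by rw [LinearIsometryEquiv.norm_map, hV])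
    simpa only [affineChart_symm_apply, map_smul, add_zero] using this
end IsNormalChart

/-- A chart around `x₀` in which the first coordinate axis is a geodesic in the given direction and
the metric has a normal form to third order. -/
lemma HasInjRadiusGT.exists_axisJet_of_isChaoticAt (hα : 0 < α) (hinj : HasInjRadiusGT M (2 * α))
    {x₀ : M} {τ₀ : TangentSpace (𝓡 3) x₀} (hτ₀ : τ₀ ≠ 0) (hch : IsChaoticAt x₀ τ₀) :
    ∃ (e : OpenPartialHomeomorph M E3) (T C a b : ℝ), IsUnitAxis e T ∧
      AxisJet (gam e) e.target T C a b ∧ a ≠ 2 * b ∧ e.symm 0 = x₀ := by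
  obtain ⟨r, hr, hx⟩ := hinj x₀
  have hr0 : 0 < r := by linarith
  have hτ : ‖(‖τ₀‖⁻¹ • τ₀)‖ = 1 := by
    rw [norm_smul, norm_inv, norm_norm, inv_mul_cancel₀ (norm_ne_zero_iff.2 hτ₀)]
  obtain ⟨e, hn, hx0, hpair⟩ := hx.exists_normalChart hr0 hτ
  have hα' := hn.pderiv_christoffel_add hr0
  have hs := (hn.isFlatAtZero hr0).pderiv_christoffel_symm 1 2
  obtain ⟨θ, -, hθ⟩ := exists_rotForm_eq_zero (p := fun j k ↦ pderiv 0 (christoffel e 0 j k) 0)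
    (by linarith [hα' 1 2, hα' 2 1])
  set e' := affineChart e 0 (rot θ) with he'
  have hn' : IsNormalChart e' r := hn.rot hr0 θ
  have hf := hn'.isFlatAtZero hr0
  have hsymm : ∀ t : ℝ, e'.symm (t • bvec 0) = e.symm (t • bvec 0) := fun t ↦ by
    rw [he', affineChart_symm_apply, map_smul, rot_bvec_zero, add_zero]
  have h0 : rot θ 0 + 0 ∈ e.target := by simpa using (hn.isFlatAtZero hr0).mem
  have hB : pderiv 0 (christoffel e' 0 1 2) 0 = 0 := by
    rw [(hinj.pderiv_christoffel_rot hα hn.smooth h0).1, map_zero, add_zero, hθ]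
  have hA : pderiv 1 (christoffel e' 0 0 2) 0 = 0 := by
    linarith [hn'.pderiv_christoffel_add hr0 1 2]
  have hmem : ∀ t ∈ Ioo (-r) r, t • bvec 0 ∈ e'.target := fun t ht ↦ by
    rw [hn'.target_eq, mem_ball_zero_iff, norm_smul, norm_bvec, mul_one, Real.norm_eq_abs]
    exact abs_lt.2 ht
  have hsub : Icc 0 (r / 2) ⊆ Ioo (-r) r := fun t ht ↦ ⟨by linarith [ht.1], by linarith [ht.2]⟩
  have hgeod : ∀ t ∈ Icc 0 (r / 2), gam e' (t • bvec 0) (bvec 0) (bvec 0) = 0 := fun t ht ↦ by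
    have := hsub ht
    refine hn'.gam_line ?_
    rw [norm_smul, norm_bvec, mul_one, Real.norm_eq_abs]
    exact abs_lt.2 this
  obtain ⟨C, hC⟩ := hf.exists_axisJet (half_pos hr0) (fun t ht ↦ hmem t (hsub ht)) hgeod hA hB
  refine ⟨e', r / 2, C, _, _, ⟨hn'.smooth, half_pos hr0, fun t ht ↦ hmem t (hsub ht), hgeod, ?_⟩,
    hC, ?_, ?_⟩
  · rw [hf.coordInner_zero]
    simp
  · have hpair' : (⟨e'.symm ((0 : ℝ) • bvec 0), velocity (fun t : ℝ ↦ e'.symm (t • bvec 0)) 0⟩ :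
        TangentBundle (𝓡 3) M) = ⟨x₀, ‖τ₀‖⁻¹ • τ₀⟩ := by
      have hcongr : ∀ γ γ' : ℝ → M, γ = γ' →
          (⟨γ 0, velocity γ 0⟩ : TangentBundle (𝓡 3) M) = ⟨γ' 0, velocity γ' 0⟩ := by
        rintro _ _ rfl
        rfl
      exact (hcongr _ _ (funext hsymm)).trans hpair
    have h1 := hf.christoffel_of_isChaoticAt hr0 hmem (hn'.rays (bvec 0) (norm_bvec 0)) hpair' hch
    rw [hA, hB] at h1
    have h2 := h1.resolve_left (by simp)
    intro h3
    exact h2 (by linarith)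
  · have := hsymm 0
    rw [zero_smul] at this
    rw [this, hx0]
end

lemma E3_norm_le (v : E3) : ‖v‖ ≤ |v 0| + |v 1| + |v 2| := by
  conv_lhs => rw [E3_eq_sum_three v]
  refine (norm_add_le _ _).trans ((add_le_add_left (norm_add_le _ _) _).trans ?_)
  simp only [norm_smul, norm_bvec, mul_one, Real.norm_eq_abs]
  exact le_rfl

lemma volume_setOf_abs_le (a b c : ℝ) (hb : 0 ≤ b) (hc : 0 ≤ c) :
    volume {u : E3 | |u 0| ≤ a ∧ |u 1| ≤ b ∧ |u 2| ≤ c} = ENNReal.ofReal (8 * a * b * c) := by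
  have h : {u : E3 | |u 0| ≤ a ∧ |u 1| ≤ b ∧ |u 2| ≤ c} =
      euclideanBox ![-a, -b, -c] ![a, b, c] := by
    ext u
    simp [mem_euclideanBox, Fin.forall_fin_succ, abs_le]
  rw [h, volume_euclideanBox, Fin.prod_univ_three, mul_assoc]
  simp only [Matrix.cons_val_zero, Matrix.cons_val_one, Matrix.cons_val_two, Matrix.head_cons,
    Matrix.tail_cons, sub_neg_eq_add]
  rw [← ENNReal.ofReal_mul (by linarith), ← ENNReal.ofReal_mul' (by positivity)]
  congr 1
  ring

lemma measurableSet_setOf_abs_le (a b c : ℝ) :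
    MeasurableSet {u : E3 | |u 0| ≤ a ∧ |u 1| ≤ b ∧ |u 2| ≤ c} := by
  have h : ∀ (i : Fin 3) (c : ℝ), IsClosed {u : E3 | |u i| ≤ c} := fun i c ↦
    isClosed_le (by fun_prop) continuous_const
  exact ((h 0 a).inter ((h 1 b).inter (h 2 c))).measurableSet

lemma setOf_abs_le_mem_nhds {a b c : ℝ} (ha : 0 < a) (hb : 0 < b) (hc : 0 < c) :
    {u : E3 | |u 0| ≤ a ∧ |u 1| ≤ b ∧ |u 2| ≤ c} ∈ 𝓝 0 := by
  filter_upwards [Metric.closedBall_mem_nhds (0 : E3) (lt_min ha (lt_min hb hc))] with u hu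
  rw [mem_closedBall_zero_iff] at hu
  exact ⟨(E3_abs_apply_le u 0).trans (hu.trans (min_le_left _ _)),
    (E3_abs_apply_le u 1).trans (hu.trans ((min_le_right _ _).trans (min_le_left _ _))),
    (E3_abs_apply_le u 2).trans (hu.trans ((min_le_right _ _).trans (min_le_right _ _)))⟩

lemma add_mem_setOf_abs_le {k t : ℝ} (hk : 0 < k) (hk1 : k ≤ 1 / 4) {u z : E3}
    (h1 : ‖u - t • bvec 0‖ ≤ k ^ 2 / 2) (h2 : |u 2| ≤ k ^ 5 / 2) (ht : |t| ≤ k / 2)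
    (hz : ‖z‖ ≤ k ^ 5 / 2) : u + z ∈ {u : E3 | |u 0| ≤ k ∧ |u 1| ≤ k ^ 2 ∧ |u 2| ≤ 2 * k ^ 5} := by
  have hk2 : k ^ 2 ≤ k / 4 := by nlinarith
  have hk5 : k ^ 5 ≤ k ^ 2 := pow_le_pow_of_le_one hk.le (by linarith) (by norm_num)
  have hz' : ∀ i, |z i| ≤ k ^ 5 / 2 := fun i ↦ (E3_abs_apply_le z i).trans hz
  have hy := fun i ↦ (E3_abs_apply_le (u - t • bvec 0) i).trans h1
  refine ⟨?_, ?_, ?_⟩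
  · have h3 : (u + z) 0 = (u - t • bvec 0) 0 + t + z 0 := by simp
    rw [h3]
    have := abs_add_three ((u - t • bvec 0) 0) t (z 0)
    linarith [hy 0, hz' 0]
  · have h3 : (u + z) 1 = (u - t • bvec 0) 1 + z 1 := by simp
    rw [h3]
    have := abs_add_le ((u - t • bvec 0) 1) (z 1)
    linarith [hy 1, hz' 1]
  · have h3 : (u + z) 2 = u 2 + z 2 := by simp
    rw [h3]
    have := abs_add_le (u 2) (z 2)
    have := pow_pos hk 5
    linarith [hz' 2]

section
variable {M : Type*} [EMetricSpace M] [ChartedSpace E3 M] [IsManifold (𝓡 3) ∞ M]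
    [RiemannianBundle (fun x : M ↦ TangentSpace (𝓡 3) x)]
    [IsContMDiffRiemannianBundle (𝓡 3) ∞ E3 (fun x : M ↦ TangentSpace (𝓡 3) x)]
    [IsRiemannianManifold (𝓡 3) M] [MeasurableSpace M] [BorelSpace M]
    {e : OpenPartialHomeomorph M E3} {T C a b α : ℝ}

theorem nikodymMax_slab_five (hα : 0 < α) (hinj : HasInjRadiusGT M (2 * α)) (hax : IsUnitAxis e T)
    (hj : AxisJet (gam e) e.target T C a b) (hab : a ≠ 2 * b) :
    (∃ c : ℝ, 0 < c ∧ ∀ᶠ k : ℝ in 𝓝[>] 0, ∀ p q : ℝ≥0∞, 1 ≤ p → 1 ≤ q →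
      ENNReal.ofReal (c * k ^ (1 + (3 : ℕ) / q.toReal - (8 : ℕ) / p.toReal : ℝ)) *
        eLpNorm (slabFun e {u : E3 | |u 0| ≤ k ∧ |u 1| ≤ k ^ 2 ∧ |u 2| ≤ 2 * k ^ 5}) p μHE[3] ≤
      eLpNorm (nikodymMax (geodesicSegments M α) (k ^ 5)
        (slabFun e {u : E3 | |u 0| ≤ k ∧ |u 1| ≤ k ^ 2 ∧ |u 2| ≤ 2 * k ^ 5})) q μHE[3]) ∧
    ∀ K : Set M, K ∈ 𝓝 (e.symm 0) → ∀ (p q : ℝ≥0∞) (σ : ℝ), 1 ≤ p → 1 ≤ q →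
      NikodymBound (geodesicSegments M α) K p q σ →
      0 ≤ 1 + (3 : ℕ) / q.toReal - (8 : ℕ) / p.toReal + (5 : ℕ) * σ := by
  refine nikodymMax_slab hax.smooth hax.zero_mem (by norm_num)
    (B := fun k ↦ {u : E3 | |u 0| ≤ k ∧ |u 1| ≤ k ^ 2 ∧ |u 2| ≤ 2 * k ^ 5}) (D := 4) (V := 16) ?_ ?_
  · filter_upwards [Ioo_mem_nhdsGT (zero_lt_one (α := ℝ))] with k hk
    have hk0 := hk.1
    have h2 : k ^ 2 ≤ k := pow_le_of_le_one hk0.le hk.2.le (by norm_num)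
    have h5 : k ^ 5 ≤ k := pow_le_of_le_one hk0.le hk.2.le (by norm_num)
    refine ⟨measurableSet_setOf_abs_le _ _ _,
      setOf_abs_le_mem_nhds hk0 (by positivity) (by positivity), fun u hu ↦ ?_, ?_⟩
    · rw [mem_closedBall_zero_iff]
      exact (E3_norm_le u).trans (by linarith [hu.1, hu.2.1, hu.2.2])
    · rw [volume_setOf_abs_le _ _ _ (by positivity) (by positivity)]
      exact ENNReal.ofReal_le_ofReal (le_of_eq (by ring))
  · refine exists_forall_le_nikodymMax hα hinj hax hj hab (F := geodesicSegments M α) (n := 5)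
      (j := 1) ⟨1, one_pos, fun c u V hc _ _ ↦ hc.mem⟩ (by norm_num) ?_
    obtain ⟨η, c₀, hη, hc₀, hc₀1, -, hslab⟩ := hj.exists_forall_slab
    refine ⟨η, c₀, 1 / 4, hη, hc₀, by norm_num, ?_⟩
    intro k x τ hk hk1 hx hτ u v hu hclose hu0 hv0 t ht z hz
    obtain ⟨h1, h2⟩ := hslab k 0 x τ hk (by linarith) le_rfl (by positivity) (by simpa using hx)
      (by simpa using hτ) u v hu (fun t ht ↦ (hclose t ht).2) (by simpa using hu0) hv0 t ht
    have hck : c₀ * k ≤ k / 2 := by nlinarith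
    exact add_mem_setOf_abs_le hk hk1 h1 h2 (by
      rw [abs_of_nonneg ht.1]
      exact ht.2.trans hck) hz

theorem le_of_nikodymBound_of_isChaoticAt (hα : 0 < α) (hinj : HasInjRadiusGT M (2 * α)) {x₀ : M}
    {τ₀ : TangentSpace (𝓡 3) x₀} (hτ₀ : τ₀ ≠ 0) (hch : IsChaoticAt x₀ τ₀) {K : Set M}
    (hK : K ∈ 𝓝 x₀) : ¬ NikodymBound (geodesicSegments M α) K (5 / 2) (10 / 3) (1 / 5) ∧
      (∀ q : ℝ≥0∞, 1 ≤ q →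
        NikodymBound (geodesicSegments M α) K (5 / 2) q (1 / 5) → q ≤ 5 / 2) ∧
      (∀ p : ℝ≥0∞, 1 ≤ p →
        NikodymBound (geodesicSegments M α) K p p (3 / p.toReal - 1) → p ≤ 5 / 2) := by
  obtain ⟨e, T, C, a, b, hax, hj, hab, rfl⟩ := hinj.exists_axisJet_of_isChaoticAt hα hτ₀ hch
  have h := (nikodymMax_slab_five hα hinj hax hj hab).2 K hK
  have h52 : (5 / 2 : ℝ≥0∞).toReal = 5 / 2 := by simp
  have h52' : (1 : ℝ≥0∞) ≤ 5 / 2 := by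
    rw [ENNReal.le_div_iff_mul_le (by simp) (by simp)]
    norm_num
  have hle : ∀ q : ℝ≥0∞, 6 / 5 ≤ 3 / q.toReal → q ≤ 5 / 2 := by
    intro q hq
    have hq0 : 0 < q.toReal := by
      by_contra! hq0
      have : q.toReal = 0 := le_antisymm hq0 ENNReal.toReal_nonneg
      rw [this] at hq
      norm_num at hq
    have hqt : q ≠ ⊤ := by
      rintro rfl
      simp at hq0
    rw [← ENNReal.toReal_le_toReal hqt (by simp [ENNReal.div_eq_top]), h52]
    rw [div_le_div_iff₀ (by norm_num) hq0] at hq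
    linarith
  have hmain : ∀ q : ℝ≥0∞, 1 ≤ q →
      NikodymBound (geodesicSegments M α) K (5 / 2) q (1 / 5) → q ≤ 5 / 2 := by
    intro q hq hb
    refine hle q ?_
    have := h (5 / 2) q (1 / 5) h52' hq hb
    rw [h52] at this
    push_cast at this
    linarith
  refine ⟨fun hb ↦ ?_, hmain, fun p hp hb ↦ hle p ?_⟩
  · have h1 : (1 : ℝ≥0∞) ≤ 10 / 3 := by
      rw [ENNReal.le_div_iff_mul_le (by simp) (by simp)]
      norm_num
    have h2 := ENNReal.toReal_mono (by simp [ENNReal.div_eq_top]) (hmain _ h1 hb)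
    norm_num at h2
  · have h1 := h p p _ hp hp hb
    push_cast at h1
    have h2 : 8 / p.toReal = 8 / 3 * (3 / p.toReal) := by ring
    linarith
end

lemma E3_axis_eq (s : ℝ) : (!₂[s, 0, 0] : E3) = s • bvec 0 := by
  ext i
  fin_cases i <;> simp

lemma abs_rotForm_le (θ : ℝ) (p : Fin 3 → Fin 3 → ℝ) :
    |rotForm θ p| ≤ |p 1 1| + |p 2 1| + |p 1 2| + |p 2 2| := by
  have hs := Real.abs_sin_le_one θ
  have hc := Real.abs_cos_le_one θ
  have h : ∀ x y z : ℝ, |x| ≤ 1 → |y| ≤ 1 → |x * (y * z)| ≤ |z| := by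
    intro x y z hx hy
    rw [abs_mul, abs_mul]
    calc |x| * (|y| * |z|) ≤ 1 * (1 * |z|) := by gcongr
      _ = |z| := by ring
  have hs' : |-Real.sin θ| ≤ 1 := by rwa [abs_neg]
  unfold rotForm
  rw [mul_add, mul_add]
  refine (abs_add_le _ _).trans ((add_le_add (abs_add_le _ _) (abs_add_le _ _)).trans ?_)
  linarith [h _ _ (p 1 1) hs' hc, h _ _ (p 2 1) hs' hs, h _ _ (p 1 2) hc hc, h _ _ (p 2 2) hc hs]

lemma hasDerivAt_rotForm {θ : ℝ} {P : Fin 3 → Fin 3 → ℝ → ℝ} {P' : Fin 3 → Fin 3 → ℝ} {t : ℝ}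
    (h : ∀ j k, HasDerivAt (P j k) (P' j k) t) :
    HasDerivAt (fun t ↦ rotForm θ fun j k ↦ P j k t) (rotForm θ P') t :=
  ((((h 1 1).const_mul _).fun_add ((h 2 1).const_mul _)).const_mul _).fun_add
    ((((h 1 2).const_mul _).fun_add ((h 2 2).const_mul _)).const_mul _)

section
variable {M : Type*} [EMetricSpace M] [ChartedSpace E3 M] [IsManifold (𝓡 3) ∞ M]
    [RiemannianBundle (fun x : M ↦ TangentSpace (𝓡 3) x)]
    [IsContMDiffRiemannianBundle (𝓡 3) ∞ E3 (fun x : M ↦ TangentSpace (𝓡 3) x)]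
    {e : OpenPartialHomeomorph M E3} {a b r α : ℝ}

lemma velocity_comp_add_const {γ : ℝ → M} {s t : ℝ}
    (h : MDifferentiableAt 𝓘(ℝ, ℝ) (𝓡 3) γ (t + s)) :
    velocity (fun τ ↦ γ (τ + s)) t = velocity γ (t + s) := by
  have hadd : HasDerivAt (fun τ : ℝ ↦ τ + s) 1 t := (hasDerivAt_id t).add_const s
  have h1 := mfderiv_comp (I := 𝓘(ℝ, ℝ)) (I' := 𝓘(ℝ, ℝ)) (I'' := 𝓡 3) t (g := γ)
    (f := fun τ : ℝ ↦ τ + s) h hadd.differentiableAt.mdifferentiableAt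
  have h2 : mfderiv 𝓘(ℝ, ℝ) 𝓘(ℝ, ℝ) (fun τ : ℝ ↦ τ + s) t (1 : ℝ) = (1 : ℝ) := by
    rw [mfderiv_eq_fderiv]
    exact (fderiv_apply_one_eq_deriv (f := fun τ : ℝ ↦ τ + s) (x := t)).trans hadd.deriv
  have h3 : velocity (fun τ ↦ γ (τ + s)) t = mfderiv 𝓘(ℝ, ℝ) (𝓡 3) γ (t + s)
      (mfderiv 𝓘(ℝ, ℝ) 𝓘(ℝ, ℝ) (fun τ : ℝ ↦ τ + s) t (1 : ℝ)) :=
    congrArg (fun L : ℝ →L[ℝ] E3 ↦ L (1 : ℝ)) h1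
  rw [h3]
  exact congrArg (mfderiv 𝓘(ℝ, ℝ) (𝓡 3) γ (t + s)) h2

lemma IsUnitGeodesicOn.comp_add_const {γ : ℝ → M} {I J : Set ℝ} (hI : IsOpen I)
    (h : IsUnitGeodesicOn γ I) {s : ℝ} (hJ : ∀ t ∈ J, t + s ∈ I) :
    IsUnitGeodesicOn (fun t ↦ γ (t + s)) J := by
  have hadd : ContMDiff 𝓘(ℝ, ℝ) 𝓘(ℝ, ℝ) ∞ fun τ : ℝ ↦ τ + s := by
    rw [contMDiff_iff_contDiff]
    fun_prop
  refine ⟨⟨h.1.1.comp hadd.contMDiffOn hJ, fun e he t ht hs ↦ ?_⟩, fun t ht ↦ ?_⟩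
  · have h1 := h.1.2 e he (t + s) (hJ t ht) hs
    have hd' : (deriv fun τ ↦ e (γ (τ + s))) = fun τ ↦ deriv (fun τ ↦ e (γ τ)) (τ + s) :=
      funext fun τ ↦ deriv_comp_add_const (f := fun τ ↦ e (γ τ)) s τ
    rw [covDeriv_eq] at h1 ⊢
    rw [hd', deriv_comp_add_const (f := deriv fun τ ↦ e (γ τ)) s t]
    exact h1
  · rw [velocity_comp_add_const (((h.1.1 _ (hJ t ht)).contMDiffAt
      (hI.mem_nhds (hJ t ht))).mdifferentiableAt (by simp))]
    exact h.2 _ (hJ t ht)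

/-- The first coordinate axis lies in the domain, and the chart is orthonormal and flat to first
order along it. -/
structure IsAxisFlat (e : OpenPartialHomeomorph M E3) (a b : ℝ) : Prop where
  smooth : IsSmoothChart e
  flat : ∀ s ∈ Ioo a b, IsFlatAt e (s • bvec 0)

lemma IsFermiChart.isAxisFlat (h : IsFermiChart e a b r) : IsAxisFlat e a b where
  smooth := h.smooth
  flat s hs := by
    have hmem : s • bvec 0 ∈ e.target := by
      rw [h.target_eq]
      simpa [h.radius_pos.ne', sq_pos_iff] using hs
    refine ⟨h.smooth, hmem, ?_, ?_⟩
    · simpa only [E3_axis_eq] using h.orthonormal s hs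
    have hpar : ∀ V, gam e (s • bvec 0) (bvec 0) V = 0 := by
      have h1 : ∀ j, gam e (s • bvec 0) (bvec 0) (bvec j) = 0 := by
        intro j
        have h2 := h.parallel s hs j
        have h3 : HasDerivAt (fun τ : ℝ ↦ (!₂[τ, 0, 0] : E3)) (bvec 0) s := by
          simp only [E3_axis_eq]
          simpa using (hasDerivAt_id s).smul_const (bvec 0)
        rw [covDeriv_eq, h3.deriv, E3_axis_eq] at h2
        simpa using h2
      intro V
      rw [E3_eq_sum_three V]
      simp [h1]
    have hperp : ∀ V : E3, V 0 = 0 → gam e (s • bvec 0) V V = 0 := by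
      intro V hV
      obtain ⟨l, hl, hlr⟩ : ∃ l : ℝ, 0 < l ∧ l ^ 2 * (V 1 ^ 2 + V 2 ^ 2) < r ^ 2 := by
        have hr := h.radius_pos
        refine ⟨r / (1 + (V 1 ^ 2 + V 2 ^ 2)), by positivity, ?_⟩
        have hq : 0 ≤ V 1 ^ 2 + V 2 ^ 2 := by positivity
        rw [div_pow, div_mul_eq_mul_div, div_lt_iff₀ (by positivity)]
        set q := V 1 ^ 2 + V 2 ^ 2
        exact mul_lt_mul_of_pos_left (by nlinarith : q < (1 + q) ^ 2) (by positivity)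
      have hW : (s • bvec 0 + l • V) ∈ e.target := by
        rw [h.target_eq]
        refine ⟨by simpa [hV] using hs, ?_⟩
        simp
        nlinarith
      have hray := h.rays _ hW
      have hfun : ∀ t : ℝ, (!₂[(s • bvec 0 + l • V) 0, t * (s • bvec 0 + l • V) 1,
          t * (s • bvec 0 + l • V) 2] : E3) = s • bvec 0 + t • (l • V) := by
        intro t
        ext i
        fin_cases i <;> simp [hV]
      simp only [hfun] at hray
      have hopen : IsOpen {t : ℝ | s • bvec 0 + t • (l • V) ∈ e.target} :=
        e.open_target.preimage (by fun_prop)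
      have h1 := hray.gam_line h.smooth hopen (t := 0) (by simpa using hmem) (by simpa using hmem)
      rw [zero_smul, add_zero] at h1
      simp only [map_smul, _root_.smul_apply, smul_smul, smul_eq_zero] at h1
      exact h1.resolve_left (by positivity)
    refine gam_eq_zero_of_diag fun V ↦ ?_
    have hV : V = V 0 • bvec 0 + (V - V 0 • bvec 0) := by abel
    have h1 := hperp (V - V 0 • bvec 0) (by simp)
    rw [hV]
    set W := V - V 0 • bvec 0
    simp only [map_add, map_smul, _root_.add_apply, _root_.smul_apply, hpar, h1,
      gam_comm e _ W (bvec 0)]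
    simp

lemma IsSmoothChart.metricCoeff_affineChart (he : IsSmoothChart e) {u₀ z : E3} {R : E3 ≃ₗᵢ[ℝ] E3}
    (hz : R z + u₀ ∈ e.target)
    (hm : ∀ i j : Fin 3, metricCoeff e i j (R z + u₀) = if i = j then 1 else 0) (i j : Fin 3) :
    metricCoeff (_root_.affineChart e u₀ R) i j z = if i = j then 1 else 0 := by
  have h4 := coordInner_eq_inner (_root_.affineChart e u₀ R) z (bvec i) (bvec j)
  rw [he.coordVec_affineChart hz, he.coordVec_affineChart hz] at h4
  replace h4 := h4.trans (coordInner_eq_inner e (R z + u₀) (R (bvec i)) (R (bvec j))).symm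
  have h5 : coordInner (_root_.affineChart e u₀ R) z (bvec i) (bvec j) =
      metricCoeff (_root_.affineChart e u₀ R) i j z := by
    simp [coordInner]
  have h6 : coordInner e (R z + u₀) (R (bvec i)) (R (bvec j)) =
      inner ℝ (R (bvec i)) (R (bvec j)) := by
    rw [PiLp.inner_apply]
    simp only [coordInner, hm]
    simp [mul_comm]
  rw [← h5, h4, h6, LinearIsometryEquiv.inner_map_map]
  simp [PiLp.inner_apply, eq_comm]

namespace IsAxisFlat

lemma rot_axis_add (θ s t : ℝ) : rot θ (t • bvec 0) + s • bvec 0 = (s + t) • bvec 0 := by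
  rw [map_smul, rot_bvec_zero]
  module

/-- A rotated chart with base point on the axis is again flat. -/
lemma isFlatAtZero_affineChart (h : IsAxisFlat e a b) (hα : 0 < α)
    (hinj : HasInjRadiusGT M (2 * α)) {s t : ℝ} (hs : s + t ∈ Ioo a b) (θ : ℝ) :
    IsFlatAt (affineChart e (s • bvec 0) (rot θ)) (t • bvec 0) := by
  have hf := h.flat _ hs
  have hz : rot θ (t • bvec 0) + s • bvec 0 ∈ e.target := by
    rw [rot_axis_add]
    exact hf.mem
  refine ⟨h.smooth.affineChart _ _, hz, h.smooth.metricCoeff_affineChart hz (by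
    rw [rot_axis_add]
    exact hf.orthonormal), ?_⟩
  · refine gam_eq_zero_of_diag fun V ↦ ?_
    rw [hinj.gam_affineChart hα h.smooth hz, rot_axis_add, hf.gam_zero]
    simp

lemma pderiv_zero_eq_zero {U : Set E3} {f : E3 → ℝ} (hf : ContDiffOn ℝ ∞ f U) (hU : IsOpen U)
    (hmem : ∀ s ∈ Ioo a b, s • bvec 0 ∈ U) (h0 : ∀ s ∈ Ioo a b, f (s • bvec 0) = 0) {s : ℝ}
    (hs : s ∈ Ioo a b) : pderiv 0 f (s • bvec 0) = 0 := by
  have h1 := hasDerivAt_comp_axis (hf.differentiableAt_of_isOpen hU (hmem s hs))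
  have h2 : (fun τ : ℝ ↦ f (τ • bvec 0)) =ᶠ[𝓝 s] fun _ ↦ 0 := by
    filter_upwards [isOpen_Ioo.mem_nhds hs] with τ hτ using h0 τ hτ
  exact h1.unique ((hasDerivAt_const s (0 : ℝ)).congr_of_eventuallyEq h2)

lemma pderiv_christoffel_cross (h : IsAxisFlat e a b) {s : ℝ} (hs : s ∈ Ioo a b) (j k : Fin 3) :
    pderiv 0 (christoffel e 0 j k) (s • bvec 0) = 0 ∧
      pderiv 0 (pderiv 0 (christoffel e 0 j k)) (s • bvec 0) = 0 := by
  have hc := h.smooth.contDiffOn_christoffel 0 j k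
  have h1 := fun s hs ↦ pderiv_zero_eq_zero hc e.open_target (fun s hs ↦ (h.flat s hs).mem)
    (fun s hs ↦ (h.flat s hs).christoffel_zero 0 j k) (s := s) hs
  exact ⟨h1 s hs, pderiv_zero_eq_zero (contDiffOn_pderiv e.open_target hc 0) e.open_target
    (fun s hs ↦ (h.flat s hs).mem) h1 hs⟩

lemma pderiv_christoffel_symm (h : IsAxisFlat e a b) {s : ℝ} (hs : s ∈ Ioo a b) :
    pderiv 1 (christoffel e 0 0 2) (s • bvec 0) = pderiv 2 (christoffel e 0 0 1) (s • bvec 0) := by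
  have hf := h.flat s hs
  have h1 := hf.pderiv_christoffel 0 0 2 1 0
  have h2 := hf.pderiv_christoffel 0 0 1 2 0
  have hc : ∀ i j k l : Fin 3, pderiv i (pderiv j (metricCoeff e k l)) (s • bvec 0) =
      pderiv j (pderiv i (metricCoeff e k l)) (s • bvec 0) := fun i j k l ↦
    pderiv_comm (h.smooth.contDiffOn_metricCoeff k l) e.open_target hf.mem i j
  have h3 : ∀ i k, pderiv 0 (pderiv i (metricCoeff e 0 k)) (s • bvec 0) = 0 := fun i k ↦
    pderiv_zero_eq_zero (contDiffOn_pderiv e.open_target (h.smooth.contDiffOn_metricCoeff 0 k) i)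
      e.open_target (fun s hs ↦ (h.flat s hs).mem) (fun s hs ↦ (h.flat s hs).pderiv_metric 0 k i) hs
  rw [h1.1, h2.1, hc 1 0, hc 2 0, hc 2 1, h3, h3]

lemma pderiv_christoffel_eq (h : IsAxisFlat e a b) {s : ℝ} (hs : s ∈ Ioo a b) :
    pderiv 1 (christoffel e 0 0 2) (s • bvec 0) =
      -(1 / 2) * pderiv 1 (pderiv 2 (metricCoeff e 0 0)) (s • bvec 0) := by
  have hf := h.flat s hs
  have hc : ∀ i j k l : Fin 3, pderiv i (pderiv j (metricCoeff e k l)) (s • bvec 0) =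
      pderiv j (pderiv i (metricCoeff e k l)) (s • bvec 0) := fun i j k l ↦
    pderiv_comm (h.smooth.contDiffOn_metricCoeff k l) e.open_target hf.mem i j
  have h3 : ∀ i k, pderiv 0 (pderiv i (metricCoeff e 0 k)) (s • bvec 0) = 0 := fun i k ↦
    pderiv_zero_eq_zero (contDiffOn_pderiv e.open_target (h.smooth.contDiffOn_metricCoeff 0 k) i)
      e.open_target (fun s hs ↦ (h.flat s hs).mem) (fun s hs ↦ (h.flat s hs).pderiv_metric 0 k i) hs
  rw [(hf.pderiv_christoffel 0 0 2 1 0).1, hc 1 0, h3]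
  ring

lemma norm_fderiv_gam_affineChart_le (h : IsAxisFlat e a b) (hα : 0 < α)
    (hinj : HasInjRadiusGT M (2 * α)) {s t θ : ℝ} (hs : s + t ∈ Ioo a b) :
    ‖fderiv ℝ (gam (affineChart e (s • bvec 0) (rot θ))) (t • bvec 0)‖ ≤
      ‖fderiv ℝ (gam e) ((s + t) • bvec 0)‖ := by
  have he' := h.smooth.affineChart (s • bvec 0) (rot θ)
  have hz : rot θ (t • bvec 0) + s • bvec 0 ∈ e.target := by
    rw [rot_axis_add]
    exact (h.flat _ hs).mem
  have hD : ∀ Y V W, fderiv ℝ (gam (affineChart e (s • bvec 0) (rot θ))) (t • bvec 0) Y V W =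
      (rot θ).symm (fderiv ℝ (gam e) ((s + t) • bvec 0) (rot θ Y) (rot θ V) (rot θ W)) := by
    intro Y V W
    have h1 := he'.hasFDerivAt_gam_apply (u := t • bvec 0) hz V W
    have h2 : HasFDerivAt (fun z ↦ rot θ z + s • bvec 0) (rot θ : E3 →L[ℝ] E3) (t • bvec 0) :=
      (rot θ : E3 ≃L[ℝ] E3).hasFDerivAt.add_const _
    have h3 := ((rot θ).symm : E3 ≃L[ℝ] E3).hasFDerivAt.comp (t • bvec 0)
      ((h.smooth.hasFDerivAt_gam_apply hz (rot θ V) (rot θ W)).comp (t • bvec 0) h2)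
    have h4 := h3.congr_of_eventuallyEq ((affineChart_target_mem_nhds hz).mono fun w hw ↦
      hinj.gam_affineChart hα h.smooth hw V W)
    have h5 := congrArg (fun L : E3 →L[ℝ] E3 ↦ L Y) (h1.unique h4)
    rw [rot_axis_add] at h5
    exact h5
  set N := ‖fderiv ℝ (gam e) ((s + t) • bvec 0)‖ with hN
  refine ContinuousLinearMap.opNorm_le_bound _ (norm_nonneg _) fun Y ↦
    ContinuousLinearMap.opNorm_le_bound _ (by positivity) fun V ↦
    ContinuousLinearMap.opNorm_le_bound _ (by positivity) fun W ↦ ?_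
  rw [hD, LinearIsometryEquiv.norm_map]
  refine (ContinuousLinearMap.le_opNorm _ _).trans ?_
  rw [LinearIsometryEquiv.norm_map]
  gcongr
  refine (ContinuousLinearMap.le_opNorm₂ _ _ _).trans ?_
  rw [LinearIsometryEquiv.norm_map, LinearIsometryEquiv.norm_map]

lemma exists_axisJet (h : IsAxisFlat e a b) (hα : 0 < α) (hinj : HasInjRadiusGT M (2 * α))
    {c d : ℝ} (hcd : Icc c d ⊆ Ioo a b) :
    ∃ C : ℝ, ∀ s T θ : ℝ, 0 < T → c ≤ s → s + T ≤ d →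
      rotForm θ (fun j k ↦ pderiv j (christoffel e 0 0 k) (s • bvec 0)) = 0 →
      IsUnitAxis (affineChart e (s • bvec 0) (rot θ)) T ∧
      AxisJet (gam (affineChart e (s • bvec 0) (rot θ))) (affineChart e (s • bvec 0) (rot θ)).target
        T C (rotForm θ fun j k ↦ pderiv 0 (pderiv j (christoffel e 0 0 k)) (s • bvec 0)) 0 := by
  have hU := e.open_target
  have hax : Continuous fun t : ℝ ↦ t • bvec 0 := by fun_prop
  have hmem : ∀ s ∈ Ioo a b, s • bvec 0 ∈ e.target := fun s hs ↦ (h.flat s hs).mem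
  have hbound : ∀ {F : Type} [NormedAddCommGroup F] {f : E3 → F}, ContinuousOn f e.target →
      ∃ C, ∀ t ∈ Icc c d, ‖f (t • bvec 0)‖ ≤ C := fun hf ↦
    isCompact_Icc.exists_bound_of_continuousOn (hf.comp hax.continuousOn fun t ht ↦
      hmem t (hcd ht))
  have hp : ∀ {f : E3 → ℝ}, ContDiffOn ℝ ∞ f e.target → ∀ i, ContDiffOn ℝ ∞ (pderiv i f) e.target :=
    fun hf i ↦ contDiffOn_pderiv hU hf i
  have hP : ∀ j k, ContDiffOn ℝ ∞ (pderiv j (christoffel e 0 0 k)) e.target := fun j k ↦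
    hp (h.smooth.contDiffOn_christoffel 0 0 k) j
  obtain ⟨C₁, hC₁⟩ := hbound
    (h.smooth.contDiffOn_gam.fderiv_of_isOpen hU (m := ∞) (by simp)).continuousOn
  have hC₂ : ∀ j k, ∃ C, ∀ t ∈ Icc c d,
      ‖pderiv 0 (pderiv 0 (pderiv j (christoffel e 0 0 k))) (t • bvec 0)‖ ≤ C := fun j k ↦
    hbound (hp (hp (hP j k) 0) 0).continuousOn
  choose C₂ hC₂ using hC₂
  set C₃ := C₂ 1 1 + C₂ 2 1 + C₂ 1 2 + C₂ 2 2 with hC₃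
  refine ⟨max (max C₁ C₃) 0, fun s T θ hT hs hsT hA ↦ ?_⟩
  set e' := affineChart e (s • bvec 0) (rot θ) with he'
  have hIcc : ∀ t ∈ Icc 0 T, s + t ∈ Icc c d := fun t ht ↦ ⟨by linarith [ht.1], by linarith [ht.2]⟩
  have hflat : ∀ t ∈ Icc 0 T, IsFlatAt e' (t • bvec 0) := fun t ht ↦
    h.isFlatAtZero_affineChart hα hinj (hcd (hIcc t ht)) θ
  have hgeod : ∀ t ∈ Icc 0 T, gam e' (t • bvec 0) (bvec 0) (bvec 0) = 0 := fun t ht ↦ by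
    rw [(hflat t ht).gam_zero]
    rfl
  have hes : IsSmoothChart e' := h.smooth.affineChart _ _
  have h0T : (0 : ℝ) ∈ Icc 0 T := ⟨le_rfl, hT.le⟩
  have hM0 : 0 ≤ max (max C₁ C₃) 0 := le_max_right _ _
  have hzt : ∀ t ∈ Icc 0 T, rot θ (t • bvec 0) + s • bvec 0 ∈ e.target := fun t ht ↦ (hflat t ht).mem
  have hf0 : IsFlatAtZero e' := by
    have := hflat 0 h0T
    rwa [zero_smul] at this
  refine ⟨⟨hes, hT, fun t ht ↦ (hflat t ht).mem, hgeod, ?_⟩, e'.open_target, hes.contDiffOn_gam,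
    gam_comm e', hT, hM0, fun t ht ↦ (hflat t ht).mem, hgeod, fun t ht ↦ ?_, fun t ht ↦ ?_,
    fun t ht ↦ hes.fderiv_gam_axis hT (fun t ht ↦ (hflat t ht).mem) hgeod ht, fun t ht ↦ ?_,
    fun t ht ↦ ?_⟩
  · rw [hf0.coordInner_zero]
    simp
  · rw [(hflat t ht).gam_zero, norm_zero]
    exact mul_nonneg hM0 ht.1
  · exact (h.norm_fderiv_gam_affineChart_le hα hinj (hcd (hIcc t ht))).trans
      ((hC₁ _ (hIcc t ht)).trans ((le_max_left _ _).trans (le_max_left _ _)))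
  · rw [hes.fderiv_gam_apply (hflat t ht).mem,
      (hinj.pderiv_christoffel_rot hα h.smooth (hzt t ht)).2, rot_axis_add]
    have hd : ∀ {f : E3 → ℝ}, ContDiffOn ℝ ∞ f e.target → ∀ t ∈ Icc 0 T,
        HasDerivAt (fun τ : ℝ ↦ f ((s + τ) • bvec 0)) (pderiv 0 f ((s + t) • bvec 0)) t := by
      intro f hf t ht
      have h1 := hasDerivAt_comp_axis (hf.differentiableAt_of_isOpen hU (hmem _ (hcd (hIcc t ht))))
      exact h1.comp_const_add s t
    have h1 := abs_sub_sub_le_mul_of_hasDerivAt (M := max (max C₁ C₃) 0)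
      (fun t ht ↦ hasDerivAt_rotForm (θ := θ) fun j k ↦ hd (hP j k) t ht)
      (fun t ht ↦ hasDerivAt_rotForm (θ := θ) fun j k ↦ hd (hp (hP j k) 0) t ht)
      (fun t ht ↦ (abs_rotForm_le θ _).trans (le_trans ?_ ((le_max_right C₁ C₃).trans
        (le_max_left _ 0)))) ht
    · simp only [add_zero, hA, sub_zero] at h1
      exact h1
    · have := fun j k ↦ hC₂ j k (s + t) (hIcc t ht)
      simp only [Real.norm_eq_abs] at this
      linarith [this 1 1, this 2 1, this 1 2, this 2 2]
  · rw [(hflat t ht).gam_zero]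
    simpa using mul_nonneg hM0 (pow_nonneg ht.1 3)
end IsAxisFlat

lemma IsFermiChart.rotForm_of_isChaoticAt (h : IsFermiChart e a b r) (hα : 0 < α)
    (hinj : HasInjRadiusGT M (2 * α)) {s : ℝ} (hs : s ∈ Ioo a b)
    (hch : IsChaoticAt (e.symm !₂[s, 0, 0]) (velocity (fun s : ℝ ↦ e.symm !₂[s, 0, 0]) s)) (θ : ℝ) :
    rotForm θ (fun j k ↦ pderiv j (christoffel e 0 0 k) (s • bvec 0)) ≠ 0 ∨
      rotForm θ (fun j k ↦ pderiv 0 (pderiv j (christoffel e 0 0 k)) (s • bvec 0)) ≠ 0 := by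
  have hf := h.isAxisFlat
  set γ : ℝ → M := fun s ↦ e.symm !₂[s, 0, 0] with hγ
  set e' := affineChart e (s • bvec 0) (rot θ) with he'
  obtain ⟨η, hη, hηs⟩ : ∃ η > 0, ∀ t ∈ Ioo (-η) η, s + t ∈ Ioo a b := by
    refine ⟨min (s - a) (b - s), lt_min (by linarith [hs.1]) (by linarith [hs.2]), fun t ht ↦ ?_⟩
    have h1 := min_le_left (s - a) (b - s)
    have h2 := min_le_right (s - a) (b - s)
    exact ⟨by linarith [ht.1], by linarith [ht.2]⟩
  have hflat : ∀ t ∈ Ioo (-η) η, IsFlatAt e' (t • bvec 0) := fun t ht ↦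
    hf.isFlatAtZero_affineChart hα hinj (hηs t ht) θ
  have h0 : (0 : ℝ) ∈ Ioo (-η) η := ⟨by linarith, hη⟩
  have hf0 : IsFlatAtZero e' := by
    have := hflat 0 h0
    rwa [zero_smul] at this
  have hfun : (fun t : ℝ ↦ e'.symm (t • bvec 0)) = fun t ↦ γ (t + s) := by
    ext t
    rw [he', affineChart_symm_apply, IsAxisFlat.rot_axis_add, hγ]
    simp only [E3_axis_eq, add_comm]
  have hgeo : IsUnitGeodesicOn (fun t : ℝ ↦ e'.symm (t • bvec 0)) (Ioo (-η) η) := by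
    rw [hfun]
    exact h.axis.comp_add_const isOpen_Ioo fun t ht ↦ by
      rw [add_comm]
      exact hηs t ht
  have hvel : velocity (fun t ↦ γ (t + s)) 0 = velocity γ (0 + s) :=
    velocity_comp_add_const (((h.axis.1.1 (0 + s) (by rwa [zero_add])).contMDiffAt
      (isOpen_Ioo.mem_nhds (by rwa [zero_add]))).mdifferentiableAt (by simp))
  have hpair : (⟨e'.symm ((0 : ℝ) • bvec 0), velocity (fun t : ℝ ↦ e'.symm (t • bvec 0)) 0⟩ :
      TangentBundle (𝓡 3) M) = ⟨γ s, ‖velocity γ s‖⁻¹ • velocity γ s⟩ := by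
    rw [h.axis.2 s hs, inv_one, one_smul]
    have hcongr : ∀ c c' : ℝ → M, c = c' →
        (⟨c 0, velocity c 0⟩ : TangentBundle (𝓡 3) M) = ⟨c' 0, velocity c' 0⟩ := by
      rintro _ _ rfl
      rfl
    refine (hcongr _ _ hfun).trans ?_
    have h2 : (⟨γ (0 + s), velocity (fun t ↦ γ (t + s)) 0⟩ : TangentBundle (𝓡 3) M) =
        ⟨γ (0 + s), velocity γ (0 + s)⟩ := congrArg _ hvel
    refine h2.trans ?_
    rw [zero_add]
  have h1 := hf0.christoffel_of_isChaoticAt hη (fun t ht ↦ (hflat t ht).mem) hgeo hpair hch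
  have hax' : IsAxisFlat e' (-η) η := ⟨hf.smooth.affineChart _ _, hflat⟩
  have h2 := hax'.pderiv_christoffel_cross h0 1 2
  rw [zero_smul] at h2
  have hz : rot θ 0 + s • bvec 0 ∈ e.target := by simpa using (hf.flat s hs).mem
  rw [h2.1, h2.2, (hinj.pderiv_christoffel_rot hα hf.smooth hz).2,
    hinj.pderiv_pderiv_christoffel_rot hα hf.smooth hz, map_zero, zero_add] at h1
  exact h1.imp Ne.symm Ne.symm
end

lemma rot_zero_apply (u : E3) : rot 0 u = u := by
  rw [E3_eq_sum_three u]
  simp only [map_add, map_smul, rot_bvec_zero, rot_bvec_one]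
  ext i
  fin_cases i <;> simp [rot]

lemma rot_zero_symm_apply (u : E3) : (rot 0).symm u = u := by
  rw [LinearIsometryEquiv.symm_apply_eq, rot_zero_apply]

lemma rotForm_zero (p : Fin 3 → Fin 3 → ℝ) : rotForm 0 p = p 1 2 := by
  simp [rotForm]

section
variable {M : Type*} [EMetricSpace M] [ChartedSpace E3 M] [IsManifold (𝓡 3) ∞ M]
    [RiemannianBundle (fun x : M ↦ TangentSpace (𝓡 3) x)]
    [IsContMDiffRiemannianBundle (𝓡 3) ∞ E3 (fun x : M ↦ TangentSpace (𝓡 3) x)]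
    {e : OpenPartialHomeomorph M E3} {a b r α : ℝ}

lemma affineChart_zero_rot (e : OpenPartialHomeomorph M E3) : affineChart e 0 (rot 0) = e := by
  refine OpenPartialHomeomorph.ext _ _ (fun x ↦ ?_) (fun z ↦ ?_) rfl
  · rw [affineChart_apply, rot_zero_symm_apply, sub_zero]
  · rw [affineChart_symm_apply, rot_zero_apply, add_zero]

lemma slabFun_affineChart (e : OpenPartialHomeomorph M E3) (u₀ : E3) (R : E3 ≃ₗᵢ[ℝ] E3)
    (B : Set E3) : slabFun (affineChart e u₀ R) B = slabFun e {u | R.symm (u - u₀) ∈ B} := rfl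

variable [IsRiemannianManifold (𝓡 3) M] [MeasurableSpace M] [BorelSpace M]

theorem IsFermiChart.exists_forall_le_eLpNorm_nikodymMax (h : IsFermiChart e a b r) (hα : 0 < α)
    (hinj : HasInjRadiusGT M (2 * α)) {s₀ : ℝ} (hs : s₀ ∈ Ioo a b)
    (hg : pderiv 1 (pderiv 2 (metricCoeff e 0 0)) !₂[s₀, 0, 0] = 0)
    (hch : IsChaoticAt (e.symm !₂[s₀, 0, 0])
      (velocity (fun s : ℝ ↦ e.symm !₂[s, 0, 0]) s₀)) :
    ∃ c : ℝ, 0 < c ∧ ∀ᶠ δ : ℝ in 𝓝[>] 0, ∀ f : M → ℝ,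
      f = slabFun e {u : E3 | |u 0 - s₀| ≤ δ ^ (1 / 5 : ℝ) ∧ |u 1| ≤ δ ^ (2 / 5 : ℝ) ∧
        |u 2| ≤ 2 * δ} →
      ∀ p q : ℝ≥0∞, 1 ≤ p → 1 ≤ q →
        ENNReal.ofReal (c * δ ^ (1 / 5 + 3 / (5 * q.toReal) - 8 / (5 * p.toReal))) *
            eLpNorm f p μHE[3] ≤
          eLpNorm (nikodymMax (geodesicSegments M α) δ f) q μHE[3] := by
  have hf := h.isAxisFlat
  obtain ⟨T, hT, hTb⟩ : ∃ T > 0, s₀ + T < b := ⟨(b - s₀) / 2, by linarith [hs.2], by linarith [hs.2]⟩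
  obtain ⟨C, hC⟩ := hf.exists_axisJet hα hinj (c := s₀) (d := s₀ + T)
    (Icc_subset_Ioo hs.1 hTb)
  have hA : rotForm 0 (fun j k ↦ pderiv j (christoffel e 0 0 k) (s₀ • bvec 0)) = 0 := by
    rw [rotForm_zero, hf.pderiv_christoffel_eq hs, ← E3_axis_eq, hg, mul_zero]
  obtain ⟨hax, hj⟩ := hC s₀ T 0 hT le_rfl le_rfl hA
  have hne := (h.rotForm_of_isChaoticAt hα hinj hs hch 0).resolve_left (by rw [hA]; simp)
  obtain ⟨c, hc, hev⟩ := (nikodymMax_slab_five hα hinj hax hj (by simpa using hne)).1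
  refine ⟨c, hc, ?_⟩
  have hev' := eventually_nhdsGT_zero_of_pow (n := 5) (P := fun k δ ↦ ∀ p q : ℝ≥0∞, 1 ≤ p → 1 ≤ q →
      ENNReal.ofReal (c * k ^ (1 + (3 : ℕ) / q.toReal - (8 : ℕ) / p.toReal : ℝ)) *
        eLpNorm (slabFun (affineChart e (s₀ • bvec 0) (rot 0))
          {u : E3 | |u 0| ≤ k ∧ |u 1| ≤ k ^ 2 ∧ |u 2| ≤ 2 * δ}) p μHE[3] ≤
      eLpNorm (nikodymMax (geodesicSegments M α) δ
        (slabFun (affineChart e (s₀ • bvec 0) (rot 0))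
          {u : E3 | |u 0| ≤ k ∧ |u 1| ≤ k ^ 2 ∧ |u 2| ≤ 2 * δ})) q μHE[3]) (by norm_num) hev
  filter_upwards [hev', eventually_mem_nhdsWithin] with δ hδ hδ0 f hf p q hp hq
  have hδ0 : 0 < δ := hδ0
  have h1 := hδ p q hp hq
  have hk2 : (δ ^ (1 / (5 : ℕ) : ℝ)) ^ 2 = δ ^ (2 / 5 : ℝ) := by
    rw [← Real.rpow_natCast, ← Real.rpow_mul hδ0.le]
    norm_num
  rw [slabFun_affineChart, ← Real.rpow_mul hδ0.le, hk2] at h1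
  have hset : {u : E3 | (rot 0).symm (u - s₀ • bvec 0) ∈
        {u : E3 | |u 0| ≤ δ ^ (1 / (5 : ℕ) : ℝ) ∧ |u 1| ≤ δ ^ (2 / 5 : ℝ) ∧ |u 2| ≤ 2 * δ}} =
      {u : E3 | |u 0 - s₀| ≤ δ ^ (1 / 5 : ℝ) ∧ |u 1| ≤ δ ^ (2 / 5 : ℝ) ∧ |u 2| ≤ 2 * δ} := by
    ext u
    simp [rot_zero_symm_apply]
  rw [hset, ← hf] at h1
  convert h1 using 5
  push_cast
  rw [← div_div, ← div_div]
  ring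

/-- The metric whose components `g_{ij}` with `(i, j) ≠ (0, 0)` are Euclidean, and whose component
`g_{00}` is a rotating quadratic form. -/
def IsRotatingMetric (e : OpenPartialHomeomorph M E3) : Prop :=
  ∀ u ∈ e.target, ∀ i j : Fin 3, metricCoeff e i j u = (if i = j then 1 else 0) +
    if i = 0 ∧ j = 0 then
      (u 1 ^ 2 - u 2 ^ 2) * Real.cos (u 0) + 2 * u 1 * u 2 * Real.sin (u 0)
    else 0

lemma hasFDerivAt_E3_apply (i : Fin 3) (u : E3) :
    HasFDerivAt (fun u : E3 ↦ u i) (EuclideanSpace.proj i : E3 →L[ℝ] ℝ) u :=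
  (EuclideanSpace.proj i : E3 →L[ℝ] ℝ).hasFDerivAt

lemma pderiv_eq_of_hasFDerivAt {f : E3 → ℝ} {u : E3} {L : E3 →L[ℝ] ℝ} (h : HasFDerivAt f L u)
    (i : Fin 3) : pderiv i f u = L (bvec i) := by
  rw [pderiv, h.fderiv]

lemma IsRotatingMetric.christoffel_two (hm : IsRotatingMetric e) (hes : IsSmoothChart e) {u : E3}
    (hu : u ∈ e.target) (i j : Fin 3) : christoffel e i j 2 u =
      if i = 0 ∧ j = 0 then u 2 * Real.cos (u 0) - u 1 * Real.sin (u 0) else 0 := by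
  have hpd : ∀ a i j : Fin 3, i ≠ 0 ∨ j ≠ 0 → pderiv a (metricCoeff e i j) u = 0 := by
    intro a i j hij
    have h1 : metricCoeff e i j =ᶠ[𝓝 u] fun _ ↦ if i = j then 1 else 0 := by
      filter_upwards [e.open_target.mem_nhds hu] with w hw
      rw [hm w hw i j, if_neg (c := i = 0 ∧ j = 0) (by tauto), add_zero]
    rw [pderiv_eq_of_hasFDerivAt ((hasFDerivAt_const _ u).congr_of_eventuallyEq h1)]
    rfl
  have hinv : ∀ l, metricInv e 2 l u = if l = 2 then 1 else 0 := by
    set p := metricCoeff e 0 0 u with hp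
    have hp0 : p ≠ 0 := by
      have h1 := hes.coordVec_ne_zero hu (V := bvec 0) (by
        rw [← norm_pos_iff, norm_bvec]
        exact one_pos)
      have h2 : p = coordInner e u (bvec 0) (bvec 0) := by simp [coordInner, hp]
      rw [h2, ← norm_coordVec_sq]
      positivity
    have h1 : (Matrix.of fun k l ↦ metricCoeff e k l u) = Matrix.diagonal ![p, 1, 1] := by
      ext k l
      fin_cases k <;> fin_cases l <;> simp [hp, hm u hu]
    have h2 : (Matrix.diagonal ![p, 1, 1])⁻¹ = Matrix.diagonal ![p⁻¹, 1, 1] := by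
      refine Matrix.inv_eq_right_inv ?_
      rw [Matrix.diagonal_mul_diagonal, ← Matrix.diagonal_one]
      congr 1
      ext k
      fin_cases k <;> simp [hp0]
    intro l
    rw [metricInv, h1, h2]
    fin_cases l <;> simp [Matrix.diagonal]
  have h00 : pderiv 2 (metricCoeff e 0 0) u =
      -(2 * (u 2 * Real.cos (u 0) - u 1 * Real.sin (u 0))) := by
    have h1 : metricCoeff e 0 0 =ᶠ[𝓝 u] fun w ↦ 1 +
        ((w 1 ^ 2 - w 2 ^ 2) * Real.cos (w 0) + 2 * w 1 * w 2 * Real.sin (w 0)) := by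
      filter_upwards [e.open_target.mem_nhds hu] with w hw
      simp [hm w hw]
    have h2 : HasFDerivAt (fun w : E3 ↦
        (w 1 ^ 2 - w 2 ^ 2) * Real.cos (w 0) + 2 * w 1 * w 2 * Real.sin (w 0)) _ u := ((((hasFDerivAt_E3_apply 1 u).pow 2).sub ((hasFDerivAt_E3_apply 2 u).pow 2)).mul
      (hasFDerivAt_E3_apply 0 u).cos).add
      ((((hasFDerivAt_E3_apply 1 u).const_mul 2).mul (hasFDerivAt_E3_apply 2 u)).mul
        (hasFDerivAt_E3_apply 0 u).sin)
    rw [pderiv_eq_of_hasFDerivAt ((h2.const_add 1).congr_of_eventuallyEq h1)]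
    simp
    ring
  rw [christoffel, Fin.sum_univ_three]
  simp only [hinv, hpd _ _ 2 (Or.inr (by decide))]
  by_cases hij : i = 0 ∧ j = 0
  · rw [hij.1, hij.2, h00]
    simp
  · rw [if_neg hij, hpd 2 i j (by tauto)]
    simp

lemma IsRotatingMetric.pderiv_one_christoffel (hm : IsRotatingMetric e) (hes : IsSmoothChart e)
    {u : E3} (hu : u ∈ e.target) : pderiv 1 (christoffel e 0 0 2) u = -Real.sin (u 0) := by
  have h1 : christoffel e 0 0 2 =ᶠ[𝓝 u] fun w ↦ w 2 * Real.cos (w 0) - w 1 * Real.sin (w 0) := by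
    filter_upwards [e.open_target.mem_nhds hu] with w hw
    simp [hm.christoffel_two hes hw]
  have h2 : HasFDerivAt (fun w : E3 ↦ w 2 * Real.cos (w 0) - w 1 * Real.sin (w 0)) _ u :=
    ((hasFDerivAt_E3_apply 2 u).mul (hasFDerivAt_E3_apply 0 u).cos).sub
      ((hasFDerivAt_E3_apply 1 u).mul (hasFDerivAt_E3_apply 0 u).sin)
  rw [pderiv_eq_of_hasFDerivAt (h2.congr_of_eventuallyEq h1)]
  simp

lemma IsRotatingMetric.pderiv_zero_pderiv_one_christoffel (hm : IsRotatingMetric e)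
    (hes : IsSmoothChart e) {u : E3} (hu : u ∈ e.target) :
    pderiv 0 (pderiv 1 (christoffel e 0 0 2)) u = -Real.cos (u 0) := by
  have h1 : pderiv 1 (christoffel e 0 0 2) =ᶠ[𝓝 u] fun w ↦ -Real.sin (w 0) := by
    filter_upwards [e.open_target.mem_nhds hu] with w hw
    exact hm.pderiv_one_christoffel hes hw
  have h2 : HasFDerivAt (fun w : E3 ↦ -Real.sin (w 0)) _ u := (hasFDerivAt_E3_apply 0 u).sin.neg
  rw [pderiv_eq_of_hasFDerivAt (h2.congr_of_eventuallyEq h1)]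
  simp

lemma IsRotatingMetric.abs_gam_two_le (hm : IsRotatingMetric e) (hes : IsSmoothChart e) {u : E3}
    (hu : u ∈ e.target) (v : E3) :
    |gam e u v v 2| ≤ 1 * (|u 0| * |u 1| + |u 2|) * ‖v‖ ^ 2 := by
  have h1 : gam e u v v 2 = (u 2 * Real.cos (u 0) - u 1 * Real.sin (u 0)) * v 0 ^ 2 := by
    rw [gam_apply]
    simp only [hm.christoffel_two hes hu, Fin.sum_univ_three]
    simp
    ring
  have h2 : |v 0| ^ 2 ≤ ‖v‖ ^ 2 := by gcongr; exact E3_abs_apply_le v 0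
  have h3 : |u 2 * Real.cos (u 0) - u 1 * Real.sin (u 0)| ≤ |u 0| * |u 1| + |u 2| := by
    refine (abs_sub _ _).trans ?_
    rw [abs_mul, abs_mul]
    have h4 := mul_le_mul_of_nonneg_left (Real.abs_cos_le_one (u 0)) (abs_nonneg (u 2))
    have h5 := mul_le_mul_of_nonneg_left (Real.abs_sin_le_abs (x := u 0)) (abs_nonneg (u 1))
    linarith
  rw [h1, abs_mul, abs_pow, one_mul]
  exact mul_le_mul h3 h2 (by positivity) (by positivity)

/-- Segments whose initial data are close to those of the axis stay close to the axis. -/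
lemma IsAxisFlat.exists_forall_subset_cthickening (h : IsAxisFlat e a b) (hα : 0 < α) (ha : a < 0)
    (hb : α < b) {ρ : ℝ} (hρ : 0 < ρ) : ∃ η : ℝ, 0 < η ∧ ∀ (c : ℝ → M) (u V : E3),
      IsGeodFrom e α c u V → ‖u‖ ≤ η → ‖V - bvec 0‖ ≤ η →
      c '' Icc 0 (α / ‖coordVec e u V‖) ⊆ Metric.cthickening ρ (axisSegment e 0 α) := by
  have hmem : ∀ t ∈ Icc 0 α, t • bvec 0 ∈ e.target := fun t ht ↦
    (h.flat t ⟨ha.trans_le ht.1, ht.2.trans_lt hb⟩).mem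
  set S := axisSegment e 0 α with hS
  have hO : IsOpen (e.target ∩ e.symm ⁻¹' Metric.thickening ρ S) :=
    e.symm.isOpen_inter_preimage Metric.isOpen_thickening
  obtain ⟨ε, hε, hsub⟩ := (AxisJet.isCompact_axis α).exists_cthickening_subset_open hO (by
    rintro _ ⟨t, ht, rfl⟩
    refine ⟨hmem t ht, Metric.self_subset_thickening hρ S ⟨t, ht, ?_⟩⟩
    simp only [E3_axis_eq])
  set T := min ((α + b) / 2) (α + ε / 2) with hT
  have hαT : α < T := lt_min (by linarith) (by linarith)
  have hTb : T < b := (min_le_left _ _).trans_lt (by linarith)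
  have hTε : T ≤ α + ε / 2 := min_le_right _ _
  have hT0 : 0 < T := hα.trans hαT
  have hflat : ∀ t ∈ Icc 0 T, IsFlatAt e (t • bvec 0) := fun t ht ↦
    h.flat t ⟨ha.trans_le ht.1, ht.2.trans_lt hTb⟩
  have h0 : (0 : E3) ∈ e.target := by simpa using hmem 0 ⟨le_rfl, hα.le⟩
  have hc := (h.smooth.continuousOn_coordInner (0, bvec 0) ⟨h0, mem_univ _⟩).continuousAt
    ((e.open_target.prod isOpen_univ).mem_nhds ⟨h0, mem_univ _⟩)
  have h1 : ∀ᶠ p : E3 × E3 in 𝓝 (0, bvec 0), coordInner e p.1 p.2 p.2 ∈ Ioi ((α / T) ^ 2) := by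
    refine hc.eventually (isOpen_Ioi.mem_nhds ?_)
    have h2 := hflat 0 ⟨le_rfl, hT0.le⟩
    rw [zero_smul] at h2
    have h3 : coordInner e 0 (bvec 0) (bvec 0) = 1 := by
      rw [IsFlatAtZero.coordInner_zero h2]
      simp
    change (α / T) ^ 2 < coordInner e 0 (bvec 0) (bvec 0)
    rw [h3, sq_lt_one_iff₀ (by positivity), div_lt_one hT0]
    exact hαT
  have h2 : ∀ᶠ p : E3 × E3 in 𝓝 (0, bvec 0), p.1 ∈ e.target :=
    continuous_fst.continuousAt.eventually (e.open_target.mem_nhds h0)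
  obtain ⟨η₁, hη₁, hnorm⟩ := Metric.eventually_nhds_iff.1 (h1.and h2)
  obtain ⟨η₂, hη₂, hclose⟩ := h.smooth.exists_forall_geodCurve_close (u₀ := 0) (f := bvec 0)
    hT0.le (by simpa using fun t ht ht' ↦ (hflat t ⟨ht, ht'⟩).mem)
    (fun t ht ↦ by rw [zero_add, (hflat t ht).gam_zero]; rfl) (half_pos hε)
  refine ⟨min (η₁ / 2) η₂, by positivity, fun c u V hcg hu hV ↦ ?_⟩
  obtain ⟨h3, h4⟩ := hnorm (y := (u, V)) (by
    rw [Prod.dist_eq, dist_zero_right, dist_eq_norm]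
    have := min_le_left (η₁ / 2) η₂
    exact max_lt (by simp only; linarith) (by simp only; linarith))
  simp only [mem_Ioi] at h3 h4
  rw [← norm_coordVec_sq] at h3
  have hN : α / T < ‖coordVec e u V‖ := lt_of_pow_lt_pow_left₀ 2 (norm_nonneg _) h3
  have hN0 : 0 < ‖coordVec e u V‖ := lt_trans (by positivity) hN
  have hle : α / ‖coordVec e u V‖ ≤ T := by
    rw [div_le_iff₀ hN0]
    rw [div_lt_iff₀ hT0] at hN
    linarith
  rintro _ ⟨t, ht, rfl⟩
  have hc0 : c 0 ∈ e.source := by rw [hcg.zero]; exact e.map_target h4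
  obtain ⟨h5, h6, -⟩ := hclose c _ hle hcg.geod hc0
    (by rw [hcg.zero, e.right_inv h4, sub_zero]; exact hu.trans (min_le_right _ _))
    (by rw [hcg.deriv_zero]; exact hV.trans (min_le_right _ _)) t ht
  have h7 : e (c t) ∈ Metric.cthickening ε ((fun t : ℝ ↦ t • bvec 0) '' Icc 0 α) := by
    refine Metric.mem_cthickening_of_dist_le _ (min t α • bvec 0) _ _
      ⟨min t α, ⟨le_min ht.1 hα.le, min_le_right _ _⟩, rfl⟩ ?_
    rw [dist_eq_norm]
    have h8 : e (c t) - min t α • bvec 0 = (e (c t) - (0 + t • bvec 0)) +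
        (t - min t α) • bvec 0 := by module
    have h9 : 0 ≤ t - min t α := by linarith [min_le_left t α]
    rw [h8]
    refine (norm_add_le _ _).trans ?_
    rw [norm_smul, norm_bvec, mul_one, Real.norm_of_nonneg h9]
    have h10 : t - min t α ≤ ε / 2 := by
      rcases min_cases t α with h | h <;> linarith [ht.2]
    linarith
  have h8 := (hsub h7).2
  rw [mem_preimage, e.left_inv h5] at h8
  exact Metric.thickening_subset_cthickening _ _ h8

theorem IsFermiChart.nikodymMax_of_isRotatingMetric (h : IsFermiChart e a b r) (hα : 0 < α)
    (hinj : HasInjRadiusGT M (2 * α)) (ha : a < 0) (hb : α < b) {ρ : ℝ} (hρ : 0 < ρ)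
    (hm : IsRotatingMetric e) {F : Set (Set M)}
    (hF : F = {S ∈ geodesicSegments M α | S ⊆ Metric.cthickening ρ (axisSegment e 0 α)}) :
    (∃ c : ℝ, 0 < c ∧ ∀ᶠ k : ℝ in 𝓝[>] 0, ∀ p q : ℝ≥0∞, 1 ≤ p → 1 ≤ q →
      ENNReal.ofReal (c * k ^ (1 + (1 : ℕ) / q.toReal - (6 : ℕ) / p.toReal : ℝ)) *
        eLpNorm (slabFun e {u : E3 | |u 0| + |u 1| ≤ k ∧ |u 2| ≤ k ^ 4}) p μHE[3] ≤
      eLpNorm (nikodymMax F (k ^ 4)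
        (slabFun e {u : E3 | |u 0| + |u 1| ≤ k ∧ |u 2| ≤ k ^ 4})) q μHE[3]) ∧
    ∀ K : Set M, K ∈ 𝓝 (e.symm 0) → ∀ (p q : ℝ≥0∞) (σ : ℝ), 1 ≤ p → 1 ≤ q →
      NikodymBound F K p q σ →
      0 ≤ 1 + (1 : ℕ) / q.toReal - (6 : ℕ) / p.toReal + (4 : ℕ) * σ := by
  have hf := h.isAxisFlat
  have h0 : (0 : ℝ) ∈ Ioo a b := ⟨ha, hα.trans hb⟩
  have h0t : (0 : E3) ∈ e.target := by simpa using (hf.flat 0 h0).mem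
  obtain ⟨C, hC⟩ := hf.exists_axisJet hα hinj (c := 0) (d := α) (Icc_subset_Ioo ha hb)
  have hA : rotForm 0 (fun j k ↦ pderiv j (christoffel e 0 0 k) ((0 : ℝ) • bvec 0)) = 0 := by
    rw [rotForm_zero, zero_smul, hm.pderiv_one_christoffel h.smooth h0t]
    simp
  obtain ⟨hax, hj⟩ := hC 0 α 0 hα le_rfl (by simp) hA
  rw [rotForm_zero, zero_smul, hm.pderiv_zero_pderiv_one_christoffel h.smooth h0t] at hj
  rw [zero_smul] at hax
  rw [affineChart_zero_rot] at hax hj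
  refine nikodymMax_slab h.smooth h0t (by norm_num)
    (B := fun k ↦ {u : E3 | |u 0| + |u 1| ≤ k ∧ |u 2| ≤ k ^ 4}) (D := 2) (V := 8) ?_ ?_
  · filter_upwards [Ioo_mem_nhdsGT (zero_lt_one (α := ℝ))] with k hk
    have hk0 := hk.1
    have h4 : k ^ 4 ≤ k := pow_le_of_le_one hk0.le hk.2.le (by norm_num)
    have hcl : IsClosed {u : E3 | |u 0| + |u 1| ≤ k} := isClosed_le (by fun_prop) continuous_const
    have hcl' : IsClosed {u : E3 | |u 2| ≤ k ^ 4} := isClosed_le (by fun_prop) continuous_const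
    refine ⟨(hcl.inter hcl').measurableSet, ?_, fun u hu ↦ ?_, ?_⟩
    · filter_upwards [setOf_abs_le_mem_nhds (half_pos hk0) (half_pos hk0) (pow_pos hk0 4)] with u hu
      exact ⟨by linarith [hu.1, hu.2.1], hu.2.2⟩
    · rw [mem_closedBall_zero_iff]
      exact (E3_norm_le u).trans (by linarith [hu.1, hu.2])
    · have hsub : {u : E3 | |u 0| + |u 1| ≤ k ∧ |u 2| ≤ k ^ 4} ⊆
          {u : E3 | |u 0| ≤ k ∧ |u 1| ≤ k ∧ |u 2| ≤ k ^ 4} := fun u hu ↦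
        ⟨by linarith [hu.1, abs_nonneg (u 1)], by linarith [hu.1, abs_nonneg (u 0)], hu.2⟩
      refine (measure_mono hsub).trans ?_
      rw [volume_setOf_abs_le _ _ _ hk0.le (by positivity)]
      exact ENNReal.ofReal_le_ofReal (le_of_eq (by ring))
  · obtain ⟨η, hη, hsubF⟩ := hf.exists_forall_subset_cthickening hα ha hb hρ
    refine exists_forall_le_nikodymMax hα hinj hax hj (by norm_num) (F := F) (n := 4)
      (j := 0) ⟨η, hη, fun c u V hc hu hV ↦ ?_⟩ (by norm_num) ?_
    · rw [hF]
      exact ⟨hc.mem, hsubF c u V hc hu hV⟩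
    obtain ⟨η, c₀, hη, hc₀, hc₀1, -, hslab⟩ := hj.exists_forall_slab_of_quad_le zero_le_one
      fun u hu v ↦ hm.abs_gam_two_le h.smooth hu v
    refine ⟨η, c₀, 1 / 2, hη, hc₀, by norm_num, ?_⟩
    intro k x τ hk hk1 hx hτ u v hu hclose hu0 hv0 t ht z hz
    obtain ⟨h1, h2⟩ := hslab k x τ hk (by linarith) (by simpa using hx)
      (by simpa using hτ) u v hu hclose hu0 hv0 t ht
    have hk2 : k ^ 4 ≤ k ^ 2 := pow_le_pow_of_le_one hk.le (by linarith) (by norm_num)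
    have hk3 : k ^ 2 ≤ k / 2 := by nlinarith
    have hz' : ∀ i, |z i| ≤ k ^ 4 / 2 := fun i ↦ (E3_abs_apply_le z i).trans hz
    have h3 := fun i ↦ abs_add_le (u t i) (z i)
    simp only [mem_ofPred_eq, PiLp.add_apply]
    exact ⟨by linarith [h3 0, h3 1, hz' 0, hz' 1], by linarith [h3 2, hz' 2]⟩

theorem IsFermiChart.exists_forall_le_of_isRotatingMetric (h : IsFermiChart e a b r) (hα : 0 < α)
    (hinj : HasInjRadiusGT M (2 * α)) (ha : a < 0) (hb : α < b) {ρ : ℝ} (hρ : 0 < ρ)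
    (hm : IsRotatingMetric e) {F : Set (Set M)}
    (hF : F = {S ∈ geodesicSegments M α | S ⊆ Metric.cthickening ρ (axisSegment e 0 α)}) :
    (∃ c : ℝ, 0 < c ∧ ∀ᶠ δ : ℝ in 𝓝[>] 0, ∀ f : M → ℝ,
      f = slabFun e {u : E3 | |u 0| + |u 1| ≤ δ ^ (1 / 4 : ℝ) ∧ |u 2| ≤ δ} →
      ∀ p q : ℝ≥0∞, 1 ≤ p → 1 ≤ q →
        ENNReal.ofReal (c * δ ^ (1 / 4 + 1 / (4 * q.toReal) - 3 / (2 * p.toReal))) *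
            eLpNorm f p μHE[3] ≤
          eLpNorm (nikodymMax F δ f) q μHE[3]) ∧
    ∀ K : Set M, K ∈ 𝓝 (e.symm !₂[0, 0, 0]) →
      ¬ NikodymBound F K (5 / 2) (10 / 3) (1 / 5) ∧
      ∀ p : ℝ≥0∞, 1 ≤ p → NikodymBound F K p p (3 / p.toReal - 1) → p ≤ 7 / 3 := by
  obtain ⟨⟨c, hc, hev⟩, hK⟩ := h.nikodymMax_of_isRotatingMetric hα hinj ha hb hρ hm hF
  refine ⟨⟨c, hc, ?_⟩, fun K hK0 ↦ ⟨fun hB ↦ ?_, fun p hp hB ↦ ?_⟩⟩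
  · have hev' := eventually_nhdsGT_zero_of_pow (n := 4) (P := fun k δ ↦ ∀ p q : ℝ≥0∞, 1 ≤ p →
        1 ≤ q → ENNReal.ofReal (c * k ^ (1 + (1 : ℕ) / q.toReal - (6 : ℕ) / p.toReal : ℝ)) *
          eLpNorm (slabFun e {u : E3 | |u 0| + |u 1| ≤ k ∧ |u 2| ≤ δ}) p μHE[3] ≤
        eLpNorm (nikodymMax F δ
          (slabFun e {u : E3 | |u 0| + |u 1| ≤ k ∧ |u 2| ≤ δ})) q μHE[3]) (by norm_num) hev
    filter_upwards [hev', eventually_mem_nhdsWithin] with δ hδ hδ0 f hf p q hp hq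
    have hδ0 : 0 < δ := hδ0
    have h1 := hδ p q hp hq
    have h4 : (1 / (4 : ℕ) : ℝ) = 1 / 4 := by norm_num
    rw [← Real.rpow_mul hδ0.le, h4, ← hf] at h1
    convert h1 using 5
    push_cast
    rw [← div_div, ← div_div]
    ring
  · have h52 : (5 / 2 : ℝ≥0∞).toReal = 5 / 2 := by simp
    have h103 : (10 / 3 : ℝ≥0∞).toReal = 10 / 3 := by simp
    have h1 := hK K (by rwa [E3_axis_eq, zero_smul] at hK0) _ _ _
      (by rw [ENNReal.le_div_iff_mul_le (by simp) (by simp)]; norm_num)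
      (by rw [ENNReal.le_div_iff_mul_le (by simp) (by simp)]; norm_num) hB
    rw [h52, h103] at h1
    norm_num at h1
  · have h1 := hK K (by rwa [E3_axis_eq, zero_smul] at hK0) _ _ _ hp hp hB
    push_cast at h1
    have h3 : 3 ≤ 7 / p.toReal := by
      have : 1 / p.toReal - 6 / p.toReal + 4 * (3 / p.toReal) = 7 / p.toReal := by ring
      linarith
    have hp0 : 0 < p.toReal := by
      by_contra! hp0
      rw [le_antisymm hp0 ENNReal.toReal_nonneg] at h3
      norm_num at h3
    have hpt : p ≠ ⊤ := by
      rintro rfl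
      simp at hp0
    rw [← ENNReal.toReal_le_toReal hpt (by simp [ENNReal.div_eq_top])]
    have h73 : (7 / 3 : ℝ≥0∞).toReal = 7 / 3 := by simp
    rw [h73]
    rw [le_div_iff₀ hp0] at h3
    linarith
end

lemma continuous_rotForm (p : Fin 3 → Fin 3 → ℝ) : Continuous fun θ ↦ rotForm θ p := by
  unfold rotForm
  fun_prop

lemma rotForm_sub (θ : ℝ) (p q : Fin 3 → Fin 3 → ℝ) :
    rotForm θ (fun j k ↦ p j k - q j k) = rotForm θ p - rotForm θ q := by
  unfold rotForm
  ring

section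
variable {M : Type*} [EMetricSpace M] [ChartedSpace E3 M] [IsManifold (𝓡 3) ∞ M]
    [RiemannianBundle (fun x : M ↦ TangentSpace (𝓡 3) x)]
    [IsContMDiffRiemannianBundle (𝓡 3) ∞ E3 (fun x : M ↦ TangentSpace (𝓡 3) x)]
    {e : OpenPartialHomeomorph M E3} {a b r α : ℝ}

/-- A geodesic segment that starts on the axis, in another direction, meets the axis only at its
initial point. -/
lemma IsAxisFlat.exists_isGeodFrom (h : IsAxisFlat e a b) (hα : 0 < α)
    (hinj : HasInjRadiusGT M (2 * α)) {s : ℝ} (hs : s ∈ Ioo a b) {V : E3} (hV : V 1 ≠ 0) :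
    ∃ c : ℝ → M, IsGeodFrom e α c (s • bvec 0) V ∧ ∀ t ∈ Ioo a b, |t - s| ≤ α →
      e.symm (t • bvec 0) ∈ c '' Icc 0 (α / ‖coordVec e (s • bvec 0) V‖) → t = s := by
  have hf := h.flat s hs
  obtain ⟨r, hr, hx⟩ := hinj (e.symm (s • bvec 0))
  have hr0 : 0 < r := by linarith
  obtain ⟨c, hc, hinter⟩ := hx.exists_geodesics hr0 h.smooth hf.mem rfl
  have hV0 : V ≠ 0 := by
    rintro rfl
    simp at hV
  have hN : ∀ W ≠ 0, 0 < ‖coordVec e (s • bvec 0) W‖ := fun W hW ↦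
    norm_pos_iff.2 (h.smooth.coordVec_ne_zero hf.mem hW)
  refine ⟨c V, ⟨(hc V hV0).1, (hc V hV0).2.1, (hc V hV0).2.2.1.mono fun t ht ↦ ⟨?_, ?_⟩,
    (hc V hV0).2.2.2 α hα (by linarith)⟩, fun t ht hts hmem ↦ ?_⟩
  · have := hN V hV0
    have : 0 < r / ‖coordVec e (s • bvec 0) V‖ := by positivity
    linarith [ht.1]
  · have := hN V hV0
    refine ht.2.trans_lt ?_
    gcongr
    linarith
  have key : ∀ ς : ℝ, (ς = 1 ∨ ς = -1) → 0 ≤ ς * (t - s) → t = s := by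
    intro ς hς hpos
    have hς2 : ς * ς = 1 := by rcases hς with rfl | rfl <;> norm_num
    set W := ς • bvec 0 with hW
    have hW0 : W ≠ 0 := by
      rw [← norm_pos_iff, hW, norm_smul, norm_bvec, mul_one, norm_pos_iff]
      rintro rfl
      norm_num at hς
    have hWn : ‖coordVec e (s • bvec 0) W‖ = 1 := by
      have h1 := norm_coordVec_sq e (s • bvec 0) W
      have h2 : coordInner e (s • bvec 0) W W = 1 := by
        simp [coordInner, hf.orthonormal, hW, hς2]
      rw [h2] at h1
      nlinarith [norm_nonneg (coordVec e (s • bvec 0) W)]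
    have hline : ∀ τ : ℝ, s • bvec 0 + τ • W = (s + τ * ς) • bvec 0 := fun τ ↦ by
      rw [hW]
      module
    have hτ : ∀ τ ∈ Icc 0 (ς * (t - s)), s + τ * ς ∈ Ioo a b := by
      intro τ hτ
      rcases hς with rfl | rfl
      · exact ⟨by linarith [hs.1, hτ.1], by linarith [ht.2, hτ.2]⟩
      · exact ⟨by linarith [ht.1, hτ.2], by linarith [hs.2, hτ.1]⟩
    have habs : |ς * (t - s)| = |t - s| := by
      rw [abs_mul]
      rcases hς with rfl | rfl <;> simp
    have hle : ς * (t - s) < r := by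
      rw [← abs_of_nonneg hpos, habs]
      linarith
    obtain ⟨g1, g2, g3, -⟩ := hc W hW0
    rw [hWn, div_one] at g3
    have h1 := h.smooth.geodCurve_eq_line (u₀ := s • bvec 0) (f := W) (c := c W) hpos
      (fun τ h' ↦ by rw [hline]; exact (h.flat _ (hτ τ h')).mem)
      (fun τ h' ↦ by rw [hline, (h.flat _ (hτ τ h')).gam_zero]; rfl)
      (g3.mono fun τ h' ↦ ⟨by linarith [h'.1], h'.2.trans_lt hle⟩) g1 g2 (t := ς * (t - s))
      ⟨hpos, le_rfl⟩
    have h2 : s + ς * (t - s) * ς = t := by linear_combination (t - s) * hς2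
    rw [hline, h2] at h1
    obtain ⟨τ, hτ1, hτ2⟩ := hmem
    have hNV := hN V hV0
    have h3 := hinter V W τ (ς * (t - s)) hV0 hW0 (by
      rw [abs_of_nonneg hτ1.1]
      have := (le_div_iff₀ hNV).1 hτ1.2
      linarith) (by
      rw [hWn, mul_one, abs_of_nonneg hpos]
      exact hle) (hτ2.trans h1.symm)
    have h4 : τ = 0 := by
      have := congrArg (fun v : E3 ↦ v 1) h3
      simpa [hW, hV] using this
    rw [h4, zero_smul, hW, smul_smul] at h3
    have h5 := congrArg (fun v : E3 ↦ v 0) h3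
    simp only [PiLp.zero_apply, PiLp.smul_apply] at h5
    have h6 : (bvec 0 : E3) 0 = 1 := by simp
    rw [h6, smul_eq_mul, mul_one] at h5
    linear_combination -h5 - (t - s) * hς2
  rcases le_total 0 (t - s) with h0 | h0
  · exact key 1 (Or.inl rfl) (by linarith)
  · exact key (-1) (Or.inr rfl) (by linarith)

/-- Near a point where the chaotic curvature condition holds in the direction of the axis, suitable
rotated charts have expansions along the axis with uniform constants. -/
lemma IsFermiChart.exists_forall_axisJet (h : IsFermiChart e a b r) (hα : 0 < α)
    (hinj : HasInjRadiusGT M (2 * α)) (h0 : (0 : ℝ) ∈ Ioo a b)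
    (hch : IsChaoticAt (e.symm !₂[0, 0, 0]) (velocity (fun s : ℝ ↦ e.symm !₂[s, 0, 0]) 0)) :
    ∃ C κ ε T : ℝ, 0 ≤ C ∧ 0 < κ ∧ 0 < ε ∧ 0 < T ∧ ∀ s : ℝ, |s| < ε → ∃ θ A : ℝ,
      IsUnitAxis (affineChart e (s • bvec 0) (rot θ)) T ∧
      AxisJet (gam (affineChart e (s • bvec 0) (rot θ))) (affineChart e (s • bvec 0) (rot θ)).target
        T C A 0 ∧ |A| ≤ C ∧ κ ≤ |A| := by
  have hf := h.isAxisFlat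
  have hU := e.open_target
  set A : ℝ → Fin 3 → Fin 3 → ℝ := fun s j k ↦ pderiv j (christoffel e 0 0 k) (s • bvec 0) with hA
  set A' : ℝ → Fin 3 → Fin 3 → ℝ := fun s j k ↦
    pderiv 0 (pderiv j (christoffel e 0 0 k)) (s • bvec 0) with hA'
  have hmem0 := (hf.flat 0 h0).mem
  have hax : ContinuousAt (fun s : ℝ ↦ s • bvec 0) 0 := by fun_prop
  have hP : ∀ j k, ContDiffOn ℝ ∞ (pderiv j (christoffel e 0 0 k)) e.target := fun j k ↦
    contDiffOn_pderiv hU (h.smooth.contDiffOn_christoffel 0 0 k) j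
  have hAc : ∀ j k, ContinuousAt (fun s ↦ A s j k) 0 := fun j k ↦
    ContinuousAt.comp (f := fun s : ℝ ↦ s • bvec 0) (x := 0)
      ((hP j k).continuousOn.continuousAt (hU.mem_nhds hmem0)) hax
  have hAc' : ∀ j k, ContinuousAt (fun s ↦ A' s j k) 0 := fun j k ↦
    ContinuousAt.comp (f := fun s : ℝ ↦ s • bvec 0) (x := 0)
      ((contDiffOn_pderiv hU (hP j k) 0).continuousOn.continuousAt (hU.mem_nhds hmem0)) hax
  obtain ⟨θ₀, -, hmin⟩ := isCompact_Icc.exists_isMinOn (s := Icc 0 (Real.pi / 2))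
    (nonempty_Icc.2 Real.pi_div_two_pos.le) (f := fun θ ↦ |rotForm θ (A 0)| + |rotForm θ (A' 0)|)
    (((continuous_rotForm _).abs.add (continuous_rotForm _).abs).continuousOn)
  set κ := |rotForm θ₀ (A 0)| + |rotForm θ₀ (A' 0)| with hκ
  have hκ0 : 0 < κ := by
    rcases h.rotForm_of_isChaoticAt hα hinj h0 hch θ₀ with h1 | h1
    · exact add_pos_of_pos_of_nonneg (abs_pos.2 h1) (abs_nonneg _)
    · exact add_pos_of_nonneg_of_pos (abs_nonneg _) (abs_pos.2 h1)
  have hsmall : ∀ j k, ∀ᶠ s in 𝓝 (0 : ℝ), |A s j k - A 0 j k| < κ / 16 ∧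
      |A' s j k - A' 0 j k| < κ / 16 := by
    intro j k
    have hκ16 : 0 < κ / 16 := by positivity
    have h1 := (hAc j k).eventually (Metric.ball_mem_nhds _ hκ16)
    have h2 := (hAc' j k).eventually (Metric.ball_mem_nhds _ hκ16)
    filter_upwards [h1, h2] with s h1 h2 using ⟨h1, h2⟩
  obtain ⟨ε, hε, hball⟩ := Metric.eventually_nhds_iff.1
    ((hsmall 1 1).and ((hsmall 2 1).and ((hsmall 1 2).and (hsmall 2 2))))
  set m := min (-a) b with hm
  have hm0 : 0 < m := lt_min (by linarith [h0.1]) h0.2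
  have hma : m ≤ -a := min_le_left _ _
  have hmb : m ≤ b := min_le_right _ _
  obtain ⟨C, hC⟩ := hf.exists_axisJet hα hinj (c := -(m / 2)) (d := m / 2)
    (Icc_subset_Ioo (by linarith) (by linarith))
  set C₁ := |A' 0 1 1| + |A' 0 2 1| + |A' 0 1 2| + |A' 0 2 2| with hC₁
  refine ⟨max (max C (C₁ + κ)) 0, κ / 2, min ε (m / 4), m / 4, le_max_right _ _, by positivity,
    by positivity, by positivity, fun s hs ↦ ?_⟩
  have hsm := abs_lt.1 (hs.trans_le (min_le_right _ _))
  obtain ⟨d11, d21, d12, d22⟩ := hball (y := s) (by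
    rw [dist_zero_right, Real.norm_eq_abs]
    exact hs.trans_le (min_le_left _ _))
  have hsI : s ∈ Ioo a b := ⟨by linarith, by linarith⟩
  obtain ⟨θ, hθ, hθ0⟩ := exists_rotForm_eq_zero (p := A s) (hf.pderiv_christoffel_symm hsI)
  obtain ⟨hu, hj⟩ := hC s (m / 4) θ (by positivity) (by linarith) (by linarith) hθ0
  have h1 : |rotForm θ (A s) - rotForm θ (A 0)| ≤ κ / 4 := by
    rw [← rotForm_sub]
    exact (abs_rotForm_le θ _).trans (by linarith [d11.1, d21.1, d12.1, d22.1])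
  have h2 : |rotForm θ (A' s) - rotForm θ (A' 0)| ≤ κ / 4 := by
    rw [← rotForm_sub]
    exact (abs_rotForm_le θ _).trans (by linarith [d11.2, d21.2, d12.2, d22.2])
  have h3 : κ ≤ |rotForm θ (A 0)| + |rotForm θ (A' 0)| := hmin hθ
  have h4 : |rotForm θ (A' 0)| ≤ C₁ := abs_rotForm_le θ _
  have h5 := abs_sub_abs_le_abs_sub (rotForm θ (A' s)) (rotForm θ (A' 0))
  have h6 := abs_sub_abs_le_abs_sub (rotForm θ (A' 0)) (rotForm θ (A' s))
  rw [hθ0, zero_sub, abs_neg] at h1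
  rw [abs_sub_comm] at h6
  exact ⟨θ, rotForm θ (A' s), hu, hj.mono ((le_max_left _ _).trans (le_max_left _ _)),
    by linarith [((le_max_right C (C₁ + κ)).trans (le_max_left _ 0))], by linarith⟩
end

section
variable {Γ : E3 → E3 →L[ℝ] E3 →L[ℝ] E3} {U : Set E3} {T M a b : ℝ}

/-- Short-time expansion of a geodesic that starts on the axis. -/
lemma AxisJet.exists_forall_start (h : AxisJet Γ U T M a b) {ε : ℝ} (hε : 0 < ε) :
    ∃ η : ℝ, 0 < η ∧ ∀ t₀ t₁ τ : ℝ, 0 ≤ t₀ → t₀ ≤ t₁ → t₁ ≤ η → ∀ u v : ℝ → E3,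
      IsGeodSol Γ u v (Icc t₀ t₁) →
      (∀ t ∈ Icc t₀ t₁, ‖u t - t • bvec 0‖ ≤ η ∧ ‖v t - bvec 0‖ ≤ η) →
      u t₀ = t₀ • bvec 0 → v t₀ = bvec 0 + τ • bvec 1 →
      ‖u t₁ - t₁ • bvec 0 - (τ * (t₁ - t₀)) • bvec 1‖ ≤ ε * (|τ| * (t₁ - t₀)) ∧
        ‖v t₁ - bvec 0 - τ • bvec 1‖ ≤ ε * (|τ| * (t₁ - t₀)) := by
  obtain ⟨η₁, C, hη₁, hC, hgrow⟩ := h.exists_forall_growth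
  obtain ⟨η₂, hη₂, hlin⟩ := h.exists_forall_linearization (ε := ε / (4 * C)) (by positivity)
  have hM := h.nonneg
  have hT := h.pos
  set η₃ := ε / (6 * M * C + 1) with hη₃
  have hη₃0 : 0 < η₃ := by positivity
  set η := min (min (min η₁ η₂) (min T 1)) (η₃ / 2) with hη
  have hη1 : η ≤ η₁ := (min_le_left _ _).trans ((min_le_left _ _).trans (min_le_left _ _))
  have hη2 : η ≤ η₂ := (min_le_left _ _).trans ((min_le_left _ _).trans (min_le_right _ _))
  have hηT : η ≤ T := (min_le_left _ _).trans ((min_le_right _ _).trans (min_le_left _ _))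
  have hη1' : η ≤ 1 := (min_le_left _ _).trans ((min_le_right _ _).trans (min_le_right _ _))
  have hη3 : 6 * M * C * η ≤ ε / 2 := by
    have h1 : η ≤ η₃ / 2 := min_le_right _ _
    have h2 : η₃ * (6 * M * C + 1) = ε := div_mul_cancel₀ _ (by positivity)
    have h3 : 0 ≤ M * C := by positivity
    nlinarith
  have hη0 : 0 < η := by positivity
  refine ⟨η, hη0, fun t₀ t₁ τ ht₀ ht₁ ht₁η u v hu hclose hu0 hv0 ↦ ?_⟩
  have hbd := hgrow t₀ t₁ |τ| ht₀ (ht₁η.trans hηT) (ht₁η.trans hη1') u v hu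
    (fun t ht ↦ ⟨(hclose t ht).1.trans hη1, (hclose t ht).2.trans hη1⟩)
    (by rw [hu0, sub_self, norm_zero]; positivity)
    (by rw [hv0, add_sub_cancel_left, norm_smul, norm_bvec, mul_one, Real.norm_eq_abs])
  have hline : ∀ t : ℝ, HasDerivAt (fun t : ℝ ↦ t • bvec 0) (bvec 0) t := fun t ↦ by
    simpa using (hasDerivAt_id t).smul_const (bvec 0)
  have hy : ∀ t ∈ Icc t₀ t₁, ‖u t - t • bvec 0‖ ≤ C * |τ| * η := by
    intro t ht
    have h1 := norm_image_sub_le_of_norm_deriv_le_segment' (f := fun t ↦ u t - t • bvec 0)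
      (f' := fun t ↦ v t - bvec 0) (C := C * |τ|) (a := t₀) (b := t₁)
      (fun t ht ↦ ((hu t ht).1.sub (hline t)).hasDerivWithinAt)
      (fun t ht ↦ (hbd t (Ico_subset_Icc_self ht)).2.1) t ht
    rw [hu0, sub_self, sub_zero] at h1
    refine h1.trans ?_
    gcongr
    linarith [ht.2]
  have hacc : ∀ t ∈ Icc t₀ t₁, ‖Γ (u t) (v t) (v t)‖ ≤ ε * |τ| := by
    intro t ht
    have htT : t ∈ Icc 0 T := ⟨ht₀.trans ht.1, ht.2.trans (ht₁η.trans hηT)⟩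
    have h1 := hlin t htT (u t) (t • bvec 0) (v t) (bvec 0) ((hclose t ht).1.trans hη2)
      (by simpa using hη₂.le) ((hclose t ht).2.trans hη2) (by simpa using hη₂.le)
    rw [h.geod t htT, sub_zero] at h1
    have h2 : ‖fderiv ℝ Γ (t • bvec 0) (u t - t • bvec 0) (bvec 0) (bvec 0)‖ ≤
        M * (C * |τ| * η) := by
      have := (fderiv ℝ Γ (t • bvec 0) (u t - t • bvec 0)).le_opNorm₂ (bvec 0) (bvec 0)
      rw [norm_bvec, mul_one, mul_one] at this
      refine this.trans ((((fderiv ℝ Γ (t • bvec 0)).le_of_opNorm_le (h.fderiv_le t htT) _)).trans ?_)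
      exact mul_le_mul_of_nonneg_left (hy t ht) hM
    have h3 : ‖(2 : ℝ) • Γ (t • bvec 0) (bvec 0) (v t - bvec 0)‖ ≤ 2 * (M * η * (C * |τ|)) := by
      rw [norm_smul, Real.norm_ofNat]
      have := (Γ (t • bvec 0)).le_opNorm₂ (bvec 0) (v t - bvec 0)
      rw [norm_bvec, mul_one] at this
      have h4 : ‖Γ (t • bvec 0)‖ ≤ M * η := (h.norm_le t htT).trans (by
        gcongr
        exact ht.2.trans ht₁η)
      have h5 := mul_le_mul h4 (hbd t ht).2.1 (norm_nonneg _) (by positivity)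
      linarith
    have h6 : ε / (4 * C) * (‖u t - t • bvec 0‖ + ‖v t - bvec 0‖) ≤ ε / 2 * |τ| := by
      have h7 : ‖u t - t • bvec 0‖ + ‖v t - bvec 0‖ ≤ 2 * C * |τ| := by
        linarith [(hbd t ht).1, (hbd t ht).2.1]
      calc _ ≤ ε / (4 * C) * (2 * C * |τ|) := by gcongr
        _ = ε / 2 * |τ| := by field_simp; ring
    have h8 := norm_add_le (Γ (u t) (v t) (v t) -
      (fderiv ℝ Γ (t • bvec 0) (u t - t • bvec 0) (bvec 0) (bvec 0) +
      (2 : ℝ) • Γ (t • bvec 0) (bvec 0) (v t - bvec 0)))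
      (fderiv ℝ Γ (t • bvec 0) (u t - t • bvec 0) (bvec 0) (bvec 0) +
      (2 : ℝ) • Γ (t • bvec 0) (bvec 0) (v t - bvec 0))
    rw [sub_add_cancel] at h8
    have h9 := norm_add_le (fderiv ℝ Γ (t • bvec 0) (u t - t • bvec 0) (bvec 0) (bvec 0))
      ((2 : ℝ) • Γ (t • bvec 0) (bvec 0) (v t - bvec 0))
    have h10 := mul_le_mul_of_nonneg_right hη3 (abs_nonneg τ)
    have h11 : 0 ≤ M * C * η * |τ| := by positivity
    linarith
  have hv : ∀ t ∈ Icc t₀ t₁, ‖v t - bvec 0 - τ • bvec 1‖ ≤ ε * |τ| * (t - t₀) := by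
    intro t ht
    have h1 := norm_image_sub_le_of_norm_deriv_le_segment' (f := v)
      (f' := fun t ↦ -(Γ (u t) (v t) (v t))) (C := ε * |τ|) (a := t₀) (b := t₁)
      (fun t ht ↦ (hu t ht).2.hasDerivWithinAt)
      (fun t ht ↦ by rw [norm_neg]; exact hacc t (Ico_subset_Icc_self ht)) t ht
    rwa [hv0, ← sub_sub] at h1
  constructor
  · have h1 := norm_image_sub_le_of_norm_deriv_le_segment'
      (f := fun t ↦ u t - t • bvec 0 - (τ * (t - t₀)) • bvec 1)
      (f' := fun t ↦ v t - bvec 0 - τ • bvec 1) (C := ε * |τ|) (a := t₀) (b := t₁)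
      (fun t ht ↦ by
        have h2 : HasDerivAt (fun t : ℝ ↦ (τ * (t - t₀)) • bvec 1) (τ • bvec 1) t := by
          simpa using (((hasDerivAt_id t).sub_const t₀).const_mul τ).smul_const (bvec 1)
        exact (((hu t ht).1.sub (hline t)).sub h2).hasDerivWithinAt)
      (fun t ht ↦ (hv t (Ico_subset_Icc_self ht)).trans
        (mul_le_of_le_one_right (by positivity) (by linarith [ht.2]))) t₁ ⟨ht₁, le_rfl⟩
    simp only [hu0, sub_self, mul_zero, zero_smul, sub_zero] at h1
    rwa [mul_assoc] at h1
  · rw [← mul_assoc]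
    exact hv t₁ ⟨ht₁, le_rfl⟩

/-- Separation of two geodesics that start at different points of the axis. -/
lemma exists_forall_axisJet_spread_of_axis {M κ : ℝ} (hM : 0 ≤ M) (hκ : 0 < κ) :
    ∃ S c : ℝ, 0 < S ∧ S ≤ 1 ∧ 0 < c ∧ ∀ (Γ : E3 → E3 →L[ℝ] E3 →L[ℝ] E3) (U : Set E3)
      (T a s₁ : ℝ), AxisJet Γ U T M a 0 → |a| ≤ M → κ ≤ |a| → 0 < s₁ →
      2 * s₁ ≤ S → 2 * s₁ ≤ T → ∃ η : ℝ, 0 < η ∧ ∀ s σ σ' τ τ' : ℝ, s ∈ Icc s₁ (2 * s₁) →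
      0 ≤ σ' → σ' ≤ σ → σ ≤ η → ∀ u v u' v' : ℝ → E3, IsGeodSol Γ u v (Icc σ s) →
      IsGeodSol Γ u' v' (Icc σ' s) →
      (∀ t ∈ Icc σ s, ‖u t - t • bvec 0‖ ≤ η ∧ ‖v t - bvec 0‖ ≤ η) →
      (∀ t ∈ Icc σ' s, ‖u' t - t • bvec 0‖ ≤ η ∧ ‖v' t - bvec 0‖ ≤ η) →
      u σ = σ • bvec 0 → v σ = bvec 0 + τ • bvec 1 →
      u' σ' = σ' • bvec 0 → v' σ' = bvec 0 + τ' • bvec 1 →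
      c * s₁ ^ 4 * (|τ'| * (σ - σ') + |τ - τ'|) ≤ |(u s - u' s) 1| + |(u s - u' s) 2| ∧
        ‖u s - u' s‖ ≤ 6 * (|τ'| * (σ - σ') + |τ - τ'|) := by
  obtain ⟨S, c, hS, hS1, hc, hspread⟩ := exists_forall_axisJet_spread hM hκ
  refine ⟨S, c, hS, hS1, hc, fun Γ U T a s₁ h ha hκa hs₁ hs₁S hs₁T ↦ ?_⟩
  obtain ⟨η₁, hη₁, hsp⟩ := hspread Γ U T a 0 s₁ h ha (by simpa using hM) (by simpa using hκa) hs₁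
    hs₁S hs₁T
  obtain ⟨η₂, hη₂, hstart⟩ := h.exists_forall_start (ε := s₁ ^ 5) (by positivity)
  refine ⟨min (min η₁ η₂) (min (s₁ ^ 5) s₁), by positivity, ?_⟩
  intro s σ σ' τ τ' hs hσ' hσσ hση u v u' v' hu hu' hclose hclose' hu0 hv0 hu0' hv0'
  have h1 : min (min η₁ η₂) (min (s₁ ^ 5) s₁) ≤ η₁ := (min_le_left _ _).trans (min_le_left _ _)
  have h2 : min (min η₁ η₂) (min (s₁ ^ 5) s₁) ≤ η₂ := (min_le_left _ _).trans (min_le_right _ _)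
  have h3 : σ ≤ s₁ ^ 5 := hση.trans ((min_le_right _ _).trans (min_le_left _ _))
  have h4 : σ ≤ s := hση.trans ((min_le_right _ _).trans ((min_le_right _ _).trans hs.1))
  have hsub : Icc σ s ⊆ Icc σ' s := Icc_subset_Icc_left hσσ
  have hsub' : Icc σ' σ ⊆ Icc σ' s := Icc_subset_Icc_right h4
  obtain ⟨g1, g2⟩ := hstart σ' σ τ' hσ' hσσ (hση.trans h2) u' v' (hu'.mono hsub')
    (fun t ht ↦ ⟨(hclose' t (hsub' ht)).1.trans h2, (hclose' t (hsub' ht)).2.trans h2⟩) hu0' hv0'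
  have hX : |(-(τ' * (σ - σ')))| = |τ'| * (σ - σ') := by
    rw [abs_neg, abs_mul, abs_of_nonneg (by linarith : 0 ≤ σ - σ')]
  have hle : s₁ ^ 5 * (|τ'| * (σ - σ')) ≤ s₁ ^ 5 * (|τ'| * (σ - σ') + |τ - τ'|) := by
    gcongr
    linarith [abs_nonneg (τ - τ')]
  have h5 := hsp s σ (-(τ' * (σ - σ'))) (τ - τ') hs (hσ'.trans hσσ) h3 u v u' v' hu
    (hu'.mono hsub) (fun t ht ↦ ⟨(hclose t ht).1.trans h1, (hclose' t (hsub ht)).1.trans h1,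
      (hclose t ht).2.trans h1, (hclose' t (hsub ht)).2.trans h1⟩)
    (by
      rw [hX]
      refine le_trans (le_of_eq ?_) (g1.trans hle)
      rw [hu0, ← norm_neg]
      congr 1
      module)
    (by
      rw [hX]
      refine le_trans (le_of_eq ?_) (g2.trans hle)
      rw [hv0, ← norm_neg]
      congr 1
      module)
  rwa [hX] at h5
end

section
variable {M : Type*} [EMetricSpace M] [ChartedSpace E3 M] [IsManifold (𝓡 3) ∞ M]
    [RiemannianBundle (fun x : M ↦ TangentSpace (𝓡 3) x)]
    [IsContMDiffRiemannianBundle (𝓡 3) ∞ E3 (fun x : M ↦ TangentSpace (𝓡 3) x)]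

lemma norm_bvec_zero_add_smul_sub (τ : ℝ) : ‖bvec 0 + τ • bvec 1 - bvec 0‖ = |τ| := by
  rw [add_sub_cancel_left, norm_smul, norm_bvec, mul_one, Real.norm_eq_abs]

lemma norm_smul_bvec_zero (σ : ℝ) : ‖σ • bvec 0‖ = |σ| := by
  rw [norm_smul, norm_bvec, mul_one, Real.norm_eq_abs]

/-- Geodesics from the axis cross a transversal plane, at points that separate at least as fast as
the initial data. -/
lemma exists_forall_crossing {C κ : ℝ} (hC : 0 ≤ C) (hκ : 0 < κ) :
    ∃ S : ℝ, 0 < S ∧ ∀ (e : OpenPartialHomeomorph M E3) (T α a s₁ : ℝ), IsUnitAxis e T →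
      AxisJet (gam e) e.target T C a 0 → |a| ≤ C → κ ≤ |a| → 0 < s₁ → 2 * s₁ ≤ S → 2 * s₁ ≤ T →
      2 * s₁ ≤ α / 2 → ∃ η A : ℝ, 0 < η ∧ 0 < A ∧
      (∀ (σ τ : ℝ) (c : ℝ → M), 0 ≤ σ → σ ≤ η → |τ| ≤ η →
        IsGeodFrom e α c (σ • bvec 0) (bvec 0 + τ • bvec 1) → ∃ t ∈ Icc s₁ (2 * s₁),
          c (t - σ) ∈ e.source ∧
          c (t - σ) ∈ c '' Icc 0 (α / ‖coordVec e (σ • bvec 0) (bvec 0 + τ • bvec 1)‖) ∧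
          e (c (t - σ)) 0 = 3 / 2 * s₁) ∧
      ∀ (σ τ σ' τ' : ℝ) (c c' : ℝ → M) (t t' : ℝ), 0 ≤ σ' → σ' ≤ σ → σ ≤ η → |τ| ≤ η → |τ'| ≤ η →
        IsGeodFrom e α c (σ • bvec 0) (bvec 0 + τ • bvec 1) →
        IsGeodFrom e α c' (σ' • bvec 0) (bvec 0 + τ' • bvec 1) → t ∈ Icc s₁ (2 * s₁) →
        t' ∈ Icc s₁ (2 * s₁) → e (c (t - σ)) 0 = 3 / 2 * s₁ → e (c' (t' - σ')) 0 = 3 / 2 * s₁ →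
        |τ'| * (σ - σ') + |τ - τ'| ≤ A * ‖e (c (t - σ)) - e (c' (t' - σ'))‖ ∧
        ‖e (c (t - σ)) - e (c' (t' - σ'))‖ ≤ 24 * (|τ'| * (σ - σ') + |τ - τ'|) := by
  obtain ⟨S, c₁, hS, -, hc₁, hspread⟩ := exists_forall_axisJet_spread_of_axis hC hκ
  refine ⟨S, hS, fun e T α a s₁ hax hj ha hκa hs₁ hs₁S hs₁T hs₁α ↦ ?_⟩
  obtain ⟨ηp, hηp, hspread⟩ := hspread (gam e) e.target T a s₁ hj ha hκa hs₁ hs₁S hs₁T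
  set c' := min (c₁ * s₁ ^ 4) 1 with hc'
  have hc'0 : 0 < c' := by positivity
  have hc'1 : c' ≤ 1 := min_le_right _ _
  set ε := min ηp (min (s₁ / 2) (c' / 50)) with hε
  have hε0 : 0 < ε := by positivity
  have hεp : ε ≤ ηp := min_le_left _ _
  have hεs : ε ≤ s₁ / 2 := (min_le_right _ _).trans (min_le_left _ _)
  have hεc : 50 * ε ≤ c' := by
    have : ε ≤ c' / 50 := (min_le_right _ _).trans (min_le_right _ _)
    linarith
  obtain ⟨ηl, hηl, hlocal⟩ := hax.exists_forall_isGeodSol (α := α) hs₁T hs₁α hε0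
  set η := min (min ηl ηp) s₁ with hη
  have hη1 : η ≤ ηl := (min_le_left _ _).trans (min_le_left _ _)
  have hη2 : η ≤ ηp := (min_le_left _ _).trans (min_le_right _ _)
  have hη3 : η ≤ s₁ := min_le_right _ _
  have hloc := fun (σ τ : ℝ) (c : ℝ → M) (hσ : 0 ≤ σ) (hση : σ ≤ η) (hτ : |τ| ≤ η)
      (hc : IsGeodFrom e α c (σ • bvec 0) (bvec 0 + τ • bvec 1)) ↦
    hlocal c _ _ σ hc (by rw [norm_smul_bvec_zero, abs_of_nonneg hσ]; exact hση.trans hη1)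
      (by rw [norm_bvec_zero_add_smul_sub]; exact hτ.trans hη1) hσ (hση.trans hη1)
  refine ⟨η, 54 / c', by positivity, by positivity, ?_, ?_⟩
  · intro σ τ c hσ hση hτ hc
    obtain ⟨g1, -, -, g4⟩ := hloc σ τ c hσ hση hτ hc
    have hsub : Icc s₁ (2 * s₁) ⊆ Icc σ (2 * s₁) := Icc_subset_Icc_left (hση.trans hη3)
    have hnear : ∀ t ∈ Icc s₁ (2 * s₁), |e (c (t - σ)) 0 - t| ≤ s₁ / 2 := by
      intro t ht
      have h1 := (E3_abs_apply_le _ 0).trans (g4 t (hsub ht)).2.2.1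
      have h2 : (e (c (t - σ)) - t • bvec 0) 0 = e (c (t - σ)) 0 - t := by simp
      rw [h2] at h1
      exact h1.trans hεs
    have hcont : ContinuousOn (fun t ↦ e (c (t - σ)) 0) (Icc s₁ (2 * s₁)) := fun t ht ↦
      (E3_hasDerivAt_apply (g1 t (hsub ht)).1 0).continuousAt.continuousWithinAt
    have hle : s₁ ≤ 2 * s₁ := by linarith
    obtain ⟨t, ht, hteq⟩ := intermediate_value_Icc hle hcont (show 3 / 2 * s₁ ∈ _ from
      ⟨by linarith [(abs_le.1 (hnear s₁ ⟨le_rfl, hle⟩)).2],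
        by linarith [(abs_le.1 (hnear (2 * s₁) ⟨hle, le_rfl⟩)).1]⟩)
    exact ⟨t, ht, (g4 t (hsub ht)).1, (g4 t (hsub ht)).2.1, hteq⟩
  · intro σ τ σ' τ' c c'' t t' hσ' hσσ hση hτ hτ' hc hc' ht ht' h0 h0'
    obtain ⟨g1, g2, g3, g4⟩ := hloc σ τ c (hσ'.trans hσσ) hση hτ hc
    obtain ⟨g1', g2', g3', g4'⟩ := hloc σ' τ' c'' hσ' (hσσ.trans hση) hτ' hc'
    have hsub : Icc σ t ⊆ Icc σ (2 * s₁) := Icc_subset_Icc_right ht.2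
    have hsub' : Icc σ' t ⊆ Icc σ' (2 * s₁) := Icc_subset_Icc_right ht.2
    obtain ⟨h1, h2⟩ := hspread t σ σ' τ τ' ht hσ' hσσ (hση.trans hη2) _ _ _ _ (g1.mono hsub)
      (g1'.mono hsub') (fun t ht ↦ ⟨(g4 t (hsub ht)).2.2.1.trans hεp,
        (g4 t (hsub ht)).2.2.2.trans hεp⟩) (fun t ht ↦ ⟨(g4' t (hsub' ht)).2.2.1.trans hεp,
        (g4' t (hsub' ht)).2.2.2.trans hεp⟩) g2 g3 g2' g3'
    set m := |τ'| * (σ - σ') + |τ - τ'| with hm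
    have hm0 : 0 ≤ m := add_nonneg (mul_nonneg (abs_nonneg _) (by linarith)) (abs_nonneg _)
    have hI : ∀ s ∈ Icc s₁ (2 * s₁), s ∈ Icc σ' (2 * s₁) := fun s hs ↦
      ⟨(hσσ.trans (hση.trans hη3)).trans hs.1, hs.2⟩
    have hr := norm_sub_sub_smul_le (fun t ht ↦ (g1' t ht).1) (fun t ht ↦ (g4' t ht).2.2.2)
      (hI t ht) (hI t' ht')
    set u := e (c (t - σ)) with hu
    set u' := e (c'' (t - σ')) with hu'
    set u'' := e (c'' (t' - σ')) with hu''
    have hD : u - u'' = (u - u') + (t - t') • bvec 0 + (u' - u'' - (t - t') • bvec 0) := by abel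
    constructor
    · have := abs_add_le_of_transversal hD (le_trans
        (mul_le_mul_of_nonneg_right (min_le_left _ _) hm0) h1) h2 hr hc'0 hc'1 hεc
      linarith [abs_nonneg (t - t')]
    · have hd : |t - t'| ≤ 12 * m := by
        have h3 : t - t' = -((u - u') 0) - (u' - u'' - (t - t') • bvec 0) 0 := by
          simp
          linarith
        have h4 := abs_sub (-((u - u') 0)) ((u' - u'' - (t - t') • bvec 0) 0)
        rw [← h3, abs_neg] at h4
        have h5 := E3_abs_apply_le (u - u') 0
        have h6 := (E3_abs_apply_le (u' - u'' - (t - t') • bvec 0) 0).trans hr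
        have h7 : ε * |t - t'| ≤ 1 / 2 * |t - t'| := by
          gcongr
          linarith
        linarith
      have h7 : ε * |t - t'| ≤ 1 / 2 * |t - t'| := by
        gcongr
        linarith
      rw [hD]
      refine (norm_add_le _ _).trans ((add_le_add_left (norm_add_le _ _) _).trans ?_)
      rw [norm_smul_bvec_zero]
      linarith

variable [IsRiemannianManifold (𝓡 3) M] [MeasurableSpace M] [BorelSpace M]
    {e : OpenPartialHomeomorph M E3} {T C a b α : ℝ}

set_option maxHeartbeats 400000 in
/-- The weighted averages of a slab over tubes about geodesics that start on the axis. -/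
lemma IsUnitAxis.exists_forall_le_average (hax : IsUnitAxis e T)
    (hj : AxisJet (gam e) e.target T C a b) (hα : 0 < α) (hinj : HasInjRadiusGT M (2 * α)) :
    ∃ η : ℝ, 0 < η ∧ ∀ κ : ℝ, ∃ cA : ℝ, 0 < cA ∧ ∀ᶠ k : ℝ in 𝓝[>] 0, ∀ (σ τ : ℝ) (c : ℝ → M),
      0 ≤ σ → σ ≤ η * k → |τ| ≤ η * k →
      IsGeodFrom e α c (σ • bvec 0) (bvec 0 + τ • bvec 1) → ∀ S : Set M,
      S = c '' Icc 0 (α / ‖coordVec e (σ • bvec 0) (bvec 0 + τ • bvec 1)‖) →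
      ENNReal.ofReal (cA * k ^ (1 + max κ 0)) ≤ (μHE[3] (Metric.cthickening (k ^ 5) S))⁻¹ *
        ∫⁻ y in Metric.cthickening (k ^ 5) S,
          ‖slabFun e {u : E3 | |u 0| ≤ k ∧ |u 1| ≤ k ^ 2 ∧ |u 2| ≤ 2 * k ^ 5} y‖ₑ *
            edist y (e.symm (σ • bvec 0)) ^ κ ∂μHE[3] := by
  obtain ⟨ηs, c₀, hηs, hc₀, hc₀1, hc₀T, hslab⟩ := hj.exists_forall_slab
  obtain ⟨ηt, Bt, δt, hηt, hBt, hδt, htube⟩ := hax.exists_forall_measure_tube_le hα hinj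
  obtain ⟨R, L, hbil⟩ := hax.smooth.exists_isBilipBall hax.zero_mem
  have hR := hbil.pos
  have hL := hbil.one_le
  have hT := hax.pos
  set T' := min T (α / 2) with hT'
  have hT'0 : 0 < T' := by positivity
  set ε := min ηs (min (R / 4) (1 / 2)) with hε
  have hε0 : 0 < ε := by positivity
  have hεs : ε ≤ ηs := min_le_left _ _
  have hεR : ε ≤ R / 4 := (min_le_right _ _).trans (min_le_left _ _)
  have hε2 : ε ≤ 1 / 2 := (min_le_right _ _).trans (min_le_right _ _)
  obtain ⟨ηl, hηl, hlocal⟩ := hax.exists_forall_isGeodSol (α := α) (min_le_left T (α / 2))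
    (min_le_right T (α / 2)) hε0
  set η := min (c₀ / 4) (min ηl ηt) with hη
  have hη0 : 0 < η := by positivity
  have hη1 : η ≤ c₀ / 4 := min_le_left _ _
  have hη2 : η ≤ ηl := (min_le_right _ _).trans (min_le_left _ _)
  have hη3 : η ≤ ηt := (min_le_right _ _).trans (min_le_right _ _)
  refine ⟨η, hη0, fun κ ↦ ⟨(c₀ / (8 * L)) ^ max κ 0 * (c₀ / 8 / (2 * L) ^ 5 / Bt), by positivity, ?_⟩⟩
  have hk₁0 : 0 < min (min (min (1 / 4) (c₀ / 8)) (min δt (R / 2))) (min (T' / c₀) (1 / (2 * L))) := by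
    positivity
  filter_upwards [Ioo_mem_nhdsGT hk₁0] with k hk σ τ c hσ hση hτη hc S hS
  have hk0 : 0 < k := hk.1
  have hk1 : k ≤ 1 / 4 :=
    hk.2.le.trans ((min_le_left _ _).trans ((min_le_left _ _).trans (min_le_left _ _)))
  have hkc : k ≤ c₀ / 8 :=
    hk.2.le.trans ((min_le_left _ _).trans ((min_le_left _ _).trans (min_le_right _ _)))
  have hkδ : k < δt :=
    hk.2.trans_le ((min_le_left _ _).trans ((min_le_right _ _).trans (min_le_left _ _)))
  have hkR : k ≤ R / 2 :=
    hk.2.le.trans ((min_le_left _ _).trans ((min_le_right _ _).trans (min_le_right _ _)))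
  have hkT : c₀ * k ≤ T' := by
    have := hk.2.le.trans ((min_le_right _ _).trans (min_le_left _ _))
    rwa [le_div_iff₀ hc₀, mul_comm] at this
  have hkL : k * (2 * L) ≤ 1 := by
    have := hk.2.le.trans ((min_le_right _ _).trans (min_le_right _ _))
    rwa [le_div_iff₀ (by positivity)] at this
  have hηk : η * k ≤ η := mul_le_of_le_one_right hη0.le (by linarith)
  have hσc : σ ≤ c₀ * k / 4 := by
    have := mul_le_mul_of_nonneg_right hη1 hk0.le
    linarith
  have hk2 : k ^ 2 ≤ c₀ * k / 8 := by
    have := mul_le_mul_of_nonneg_left hkc hk0.le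
    linarith
  have hk5 : k ^ 5 ≤ k ^ 2 := pow_le_pow_of_le_one hk0.le (by linarith) (by norm_num)
  have hk5' : k ^ 5 ≤ k := pow_le_of_le_one hk0.le (by linarith) (by norm_num)
  have hck : c₀ * k ≤ k / 2 := by
    have := mul_le_mul_of_nonneg_right hc₀1 hk0.le
    linarith
  have hck0 : 0 < c₀ * k := by positivity
  have hσn : ‖σ • bvec 0‖ ≤ η := by
    rw [norm_smul_bvec_zero, abs_of_nonneg hσ]
    exact hση.trans hηk
  have hτn : ‖bvec 0 + τ • bvec 1 - bvec 0‖ ≤ η := by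
    rw [norm_bvec_zero_add_smul_sub]
    exact hτη.trans hηk
  obtain ⟨g1, g2, g3, g4⟩ := hlocal c _ _ σ hc (hσn.trans hη2) (hτn.trans hη2) hσ
    (hση.trans (hηk.trans hη2))
  set u : ℝ → E3 := fun t ↦ e (c (t - σ)) with hu
  have hsub : Icc σ (c₀ * k) ⊆ Icc σ T' := Icc_subset_Icc_right hkT
  have hsub' : Icc (c₀ * k / 2) (c₀ * k) ⊆ Icc σ (c₀ * k) := Icc_subset_Icc_left (by linarith)
  have hin := hslab k σ 0 τ hk0 (by linarith) hσ (by linarith) (by simp; positivity)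
    (hτη.trans (by
      have := mul_le_mul_of_nonneg_right hη1 hk0.le
      linarith)) u _ (g1.mono hsub) (fun t ht ↦ ⟨(g4 t (hsub ht)).2.2.1.trans hεs,
      (g4 t (hsub ht)).2.2.2.trans hεs⟩) (by rw [zero_smul, add_zero]; exact g2) g3
  obtain ⟨W, hWm, hWS, hWe, hWμ⟩ := hbil.thick_curve (u := u) (t₁ := c₀ * k / 2)
    (t₂ := c₀ * k) (δ := k ^ 5 / 2) (by linarith) (by positivity) (by linarith)
    (fun t ht ↦ by
      have h1 := (g4 t (hsub (hsub' ht))).2.2.1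
      have h2 : ‖u t‖ ≤ ‖u t - t • bvec 0‖ + ‖t • bvec 0‖ := by
        simpa using norm_add_le (u t - t • bvec 0) (t • bvec 0)
      rw [norm_smul_bvec_zero, abs_of_nonneg (by linarith [ht.1])] at h2
      linarith [ht.2])
    (fun t ht t' ht' ↦ by
      have := norm_sub_sub_smul_le (fun t ht ↦ (g1 t ht).1) (fun t ht ↦ (g4 t ht).2.2.2)
        (hsub (hsub' ht)) (hsub (hsub' ht'))
      refine this.trans ?_
      have h5 : ε * |t - t'| ≤ 1 / 2 * |t - t'| := mul_le_mul_of_nonneg_right hε2 (abs_nonneg _)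
      linarith)
    (S := S) (fun t ht ↦ by
      have := g4 t (hsub (hsub' ht))
      rw [hu, e.left_inv this.1, hS]
      exact this.2.1)
  have hWS' : W ⊆ Metric.cthickening (k ^ 5) S :=
    hWS.trans (Metric.cthickening_mono (by linarith [pow_pos hk0 5]) _)
  have htb := htube c _ _ hc (hσn.trans hη3) (hτn.trans hη3) (k ^ 5) (by positivity)
    (hk5'.trans_lt hkδ)
  rw [← hS] at htb
  have hσR : σ • bvec 0 ∈ Metric.closedBall (0 : E3) R := by
    rw [mem_closedBall_zero_iff, norm_smul_bvec_zero, abs_of_nonneg hσ]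
    linarith
  refine (le_trans (ENNReal.ofReal_le_ofReal (le_of_eq ?_)) (ofReal_le_average
    (w := (c₀ * k - c₀ * k / 2) * (k ^ 5 / 2) ^ 2 / (2 * L) ^ 5)
    (l := (c₀ / (8 * L) * k) ^ max κ 0) (by positivity) (by positivity) htb hWm hWS' hWμ ?_))
  · rw [Real.mul_rpow (by positivity) hk0.le, Real.rpow_add hk0, Real.rpow_one]
    field_simp
    ring
  · intro y hy
    obtain ⟨t, ht, z, hz, hzR, rfl⟩ := hWe y hy
    have hzR' : u t + z ∈ Metric.closedBall (0 : E3) R := by rwa [mem_closedBall_zero_iff]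
    obtain ⟨h1, h2⟩ := hin t (hsub' ht)
    have ht0 : 0 ≤ t := by linarith [ht.1]
    rw [slabFun_symm (hbil.subset hzR') (add_mem_setOf_abs_le hk0 hk1 h1 h2 (by
      rw [abs_of_nonneg ht0]
      linarith [ht.2]) hz), enorm_one, one_mul]
    set D := edist (e.symm (u t + z)) (e.symm (σ • bvec 0)) with hD
    have hdec : u t + z - σ • bvec 0 = (u t - t • bvec 0) + z + (t - σ) • bvec 0 := by module
    have hlow : c₀ * k / 8 ≤ ‖u t + z - σ • bvec 0‖ := by
      have h3 := norm_sub_le (u t + z - σ • bvec 0) ((u t - t • bvec 0) + z)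
      rw [hdec, add_sub_cancel_left, norm_smul_bvec_zero, ← hdec] at h3
      have h4 := norm_add_le (u t - t • bvec 0) z
      linarith [le_abs_self (t - σ), ht.1]
    have hup : ‖u t + z - σ • bvec 0‖ ≤ 2 * k := by
      rw [hdec]
      have h3 := norm_add_le ((u t - t • bvec 0) + z) ((t - σ) • bvec 0)
      have h4 := norm_add_le (u t - t • bvec 0) z
      rw [norm_smul_bvec_zero, abs_of_nonneg (by linarith [ht.1])] at h3
      linarith [ht.2]
    have hD1 : D ≤ 1 := by
      refine (hbil.upper _ hzR' _ hσR).trans ?_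
      rw [edist_dist, dist_eq_norm, ← ENNReal.ofReal_mul (by linarith), ← ENNReal.ofReal_one]
      refine ENNReal.ofReal_le_ofReal ?_
      have := mul_le_mul_of_nonneg_left hup (by linarith : 0 ≤ L)
      linarith
    have hDl : ENNReal.ofReal (c₀ / (8 * L) * k) ≤ D := by
      have h3 := hbil.lower _ hzR' _ hσR
      rw [edist_dist, dist_eq_norm] at h3
      have h4 : ENNReal.ofReal (c₀ / (8 * L) * k) = ENNReal.ofReal (c₀ * k / 8) / ENNReal.ofReal L := by
        rw [← ENNReal.ofReal_div_of_pos (by linarith)]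
        congr 1
        field_simp
      rw [h4]
      exact ENNReal.div_le_of_le_mul' ((ENNReal.ofReal_le_ofReal hlow).trans h3)
    rw [← ENNReal.ofReal_rpow_of_pos (by positivity)]
    exact (ENNReal.rpow_le_rpow hDl (le_max_right _ _)).trans
      (ENNReal.rpow_le_rpow_of_exponent_ge hD1 (le_max_left _ _))
end

/-- The reflection of the first coordinate. -/
noncomputable def axisReflection : E3 ≃ₗᵢ[ℝ] E3 where
  toFun V := !₂[-V 0, V 1, V 2]
  invFun V := !₂[-V 0, V 1, V 2]
  map_add' V W := by
    ext i
    fin_cases i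
    · simp [add_comm]
    · simp
    · simp
  map_smul' c V := by
    ext i
    fin_cases i <;> simp
  left_inv V := by
    ext i
    fin_cases i <;> simp
  right_inv V := by
    ext i
    fin_cases i <;> simp
  norm_map' V := by
    rw [EuclideanSpace.norm_eq, EuclideanSpace.norm_eq]
    congr 1
    simp [Fin.sum_univ_three]

lemma axisReflection_apply (V : E3) : axisReflection V = !₂[-V 0, V 1, V 2] := rfl

section
variable {M : Type*} [EMetricSpace M] [ChartedSpace E3 M] [IsManifold (𝓡 3) ∞ M]
    [RiemannianBundle (fun x : M ↦ TangentSpace (𝓡 3) x)]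
    [IsContMDiffRiemannianBundle (𝓡 3) ∞ E3 (fun x : M ↦ TangentSpace (𝓡 3) x)]
    {e : OpenPartialHomeomorph M E3} {a b r α : ℝ}

lemma velocity_comp_neg {γ : ℝ → M} {t : ℝ} (h : MDifferentiableAt 𝓘(ℝ, ℝ) (𝓡 3) γ (-t)) :
    velocity (fun τ ↦ γ (-τ)) t = -velocity γ (-t) := by
  have hneg : HasDerivAt (fun τ : ℝ ↦ -τ) (-1) t := hasDerivAt_neg t
  have h1 := mfderiv_comp (I := 𝓘(ℝ, ℝ)) (I' := 𝓘(ℝ, ℝ)) (I'' := 𝓡 3) t (g := γ)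
    (f := fun τ : ℝ ↦ -τ) h hneg.differentiableAt.mdifferentiableAt
  have h2 : mfderiv 𝓘(ℝ, ℝ) 𝓘(ℝ, ℝ) (fun τ : ℝ ↦ -τ) t (1 : ℝ) = (-1 : ℝ) := by
    rw [mfderiv_eq_fderiv]
    exact (fderiv_apply_one_eq_deriv (f := fun τ : ℝ ↦ -τ) (x := t)).trans hneg.deriv
  have h3 : velocity (fun τ ↦ γ (-τ)) t = mfderiv 𝓘(ℝ, ℝ) (𝓡 3) γ (-t)
      (mfderiv 𝓘(ℝ, ℝ) 𝓘(ℝ, ℝ) (fun τ : ℝ ↦ -τ) t (1 : ℝ)) :=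
    congrArg (fun L : ℝ →L[ℝ] E3 ↦ L (1 : ℝ)) h1
  rw [h3]
  refine (congrArg (mfderiv 𝓘(ℝ, ℝ) (𝓡 3) γ (-t)) h2).trans ?_
  exact map_neg (mfderiv 𝓘(ℝ, ℝ) (𝓡 3) γ (-t)) (1 : ℝ)

lemma IsUnitGeodesicOn.comp_neg {γ : ℝ → M} {I J : Set ℝ} (hI : IsOpen I)
    (h : IsUnitGeodesicOn γ I) (hJ : ∀ t ∈ J, -t ∈ I) : IsUnitGeodesicOn (fun t ↦ γ (-t)) J := by
  have hneg : ContMDiff 𝓘(ℝ, ℝ) 𝓘(ℝ, ℝ) ∞ fun τ : ℝ ↦ -τ := by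
    rw [contMDiff_iff_contDiff]
    fun_prop
  refine ⟨⟨h.1.1.comp hneg.contMDiffOn hJ, fun e he t ht hs ↦ ?_⟩, fun t ht ↦ ?_⟩
  · have h1 := h.1.2 e he (-t) (hJ t ht) hs
    have hd : (deriv fun τ ↦ e (γ (-τ))) = fun τ ↦ -deriv (fun τ ↦ e (γ τ)) (-τ) :=
      funext fun τ ↦ deriv_comp_neg (fun τ ↦ e (γ τ)) τ
    have hd' : deriv (fun τ ↦ -deriv (fun τ ↦ e (γ τ)) (-τ)) t =
        deriv (deriv fun τ ↦ e (γ τ)) (-t) := by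
      rw [deriv.fun_neg, deriv_comp_neg (deriv fun τ ↦ e (γ τ)) t, neg_neg]
    rw [covDeriv_eq] at h1 ⊢
    rw [hd, hd']
    simpa only [map_neg, _root_.neg_apply, neg_neg] using h1
  · rw [velocity_comp_neg (((h.1.1 _ (hJ t ht)).contMDiffAt
      (hI.mem_nhds (hJ t ht))).mdifferentiableAt (by simp))]
    exact (norm_neg _).trans (h.2 _ (hJ t ht))

lemma IsChaoticAt.neg {x : M} {τ : TangentSpace (𝓡 3) x} (h : IsChaoticAt x τ) :
    IsChaoticAt x (-τ) := by
  intro γ t₀ η hη hγ hor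
  refine h γ t₀ η hη hγ ?_
  rw [norm_neg, smul_neg, neg_neg] at hor
  exact hor.symm

lemma IsChaoticAt.congr {p q : TangentBundle (𝓡 3) M} (h : IsChaoticAt p.1 p.2) (hpq : p = q) :
    IsChaoticAt q.1 q.2 := hpq ▸ h

lemma IsFermiChart.reflect (h : IsFermiChart e a b r) (hα : 0 < α)
    (hinj : HasInjRadiusGT M (2 * α)) : IsFermiChart (affineChart e 0 axisReflection) (-b) (-a) r := by
  have hf := h.isAxisFlat
  have hmemI : ∀ s ∈ Ioo (-b) (-a), -s ∈ Ioo a b := fun s hs ↦ ⟨by linarith [hs.2], by linarith [hs.1]⟩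
  have haxis : ∀ s : ℝ, axisReflection !₂[s, 0, 0] + 0 = (-s) • bvec 0 := by
    intro s
    rw [add_zero, axisReflection_apply, ← E3_axis_eq]
    simp
  have hz : ∀ s ∈ Ioo (-b) (-a), axisReflection !₂[s, 0, 0] + 0 ∈ e.target := fun s hs ↦ by
    rw [haxis]
    exact (hf.flat _ (hmemI s hs)).mem
  refine ⟨h.smooth.affineChart _ _, h.radius_pos, ?_, ?_, fun s hs ↦ ?_, fun s hs j ↦ ?_,
    fun u hu ↦ ?_⟩
  · ext z
    rw [mem_affineChart_target, add_zero, h.target_eq, axisReflection_apply]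
    simp [neg_lt, lt_neg, and_comm]
  · have hfun : (fun s : ℝ ↦ (affineChart e 0 axisReflection).symm !₂[s, 0, 0]) =
        fun s ↦ (fun s : ℝ ↦ e.symm !₂[s, 0, 0]) (-s) := by
      ext s
      rw [affineChart_symm_apply, haxis, ← E3_axis_eq]
    rw [hfun]
    exact h.axis.comp_neg isOpen_Ioo hmemI
  · refine h.smooth.metricCoeff_affineChart (hz s hs) ?_
    rw [haxis]
    exact (hf.flat _ (hmemI s hs)).orthonormal
  · rw [covDeriv_eq, hinj.gam_affineChart hα h.smooth (hz s hs), haxis,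
      (hf.flat _ (hmemI s hs)).gam_zero]
    simp
  · have h1 := h.rays (axisReflection u) (by simpa [mem_affineChart_target] using hu)
    have hfun : ∀ t : ℝ, axisReflection !₂[u 0, t * u 1, t * u 2] + 0 =
        !₂[(axisReflection u) 0, t * (axisReflection u) 1, t * (axisReflection u) 2] := by
      intro t
      rw [add_zero, axisReflection_apply, axisReflection_apply]
      simp
    simpa only [affineChart_symm_apply, mem_affineChart_target, hfun] using h1

lemma affineChart_reflection_symm (x y : ℝ) :
    (affineChart e 0 axisReflection).symm !₂[0, x, y] = e.symm !₂[0, x, y] := by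
  rw [affineChart_symm_apply, add_zero, axisReflection_apply]
  simp

lemma axisSegment_reflection (a₀ a₁ : ℝ) :
    axisSegment (affineChart e 0 axisReflection) (-a₁) (-a₀) = axisSegment e a₀ a₁ := by
  have hfun : ∀ s : ℝ, (affineChart e 0 axisReflection).symm !₂[s, 0, 0] = e.symm !₂[-s, 0, 0] := by
    intro s
    rw [affineChart_symm_apply, add_zero, axisReflection_apply]
    simp
  simp only [axisSegment, hfun]
  rw [← image_neg_Icc, image_image]
  simp

lemma IsFermiChart.isChaoticAt_reflect (h : IsFermiChart e a b r) (h0 : (0 : ℝ) ∈ Ioo a b)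
    (hch : IsChaoticAt (e.symm !₂[0, 0, 0]) (velocity (fun s : ℝ ↦ e.symm !₂[s, 0, 0]) 0)) :
    IsChaoticAt ((affineChart e 0 axisReflection).symm !₂[0, 0, 0])
      (velocity (fun s : ℝ ↦ (affineChart e 0 axisReflection).symm !₂[s, 0, 0]) 0) := by
  set γ : ℝ → M := fun s ↦ e.symm !₂[s, 0, 0] with hγ
  have hfun : (fun s : ℝ ↦ (affineChart e 0 axisReflection).symm !₂[s, 0, 0]) = fun s ↦ γ (-s) := by
    ext s
    rw [affineChart_symm_apply, add_zero, axisReflection_apply, hγ]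
    simp
  have hcongr : ∀ c c' : ℝ → M, c = c' →
      (⟨c 0, velocity c 0⟩ : TangentBundle (𝓡 3) M) = ⟨c' 0, velocity c' 0⟩ := by
    rintro _ _ rfl
    rfl
  have hvel : velocity (fun s ↦ γ (-s)) 0 = -velocity γ (-0) :=
    velocity_comp_neg (((h.axis.1.1 (-0) (by rwa [neg_zero])).contMDiffAt
      (isOpen_Ioo.mem_nhds (by rwa [neg_zero]))).mdifferentiableAt (by simp))
  have h1 : (⟨γ (-0), velocity (fun s ↦ γ (-s)) 0⟩ : TangentBundle (𝓡 3) M) =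
      ⟨γ 0, -velocity γ 0⟩ := by
    have h2 : (⟨γ (-0), velocity (fun s ↦ γ (-s)) 0⟩ : TangentBundle (𝓡 3) M) =
        ⟨γ (-0), -velocity γ (-0)⟩ := congrArg _ hvel
    rw [h2, neg_zero]
  exact hch.neg.congr (((hcongr _ _ hfun).trans h1).symm)
end

lemma eventually_mul_log_rpow_mul_rpow_lt {C c g : ℝ} (hC : 0 ≤ C) (hc : 0 < c) (hg : 0 < g) :
    ∀ᶠ k : ℝ in 𝓝[>] 0, C * Real.log (1 / k ^ 5) ^ (3 / 2 : ℝ) * k ^ g < c := by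
  set ε := g / 15 with hε
  have hε0 : 0 < ε := by positivity
  set C' := C * ε⁻¹ ^ (3 / 2 : ℝ) with hC'
  have h1 : Tendsto (fun k : ℝ ↦ C' * k ^ (g / 2)) (𝓝[>] 0) (𝓝 (C' * 0)) := by
    refine Tendsto.const_mul _ ?_
    have h2 := (Real.continuousAt_rpow_const 0 (g / 2) (Or.inr (by positivity))).tendsto
    rw [Real.zero_rpow (by positivity)] at h2
    exact h2.mono_left nhdsWithin_le_nhds
  rw [mul_zero] at h1
  filter_upwards [h1.eventually_lt_const hc, Ioo_mem_nhdsGT (zero_lt_one (α := ℝ))] with k hk hk1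
  have hk0 := hk1.1
  have hk5 : k ^ 5 ≤ 1 := pow_le_one₀ hk0.le hk1.2.le
  refine lt_of_le_of_lt ?_ hk
  have hlog0 : 0 ≤ Real.log (1 / k ^ 5) := Real.log_nonneg (by
    rw [le_div_iff₀ (by positivity)]
    linarith)
  have hlog : Real.log (1 / k ^ 5) ≤ k ^ (-(g / 3)) * ε⁻¹ := by
    refine (Real.log_le_rpow_div (by positivity) hε0).trans_eq ?_
    rw [div_eq_mul_inv, one_div, Real.inv_rpow (by positivity), ← Real.rpow_natCast,
      ← Real.rpow_mul hk0.le, ← Real.rpow_neg hk0.le]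
    congr 2
    rw [hε]
    push_cast
    ring
  have hpow : Real.log (1 / k ^ 5) ^ (3 / 2 : ℝ) ≤ k ^ (-(g / 2)) * ε⁻¹ ^ (3 / 2 : ℝ) := by
    refine (Real.rpow_le_rpow hlog0 hlog (by norm_num)).trans_eq ?_
    rw [Real.mul_rpow (by positivity) (by positivity), ← Real.rpow_mul hk0.le]
    congr 2
    ring
  calc C * Real.log (1 / k ^ 5) ^ (3 / 2 : ℝ) * k ^ g
      ≤ C * (k ^ (-(g / 2)) * ε⁻¹ ^ (3 / 2 : ℝ)) * k ^ g := by gcongr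
    _ = C' * (k ^ (-(g / 2)) * k ^ g) := by rw [hC']; ring
    _ = C' * k ^ (g / 2) := by
        rw [← Real.rpow_add hk0]
        congr 2
        ring

/-- The image of a thin rectangle under a bilipschitz map of planes. -/
lemma exists_measure_image_box_ge {A : ℝ} (hA : 0 < A) {η k : ℝ} (hη : 0 < η) (hk : 0 < k)
    {H : EuclideanSpace ℝ (Fin 2) → EuclideanSpace ℝ (Fin 2)}
    (hH : ∀ p ∈ euclideanBox ![0, η * k / 2] ![η * k ^ 2, η * k],
      ∀ q ∈ euclideanBox ![0, η * k / 2] ![η * k ^ 2, η * k],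
      η / 2 * |p 0 - q 0| + |p 1 - q 1| ≤ A * ‖H p - H q‖ ∧
      ‖H p - H q‖ ≤ 24 * (η * |p 0 - q 0| + |p 1 - q 1|)) :
    MeasurableSet (H '' euclideanBox ![0, η * k / 2] ![η * k ^ 2, η * k]) ∧
    ENNReal.ofReal (η ^ 2 / 2 / ((1 + 2 / η) * A) ^ 2 * k ^ 3) ≤
      volume (H '' euclideanBox ![0, η * k / 2] ![η * k ^ 2, η * k]) := by
  set K : Set (EuclideanSpace ℝ (Fin 2)) := euclideanBox ![0, η * k / 2] ![η * k ^ 2, η * k] with hK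
  have hcoord : ∀ (p q : EuclideanSpace ℝ (Fin 2)) i, |p i - q i| ≤ dist p q := by
    intro p q i
    rw [dist_eq_norm]
    exact PiLp.norm_apply_le (p - q) i
  have hdist : ∀ p q : EuclideanSpace ℝ (Fin 2), dist p q ≤ |p 0 - q 0| + |p 1 - q 1| := by
    intro p q
    rw [EuclideanSpace.dist_eq, Fin.sum_univ_two, Real.dist_eq, Real.dist_eq, Real.sqrt_le_left
      (by positivity)]
    nlinarith [mul_nonneg (abs_nonneg (p 0 - q 0)) (abs_nonneg (p 1 - q 1))]
  have hcont : ContinuousOn H K := by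
    refine (LipschitzOnWith.of_dist_le_mul (K := (24 * (η + 1)).toNNReal) fun p hp q hq ↦ ?_).continuousOn
    rw [Real.coe_toNNReal _ (by positivity), dist_eq_norm]
    refine (hH p hp q hq).2.trans ?_
    have h0 := mul_le_mul_of_nonneg_left (hcoord p q 0) hη.le
    have h1 := hcoord p q 1
    linarith
  refine ⟨((isCompact_euclideanBox _ _).image_of_continuousOn hcont).isClosed.measurableSet, ?_⟩
  set L := (1 + 2 / η) * A with hL
  have hL0 : 0 < L := by positivity
  have h1 := euclideanHausdorffMeasure_le_image (f := H) (s := K) (C := L) 2 fun p hp q hq ↦ by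
    rw [edist_dist, edist_dist, ← ENNReal.ofReal_mul hL0.le]
    refine ENNReal.ofReal_le_ofReal ((hdist p q).trans ?_)
    have h2 := (hH p hp q hq).1
    rw [dist_eq_norm (H p), hL, mul_assoc]
    have h3 := mul_le_mul_of_nonneg_left h2 (show 0 ≤ 1 + 2 / η by positivity)
    refine le_trans ?_ h3
    have h4 : (1 + 2 / η) * (η / 2 * |p 0 - q 0| + |p 1 - q 1|) =
        |p 0 - q 0| + |p 1 - q 1| + (η / 2 * |p 0 - q 0| + 2 / η * |p 1 - q 1|) := by
      field_simp
      ring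
    rw [h4]
    have : 0 ≤ η / 2 * |p 0 - q 0| + 2 / η * |p 1 - q 1| := by positivity
    linarith
  rw [EuclideanSpace.euclideanHausdorffMeasure_eq_volume, hK, volume_euclideanBox,
    Fin.prod_univ_two] at h1
  simp only [Matrix.cons_val_zero, Matrix.cons_val_one, sub_zero] at h1
  rw [← ENNReal.ofReal_mul (by positivity), ← ENNReal.ofReal_pow hL0.le] at h1
  have h5 : η ^ 2 / 2 / L ^ 2 * k ^ 3 = (η * k ^ 2 * (η * k - η * k / 2)) / L ^ 2 := by ring
  rw [h5, ENNReal.ofReal_div_of_pos (by positivity)]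
  exact ENNReal.div_le_of_le_mul' h1

section
variable {M : Type*} [EMetricSpace M] [ChartedSpace E3 M] [IsManifold (𝓡 3) ∞ M]
    [RiemannianBundle (fun x : M ↦ TangentSpace (𝓡 3) x)]
    [IsContMDiffRiemannianBundle (𝓡 3) ∞ E3 (fun x : M ↦ TangentSpace (𝓡 3) x)]
    [IsRiemannianManifold (𝓡 3) M] [MeasurableSpace M] [BorelSpace M]
    {e : OpenPartialHomeomorph M E3} {a b r α : ℝ}

/-- If the auxiliary maximal function of slabs is large, then a bound for it restricts the
exponent. -/
lemma AuxBound.three_halves_le {γ₀ K : Set M} {κ : ℝ} (h : AuxBound e r γ₀ α κ K)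
    {e' : OpenPartialHomeomorph M E3} (he' : IsSmoothChart e') (h0 : (0 : E3) ∈ e'.target)
    (hK : K ∈ 𝓝 (e'.symm 0)) (hE : ∃ cE cA : ℝ, 0 < cE ∧ 0 < cA ∧ ∀ᶠ k : ℝ in 𝓝[>] 0,
      ∃ E : Set (EuclideanSpace ℝ (Fin 2)), MeasurableSet E ∧ E ⊆ Metric.ball 0 r ∧
      ENNReal.ofReal (cE * k ^ 3) ≤ volume E ∧
      ∀ x ∈ E, ENNReal.ofReal (cA * k ^ (1 + max κ 0)) ≤ auxMax e γ₀ α κ (k ^ 5)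
        (slabFun e' {u : E3 | |u 0| ≤ k ∧ |u 1| ≤ k ^ 2 ∧ |u 2| ≤ 2 * k ^ 5}) x) :
    3 / 2 ≤ κ := by
  by_contra! hκ
  obtain ⟨C, hC⟩ := h
  obtain ⟨cE, cA, hcE, hcA, hE⟩ := hE
  obtain ⟨R, L, hbil⟩ := he'.exists_isBilipBall h0
  have hL := hbil.one_le
  obtain ⟨ρ, hρ, hρK⟩ := Metric.mem_nhds_iff.1 ((e'.symm.continuousAt h0).preimage_mem_nhds hK)
  set g := 3 / 2 - max κ 0 with hg
  have hg0 : 0 < g := sub_pos.2 (max_lt hκ (by norm_num))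
  set c := cA * cE ^ (1 / 2 : ℝ) with hc
  have hc0 : 0 < c := by positivity
  set D := (L ^ 3 * 16) ^ (1 / 2 : ℝ) with hD
  have hpow : Tendsto (fun k : ℝ ↦ k ^ 5) (𝓝[>] 0) (𝓝[>] 0) := by
    refine tendsto_nhdsWithin_iff.2 ⟨?_, ?_⟩
    · have : Tendsto (fun k : ℝ ↦ k ^ 5) (𝓝 0) (𝓝 (0 ^ 5)) := (continuous_pow 5).tendsto 0
      rw [zero_pow (by norm_num)] at this
      exact this.mono_left nhdsWithin_le_nhds
    · filter_upwards [eventually_mem_nhdsWithin] with k hk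
      exact pow_pos (show 0 < k from hk) 5
  have hev := (hpow.eventually hC).and (hE.and ((eventually_mul_log_rpow_mul_rpow_lt
    (C := |C| * D) (by positivity) hc0 hg0).and (Ioo_mem_nhdsGT
      (show (0 : ℝ) < min 1 (min R ρ / 5) by have := hbil.pos; positivity))))
  obtain ⟨k, hCk, ⟨E, hEm, hEr, hEv, hEx⟩, hlog, hk⟩ := hev.exists
  have hk0 := hk.1
  have hk1 : k < 1 := hk.2.trans_le (min_le_left _ _)
  have hkR : 5 * k < min R ρ := by linarith [hk.2.trans_le (min_le_right 1 _)]
  set B : Set E3 := {u : E3 | |u 0| ≤ k ∧ |u 1| ≤ k ^ 2 ∧ |u 2| ≤ 2 * k ^ 5} with hB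
  have hBm : MeasurableSet B := measurableSet_setOf_abs_le _ _ _
  have hBsub : B ⊆ Metric.closedBall 0 (5 * k) := by
    intro u hu
    have h2 : k ^ 2 ≤ k := pow_le_of_le_one hk0.le hk1.le (by norm_num)
    have h5 : k ^ 5 ≤ k := pow_le_of_le_one hk0.le hk1.le (by norm_num)
    rw [mem_closedBall_zero_iff]
    exact (E3_norm_le u).trans (by linarith [hu.1, hu.2.1, hu.2.2])
  have hsupp : Function.support (slabFun e' B) ⊆ K := by
    intro x hx
    have hx' : x ∈ e'.source ∩ e' ⁻¹' B := by
      by_contra h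
      exact hx (indicator_of_notMem h _)
    have h1 : e' x ∈ Metric.ball 0 ρ :=
      Metric.closedBall_subset_ball (hkR.trans_le (min_le_right _ _)) (hBsub hx'.2)
    have h2 : e'.symm (e' x) ∈ K := hρK h1
    rwa [e'.left_inv hx'.1] at h2
  have hf2 : eLpNorm (slabFun e' B) 2 μHE[3] ≤ ENNReal.ofReal (D * k ^ 4) := by
    refine (eLpNorm_indicator_const_le _ _).trans ?_
    rw [enorm_one, one_mul]
    have h1 := hbil.measure_slab_le (hBsub.trans
      (Metric.closedBall_subset_closedBall (hkR.le.trans (min_le_left _ _))))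
    rw [volume_setOf_abs_le _ _ _ (by positivity) (by positivity),
      ← ENNReal.ofReal_mul (by positivity)] at h1
    refine (ENNReal.rpow_le_rpow h1 (by positivity)).trans_eq ?_
    rw [ENNReal.ofReal_rpow_of_nonneg (by positivity) (by positivity)]
    congr 1
    have h2 : L ^ 3 * (8 * k * k ^ 2 * (2 * k ^ 5)) = L ^ 3 * 16 * k ^ 8 := by ring
    have h3 : (k ^ 8) ^ (1 / 2 : ℝ) = k ^ 4 := by
      rw [← Real.rpow_natCast, ← Real.rpow_natCast, ← Real.rpow_mul hk0.le]
      norm_num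
    rw [h2, ENNReal.toReal_ofNat, Real.mul_rpow (by positivity) (by positivity), h3]
  have hmeas : volume.restrict (Metric.ball (0 : EuclideanSpace ℝ (Fin 2)) r) E = volume E := by
    rw [Measure.restrict_apply hEm, inter_eq_left.2 hEr]
  have hlow := ofReal_le_eLpNorm_of_forall_le (q := 2) hEm (l := cA * k ^ (1 + max κ 0))
    (by positivity) (m := cE * k ^ 3) (by positivity) (hEv.trans_eq hmeas.symm) hEx
    (by norm_num)
  have hfin := hlow.trans ((hCk _ (measurable_slabFun e' hBm) hsupp).trans
    (mul_le_mul_right hf2 _))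
  set l := Real.log (1 / k ^ 5) ^ (3 / 2 : ℝ) with hl
  have hl0 : 0 ≤ l := Real.rpow_nonneg (Real.log_nonneg (by
    rw [le_div_iff₀ (by positivity)]
    linarith [pow_le_one₀ hk0.le hk1.le (n := 5)])) _
  have h1 : ENNReal.ofReal (C * l) ≤ ENNReal.ofReal (|C| * l) :=
    ENNReal.ofReal_le_ofReal (by gcongr; exact le_abs_self C)
  replace hfin := hfin.trans (mul_le_mul_left h1 _)
  rw [← ENNReal.ofReal_mul (by positivity), ENNReal.ofReal_le_ofReal_iff (by positivity),
    ENNReal.toReal_ofNat, Real.mul_rpow hcE.le (by positivity)] at hfin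
  have h3 : (k ^ 3) ^ (1 / 2 : ℝ) = k ^ (3 / 2 : ℝ) := by
    rw [← Real.rpow_natCast, ← Real.rpow_mul hk0.le]
    norm_num
  have h4 : k ^ 4 = k ^ g * (k ^ (1 + max κ 0) * k ^ (3 / 2 : ℝ)) := by
    rw [← Real.rpow_natCast, ← Real.rpow_add hk0, ← Real.rpow_add hk0, hg]
    congr 1
    push_cast
    ring
  rw [h3, h4] at hfin
  have hP : 0 < k ^ (1 + max κ 0) * k ^ (3 / 2 : ℝ) := by positivity
  have h5 := mul_lt_mul_of_pos_right hlog hP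
  rw [hc] at h5
  nlinarith

/-- Geodesics from points of `γ₀`, close to the axis, give a family of test points in the plane for
the auxiliary maximal function. -/
lemma IsFermiChart.exists_forall_le_auxMax (h : IsFermiChart e a b r) (hα : 0 < α)
    (hinj : HasInjRadiusGT M (2 * α)) {a₀ : ℝ} (ha : a < a₀) (ha₀ : a₀ < 0) (hb₀ : 0 ≤ a₀ + α)
    (hb : a₀ + α < b)
    (hch : IsChaoticAt (e.symm !₂[0, 0, 0]) (velocity (fun s : ℝ ↦ e.symm !₂[s, 0, 0]) 0))
    {K : Set M} (hK : K ∈ 𝓝 (e.symm !₂[0, 0, 0])) :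
    ∃ e' : OpenPartialHomeomorph M E3, IsSmoothChart e' ∧ (0 : E3) ∈ e'.target ∧
      K ∈ 𝓝 (e'.symm 0) ∧ ∀ κ : ℝ, ∃ cE cA : ℝ, 0 < cE ∧ 0 < cA ∧ ∀ᶠ k : ℝ in 𝓝[>] 0,
      ∃ E : Set (EuclideanSpace ℝ (Fin 2)), MeasurableSet E ∧ E ⊆ Metric.ball 0 r ∧
      ENNReal.ofReal (cE * k ^ 3) ≤ volume E ∧
      ∀ x ∈ E, ENNReal.ofReal (cA * k ^ (1 + max κ 0)) ≤
        auxMax e (axisSegment e a₀ (a₀ + α)) α κ (k ^ 5)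
          (slabFun e' {u : E3 | |u 0| ≤ k ∧ |u 1| ≤ k ^ 2 ∧ |u 2| ≤ 2 * k ^ 5}) x := by
  have hf := h.isAxisFlat
  have h0 : (0 : ℝ) ∈ Ioo a b := ⟨ha.trans ha₀, hb₀.trans_lt hb⟩
  obtain ⟨C, κ₀, ε, T, hC, hκ₀, hε, hT, hjet⟩ := h.exists_forall_axisJet hα hinj h0 hch
  obtain ⟨S, hS, hcross⟩ := exists_forall_crossing (M := M) hC hκ₀
  have hKev : ∀ᶠ s in 𝓝 (0 : ℝ), K ∈ 𝓝 (e.symm (s • bvec 0)) := by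
    have h1 : ContinuousAt (fun s : ℝ ↦ e.symm (s • bvec 0)) 0 :=
      ContinuousAt.comp (g := e.symm) (e.symm.continuousAt (hf.flat 0 h0).mem) (by fun_prop)
    rw [E3_axis_eq] at hK
    exact h1.eventually (eventually_mem_nhds_iff.2 hK)
  obtain ⟨ε', hε', hKε⟩ := Metric.eventually_nhds_iff.1 hKev
  obtain ⟨s₁, hs₁, hs₁S, hs₁T, hs₁α, hs₁ε, hs₁a, hs₁ε'⟩ : ∃ s₁ : ℝ, 0 < s₁ ∧ 2 * s₁ ≤ S ∧
      2 * s₁ ≤ T ∧ 2 * s₁ ≤ α / 2 ∧ 2 * s₁ ≤ ε ∧ 2 * s₁ ≤ -a₀ ∧ 2 * s₁ ≤ ε' := by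
    set m := min (min S T) (min (min (α / 2) ε) (min (-a₀) ε')) with hm
    have hm0 : 0 < m := lt_min (lt_min hS hT) (lt_min (lt_min (by linarith) hε)
      (lt_min (by linarith) hε'))
    have h1 : m ≤ m := le_rfl
    simp only [hm, le_min_iff] at h1
    rw [← hm] at h1
    refine ⟨m / 2, by linarith, ?_⟩
    simp only [mul_div_cancel₀ m (two_ne_zero' ℝ)]
    tauto
  set s₀ : ℝ := -(3 / 2 * s₁) with hs₀
  have hs₀abs : |s₀| = 3 / 2 * s₁ := by rw [hs₀, abs_neg, abs_of_pos (by positivity)]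
  obtain ⟨θ, A, hax, hj, hA, hκA⟩ := hjet s₀ (by rw [hs₀abs]; linarith)
  set e' := affineChart e (s₀ • bvec 0) (rot θ) with he'
  obtain ⟨η₁, A', hη₁, hA', hhit, hsep⟩ := hcross e' T α A s₁ hax hj hA hκA hs₁ hs₁S hs₁T hs₁α
  obtain ⟨η₂, hη₂, havg⟩ := hax.exists_forall_le_average hj hα hinj
  have haxis' : ∀ t : ℝ, e'.symm (t • bvec 0) = e.symm ((s₀ + t) • bvec 0) := fun t ↦ by
    rw [he', affineChart_symm_apply, IsAxisFlat.rot_axis_add]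
  have he's : IsSmoothChart e' := h.smooth.affineChart _ _
  have hf' : IsAxisFlat e' (a - s₀) (b - s₀) := ⟨he's, fun t ht ↦
    hf.isFlatAtZero_affineChart hα hinj (s := s₀) (t := t)
      ⟨by linarith [ht.1], by linarith [ht.2]⟩ θ⟩
  set η := min (min η₁ η₂) s₁ with hη
  have hη0 : 0 < η := lt_min (lt_min hη₁ hη₂) hs₁
  have hηη₁ : η ≤ η₁ := (min_le_left _ _).trans (min_le_left _ _)
  have hηη₂ : η ≤ η₂ := (min_le_left _ _).trans (min_le_right _ _)
  have hηs₁ : η ≤ s₁ := min_le_right _ _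
  refine ⟨e', hf'.smooth, hax.zero_mem, ?_, fun κ ↦ ?_⟩
  · have h1 := haxis' 0
    rw [zero_smul, add_zero] at h1
    rw [h1]
    exact hKε (by rw [Real.dist_0_eq_abs, hs₀abs]; linarith)
  obtain ⟨cA, hcA, havg⟩ := havg κ
  refine ⟨η ^ 2 / 2 / ((1 + 2 / η) * A') ^ 2, cA, by positivity, hcA, ?_⟩
  filter_upwards [havg, Ioo_mem_nhdsGT (zero_lt_one (α := ℝ))] with k hk hk01
  have hk0 := hk01.1
  have hηk : η * k ≤ η := mul_le_of_le_one_right hη0.le hk01.2.le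
  set D : Set (EuclideanSpace ℝ (Fin 2)) :=
    euclideanBox ![0, η * k / 2] ![η * k ^ 2, η * k] with hD
  have hbox : ∀ p ∈ D, 0 ≤ p 0 / k ∧ p 0 / k ≤ η * k ∧ η * k / 2 ≤ p 1 ∧ p 1 ≤ η * k := by
    intro p hp
    rw [hD, mem_euclideanBox] at hp
    have h1 := hp 0
    have h2 := hp 1
    simp only [Matrix.cons_val_zero, Matrix.cons_val_one, mem_Icc] at h1 h2
    refine ⟨div_nonneg h1.1 hk0.le, ?_, h2⟩
    rw [div_le_iff₀ hk0]
    linarith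
  have hpos : ∀ p ∈ D, 0 < p 1 := fun p hp ↦
    (show (0 : ℝ) < η * k / 2 by positivity).trans_le (hbox p hp).2.2.1
  have hdata : ∀ p : EuclideanSpace ℝ (Fin 2), p ∈ D → ∃ (c : ℝ → M) (t : ℝ),
      IsGeodFrom e' α c ((p 0 / k) • bvec 0) (bvec 0 + p 1 • bvec 1) ∧
      (∀ t ∈ Ioo (a - s₀) (b - s₀), |t - p 0 / k| ≤ α → e'.symm (t • bvec 0) ∈
        c '' Icc 0 (α / ‖coordVec e' ((p 0 / k) • bvec 0) (bvec 0 + p 1 • bvec 1)‖) →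
        t = p 0 / k) ∧ t ∈ Icc s₁ (2 * s₁) ∧ c (t - p 0 / k) ∈ e'.source ∧
      c (t - p 0 / k) ∈
        c '' Icc 0 (α / ‖coordVec e' ((p 0 / k) • bvec 0) (bvec 0 + p 1 • bvec 1)‖) ∧
      e' (c (t - p 0 / k)) 0 = 3 / 2 * s₁ := by
    intro p hp
    obtain ⟨h1, h2, h3, h4⟩ := hbox p hp
    have h5 := hpos p hp
    obtain ⟨c, hc, hc'⟩ := hf'.exists_isGeodFrom hα hinj (s := p 0 / k)
      (V := bvec 0 + p 1 • bvec 1) ⟨by linarith, by linarith⟩ (by simpa using h5.ne')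
    obtain ⟨t, ht, ht'⟩ := hhit (p 0 / k) (p 1) c h1 (by linarith)
      (by rw [abs_of_pos h5]; linarith) hc
    exact ⟨c, t, hc, hc', ht, ht'⟩
  have : Nonempty M := ⟨e.symm 0⟩
  choose! c t hc haxis ht hsrc hmem hplane using hdata
  set G : EuclideanSpace ℝ (Fin 2) → E3 := fun p ↦ e' (c p (t p - p 0 / k)) with hG
  set H : EuclideanSpace ℝ (Fin 2) → EuclideanSpace ℝ (Fin 2) := fun p ↦
    !₂[rot θ (G p) 1, rot θ (G p) 2] with hH
  have hrot0 : ∀ u : E3, rot θ u 0 = u 0 := fun u ↦ rfl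
  have hHG : ∀ p ∈ D, ∀ q ∈ D, ‖H p - H q‖ = ‖G p - G q‖ := by
    intro p hp q hq
    have h1 : (rot θ (G p) - rot θ (G q)) 0 = 0 := by
      change G p 0 - G q 0 = 0
      simp only [hG]
      rw [hplane p hp, hplane q hq, sub_self]
    rw [← (rot θ).norm_map (G p - G q), map_sub, EuclideanSpace.norm_eq, EuclideanSpace.norm_eq,
      Fin.sum_univ_three, Fin.sum_univ_two, h1]
    simp [hH]
  have hbilip : ∀ p ∈ D, ∀ q ∈ D, η / 2 * |p 0 - q 0| + |p 1 - q 1| ≤ A' * ‖H p - H q‖ ∧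
      ‖H p - H q‖ ≤ 24 * (η * |p 0 - q 0| + |p 1 - q 1|) := by
    intro p hp q hq
    wlog hpq : q 0 ≤ p 0 generalizing p q
    · have h1 := this q hq p hp (le_of_not_ge hpq)
      rwa [abs_sub_comm, abs_sub_comm (q 1), norm_sub_rev] at h1
    obtain ⟨hp1, hp2, hp3, hp4⟩ := hbox p hp
    obtain ⟨hq1, hq2, hq3, hq4⟩ := hbox q hq
    have hle : q 0 / k ≤ p 0 / k := by gcongr
    have h1 := hsep (p 0 / k) (p 1) (q 0 / k) (q 1) (c p) (c q) (t p) (t q) hq1 hle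
      (by linarith) (by rw [abs_of_pos (hpos p hp)]; linarith)
      (by rw [abs_of_pos (hpos q hq)]; linarith) (hc p hp) (hc q hq) (ht p hp) (ht q hq)
      (hplane p hp) (hplane q hq)
    rw [hHG p hp q hq, abs_of_nonneg (sub_nonneg.2 hpq)]
    rw [abs_of_pos (hpos q hq)] at h1
    have h2 : p 0 - q 0 = k * (p 0 / k - q 0 / k) := by
      field_simp
    have h3 : 0 ≤ p 0 / k - q 0 / k := sub_nonneg.2 hle
    have h4 := mul_le_mul_of_nonneg_right hq3 h3
    have h5 := mul_le_mul_of_nonneg_right hq4 h3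
    rw [h2]
    exact ⟨by linarith [h1.1], by linarith [h1.2]⟩
  obtain ⟨hEm, hEv⟩ := exists_measure_image_box_ge hA' hη0 hk0 hbilip
  have hpt : ∀ p ∈ D, rot θ (G p) + s₀ • bvec 0 = !₂[0, H p 0, H p 1] := by
    intro p hp
    have h1 := hplane p hp
    ext i
    fin_cases i
    · simp [hrot0, hs₀, hG, h1]
    · simp [hH]
    · simp [hH]
  refine ⟨H '' D, hEm, ?_, hEv, ?_⟩
  · rintro _ ⟨p, hp, rfl⟩
    have h1 : G p ∈ e'.target := e'.map_source (hsrc p hp)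
    rw [he', mem_affineChart_target, hpt p hp, h.target_eq] at h1
    rw [mem_ball_zero_iff, EuclideanSpace.norm_eq, Fin.sum_univ_two, Real.sqrt_lt' h.radius_pos]
    simpa using h1.2
  rintro _ ⟨p, hp, rfl⟩
  obtain ⟨hp1, hp2, hp3, hp4⟩ := hbox p hp
  set Sp := c p '' Icc 0 (α / ‖coordVec e' ((p 0 / k) • bvec 0) (bvec 0 + p 1 • bvec 1)‖) with hSp
  have hinter : Sp ∩ axisSegment e a₀ (a₀ + α) = {e'.symm ((p 0 / k) • bvec 0)} := by
    refine Subset.antisymm ?_ (singleton_subset_iff.2 ⟨⟨0, ⟨le_rfl, by positivity⟩, (hc p hp).zero⟩,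
      s₀ + p 0 / k, ⟨by linarith, by linarith⟩, ?_⟩)
    · rintro _ ⟨hx, s, hs, rfl⟩
      have h2 := haxis' (s - s₀)
      rw [add_sub_cancel] at h2
      simp only [E3_axis_eq, ← h2] at hx ⊢
      rw [haxis p hp (s - s₀) ⟨by linarith [hs.1], by linarith [hs.2]⟩
        (abs_le.2 ⟨by linarith [hs.1], by linarith [hs.2]⟩) hx]
      rfl
    · simp only [E3_axis_eq, haxis']
  refine (hk (p 0 / k) (p 1) (c p) hp1 (hp2.trans (by gcongr))
    (by rw [abs_of_pos (hpos p hp)]; exact hp4.trans (by gcongr)) (hc p hp) Sp rfl).trans ?_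
  refine le_iSup₂_of_le Sp ⟨(hc p hp).mem, ?_, ?_⟩ ?_
  · have h1 := hmem p hp
    rw [← e'.left_inv (hsrc p hp), he', affineChart_symm_apply] at h1
    rwa [← hpt p hp]
  · rw [hinter]
    exact singleton_nonempty _
  · simp only [hinter, Metric.infEDist_singleton]
    exact le_rfl

lemma IsFermiChart.three_halves_le_of_auxBound (h : IsFermiChart e a b r) (hα : 0 < α)
    (hinj : HasInjRadiusGT M (2 * α)) {a₀ : ℝ} (ha : a < a₀) (ha₀ : a₀ ≤ 0) (hb₀ : 0 ≤ a₀ + α)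
    (hb : a₀ + α < b)
    (hch : IsChaoticAt (e.symm !₂[0, 0, 0]) (velocity (fun s : ℝ ↦ e.symm !₂[s, 0, 0]) 0))
    {K : Set M} (hK : K ∈ 𝓝 (e.symm !₂[0, 0, 0])) {κ : ℝ}
    (hB : AuxBound e r (axisSegment e a₀ (a₀ + α)) α κ K) : 3 / 2 ≤ κ := by
  rcases ha₀.lt_or_eq with ha₀ | rfl
  · obtain ⟨e', he', h0, hK', hE⟩ := h.exists_forall_le_auxMax hα hinj ha ha₀ hb₀ hb hch hK
    exact hB.three_halves_le he' h0 hK' (hE κ)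
  · have hr := h.reflect hα hinj
    have h1 := hr.exists_forall_le_auxMax hα hinj (a₀ := -(0 + α)) (neg_lt_neg hb) (by linarith)
      (by linarith) (by linarith) (h.isChaoticAt_reflect ⟨ha, hb₀.trans_lt hb⟩ hch) (K := K)
      (by rwa [affineChart_reflection_symm])
    obtain ⟨e', he', h0, hK', hE⟩ := h1
    refine hB.three_halves_le he' h0 hK' ?_
    have h2 : -(0 + α) + α = -0 := by ring
    simpa only [h2, axisSegment_reflection, auxMax, affineChart_reflection_symm] using hE κ
end
set_option maxSynthPendingDepth 1

theorem mainTheorem9 {M : Type*} [EMetricSpace M] [ChartedSpace E3 M] [IsManifold (𝓡 3) ∞ M]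
    [RiemannianBundle (fun x : M ↦ TangentSpace (𝓡 3) x)]
    [IsContMDiffRiemannianBundle (𝓡 3) ∞ E3 (fun x : M ↦ TangentSpace (𝓡 3) x)]
    [IsRiemannianManifold (𝓡 3) M] [MeasurableSpace M] [BorelSpace M]
    (α : ℝ) (hα : 0 < α) (hinj : ENNReal.ofReal α < injRadius M / 2) :
    -- the Nikodym maximal function over all geodesics of length `α`
    (∀ (x₀ : M) (τ₀ : TangentSpace (𝓡 3) x₀), τ₀ ≠ 0 → IsChaoticAt x₀ τ₀ →
      ∀ K : Set M, IsCompact K → K ∈ 𝓝 x₀ →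
        ¬ NikodymBound (geodesicSegments M α) K (5 / 2) (10 / 3) (1 / 5) ∧
        (∀ q : ℝ≥0∞, 1 ≤ q →
          NikodymBound (geodesicSegments M α) K (5 / 2) q (1 / 5) → q ≤ 5 / 2) ∧
        (∀ p : ℝ≥0∞, 1 ≤ p →
          NikodymBound (geodesicSegments M α) K p p (3 / p.toReal - 1) → p ≤ 5 / 2)) ∧
    -- the test functions: indicators of thin slabs in Fermi coordinates
    (∀ (e : OpenPartialHomeomorph M E3) (a b r s₀ : ℝ), IsFermiChart e a b r → s₀ ∈ Ioo a b →
      pderiv 1 (pderiv 2 (metricCoeff e 0 0)) !₂[s₀, 0, 0] = 0 →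
      IsChaoticAt (e.symm !₂[s₀, 0, 0]) (velocity (fun s : ℝ ↦ e.symm !₂[s, 0, 0]) s₀) →
      ∃ c : ℝ, 0 < c ∧ ∀ᶠ δ : ℝ in 𝓝[>] 0, ∀ f : M → ℝ,
        f = slabFun e {u : E3 | |u 0 - s₀| ≤ δ ^ (1 / 5 : ℝ) ∧ |u 1| ≤ δ ^ (2 / 5 : ℝ) ∧
          |u 2| ≤ 2 * δ} →
        ∀ p q : ℝ≥0∞, 1 ≤ p → 1 ≤ q →
          ENNReal.ofReal (c * δ ^ (1 / 5 + 3 / (5 * q.toReal) - 8 / (5 * p.toReal))) *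
              eLpNorm f p μHE[3] ≤
            eLpNorm (nikodymMax (geodesicSegments M α) δ f) q μHE[3]) ∧
    -- the auxiliary maximal function
    (∀ (e : OpenPartialHomeomorph M E3) (a b r a₀ : ℝ), IsFermiChart e a b r →
      a < a₀ → a₀ ≤ 0 → 0 ≤ a₀ + α → a₀ + α < b →
      IsChaoticAt (e.symm !₂[0, 0, 0]) (velocity (fun s : ℝ ↦ e.symm !₂[s, 0, 0]) 0) →
      ∀ K : Set M, IsCompact K → K ∈ 𝓝 (e.symm !₂[0, 0, 0]) →
        ¬ AuxBound e r (axisSegment e a₀ (a₀ + α)) α (1 / 2) K ∧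
        ∀ κ : ℝ, AuxBound e r (axisSegment e a₀ (a₀ + α)) α κ K → 3 / 2 ≤ κ) ∧
    -- the model metric, and the geodesics close to its central geodesic
    (∀ (e : OpenPartialHomeomorph M E3) (a b r ρ : ℝ), IsFermiChart e a b r →
      a < 0 → α < b → 0 < ρ →
      (∀ u ∈ e.target, ∀ i j : Fin 3, metricCoeff e i j u = (if i = j then 1 else 0) +
        if i = 0 ∧ j = 0 then
          (u 1 ^ 2 - u 2 ^ 2) * Real.cos (u 0) + 2 * u 1 * u 2 * Real.sin (u 0)
        else 0) →
      ∀ F : Set (Set M),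
        F = {S ∈ geodesicSegments M α | S ⊆ Metric.cthickening ρ (axisSegment e 0 α)} →
        (∃ c : ℝ, 0 < c ∧ ∀ᶠ δ : ℝ in 𝓝[>] 0, ∀ f : M → ℝ,
          f = slabFun e {u : E3 | |u 0| + |u 1| ≤ δ ^ (1 / 4 : ℝ) ∧ |u 2| ≤ δ} →
          ∀ p q : ℝ≥0∞, 1 ≤ p → 1 ≤ q →
            ENNReal.ofReal (c * δ ^ (1 / 4 + 1 / (4 * q.toReal) - 3 / (2 * p.toReal))) *
                eLpNorm f p μHE[3] ≤
              eLpNorm (nikodymMax F δ f) q μHE[3]) ∧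
        ∀ K : Set M, IsCompact K → K ∈ 𝓝 (e.symm !₂[0, 0, 0]) →
          ¬ NikodymBound F K (5 / 2) (10 / 3) (1 / 5) ∧
          ∀ p : ℝ≥0∞, 1 ≤ p → NikodymBound F K p p (3 / p.toReal - 1) → p ≤ 7 / 3) := by
  have hinj' := hasInjRadiusGT_of_lt hinj
  refine ⟨fun x₀ τ₀ hτ₀ hch K _ hK ↦ le_of_nikodymBound_of_isChaoticAt hα hinj' hτ₀ hch hK,
    fun e a b r s₀ h hs hg hch ↦ h.exists_forall_le_eLpNorm_nikodymMax hα hinj' hs hg hch,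
    fun e a b r a₀ h ha ha₀ hb₀ hb hch K _ hK ↦ ?_,
    fun e a b r ρ h ha hb hρ hm F hF ↦ ?_⟩
  · have hκ := fun κ (hB : AuxBound e r (axisSegment e a₀ (a₀ + α)) α κ K) ↦
      h.three_halves_le_of_auxBound hα hinj' ha ha₀ hb₀ hb hch hK hB
    refine ⟨fun hB ↦ ?_, hκ⟩
    have := hκ _ hB
    norm_num at this
  · obtain ⟨h1, h2⟩ := h.exists_forall_le_of_isRotatingMetric hα hinj' ha hb hρ hm hF
    exact ⟨h1, fun K _ hK ↦ h2 K hK⟩
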